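/- \textbf{Setting.} Let $\Sigma$ be a compact connected oriented surface with a Riemannian metric $h_b$ of area $\pi$, let $\pi:N\to\Sigma$ be a principal $S^1$-bundle of degree $\ell$ with infinitesimal generator $\zeta$, and let $\mathbf i\eta$ be a connection form on $N$ with $-d\eta=2\ell\,\pi^*dv_{h_b}$. For $\delta\ge 1$ put $h_\delta=\delta^{-2}\eta\otimes\eta+\pi^*h_b$, a metric on $N$. Fix a square root $K^{1/2}$ of the canonical bundle of $\Sigma$, a Hermitian line bundle $\mathcal L\to N$ with a smooth Hermitian connection $A_0$, and let $\mathbb S=\pi^*K^{-1/2}\otimes\mathcal L\oplus\pi^*K^{1/2}\otimes\mathcal L$ be the spinor bundle. Over a local oriented orthonormal frame $e_1,e_2$ of $\Sigma$ let $X_0=\delta\zeta$ and let $X_1,X_2$ be the horizontal lifts of $e_1,e_2$; this is an oriented $h_\delta$-orthonormal frame of $N$, and in the induced trivialization of $\mathbb S$ Clifford multiplication $\mathbf c_\delta$ by the dual coframe is given by \[ c_0=\begin{pmatrix}\mathbf i&0\\0&-\mathbf i\end{pmatrix},\quad c_1=\begin{pmatrix}0&1\\-1&0\end{pmatrix},\quad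 c_2=\begin{pmatrix}0&\mathbf i\\\mathbf i&0\end{pmatrix}. \] For a connection $A$ on $\mathcal L$ let $\nabla^{A,\infty}$ be the connection on $\mathbb S$ obtained from $A$ and the pull back of the Levi-Civita connection of $\Sigma$ on $K^{\pm1/2}$. The adiabatic Dirac operator is $\mathbf D_{A,\delta}=\sum_j c_j\nabla^{A,\infty}_{X_j}$. Let $\tau(\psi)=\bar\psi\otimes\psi-\frac12|\psi|^2$, and let $*_\delta$ be the Hodge operator of $h_\delta$. A \emph{tunneling} of the $\delta$-adiabatic flow is a path $(\psi(t),A(t)=A_0+a(t))$, $t\in\mathbb R$, of spinors and connections, where $a(t)$ is a path of imaginary $1$-forms on $N$, such that $\psi\in L^{1,2}_{loc}\cap L^\infty_{loc}$ and $a\in L^{1,2}_{loc}$ on $\mathbb R\times N$, such that almost everywhere \[ \dot\psi=\mathbf D_{A,\delta}\psi,\qquad \mathbf c_\delta(\dot a)=\tau(\psi)-\mathbf c_\delta(*_\delta F_{A}), \] where $F_A=F_{A(t)}$ is the curvature of $A(t)$ on $N$, and such that $\int_{-\infty}^\infty\int_N(|\dot\psi|^2+|\dot a|_\delta^2)\,dv_\delta\,dt<\infty$.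 For $T\in\mathbb R$ and $r>0$ let $C(T,r)=[T-r,T+r]\times N$, let $\|\cdot\|_{p,\delta}$ be the $L^p$-norm on $C(T,2)$ for the metric $dt^2+h_\delta$, and let $S_\delta$ be the largest constant such that $S_\delta\|u\|_{4,\delta}^2\le\|du\|_{2,\delta}^2+\|u\|_{2,\delta}^2$ for all smooth real functions $u$ with compact support in the interior of $C(T,2)$. \textbf{Statement.} There is a constant $C>0$, independent of $\delta$, such that for every $\delta\ge1$, every tunneling $(\psi,A)$ of the $\delta$-adiabatic flow and every $T\in\mathbb R$, \[ \operatorname*{ess\,sup}_{(t,x)\in C(T,1)}|\psi(t,x)|^2\le\frac{C}{S_\delta}\,\|\psi\|_{4,\delta}^2 . \] -/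

import Mathlib

open Set Filter Topology MeasureTheory Bundle
open scoped Manifold ContDiff ENNReal Bundle

noncomputable section

namespace AdiabaticSW

universe u v

/-! ### Calculus on manifolds -/

section Calculus

variable {n : ℕ} {M : Type*} [TopologicalSpace M] [ChartedSpace (EuclideanSpace ℝ (Fin n)) M]
  [IsManifold (𝓡 n) ∞ M]

/-- The vector field `X` is smooth on `U`. -/
def SmoothFieldOn (X : ∀ p : M, TangentSpace (𝓡 n) p) (U : Set M) : Prop :=
  ContMDiffOn (𝓡 n) (𝓡 n).tangent ∞ (fun p => (⟨p, X p⟩ : TangentBundle (𝓡 n) M)) U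

/-- The real `1`-form `θ` is smooth on `U`. -/
def SmoothFormOn (θ : ∀ p : M, TangentSpace (𝓡 n) p →L[ℝ] ℝ) (U : Set M) : Prop :=
  ContMDiffOn (𝓡 n) ((𝓡 n).prod 𝓘(ℝ, EuclideanSpace ℝ (Fin n) →L[ℝ] ℝ)) ∞
    (fun p => TotalSpace.mk' (EuclideanSpace ℝ (Fin n) →L[ℝ] ℝ)
      (E := fun p : M => TangentSpace (𝓡 n) p →L[ℝ] Trivial M ℝ p) p (θ p)) U

/-- The derivative at `p` of the function `f` in the direction `w`. -/
def dirDeriv {E : Type*} [NormedAddCommGroup E] [NormedSpace ℝ E] (f : M → E) (p : M)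
    (w : TangentSpace (𝓡 n) p) : E :=
  mfderiv (𝓡 n) 𝓘(ℝ, E) f p w

/-- `dθ(X, Y) = X(θ(Y)) - Y(θ(X)) - θ([X, Y])`. -/
def extDeriv₁ (θ : ∀ p : M, TangentSpace (𝓡 n) p →L[ℝ] ℝ)
    (X Y : ∀ p : M, TangentSpace (𝓡 n) p) (p : M) : ℝ :=
  dirDeriv (fun q => θ q (Y q)) p (X p) - dirDeriv (fun q => θ q (X q)) p (Y p)
    - θ p (VectorField.mlieBracket (𝓡 n) X Y p)

/-- The coordinate vector field `∂ᵢ` of the chart at `x`, at the point with coordinates `y`. -/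
def coordField (x : M) (i : Fin n) (y : EuclideanSpace ℝ (Fin n)) :
    TangentSpace (𝓡 n) ((chartAt (EuclideanSpace ℝ (Fin n)) x).symm y) :=
  mfderiv 𝓘(ℝ, EuclideanSpace ℝ (Fin n)) (𝓡 n)
    (chartAt (EuclideanSpace ℝ (Fin n)) x).symm y (EuclideanSpace.single i (1 : ℝ))

/-- The Riemannian volume measure of the metric `g`: in each chart it is `√(det gᵢⱼ)` times
Lebesgue measure. The measures so obtained on the chart domains agree on overlaps, so the volume
measure is their supremum. -/
def riemannianVolume [MeasurableSpace M]
    (g : ∀ p : M, TangentSpace (𝓡 n) p → TangentSpace (𝓡 n) p → ℝ) : Measure M :=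
  ⨆ x : M,
    Measure.map (chartAt (EuclideanSpace ℝ (Fin n)) x).symm
      ((volume.restrict (chartAt (EuclideanSpace ℝ (Fin n)) x).target).withDensity fun y =>
        ENNReal.ofReal (Real.sqrt (Matrix.det (Matrix.of fun i j : Fin n =>
          g _ (coordField x i y) (coordField x j y)))))

/-- The square `|ξ|²` of the norm on covectors dual to the inner product `g`. -/
def dualNormSq {V : Type*} (g : V → V → ℝ) (ξ : V → ℝ) : ℝ :=
  sSup {r | ∃ w : V, g w w ≤ 1 ∧ r = ξ w ^ 2}

end Calculus

/-! ### The base surface -/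

/-- A Riemannian metric and an orientation on a surface `S`. The orientation is given by the
rotation `J` through a positive right angle. -/
structure OrientedMetric (S : Type*) [TopologicalSpace S]
    [ChartedSpace (EuclideanSpace ℝ (Fin 2)) S] [IsManifold (𝓡 2) ∞ S] where
  metric : ContMDiffRiemannianMetric (𝓡 2) ∞ (EuclideanSpace ℝ (Fin 2))
    (fun x : S => TangentSpace (𝓡 2) x)
  J : ∀ x : S, TangentSpace (𝓡 2) x →L[ℝ] TangentSpace (𝓡 2) x
  J_smooth : ∀ X : (∀ x : S, TangentSpace (𝓡 2) x),
    SmoothFieldOn X univ → SmoothFieldOn (fun x => J x (X x)) univ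
  J_sq : ∀ x v, J x (J x v) = -v
  J_isometry : ∀ x v w, metric.inner x (J x v) (J x w) = metric.inner x v w

namespace OrientedMetric

variable {S : Type*} [TopologicalSpace S] [ChartedSpace (EuclideanSpace ℝ (Fin 2)) S]
  [IsManifold (𝓡 2) ∞ S] (h : OrientedMetric S)

/-- The area form `dv(v, w) = h(J v, w)`. -/
def area (x : S) (v w : TangentSpace (𝓡 2) x) : ℝ := h.metric.inner x (h.J x v) w

/-- The total area. -/
def totalArea [MeasurableSpace S] : ℝ≥0∞ :=
  riemannianVolume (fun x v w => h.metric.inner x v w) univ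

/-- The Levi-Civita connection form `ω = h(∇e₁, e₂)` of the oriented orthonormal frame
`e₁ = e`, `e₂ = J e`. Since `∇` is metric and torsion free, `[e₁, e₂] = -ω(e₁) e₁ - ω(e₂) e₂`. -/
def connForm (e : ∀ x : S, TangentSpace (𝓡 2) x) (x : S) (v : TangentSpace (𝓡 2) x) : ℝ :=
  -h.metric.inner x (VectorField.mlieBracket (𝓡 2) e (fun y => h.J y (e y)) x) v

/-- The value on `v` of the local generator `√2 ε = η₁ + i η₂` of the canonical bundle defined by
the frame `e₁ = e`, `e₂ = J e` with dual coframe `η₁, η₂`. -/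
def canonicalGen (e : ∀ x : S, TangentSpace (𝓡 2) x) (x : S) (v : TangentSpace (𝓡 2) x) : ℂ :=
  (h.metric.inner x (e x) v : ℂ) + Complex.I * (h.metric.inner x (h.J x (e x)) v : ℂ)

end OrientedMetric

/-! ### Line bundles -/

/-- A smooth Hermitian line bundle, given by local unitary trivializations over the open sets
`base i` and their transition functions: a section is a family of local functions `fᵢ` with
`fᵢ = gᵢⱼ fⱼ`. -/
structure HermitianLineBundle (n : ℕ) (M : Type*) [TopologicalSpace M]
    [ChartedSpace (EuclideanSpace ℝ (Fin n)) M] where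
  ι : Type u
  base : ι → Set M
  isOpen_base : ∀ i, IsOpen (base i)
  indexAt : M → ι
  mem_base_indexAt : ∀ p, p ∈ base (indexAt p)
  g : ι → ι → M → Circle
  g_smooth : ∀ i j, ContMDiffOn (𝓡 n) (𝓡 1) ∞ (g i j) (base i ∩ base j)
  g_self : ∀ i, ∀ p ∈ base i, g i i p = 1
  g_comp : ∀ i j k, ∀ p ∈ base i ∩ base j ∩ base k, g i j p * g j k p = g i k p

/-- A smooth Hermitian connection: in the `k`-th trivialization the covariant derivative is
`d + i θₖ` with `θₖ` a real `1`-form. -/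
structure HermitianConnection {n : ℕ} {M : Type*} [TopologicalSpace M]
    [ChartedSpace (EuclideanSpace ℝ (Fin n)) M] [IsManifold (𝓡 n) ∞ M]
    (L : HermitianLineBundle.{u} n M) where
  θ : L.ι → ∀ p : M, TangentSpace (𝓡 n) p →L[ℝ] ℝ
  θ_smooth : ∀ k, SmoothFormOn (θ k) (L.base k)
  θ_compat : ∀ k l, ∀ p ∈ L.base k ∩ L.base l, ∀ v : TangentSpace (𝓡 n) p,
    dirDeriv (fun q => (L.g k l q : ℂ)) p v
      = Complex.I * ((θ l p v - θ k p v : ℝ) : ℂ) * (L.g k l p : ℂ)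

/-- A spin structure on an oriented Riemannian surface: a square root `K^{1/2}` of the canonical
line bundle `K`. Over `base i` there is an oriented orthonormal frame `eᵢ, J eᵢ`, which defines
the generator `εᵢ` of `K`, and `εⱼ = gᵢⱼ² εᵢ`, so that `K^{1/2}` has transition functions `gᵢⱼ`. -/
structure SpinStructure {S : Type*} [TopologicalSpace S]
    [ChartedSpace (EuclideanSpace ℝ (Fin 2)) S] [IsManifold (𝓡 2) ∞ S]
    (h : OrientedMetric S) extends HermitianLineBundle.{u} 2 S where
  e : ι → ∀ x : S, TangentSpace (𝓡 2) x
  e_smooth : ∀ i, SmoothFieldOn (e i) (base i)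
  e_unit : ∀ i, ∀ x ∈ base i, h.metric.inner x (e i x) (e i x) = 1
  g_sq : ∀ i j, ∀ x ∈ base i ∩ base j, ∀ v : TangentSpace (𝓡 2) x,
    h.canonicalGen (e j) x v = (g i j x : ℂ) ^ 2 * h.canonicalGen (e i) x v

/-! ### The circle bundle and its metrics -/

/-- The infinitesimal generator `ζ` of a circle action. -/
def generator (N : Type*) [TopologicalSpace N] [ChartedSpace (EuclideanSpace ℝ (Fin 3)) N]
    [MulAction Circle N] (p : N) : TangentSpace (𝓡 3) p :=
  let w : EuclideanSpace ℝ (Fin 3) :=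
    mfderiv 𝓘(ℝ, ℝ) (𝓡 3) (fun s : ℝ => Circle.exp s • p) 0 (1 : ℝ)
  w

/-- A principal circle bundle `N → S` over an oriented Riemannian surface with a connection
form `i η` such that `-dη = 2 ℓ dv`. When `S` has area `π`, the integer `ℓ` is the degree. -/
structure CircleBundle {S : Type*} [TopologicalSpace S]
    [ChartedSpace (EuclideanSpace ℝ (Fin 2)) S] [IsManifold (𝓡 2) ∞ S] (h : OrientedMetric S)
    (N : Type*) [TopologicalSpace N] [ChartedSpace (EuclideanSpace ℝ (Fin 3)) N]
    [IsManifold (𝓡 3) ∞ N] [MulAction Circle N] where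
  proj : N → S
  proj_smooth : ContMDiff (𝓡 3) (𝓡 2) ∞ proj
  smul_smooth : ContMDiff ((𝓡 1).prod (𝓡 3)) (𝓡 3) ∞ (fun q : Circle × N => q.1 • q.2)
  smul_free : ∀ (z : Circle) (p : N), z • p = p → z = 1
  fiber_iff : ∀ p q : N, proj p = proj q ↔ ∃ z : Circle, q = z • p
  local_section : ∀ x : S, ∃ U : Set S, IsOpen U ∧ x ∈ U ∧
    ∃ σ : S → N, ContMDiffOn (𝓡 2) (𝓡 3) ∞ σ U ∧ ∀ y ∈ U, proj (σ y) = y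
  η : ∀ p : N, TangentSpace (𝓡 3) p →L[ℝ] ℝ
  η_smooth : SmoothFormOn η univ
  η_vertical : ∀ p : N, η p (generator N p) = 1
  η_invariant : ∀ (z : Circle) (p : N) (v : TangentSpace (𝓡 3) p),
    η (z • p) (mfderiv (𝓡 3) (𝓡 3) (fun q : N => z • q) p v) = η p v
  ℓ : ℤ
  curvature : ∀ X Y : (∀ p : N, TangentSpace (𝓡 3) p),
    SmoothFieldOn X univ → SmoothFieldOn Y univ → ∀ p : N,
      -extDeriv₁ η X Y p = 2 * (ℓ : ℝ) * h.area (proj p)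
        (mfderiv (𝓡 3) (𝓡 2) proj p (X p)) (mfderiv (𝓡 3) (𝓡 2) proj p (Y p))

namespace CircleBundle

variable {S : Type*} [TopologicalSpace S] [ChartedSpace (EuclideanSpace ℝ (Fin 2)) S]
  [IsManifold (𝓡 2) ∞ S] {h : OrientedMetric S}
  {N : Type*} [TopologicalSpace N] [ChartedSpace (EuclideanSpace ℝ (Fin 3)) N]
  [IsManifold (𝓡 3) ∞ N] [MulAction Circle N] (B : CircleBundle h N)

/-- The differential of the projection. -/
def dproj (p : N) : TangentSpace (𝓡 3) p →L[ℝ] TangentSpace (𝓡 2) (B.proj p) :=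
  mfderiv (𝓡 3) (𝓡 2) B.proj p

/-- The metric `h_δ = δ⁻² η ⊗ η + π^* h`. -/
def metric (δ : ℝ) (p : N) (v w : TangentSpace (𝓡 3) p) : ℝ :=
  δ⁻¹ ^ 2 * (B.η p v * B.η p w) + h.metric.inner (B.proj p) (B.dproj p v) (B.dproj p w)

/-- The horizontal lift of `w` to `p`: the vector `v` with `dπ(v) = w` and `η(v) = 0`. -/
def hlift (p : N) (w : TangentSpace (𝓡 2) (B.proj p)) : TangentSpace (𝓡 3) p :=
  ContinuousLinearMap.inverse ((B.dproj p).prod (B.η p)) (w, 0)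

/-- The oriented `h_δ`-orthonormal frame `δ ζ, ζ₁, ζ₂` of `N`, where `ζ₁, ζ₂` are the horizontal
lifts of the oriented orthonormal frame `e, J e` of the base. -/
def frame (δ : ℝ) (e : ∀ x : S, TangentSpace (𝓡 2) x) : Fin 3 → ∀ p : N, TangentSpace (𝓡 3) p :=
  ![fun p => δ • generator N p,
    fun p => B.hlift p (e (B.proj p)),
    fun p => B.hlift p (h.J (B.proj p) (e (B.proj p)))]

/-- The volume measure of `dt² + h_δ` on `ℝ × N`. -/
def tubeVolume [MeasurableSpace N] (δ : ℝ) : Measure (ℝ × N) :=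
  (volume : Measure ℝ).prod (riemannianVolume (B.metric δ))

end CircleBundle

/-- The cylinder `C(T, L) = [T - L, T + L] × N`. -/
def cylinder (N : Type*) (T L : ℝ) : Set (ℝ × N) := Icc (T - L) (T + L) ×ˢ univ

/-! ### Sobolev spaces and the Sobolev constant -/

section Sobolev

variable {N : Type*} [TopologicalSpace N] [ChartedSpace (EuclideanSpace ℝ (Fin 3)) N]
  {E : Type*} [NormedAddCommGroup E] [NormedSpace ℝ E]

/-- The derivative along `ℝ` of a function on `ℝ × N`. -/
def timeDeriv (f : ℝ × N → E) (z : ℝ × N) : E := deriv (fun s => f (s, z.2)) z.1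

/-- The derivative of a function on `ℝ × N` along a vector field on `N`. -/
def fieldDeriv (X : ∀ p : N, TangentSpace (𝓡 3) p) (f : ℝ × N → E) (z : ℝ × N) : E :=
  dirDeriv (fun q => f (z.1, q)) z.2 (X z.2)

/-- On `ℝ × W` the function `f` belongs to `L^{1,2}_loc`, with derivative `ft` in the direction of
`ℝ` and derivatives `fX j` along the vector fields `X j`, which form a smooth frame of `N` over the
open set `W`. Here `L^{1,2}` is the completion of the smooth functions: over each compact subset of
`ℝ × W`, the function is an `L²` limit of smooth functions the derivatives of which converge in
`L²`. -/
def HasSobolevDeriv [MeasurableSpace N] (μ : Measure (ℝ × N))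
    (X : Fin 3 → ∀ p : N, TangentSpace (𝓡 3) p) (W : Set N)
    (f ft : ℝ × N → E) (fX : Fin 3 → ℝ × N → E) : Prop :=
  ∀ K : Set (ℝ × N), IsCompact K → K ⊆ univ ×ˢ W →
    MemLp f 2 (μ.restrict K) ∧ MemLp ft 2 (μ.restrict K) ∧
    (∀ j, MemLp (fX j) 2 (μ.restrict K)) ∧
    ∃ F : ℕ → ℝ × N → E,
      (∀ m, ContMDiffOn (𝓘(ℝ, ℝ).prod (𝓡 3)) 𝓘(ℝ, E) ∞ (F m) (univ ×ˢ W)) ∧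
      Tendsto (fun m => eLpNorm (F m - f) 2 (μ.restrict K)) atTop (𝓝 0) ∧
      Tendsto (fun m => eLpNorm (timeDeriv (F m) - ft) 2 (μ.restrict K)) atTop (𝓝 0) ∧
      ∀ j, Tendsto (fun m => eLpNorm (fieldDeriv (X j) (F m) - fX j) 2 (μ.restrict K))
        atTop (𝓝 0)

variable [IsManifold (𝓡 3) ∞ N] [MulAction Circle N] [MeasurableSpace N]
  {S : Type*} [TopologicalSpace S] [ChartedSpace (EuclideanSpace ℝ (Fin 2)) S]
  [IsManifold (𝓡 2) ∞ S] {h : OrientedMetric S} (B : CircleBundle h N)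

/-- `|du|` for the metric `dt² + h_δ`. -/
def gradNorm (δ : ℝ) (u : ℝ × N → ℝ) (z : ℝ × N) : ℝ :=
  Real.sqrt (timeDeriv u z ^ 2 +
    dualNormSq (B.metric δ z.2) (fun w => dirDeriv (fun q => u (z.1, q)) z.2 w))

/-- The best Sobolev constant: the largest `s` such that
`s ‖u‖₄² ≤ ‖du‖₂² + ‖u‖₂²` for all smooth functions `u` with compact support in the interior of
`C(T, 2)`. -/
def sobolevConst (δ T : ℝ) : ℝ≥0∞ :=
  sSup {s : ℝ≥0∞ | ∀ u : ℝ × N → ℝ,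
    ContMDiff (𝓘(ℝ, ℝ).prod (𝓡 3)) 𝓘(ℝ, ℝ) ∞ u → HasCompactSupport u →
    tsupport u ⊆ Ioo (T - 2) (T + 2) ×ˢ univ →
      s * eLpNorm u 4 ((B.tubeVolume δ).restrict (cylinder N T 2)) ^ 2
        ≤ eLpNorm (gradNorm B δ u) 2 ((B.tubeVolume δ).restrict (cylinder N T 2)) ^ 2
          + eLpNorm u 2 ((B.tubeVolume δ).restrict (cylinder N T 2)) ^ 2}

end Sobolev

/-! ### Spinors and the adiabatic flow -/

/-- Clifford multiplication by the oriented orthonormal coframe `δ⁻¹ η, η₁, η₂` on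
`𝕊 = K^{-1/2} ⊗ L ⊕ K^{1/2} ⊗ L`, in the trivialization defined by this coframe. -/
def cliff : Fin 3 → Matrix (Fin 2) (Fin 2) ℂ :=
  ![!![Complex.I, 0; 0, -Complex.I], !![0, 1; -1, 0], !![0, Complex.I; Complex.I, 0]]

/-- `τ(ψ) = ψ̄ ⊗ ψ - |ψ|²/2`, that is, `φ ↦ ⟨φ, ψ⟩ ψ - (|ψ|²/2) φ`. -/
def tau (ψ : Fin 2 → ℂ) : Matrix (Fin 2) (Fin 2) ℂ :=
  Matrix.vecMulVec ψ (star ψ) - ((∑ a, ‖ψ a‖ ^ 2 : ℝ) / 2 : ℂ) • (1 : Matrix (Fin 2) (Fin 2) ℂ)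

section Flow

variable {S : Type*} [TopologicalSpace S] [ChartedSpace (EuclideanSpace ℝ (Fin 2)) S]
  [IsManifold (𝓡 2) ∞ S] {h : OrientedMetric S}
  {N : Type*} [TopologicalSpace N] [ChartedSpace (EuclideanSpace ℝ (Fin 3)) N]
  [IsManifold (𝓡 3) ∞ N] [MulAction Circle N]
  (B : CircleBundle h N) (σ : SpinStructure.{u} h) (L : HermitianLineBundle.{v} 3 N)

/-- The open set over which the `i`-th frame of `S` and the `k`-th trivialization of `L` give a
trivialization of the spinor bundle. -/
def patch (i : σ.ι) (k : L.ι) : Set N := B.proj ⁻¹' σ.base i ∩ L.base k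

/-- A path of sections of the spinor bundle
`𝕊 = π^*K^{-1/2} ⊗ L ⊕ π^*K^{1/2} ⊗ L` over `N`. -/
structure SpinorPath where
  rep : σ.ι → L.ι → ℝ × N → Fin 2 → ℂ
  compat : ∀ i j k l, ∀ z : ℝ × N, z.2 ∈ patch B σ L i k ∩ patch B σ L j l →
    rep i k z 0 = (σ.g i j (B.proj z.2) : ℂ)⁻¹ * (L.g k l z.2 : ℂ) * rep j l z 0 ∧
    rep i k z 1 = (σ.g i j (B.proj z.2) : ℂ) * (L.g k l z.2 : ℂ) * rep j l z 1

variable {σ L}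

/-- The component along the frame vector `X` of the covariant derivative `∇^{A,∞} ψ` of a spinor
with value `ψ` and derivative `ψX` along `X`, in the `(i, k)`-trivialization.
Here `A = A₀ + i b`, and `K^{∓1/2}` carries the pull back of the Levi-Civita connection of the
base, which is `d ± i ω / 2`. -/
def covDeriv (A₀ : HermitianConnection L) (i : σ.ι) (k : L.ι) {p : N}
    (b : TangentSpace (𝓡 3) p →L[ℝ] ℝ) (X : TangentSpace (𝓡 3) p) (ψ ψX : Fin 2 → ℂ) :
    Fin 2 → ℂ :=
  ψX + (Complex.I * ((A₀.θ k p X + b X : ℝ) : ℂ)) • ψ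
    + ((h.connForm (σ.e i) (B.proj p) (B.dproj p X) / 2 : ℝ) * Complex.I : ℂ) • ![ψ 0, -ψ 1]

variable {B}

/-- The pointwise norm `|ψ|` of a spinor. -/
def SpinorPath.norm (ψ : SpinorPath B σ L) (z : ℝ × N) : ℝ :=
  Real.sqrt (∑ a, ‖ψ.rep (σ.indexAt (B.proj z.2)) (L.indexAt z.2) z a‖ ^ 2)

/-- The pair `(ψ(t), A₀ + i b(t))` is a tunneling of the adiabatic flow of the metric `h_δ`:
`ψ` is of class `L^{1,2}_loc ∩ L^∞_loc` and `b` of class `L^{1,2}_loc` on `ℝ × N`, the energy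
`∫ ‖∂ₜψ‖² + ‖∂ₜb‖² dt` is finite, and
`∂ₜψ = 𝐃_{A,δ} ψ`, `c(i ∂ₜb) = τ(ψ) - c(*F_A)`. -/
def IsTunneling [MeasurableSpace N] (A₀ : HermitianConnection L) (δ : ℝ) (ψ : SpinorPath B σ L)
    (b : ∀ z : ℝ × N, TangentSpace (𝓡 3) z.2 →L[ℝ] ℝ) : Prop :=
  ∃ (ψt : SpinorPath B σ L) (ψX : σ.ι → L.ι → Fin 3 → ℝ × N → Fin 2 → ℂ)
    (bt : ∀ z : ℝ × N, TangentSpace (𝓡 3) z.2 →L[ℝ] ℝ)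
    (bX : σ.ι → Fin 3 → Fin 3 → ℝ × N → ℝ),
    -- `ψX i k j` is the derivative of `ψ` along the `j`-th frame field, `bX i l j` that of the
    -- `l`-th frame component of `b`
    (∀ i k, HasSobolevDeriv (B.tubeVolume δ) (B.frame δ (σ.e i)) (patch B σ L i k)
      (ψ.rep i k) (ψt.rep i k) (ψX i k)) ∧
    (∀ i l, HasSobolevDeriv (B.tubeVolume δ) (B.frame δ (σ.e i)) (B.proj ⁻¹' σ.base i)
      (fun z => b z (B.frame δ (σ.e i) l z.2)) (fun z => bt z (B.frame δ (σ.e i) l z.2))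
      (bX i l)) ∧
    (∀ K : Set (ℝ × N), IsCompact K → eLpNorm ψ.norm ⊤ ((B.tubeVolume δ).restrict K) < ⊤) ∧
    (∫⁻ z, ENNReal.ofReal (ψt.norm z ^ 2 + dualNormSq (B.metric δ z.2) (bt z))
      ∂(B.tubeVolume δ) < ⊤) ∧
    ∀ i k, ∀ᵐ z ∂(B.tubeVolume δ), z.2 ∈ patch B σ L i k →
      let X := B.frame δ (σ.e i)
      -- `F_A = i f` with `f = dθ + db`, in the frame
      let f : Fin 3 → Fin 3 → ℝ := fun j l =>
        extDeriv₁ (A₀.θ k) (X j) (X l) z.2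
          + (bX i l j z - bX i j l z - b z (VectorField.mlieBracket (𝓡 3) (X j) (X l) z.2))
      let starF : Fin 3 → ℝ := ![f 1 2, f 2 0, f 0 1]
      ψt.rep i k z = ∑ j, (cliff j).mulVec
          (covDeriv B A₀ i k (b z) (X j z.2) (ψ.rep i k z) (ψX i k j z)) ∧
      ∑ j, (Complex.I * (bt z (X j z.2) : ℂ)) • cliff j
        = tau (ψ.rep i k z) - ∑ j, (Complex.I * (starF j : ℂ)) • cliff j

end Flow

end AdiabaticSW

end

set_option linter.unusedSectionVars false

noncomputable section

namespace AdiabaticSW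

universe u v

/-! ### Smoothness of derivatives along vector fields, and functions on ℝ × N -/

section General
variable {E' : Type*} [NormedAddCommGroup E'] [NormedSpace ℝ E'] {H : Type*} [TopologicalSpace H]
  {I : ModelWithCorners ℝ E' H} {M : Type*} [TopologicalSpace M] [ChartedSpace H M]
  [IsManifold I ∞ M] {E : Type*} [NormedAddCommGroup E] [NormedSpace ℝ E]

/-! The function w = |ψ|² satisfies Δw ≥ -2Λw weakly on ℝ × N with the metric dt² + h_δ, and Λ does
not depend on δ. The estimate is then the mean value inequality given by Moser's iteration, into
which δ enters only through the Sobolev constant S_δ.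

Why w is a subsolution: a tunneling solves the four-dimensional Seiberg-Witten equations in temporal
gauge, and a Weitzenböck formula expresses ½Δ|ψ|² as |∇ψ|² plus a curvature term plus terms of lower
order. The curvature of A enters only through the self-dual combinations F_01 + F_23 and their
cyclic analogues, which the second equation identifies with τ(ψ); this gives |ψ|⁴/2, with the
favourable sign (`curvature_test`). The remaining terms contain the structure functions of the frame
and the Levi-Civita form of Σ. They are absorbed by |∇ψ|² at the price of a multiple of |ψ|²
(`weitzenbock_le`).

Why Λ is uniform: the vertical field projects to zero on Σ, so [X_0, X_j] has no horizontal part,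
and the vertical part of [X_1, X_2] carries a factor δ⁻¹ ≤ 1 (`abs_structCoeff_le`). The connection
on K^{±1/2} is pulled back from Σ, hence is zero along the fibres.

Since ψ has only one weak derivative, the Weitzenböck formula is used in integrated form. Second
derivatives occur only as commutators inside antisymmetric forms, and `integral_curl` writes these
with first derivatives alone. `integral_pair` adds the connection, and the six pairs of directions
are combined in `integral_grad_le` through the algebraic identities `dirac_test` and `dirac_square`.
Integration by parts rests on the divergence theorem for an orthonormal frame,
`integral_divergence`.

To make powers of w admissible in test functions, w is approximated by bounded smooth functions
obtained from a truncation of |·|² and a partition of unity (`exists_isSubsolution`). Testing with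
χ² w^(2n+1) and the Sobolev inequality give a reverse Hölder inequality
(`IsSubsolution.sobolev_le`); its iteration over exponents 2^(k+1) and radii 1 + 2^(-k) gives
`exists_moser_bound`. -/

/-- The derivative of a smooth function along a smooth vector field is smooth. -/
theorem contMDiffOn_mfderiv_apply {f : M → E} {X : ∀ p : M, TangentSpace I p} {U : Set M}
    (hU : IsOpen U) (hf : ContMDiffOn I 𝓘(ℝ, E) ∞ f U)
    (hX : ContMDiffOn I I.tangent ∞ (fun p => (⟨p, X p⟩ : TangentBundle I M)) U) :
    ContMDiffOn I 𝓘(ℝ, E) ∞ (fun p => (mfderiv I 𝓘(ℝ, E) f p (X p) : E)) U := by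
  have : IsManifold I 1 M := IsManifold.of_le (n := ∞) (by simp)
  have h1 := hf.contMDiffOn_tangentMapWithin (m := ∞) (by simp) hU.uniqueMDiffOn
  have h2 := h1.comp hX (fun p hp => hp)
  have h3 := (contMDiff_snd_tangentBundle_modelSpace (n := ∞) E 𝓘(ℝ, E)).comp_contMDiffOn h2
  refine h3.congr fun p hp => ?_
  simp only [Function.comp, tangentMapWithin]
  rw [mfderivWithin_of_isOpen hU hp]

end General

/-- A pair of smooth vector fields on the factors is a smooth vector field on the tube. -/
theorem contMDiffOn_prod_field {N : Type*} [TopologicalSpace N]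
    [ChartedSpace (EuclideanSpace ℝ (Fin 3)) N] [IsManifold (𝓡 3) ∞ N] (c : ℝ)
    {X : ∀ p : N, TangentSpace (𝓡 3) p} {W : Set N} (hX : SmoothFieldOn X W) :
    ContMDiffOn (𝓘(ℝ, ℝ).prod (𝓡 3)) (𝓘(ℝ, ℝ).prod (𝓡 3)).tangent ∞
      (fun z : ℝ × N => (⟨z, (c, X z.2)⟩ : TangentBundle (𝓘(ℝ, ℝ).prod (𝓡 3)) (ℝ × N)))
      (univ ×ˢ W) := by
  have : IsManifold (𝓡 3) 1 N := IsManifold.of_le (n := ∞) (by simp)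
  have h1 : ContMDiff 𝓘(ℝ, ℝ) 𝓘(ℝ, ℝ).tangent ∞ (fun t : ℝ => (⟨t, c⟩ : TangentBundle 𝓘(ℝ, ℝ) ℝ)) :=
    contMDiff_vectorSpace_iff_contDiff.2 contDiff_const
  have h2 : ContMDiffOn (𝓘(ℝ, ℝ).prod (𝓡 3)) (𝓘(ℝ, ℝ).tangent.prod (𝓡 3).tangent) ∞
      (fun z : ℝ × N => ((⟨z.1, c⟩ : TangentBundle 𝓘(ℝ, ℝ) ℝ), (⟨z.2, X z.2⟩ : TangentBundle (𝓡 3) N)))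
      (univ ×ˢ W) :=
    ((h1.comp contMDiff_fst).contMDiffOn).prodMk (hX.comp contMDiffOn_snd fun z hz => hz.2)
  exact (contMDiff_equivTangentBundleProd_symm (I := 𝓘(ℝ, ℝ)) (M := ℝ) (I' := 𝓡 3) (M' := N)
    (n := ∞)).comp_contMDiffOn h2

section Tube
variable {N : Type*} [TopologicalSpace N] [ChartedSpace (EuclideanSpace ℝ (Fin 3)) N]
  {E : Type*} [NormedAddCommGroup E] [NormedSpace ℝ E]

/-- Smoothness on `ℝ × W`. -/
abbrev SmoothTubeOn (f : ℝ × N → E) (W : Set N) : Prop :=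
  ContMDiffOn (𝓘(ℝ, ℝ).prod (𝓡 3)) 𝓘(ℝ, E) ∞ f (univ ×ˢ W)

theorem isOpen_tube {W : Set N} (hW : IsOpen W) : IsOpen ((univ : Set ℝ) ×ˢ W) :=
  isOpen_univ.prod hW

variable {W : Set N} {f : ℝ × N → E} {z : ℝ × N}

theorem SmoothTubeOn.mdifferentiableAt (hW : IsOpen W) (hf : SmoothTubeOn f W) (hz : z.2 ∈ W) :
    MDifferentiableAt (𝓘(ℝ, ℝ).prod (𝓡 3)) 𝓘(ℝ, E) f z :=
  ((hf z ⟨mem_univ _, hz⟩).contMDiffAt ((isOpen_tube hW).mem_nhds ⟨mem_univ _, hz⟩)).mdifferentiableAt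
    (by simp)

theorem timeDeriv_eq_mfderiv (hf : MDifferentiableAt (𝓘(ℝ, ℝ).prod (𝓡 3)) 𝓘(ℝ, E) f z) :
    timeDeriv f z = mfderiv (𝓘(ℝ, ℝ).prod (𝓡 3)) 𝓘(ℝ, E) f z
      ((1 : ℝ), (0 : EuclideanSpace ℝ (Fin 3))) := by
  have h1 : HasMFDerivAt 𝓘(ℝ, ℝ) (𝓘(ℝ, ℝ).prod (𝓡 3)) (fun s : ℝ => (s, z.2)) z.1
      ((ContinuousLinearMap.id ℝ ℝ).prod (0 : ℝ →L[ℝ] EuclideanSpace ℝ (Fin 3))) :=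
    (hasMFDerivAt_id z.1).prodMk (hasMFDerivAt_const z.2 z.1)
  have h2 := HasMFDerivAt.comp (g := f) z.1 (show HasMFDerivAt _ _ f (z.1, z.2) _ from hf.hasMFDerivAt) h1
  have h3 : HasFDerivAt (fun s => f (s, z.2)) (_ : ℝ →L[ℝ] E) z.1 :=
    hasMFDerivAt_iff_hasFDerivAt.1 h2
  exact h3.hasDerivAt.deriv

theorem fieldDeriv_eq_mfderiv (X : ∀ p : N, TangentSpace (𝓡 3) p)
    (hf : MDifferentiableAt (𝓘(ℝ, ℝ).prod (𝓡 3)) 𝓘(ℝ, E) f z) :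
    fieldDeriv X f z = mfderiv (𝓘(ℝ, ℝ).prod (𝓡 3)) 𝓘(ℝ, E) f z ((0 : ℝ), X z.2) := by
  have h1 : HasMFDerivAt (𝓡 3) (𝓘(ℝ, ℝ).prod (𝓡 3)) (fun q : N => (z.1, q)) z.2
      ((0 : EuclideanSpace ℝ (Fin 3) →L[ℝ] ℝ).prod
        (ContinuousLinearMap.id ℝ (EuclideanSpace ℝ (Fin 3)))) :=
    (hasMFDerivAt_const z.1 z.2).prodMk (hasMFDerivAt_id z.2)
  have h2 := HasMFDerivAt.comp (g := f) z.2 (show HasMFDerivAt _ _ f (z.1, z.2) _ from hf.hasMFDerivAt) h1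
  have h3 := h2.mfderiv
  unfold fieldDeriv dirDeriv
  exact DFunLike.congr_fun h3 (X z.2)

variable [IsManifold (𝓡 3) ∞ N]

theorem SmoothTubeOn.timeDeriv (hW : IsOpen W) (hf : SmoothTubeOn f W) :
    SmoothTubeOn (timeDeriv f) W := by
  have h := contMDiffOn_mfderiv_apply (I := 𝓘(ℝ, ℝ).prod (𝓡 3)) (M := ℝ × N)
    (X := fun z => ((1 : ℝ), (0 : EuclideanSpace ℝ (Fin 3)))) (isOpen_tube hW) hf
    (contMDiffOn_prod_field 1 (X := fun _ => 0) (Bundle.contMDiff_zeroSection ℝ _).contMDiffOn)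
  exact h.congr fun z hz => timeDeriv_eq_mfderiv (hf.mdifferentiableAt hW hz.2)

theorem SmoothTubeOn.fieldDeriv (hW : IsOpen W) (hf : SmoothTubeOn f W)
    {X : ∀ p : N, TangentSpace (𝓡 3) p} (hX : SmoothFieldOn X W) :
    SmoothTubeOn (fieldDeriv X f) W := by
  have h := contMDiffOn_mfderiv_apply (I := 𝓘(ℝ, ℝ).prod (𝓡 3)) (M := ℝ × N)
    (X := fun z => ((0 : ℝ), X z.2)) (isOpen_tube hW) hf
    (contMDiffOn_prod_field 0 hX)
  exact h.congr fun z hz => fieldDeriv_eq_mfderiv X (hf.mdifferentiableAt hW hz.2)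

end Tube

/-! ### Lie brackets as commutators of directional derivatives -/

section Commutator
variable {n : ℕ} {M : Type*} [TopologicalSpace M] [ChartedSpace (EuclideanSpace ℝ (Fin n)) M]
  [IsManifold (𝓡 n) ∞ M] {E : Type*} [NormedAddCommGroup E] [NormedSpace ℝ E]

/-- The vector field `V` read in the chart at `p`. -/
def chartField (p : M) (V : ∀ q : M, TangentSpace (𝓡 n) q) (y : EuclideanSpace ℝ (Fin n)) :
    EuclideanSpace ℝ (Fin n) :=
  VectorField.mpullbackWithin 𝓘(ℝ, EuclideanSpace ℝ (Fin n)) (𝓡 n) (extChartAt (𝓡 n) p).symm V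
    (range (𝓡 n)) y

/-- A directional derivative, read in the chart at `p`. -/
theorem dirDeriv_chart_symm (p : M) {y : EuclideanSpace ℝ (Fin n)}
    (hy : y ∈ (extChartAt (𝓡 n) p).target) {g : M → E}
    (hg : MDifferentiableAt (𝓡 n) 𝓘(ℝ, E) g ((extChartAt (𝓡 n) p).symm y))
    (V : ∀ q : M, TangentSpace (𝓡 n) q) :
    dirDeriv g ((extChartAt (𝓡 n) p).symm y) (V ((extChartAt (𝓡 n) p).symm y))
      = fderiv ℝ (g ∘ (extChartAt (𝓡 n) p).symm) y (chartField p V y) := by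
  have : IsManifold (𝓡 n) 1 M := IsManifold.of_le (n := ∞) (by simp)
  have hinv := isInvertible_mfderivWithin_extChartAt_symm (I := 𝓡 n) hy
  have hd : MDifferentiableAt 𝓘(ℝ, EuclideanSpace ℝ (Fin n)) (𝓡 n) (extChartAt (𝓡 n) p).symm y := by
    have := mdifferentiableWithinAt_extChartAt_symm (I := 𝓡 n) hy
    rwa [ModelWithCorners.range_eq_univ, mdifferentiableWithinAt_univ] at this
  have h1 := DFunLike.congr_fun (mfderiv_comp y hg hd) (chartField p V y)
  rw [mfderiv_eq_fderiv] at h1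
  refine Eq.trans ?_ h1.symm
  rw [ModelWithCorners.range_eq_univ, mfderivWithin_univ] at hinv
  have h2 := hinv.self_apply_inverse (V ((extChartAt (𝓡 n) p).symm y))
  have h3 : chartField p V y = (mfderiv 𝓘(ℝ, EuclideanSpace ℝ (Fin n)) (𝓡 n)
      (extChartAt (𝓡 n) p).symm y).inverse (V ((extChartAt (𝓡 n) p).symm y)) := by
    unfold chartField
    rw [ModelWithCorners.range_eq_univ, VectorField.mpullbackWithin_univ]
    rfl
  unfold dirDeriv
  refine congrArg (mfderiv (𝓡 n) 𝓘(ℝ, E) g ((extChartAt (𝓡 n) p).symm y)) ?_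
  rw [h3]
  exact h2.symm

theorem dirDeriv_eq_fderiv_chart {p q : M} (hq : q ∈ (extChartAt (𝓡 n) p).source) {g : M → E}
    (hg : MDifferentiableAt (𝓡 n) 𝓘(ℝ, E) g q) (v : TangentSpace (𝓡 n) q) :
    dirDeriv g q v = fderiv ℝ (g ∘ (extChartAt (𝓡 n) p).symm) (extChartAt (𝓡 n) p q)
      (dirDeriv (extChartAt (𝓡 n) p) q v) := by
  have : IsManifold (𝓡 n) 1 M := IsManifold.of_le (n := ∞) (by simp)
  have hd : MDifferentiableAt 𝓘(ℝ, EuclideanSpace ℝ (Fin n)) (𝓡 n) (extChartAt (𝓡 n) p).symm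
      (extChartAt (𝓡 n) p q) := by
    have := mdifferentiableWithinAt_extChartAt_symm (I := 𝓡 n) ((extChartAt (𝓡 n) p).map_source hq)
    rwa [ModelWithCorners.range_eq_univ, mdifferentiableWithinAt_univ] at this
  have hd2 : MDifferentiableAt (𝓡 n) 𝓘(ℝ, EuclideanSpace ℝ (Fin n)) (extChartAt (𝓡 n) p) q :=
    mdifferentiableAt_extChartAt (by simpa using hq)
  have hqs := (extChartAt (𝓡 n) p).left_inv hq
  have hg' : MDifferentiableAt (𝓡 n) 𝓘(ℝ, E) g ((extChartAt (𝓡 n) p).symm (extChartAt (𝓡 n) p q)) := by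
    rwa [hqs]
  have hgc : MDifferentiableAt 𝓘(ℝ, EuclideanSpace ℝ (Fin n)) 𝓘(ℝ, E) (g ∘ (extChartAt (𝓡 n) p).symm)
      (extChartAt (𝓡 n) p q) := hg'.comp _ hd
  have h1 := DFunLike.congr_fun (mfderiv_comp q hgc hd2) v
  have h2 : g =ᶠ[𝓝 q] (g ∘ (extChartAt (𝓡 n) p).symm) ∘ (extChartAt (𝓡 n) p) := by
    filter_upwards [extChartAt_source_mem_nhds' (I := 𝓡 n) hq] with r hr
    simp only [Function.comp]
    rw [(extChartAt (𝓡 n) p).left_inv hr]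
  have h3 := DFunLike.congr_fun (h2.mfderiv_eq (I := 𝓡 n) (I' := 𝓘(ℝ, E))) v
  rw [mfderiv_eq_fderiv] at h1
  exact h3.trans h1

/-- The bracket is defined by pulling back to the chart at p. There the identity is the symmetry of
the second derivative of f read in the chart, so all three terms are rewritten with `chartField`. -/
theorem dirDeriv_mlieBracket {f : M → E} {X Y : ∀ q : M, TangentSpace (𝓡 n) q} {U : Set M}
    (hU : IsOpen U) (hf : ContMDiffOn (𝓡 n) 𝓘(ℝ, E) ∞ f U) (hX : SmoothFieldOn X U)
    (hY : SmoothFieldOn Y U) {p : M} (hp : p ∈ U) :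
    dirDeriv f p (VectorField.mlieBracket (𝓡 n) X Y p)
      = dirDeriv (fun q => dirDeriv f q (Y q)) p (X p)
        - dirDeriv (fun q => dirDeriv f q (X q)) p (Y p) := by
  have i1 : IsManifold (𝓡 n) 1 M := IsManifold.of_le (n := ∞) (by simp)
  have i2 : IsManifold (𝓡 n) 2 M := IsManifold.of_le (n := ∞) (by exact WithTop.coe_le_coe.2 le_top)
  set φ := extChartAt (𝓡 n) p with hφ
  have hpt : φ p ∈ φ.target := mem_extChartAt_target p
  have hps : φ.symm (φ p) = p := extChartAt_to_inv p
  have at_ (g : M → E) (hg : ContMDiffOn (𝓡 n) 𝓘(ℝ, E) ∞ g U) {q} (hq : q ∈ U) :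
      MDifferentiableAt (𝓡 n) 𝓘(ℝ, E) g q :=
    ((hg q hq).contMDiffAt (hU.mem_nhds hq)).mdifferentiableAt (by simp)
  have hXf : ContMDiffOn (𝓡 n) 𝓘(ℝ, E) ∞ (fun q => dirDeriv f q (X q)) U :=
    contMDiffOn_mfderiv_apply hU hf hX
  have hYf : ContMDiffOn (𝓡 n) 𝓘(ℝ, E) ∞ (fun q => dirDeriv f q (Y q)) U :=
    contMDiffOn_mfderiv_apply hU hf hY
  have hnear : ∀ᶠ y in 𝓝 (φ p), y ∈ φ.target ∧ φ.symm y ∈ U := by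
    have h1 : φ.target ∈ 𝓝 (φ p) := extChartAt_target_mem_nhds p
    have h2 : ContinuousAt φ.symm (φ p) := continuousAt_extChartAt_symm p
    exact (eventually_mem_set.2 h1).and (h2.eventually_mem (by rw [hps]; exact hU.mem_nhds hp))
  have key (g : M → E) (hg : ContMDiffOn (𝓡 n) 𝓘(ℝ, E) ∞ g U) (V : ∀ q : M, TangentSpace (𝓡 n) q) :
      dirDeriv g p (V p) = fderiv ℝ (g ∘ φ.symm) (φ p) (chartField p V (φ p)) := by
    rw [← dirDeriv_chart_symm p hpt (by rw [hps]; exact at_ g hg hp) V, ← hφ, hps]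
  have keyE (V : ∀ q : M, TangentSpace (𝓡 n) q) :
      (fun q => dirDeriv f q (V q)) ∘ φ.symm =ᶠ[𝓝 (φ p)]
        fun y => fderiv ℝ (f ∘ φ.symm) y (chartField p V y) := by
    filter_upwards [hnear] with y hy
    exact dirDeriv_chart_symm p hy.1 (at_ f hf hy.2) V
  have dX (V : ∀ q : M, TangentSpace (𝓡 n) q) (hV : SmoothFieldOn V U) :
      DifferentiableAt ℝ (chartField p V) (φ p) := by
    have h0 : MDifferentiableAt (𝓡 n) (𝓡 n).tangent (fun x ↦ (V x : TangentBundle (𝓡 n) M)) p :=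
      ((hV p hp).contMDiffAt (hU.mem_nhds hp)).mdifferentiableAt (by simp)
    have := (mdifferentiableWithinAt_univ.2 h0).differentiableWithinAt_mpullbackWithin_vectorField
    rw [preimage_univ, univ_inter] at this
    exact this.differentiableAt (by rw [ModelWithCorners.range_eq_univ]; exact univ_mem)
  have hfs : ContDiffAt ℝ ∞ (f ∘ φ.symm) (φ p) := by
    have hc := (hf p hp).contMDiffAt (hU.mem_nhds hp)
    have h1 := (contMDiffOn_extChartAt_symm (I := 𝓡 n) (n := ∞) p).contMDiffAt
      (extChartAt_target_mem_nhds p)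
    exact (ContMDiffAt.comp_of_eq hc h1 hps).contDiffAt
  rw [key _ hYf X, key _ hXf Y, (keyE Y).fderiv_eq, (keyE X).fderiv_eq,
    ← VectorField.fderiv_apply_lieBracket hfs (by rw [minSmoothness_of_isRCLikeNormedField]; exact WithTop.coe_le_coe.2 le_top) (dX Y hY) (dX X hX)]
  rw [dirDeriv_eq_fderiv_chart (mem_extChartAt_source p) (at_ f hf hp)]
  refine congrArg (fderiv ℝ (f ∘ φ.symm) (φ p)) ?_
  have h4 := VectorField.mlieBracketWithin_apply (I := 𝓡 n) (V := X) (W := Y) (s := univ) (x₀ := p)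
  have hinv : (mfderiv (𝓡 n) 𝓘(ℝ, EuclideanSpace ℝ (Fin n)) (extChartAt (𝓡 n) p) p).IsInvertible :=
    isInvertible_mfderiv_extChartAt (mem_extChartAt_source p)
  have h5 := congrArg (mfderiv (𝓡 n) 𝓘(ℝ, EuclideanSpace ℝ (Fin n)) (extChartAt (𝓡 n) p) p) h4
  refine h5.trans ((hinv.self_apply_inverse _).trans ?_)
  rw [preimage_univ, univ_inter]
  change VectorField.lieBracketWithin ℝ (chartField p X) (chartField p Y) _ _ = _
  rw [ModelWithCorners.range_eq_univ, VectorField.lieBracketWithin_univ]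
end Commutator

/-- Symmetry of second derivatives, in the form that the constant fields (1, 0) and (0, v) have zero
bracket. -/
theorem deriv_fderiv_comm {E' E : Type*} [NormedAddCommGroup E'] [NormedSpace ℝ E']
    [NormedAddCommGroup E] [NormedSpace ℝ E] {G : ℝ × E' → E} {t : ℝ} {y : E'}
    (hG : ContDiffAt ℝ ∞ G (t, y)) (v : E') :
    deriv (fun s => fderiv ℝ (fun x => G (s, x)) y v) t
      = fderiv ℝ (fun x => deriv (fun s => G (s, x)) t) y v := by
  have hG2 : ContDiffAt ℝ 2 G (t, y) := hG.of_le (WithTop.coe_le_coe.2 le_top)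
  have hev : ∀ᶠ z in 𝓝 (t, y), DifferentiableAt ℝ G z := by
    filter_upwards [hG2.eventually (by simp)] with z hz using hz.differentiableAt (by simp)
  have hsl (z : ℝ × E') (hz : DifferentiableAt ℝ G z) :
      fderiv ℝ (fun x => G (z.1, x)) z.2 v = fderiv ℝ G z (0, v) := by
    have h1 : HasFDerivAt (fun x : E' => (z.1, x)) (ContinuousLinearMap.inr ℝ ℝ E') z.2 :=
      hasFDerivAt_prodMk_right z.1 z.2
    have h2 := HasFDerivAt.comp z.2 (show HasFDerivAt G (fderiv ℝ G z) (z.1, z.2) from hz.hasFDerivAt) h1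
    have h3 : HasFDerivAt (fun x => G (z.1, x)) _ z.2 := h2
    rw [h3.fderiv]
    simp
  have hst (z : ℝ × E') (hz : DifferentiableAt ℝ G z) :
      deriv (fun s => G (s, z.2)) z.1 = fderiv ℝ G z (1, 0) := by
    have h1 : HasFDerivAt (fun s : ℝ => (s, z.2)) (ContinuousLinearMap.inl ℝ ℝ E') z.1 :=
      hasFDerivAt_prodMk_left z.1 z.2
    have h2 := HasFDerivAt.comp z.1 (show HasFDerivAt G (fderiv ℝ G z) (z.1, z.2) from hz.hasFDerivAt) h1
    have h3 : HasFDerivAt (fun s => G (s, z.2)) _ z.1 := h2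
    rw [h3.hasDerivAt.deriv]
    simp
  have hd1 : DifferentiableAt ℝ (fun z => fderiv ℝ G z) (t, y) :=
    (hG2.fderiv_right (m := 1) le_rfl).differentiableAt one_ne_zero
  have hA : ∀ w, DifferentiableAt ℝ (fun z => fderiv ℝ G z w) (t, y) := fun w =>
    hd1.clm_apply (differentiableAt_const w)
  have e1 : deriv (fun s => fderiv ℝ (fun x => G (s, x)) y v) t
      = fderiv ℝ (fun z => fderiv ℝ G z (0, v)) (t, y) (1, 0) := by
    have : (fun s => fderiv ℝ (fun x => G (s, x)) y v) =ᶠ[𝓝 t] fun s => fderiv ℝ G (s, y) (0, v) := by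
      have hc : Tendsto (fun s : ℝ => (s, y)) (𝓝 t) (𝓝 (t, y)) :=
        (Continuous.prodMk_left y).tendsto t
      filter_upwards [hc.eventually hev] with s hs using hsl (s, y) hs
    rw [this.deriv_eq]
    have h1 : HasFDerivAt (fun s : ℝ => (s, y)) (ContinuousLinearMap.inl ℝ ℝ E') t :=
      hasFDerivAt_prodMk_left t y
    have h3 : HasFDerivAt (fun s => fderiv ℝ G (s, y) (0, v)) _ t :=
      HasFDerivAt.comp (g := fun z => fderiv ℝ G z (0, v)) t (hA (0, v)).hasFDerivAt h1
    rw [h3.hasDerivAt.deriv]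
    simp
  have e2 : fderiv ℝ (fun x => deriv (fun s => G (s, x)) t) y v
      = fderiv ℝ (fun z => fderiv ℝ G z (1, 0)) (t, y) (0, v) := by
    have : (fun x => deriv (fun s => G (s, x)) t) =ᶠ[𝓝 y] fun x => fderiv ℝ G (t, x) (1, 0) := by
      have hc : Tendsto (fun x : E' => (t, x)) (𝓝 y) (𝓝 (t, y)) :=
        (Continuous.prodMk_right t).tendsto y
      filter_upwards [hc.eventually hev] with s hs using hst (t, s) hs
    rw [this.fderiv_eq]
    have h1 : HasFDerivAt (fun x : E' => (t, x)) (ContinuousLinearMap.inr ℝ ℝ E') y :=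
      hasFDerivAt_prodMk_right t y
    have h3 : HasFDerivAt (fun x => fderiv ℝ G (t, x) (1, 0)) _ y :=
      HasFDerivAt.comp (g := fun z => fderiv ℝ G z (1, 0)) y (hA (1, 0)).hasFDerivAt h1
    rw [h3.fderiv]
    simp
  rw [e1, e2]
  have := VectorField.fderiv_apply_lieBracket (V := fun _ => ((1 : ℝ), (0 : E'))) (W := fun _ => ((0 : ℝ), v))
    hG2 (by simp) (differentiableAt_const _) (differentiableAt_const _)
  simp only [VectorField.lieBracket, fderiv_fun_const] at this
  simpa [sub_eq_zero] using this.symm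

section Tube
variable {N : Type*} [TopologicalSpace N] [ChartedSpace (EuclideanSpace ℝ (Fin 3)) N]
  {E : Type*} [NormedAddCommGroup E] [NormedSpace ℝ E]
  {W : Set N} {f : ℝ × N → E}

theorem SmoothTubeOn.slice (hf : SmoothTubeOn f W) (t : ℝ) :
    ContMDiffOn (𝓡 3) 𝓘(ℝ, E) ∞ (fun q => f (t, q)) W :=
  hf.comp (contMDiff_const.prodMk contMDiff_id).contMDiffOn fun _ hq => ⟨mem_univ _, hq⟩

variable [IsManifold (𝓡 3) ∞ N]

/-- The field does not depend on t, so in the chart of N at p it is one fixed vector v for all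
times; the claim becomes the equality of mixed derivatives in ℝ × ℝ³. -/
theorem timeDeriv_fieldDeriv_comm (hW : IsOpen W) (hf : SmoothTubeOn f W)
    (X : ∀ p : N, TangentSpace (𝓡 3) p) {z : ℝ × N} (hz : z.2 ∈ W) :
    timeDeriv (fieldDeriv X f) z = fieldDeriv X (timeDeriv f) z := by
  obtain ⟨t, p⟩ := z
  set φ := extChartAt (𝓡 3) p with hφ
  set v := dirDeriv φ p (X p) with hv
  have md {g : ℝ × N → E} (hg : SmoothTubeOn g W) (s : ℝ) :
      MDifferentiableAt (𝓡 3) 𝓘(ℝ, E) (fun q => g (s, q)) p :=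
    ((hg.slice s p hz).contMDiffAt (hW.mem_nhds hz)).mdifferentiableAt (by simp)
  have e {g : ℝ × N → E} (hg : SmoothTubeOn g W) (s : ℝ) :
      fieldDeriv X g (s, p) = fderiv ℝ (fun y => g (s, φ.symm y)) (φ p) v :=
    dirDeriv_eq_fderiv_chart (mem_extChartAt_source p) (md hg s) (X p)
  rw [e (hf.timeDeriv hW)]
  simp only [timeDeriv, e hf]
  refine deriv_fderiv_comm (G := fun x => f (x.1, φ.symm x.2)) ?_ v
  have h1 := (contMDiffOn_extChartAt_symm (I := 𝓡 3) (n := ∞) p).contMDiffAt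
    (extChartAt_target_mem_nhds p)
  have hc := (hf (t, p) ⟨mem_univ _, hz⟩).contMDiffAt ((isOpen_tube hW).mem_nhds ⟨mem_univ _, hz⟩)
  have h2 : ContMDiffAt (𝓘(ℝ, ℝ).prod 𝓘(ℝ, EuclideanSpace ℝ (Fin 3))) (𝓘(ℝ, ℝ).prod (𝓡 3)) ∞
      (fun x : ℝ × EuclideanSpace ℝ (Fin 3) => (x.1, φ.symm x.2)) (t, φ p) :=
    contMDiffAt_fst.prodMk (ContMDiffAt.comp (t, φ p) h1 contMDiffAt_snd)
  have h3 := ContMDiffAt.comp_of_eq hc h2 (by simp [hφ])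
  rw [← contMDiffAt_iff_contDiffAt, modelWithCornersSelf_prod, ← chartedSpaceSelf_prod]
  exact h3

theorem fieldDeriv_fieldDeriv_comm (hW : IsOpen W) (hf : SmoothTubeOn f W)
    {X Y : ∀ p : N, TangentSpace (𝓡 3) p} (hX : SmoothFieldOn X W) (hY : SmoothFieldOn Y W)
    {z : ℝ × N} (hz : z.2 ∈ W) :
    fieldDeriv X (fieldDeriv Y f) z - fieldDeriv Y (fieldDeriv X f) z
      = fieldDeriv (VectorField.mlieBracket (𝓡 3) X Y) f z :=
  (dirDeriv_mlieBracket hW (hf.slice z.1) hX hY hz).symm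

end Tube

/-- A vector field is smooth if its image under a smooth family of isomorphisms is. -/
theorem smoothFieldOn_of_isomorphism {n : ℕ} {M : Type*} [TopologicalSpace M]
    [ChartedSpace (EuclideanSpace ℝ (Fin n)) M] [IsManifold (𝓡 n) ∞ M]
    {F : Type*} [NormedAddCommGroup F] [NormedSpace ℝ F] [CompleteSpace F] {U : Set M}
    (hU : IsOpen U)
    (lam : ∀ p : M, TangentSpace (𝓡 n) p →L[ℝ] F)
    (hlam : ∀ V : (∀ p : M, TangentSpace (𝓡 n) p), ∀ U' ⊆ U, IsOpen U' → SmoothFieldOn V U' →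
      ContMDiffOn (𝓡 n) 𝓘(ℝ, F) ∞ (fun p => lam p (V p)) U')
    (hinv : ∀ p ∈ U, (lam p).IsInvertible)
    {X : ∀ p : M, TangentSpace (𝓡 n) p}
    (hX : ContMDiffOn (𝓡 n) 𝓘(ℝ, F) ∞ (fun p => lam p (X p)) U) : SmoothFieldOn X U := by
  intro p₀ hp₀
  refine ContMDiffAt.contMDiffWithinAt ?_
  have : IsManifold (𝓡 n) 1 M := IsManifold.of_le (n := ∞) (by simp)
  set e := trivializationAt (EuclideanSpace ℝ (Fin n)) (TangentSpace (𝓡 n) (M := M)) p₀ with he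
  have hp₀e : p₀ ∈ e.baseSet := mem_baseSet_trivializationAt _ _ p₀
  set U' := U ∩ e.baseSet with hU'
  have hoU' : IsOpen U' := hU.inter e.open_baseSet
  have hp₀' : p₀ ∈ U' := ⟨hp₀, hp₀e⟩
  -- the coordinate fields
  have hfield (v : EuclideanSpace ℝ (Fin n)) : SmoothFieldOn (fun p => e.symmL ℝ p v) U' := by
    have h1 := (Bundle.Trivialization.contMDiffOn_symm (IB := 𝓡 n) (n := ∞) e).comp
      (s := U') (f := fun p => (p, v)) (contMDiff_id.prodMk contMDiff_const).contMDiffOn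
      (fun p hp => by simpa [e.target_eq] using hp.2)
    refine h1.congr fun p hp => ?_
    have h2 : e.symmL ℝ p v = e.symm p v := by simp [hp.2]
    exact (congrArg (TotalSpace.mk' (EuclideanSpace ℝ (Fin n)) p) h2).trans (e.mk_symm hp.2 v)
  let lamT : M → (EuclideanSpace ℝ (Fin n) →L[ℝ] F) := fun p => (lam p).comp (e.symmL ℝ p)
  have hlamT : ContMDiffAt (𝓡 n) 𝓘(ℝ, EuclideanSpace ℝ (Fin n) →L[ℝ] F) ∞ lamT p₀ := by
    have h1 : ∀ v, ContMDiffAt (𝓡 n) 𝓘(ℝ, F) ∞ (fun p => lamT p v) p₀ := fun v =>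
      (hlam _ U' inter_subset_left hoU' (hfield v) p₀ hp₀').contMDiffAt (hoU'.mem_nhds hp₀')
    -- An operator on ℝⁿ is a smooth function of its values on the standard basis, and these values
    -- are smooth because the coordinate fields are.
    have h2 : lamT = fun p => ∑ i, ContinuousLinearMap.smulRightL ℝ (EuclideanSpace ℝ (Fin n)) F
        (EuclideanSpace.proj i) (lamT p (EuclideanSpace.single i 1)) := by
      funext p
      refine ContinuousLinearMap.ext fun v => ?_
      have hv : v = ∑ i, v i • EuclideanSpace.single i (1 : ℝ) := by
        simpa using ((EuclideanSpace.basisFun (Fin n) ℝ).sum_repr v).symm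
      conv_lhs => rw [hv, map_sum]
      simp
    rw [h2]
    refine contMDiffAt_finsetSum fun i _ => ?_
    exact (ContinuousLinearMap.contMDiff (n := ∞) (ContinuousLinearMap.smulRightL ℝ (EuclideanSpace ℝ (Fin n)) F
      (EuclideanSpace.proj i))).contMDiffAt.comp p₀ (h1 _)
  have hlinv' (p : M) (hp : p ∈ U') : (lamT p).IsInvertible := by
    have h1 : lamT p = (lam p).comp ((e.continuousLinearEquivAt ℝ p hp.2).symm : _ →L[ℝ] _) := by
      refine ContinuousLinearMap.ext fun v => ?_
      exact congrArg (lam p) (congrFun (e.symm_continuousLinearEquivAt_eq (R := ℝ) hp.2).symm v)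
    rw [h1]
    exact (hinv p hp.1).comp (ContinuousLinearMap.isInvertible_equiv)
  have hlinv := hlinv' p₀ hp₀'
  have key : ∀ᶠ p in 𝓝 p₀, (e ⟨p, X p⟩).2 = (lamT p).inverse (lam p (X p)) := by
    filter_upwards [hoU'.mem_nhds hp₀'] with p hp
    have h1 : lamT p ((e ⟨p, X p⟩).2) = lam p (X p) := by
      refine congrArg (lam p) ?_
      have := e.symmL_continuousLinearMapAt (R := ℝ) hp.2 (X p)
      rwa [e.continuousLinearMapAt_apply_of_mem ℝ hp.2] at this
    rw [← h1, (hlinv' p hp).inverse_apply_self]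
  have hgoal : ContMDiffAt (𝓡 n) 𝓘(ℝ, EuclideanSpace ℝ (Fin n)) ∞
      (fun p => (lamT p).inverse (lam p (X p))) p₀ := by
    -- Inversion is smooth on the open set of invertible operators; this is where completeness of F
    -- is used.
    have h1 : ContMDiffAt (𝓡 n) 𝓘(ℝ, F →L[ℝ] EuclideanSpace ℝ (Fin n)) ∞ (fun p => (lamT p).inverse) p₀ := by
      obtain ⟨A, hA⟩ := hlinv
      have := contDiffAt_map_inverse (𝕜 := ℝ) (n := ∞) A
      rw [hA] at this
      exact ContMDiffAt.comp p₀ this.contMDiffAt hlamT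
    exact h1.clm_apply ((hX p₀ hp₀).contMDiffAt (hU.mem_nhds hp₀))
  refine (contMDiffAt_section p₀).2 ?_
  exact hgoal.congr_of_eventuallyEq key

theorem isInvertible_of_surjective_of_finrank_eq {E F : Type*} [NormedAddCommGroup E]
    [NormedSpace ℝ E] [FiniteDimensional ℝ E] [NormedAddCommGroup F] [NormedSpace ℝ F]
    [FiniteDimensional ℝ F] (hEF : Module.finrank ℝ E = Module.finrank ℝ F) (A : E →L[ℝ] F)
    (hA : Function.Surjective A) : A.IsInvertible := by
  have hinj : Function.Injective A :=
    (LinearMap.injective_iff_surjective_of_finrank_eq_finrank (f := (A : E →ₗ[ℝ] F)) hEF).2 hA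
  exact ⟨(LinearEquiv.ofBijective (A : E →ₗ[ℝ] F) ⟨hinj, hA⟩).toContinuousLinearEquiv, by ext; rfl⟩

/-! ### Geometry of the circle bundle: horizontal lifts and smooth frames -/

section Bundle
variable {S : Type*} [TopologicalSpace S] [ChartedSpace (EuclideanSpace ℝ (Fin 2)) S]
  [IsManifold (𝓡 2) ∞ S] {h : OrientedMetric S}
  {N : Type*} [TopologicalSpace N] [ChartedSpace (EuclideanSpace ℝ (Fin 3)) N]
  [IsManifold (𝓡 3) ∞ N] [MulAction Circle N] (B : CircleBundle h N)

theorem CircleBundle.proj_smul (z : Circle) (p : N) : B.proj (z • p) = B.proj p :=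
  ((B.fiber_iff p (z • p)).2 ⟨z, rfl⟩).symm

theorem CircleBundle.mdifferentiableAt_proj (p : N) : MDifferentiableAt (𝓡 3) (𝓡 2) B.proj p :=
  B.proj_smooth.contMDiffAt.mdifferentiableAt (by simp)

theorem CircleBundle.contMDiff_orbit (B : CircleBundle h N) (p : N) :
    ContMDiff 𝓘(ℝ, ℝ) (𝓡 3) ∞ (fun s : ℝ => Circle.exp s • p) :=
  B.smul_smooth.comp ((contMDiff_circleExp.of_le le_top).prodMk contMDiff_const)

theorem CircleBundle.contMDiff_smul (B : CircleBundle h N) (z : Circle) : ContMDiff (𝓡 3) (𝓡 3) ∞ (fun p : N => z • p) :=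
  B.smul_smooth.comp (contMDiff_const.prodMk contMDiff_id)

/-- The projection is constant along the orbit whose velocity at 0 is ζ. -/
theorem CircleBundle.dproj_generator (p : N) : B.dproj p (generator N p) = 0 := by
  have h1 := ((B.contMDiff_orbit p).contMDiffAt (x := 0)).mdifferentiableAt (by simp)
  have h0 : Circle.exp (0 : ℝ) • p = p := by simp
  have hf' : HasMFDerivAt (𝓡 3) (𝓡 2) B.proj (Circle.exp (0 : ℝ) • p) (mfderiv (𝓡 3) (𝓡 2) B.proj p) := by
    have key : ∀ q : N, q = p →
        HasMFDerivAt (𝓡 3) (𝓡 2) B.proj q (mfderiv (𝓡 3) (𝓡 2) B.proj p) := by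
      rintro q rfl
      exact (B.mdifferentiableAt_proj q).hasMFDerivAt
    exact key _ h0
  have h2 := HasMFDerivAt.comp (0 : ℝ) hf' h1.hasMFDerivAt
  have h3 : B.proj ∘ (fun s : ℝ => Circle.exp s • p) = fun _ => B.proj p := by
    funext s
    exact B.proj_smul _ _
  rw [h3] at h2
  have h4 := h2.mfderiv.symm.trans mfderiv_const
  exact DFunLike.congr_fun h4 (1 : ℝ)

/-- A local section can be translated by a circle element so as to pass through p; its differential
is then a right inverse of dπ at p. -/
theorem CircleBundle.dproj_surjective (p : N) : Function.Surjective (B.dproj p) := by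
  obtain ⟨U, hU, hxU, σ, hσ, hσp⟩ := B.local_section (B.proj p)
  obtain ⟨z, hz⟩ := (B.fiber_iff (σ (B.proj p)) p).1 (hσp _ hxU)
  have h1 : MDifferentiableAt (𝓡 2) (𝓡 3) σ (B.proj p) :=
    ((hσ _ hxU).contMDiffAt (hU.mem_nhds hxU)).mdifferentiableAt (by simp)
  have h2 : MDifferentiableAt (𝓡 2) (𝓡 3) (fun y => z • σ y) (B.proj p) :=
    ((B.contMDiff_smul z).contMDiffAt.mdifferentiableAt (by simp)).comp _ h1
  have h3 : MDifferentiableAt (𝓡 3) (𝓡 2) B.proj (z • σ (B.proj p)) := B.mdifferentiableAt_proj _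
  have h4 := HasMFDerivAt.comp (B.proj p) h3.hasMFDerivAt h2.hasMFDerivAt
  have h5 : B.proj ∘ (fun y => z • σ y) =ᶠ[𝓝 (B.proj p)] id := by
    filter_upwards [hU.mem_nhds hxU] with y hy
    simp [B.proj_smul, hσp y hy]
  have h6 := h4.mfderiv.symm.trans (h5.mfderiv_eq.trans mfderiv_id)
  intro w
  have h7 := DFunLike.congr_fun h6 w
  have key : ∀ q : N, q = p → (∃ v : EuclideanSpace ℝ (Fin 3), (mfderiv (𝓡 3) (𝓡 2) B.proj q v :
      EuclideanSpace ℝ (Fin 2)) = w) → ∃ v, B.dproj p v = w := by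
    rintro q rfl hq
    exact hq
  exact key _ hz.symm ⟨_, h7⟩

theorem CircleBundle.isInvertible_dproj_prod (p : N) :
    ((B.dproj p).prod (B.η p)).IsInvertible := by
  have hsurj : Function.Surjective ((B.dproj p).prod (B.η p)) := by
    rintro ⟨w, c⟩
    obtain ⟨v, hv⟩ := B.dproj_surjective p w
    -- A multiple of ζ corrects the value of η without changing the projection.
    refine ⟨v + (c - B.η p v) • generator N p, ?_⟩
    rw [ContinuousLinearMap.prod_apply, map_add, map_smul, B.dproj_generator, map_add, map_smul,
      B.η_vertical, hv]
    simp
  exact isInvertible_of_surjective_of_finrank_eq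
    (E := EuclideanSpace ℝ (Fin 3)) (F := EuclideanSpace ℝ (Fin 2) × ℝ) (by simp) _ hsurj

theorem CircleBundle.dproj_hlift (p : N) (w : TangentSpace (𝓡 2) (B.proj p)) :
    B.dproj p (B.hlift p w) = w :=
  congrArg Prod.fst ((B.isInvertible_dproj_prod p).self_apply_inverse (w, 0))

theorem CircleBundle.η_hlift (p : N) (w : TangentSpace (𝓡 2) (B.proj p)) :
    B.η p (B.hlift p w) = 0 :=
  congrArg Prod.snd ((B.isInvertible_dproj_prod p).self_apply_inverse (w, 0))

end Bundle

section FormApply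
variable {n : ℕ} {M : Type*} [TopologicalSpace M] [ChartedSpace (EuclideanSpace ℝ (Fin n)) M]
  [IsManifold (𝓡 n) ∞ M]

theorem SmoothFormOn.apply {θ : ∀ p : M, TangentSpace (𝓡 n) p →L[ℝ] ℝ} {U : Set M}
    (hθ : SmoothFormOn θ U) {X : ∀ p : M, TangentSpace (𝓡 n) p} (hX : SmoothFieldOn X U) :
    ContMDiffOn (𝓡 n) 𝓘(ℝ, ℝ) ∞ (fun p => θ p (X p)) U := by
  have : IsManifold (𝓡 n) 1 M := IsManifold.of_le (n := ∞) (by simp)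
  have h1 := ContMDiffOn.clm_bundle_apply (F₂ := ℝ) (E₂ := Trivial M ℝ) hθ hX
  intro p hp
  have h2 := h1 p hp
  rw [contMDiffWithinAt_totalSpace] at h2
  exact h2.2

theorem SmoothFieldOn.inner {S : Type*} [TopologicalSpace S] [ChartedSpace (EuclideanSpace ℝ (Fin 2)) S]
    [IsManifold (𝓡 2) ∞ S] (h : OrientedMetric S) {X Y : ∀ p : S, TangentSpace (𝓡 2) p} {U : Set S}
    (hX : SmoothFieldOn X U) (hY : SmoothFieldOn Y U) :
    ContMDiffOn (𝓡 2) 𝓘(ℝ, ℝ) ∞ (fun p => h.metric.inner p (X p) (Y p)) U := by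
  have : IsManifold (𝓡 2) 1 S := IsManifold.of_le (n := ∞) (by simp)
  have h0 := h.metric.contMDiff.contMDiffOn (s := U)
  have h1 := ContMDiffOn.clm_bundle_apply₂ (F₃ := ℝ) (E₃ := Trivial S ℝ) h0 hX hY
  intro p hp
  have h2 := h1 p hp
  rw [contMDiffWithinAt_totalSpace] at h2
  exact h2.2

/-- The rotation of a smooth local vector field is smooth. -/
theorem SmoothFieldOn.J {S : Type*} [TopologicalSpace S] [ChartedSpace (EuclideanSpace ℝ (Fin 2)) S]
    [IsManifold (𝓡 2) ∞ S] [T2Space S] (h : OrientedMetric S) {X : ∀ p : S, TangentSpace (𝓡 2) p}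
    {U : Set S} (hU : IsOpen U) (hX : SmoothFieldOn X U) :
    SmoothFieldOn (fun p => h.J p (X p)) U := by
  intro p hp
  -- `J_smooth` concerns global fields only, so X is multiplied by a bump function supported in U
  -- that equals 1 near p.
  obtain ⟨f, -, hf⟩ := (SmoothBumpFunction.nhds_basis_tsupport (I := 𝓡 2) p).mem_iff.1 (hU.mem_nhds hp)
  have h1 : SmoothFieldOn (fun q => f q • X q) univ := by
    have := ContMDiffOn.smul_section_of_tsupport (n := ∞) (V := TangentSpace (𝓡 2)) (s := X)
      (ψ := f) (u := U) f.contMDiff.contMDiffOn hU hf hX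
    exact this.contMDiffOn
  have h2 := h.J_smooth _ h1
  have h3 : (fun q => (⟨q, h.J q (X q)⟩ : TangentBundle (𝓡 2) S)) =ᶠ[𝓝 p]
      fun q => (⟨q, h.J q (f q • X q)⟩ : TangentBundle (𝓡 2) S) := by
    filter_upwards [f.eventuallyEq_one] with q hq
    simp only [hq, Pi.one_apply, one_smul]
  exact (((h2 p (mem_univ p)).contMDiffAt univ_mem).congr_of_eventuallyEq h3).contMDiffWithinAt

end FormApply

section Bundle
variable {S : Type*} [TopologicalSpace S] [ChartedSpace (EuclideanSpace ℝ (Fin 2)) S]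
  [IsManifold (𝓡 2) ∞ S] {h : OrientedMetric S}
  {N : Type*} [TopologicalSpace N] [ChartedSpace (EuclideanSpace ℝ (Fin 3)) N]
  [IsManifold (𝓡 3) ∞ N] [MulAction Circle N] (B : CircleBundle h N)

/-- A vector field on the circle bundle is smooth if its vertical part is and if its horizontal
part, read in the charts of the base, is. -/
theorem CircleBundle.smoothFieldOn_of_parts {W : Set N} (hW : IsOpen W)
    {X : ∀ p : N, TangentSpace (𝓡 3) p}
    (hη : ContMDiffOn (𝓡 3) 𝓘(ℝ, ℝ) ∞ (fun p => B.η p (X p)) W)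
    (hπ : ∀ x : S, ContMDiffOn (𝓡 3) 𝓘(ℝ, EuclideanSpace ℝ (Fin 2)) ∞
      (fun p => dirDeriv (extChartAt (𝓡 2) x) (B.proj p) (B.dproj p (X p)))
      (W ∩ B.proj ⁻¹' (extChartAt (𝓡 2) x).source)) : SmoothFieldOn X W := by
  intro p₀ hp₀
  have i1 : IsManifold (𝓡 2) 1 S := IsManifold.of_le (n := ∞) (by simp)
  set x := B.proj p₀ with hx
  set χ := extChartAt (𝓡 2) x with hχ
  set U := W ∩ B.proj ⁻¹' χ.source with hUdef
  have hU : IsOpen U := hW.inter ((isOpen_extChartAt_source x).preimage B.proj_smooth.continuous)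
  have hpU : p₀ ∈ U := ⟨hp₀, mem_extChartAt_source x⟩
  have hχd (p : N) (hp : p ∈ U) : MDifferentiableAt (𝓡 2) 𝓘(ℝ, EuclideanSpace ℝ (Fin 2)) χ (B.proj p) :=
    mdifferentiableAt_extChartAt (by simpa [hχ] using hp.2)
  -- The base is read in a fixed chart so that all tangent spaces are mapped to one vector space; dπ
  -- together with η is an isomorphism.
  let lam : ∀ p : N, TangentSpace (𝓡 3) p →L[ℝ] EuclideanSpace ℝ (Fin 2) × ℝ := fun p =>
    ContinuousLinearMap.prod (mfderiv (𝓡 3) 𝓘(ℝ, EuclideanSpace ℝ (Fin 2)) (χ ∘ B.proj) p : _ →L[ℝ] EuclideanSpace ℝ (Fin 2)) (B.η p)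
  have hlam1 (p : N) (hp : p ∈ U) (v : TangentSpace (𝓡 3) p) :
      lam p v = (dirDeriv χ (B.proj p) (B.dproj p v), B.η p v) := by
    refine Prod.ext ?_ rfl
    exact DFunLike.congr_fun (mfderiv_comp p (hχd p hp) (B.mdifferentiableAt_proj p)) v
  have hχs : ContMDiffOn (𝓡 3) 𝓘(ℝ, EuclideanSpace ℝ (Fin 2)) ∞ (χ ∘ B.proj) U :=
    (contMDiffOn_extChartAt (I := 𝓡 2) (x := x)).comp B.proj_smooth.contMDiffOn
      (fun p hp => by simpa [hχ] using hp.2)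
  have key := smoothFieldOn_of_isomorphism (X := X) hU lam ?_ ?_ ?_
  · exact ((key p₀ hpU).contMDiffAt (hU.mem_nhds hpU)).contMDiffWithinAt
  · intro V U' hU' hoU' hV
    exact (contMDiffOn_mfderiv_apply hoU' (hχs.mono hU') hV).prodMk_space
      (SmoothFormOn.apply (B.η_smooth.mono (subset_univ _)) hV)
  · intro p hp
    have hinvχ : (mfderiv (𝓡 2) 𝓘(ℝ, EuclideanSpace ℝ (Fin 2)) χ (B.proj p)).IsInvertible :=
      isInvertible_mfderiv_extChartAt hp.2
    refine isInvertible_of_surjective_of_finrank_eq (E := EuclideanSpace ℝ (Fin 3))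
      (F := EuclideanSpace ℝ (Fin 2) × ℝ) (by simp) _ ?_
    rintro ⟨w, c⟩
    obtain ⟨w', hw'⟩ := hinvχ.surjective w
    obtain ⟨v, hv⟩ := (B.isInvertible_dproj_prod p).surjective (w', c)
    refine ⟨v, (hlam1 p hp v).trans ?_⟩
    have e1 : B.dproj p v = w' := congrArg Prod.fst hv
    have e2 : B.η p v = c := congrArg Prod.snd hv
    rw [e1, e2]
    exact Prod.ext hw' rfl
  · have := ((hπ x).mono (show U ⊆ _ from subset_rfl)).prodMk_space (hη.mono inter_subset_left)
    exact this.congr fun p hp => hlam1 p hp (X p)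

theorem CircleBundle.smoothFieldOn_generator (B : CircleBundle h N) : SmoothFieldOn (generator N) (univ : Set N) := by
  refine B.smoothFieldOn_of_parts isOpen_univ ?_ fun x => ?_
  · exact contMDiffOn_const.congr fun p _ => B.η_vertical p
  · refine (contMDiffOn_const (c := 0)).congr fun p _ => ?_
    rw [B.dproj_generator]
    exact map_zero (mfderiv (𝓡 2) 𝓘(ℝ, EuclideanSpace ℝ (Fin 2)) (extChartAt (𝓡 2) x) (B.proj p))

theorem CircleBundle.smoothFieldOn_hlift {v : ∀ x : S, TangentSpace (𝓡 2) x} {U : Set S}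
    (hU : IsOpen U) (hv : SmoothFieldOn v U) :
    SmoothFieldOn (fun p => B.hlift p (v (B.proj p))) (B.proj ⁻¹' U) := by
  refine B.smoothFieldOn_of_parts (hU.preimage B.proj_smooth.continuous) ?_ fun x => ?_
  · exact (contMDiffOn_const (c := 0)).congr fun p _ => B.η_hlift p _
  · have i1 : IsManifold (𝓡 2) 1 S := IsManifold.of_le (n := ∞) (by simp)
    have h1 : ContMDiffOn (𝓡 2) 𝓘(ℝ, EuclideanSpace ℝ (Fin 2)) ∞
        (fun y => dirDeriv (extChartAt (𝓡 2) x) y (v y)) (U ∩ (extChartAt (𝓡 2) x).source) := by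
      refine contMDiffOn_mfderiv_apply (hU.inter (isOpen_extChartAt_source x)) ?_
        (hv.mono inter_subset_left)
      exact (contMDiffOn_extChartAt (I := 𝓡 2) (x := x)).mono fun y hy => by simpa using hy.2
    refine (h1.comp B.proj_smooth.contMDiffOn fun p hp => hp).congr fun p hp => ?_
    simp only [Function.comp, B.dproj_hlift]

theorem CircleBundle.smoothFieldOn_frame [T2Space S] (δ : ℝ) {e : ∀ x : S, TangentSpace (𝓡 2) x} {U : Set S}
    (hU : IsOpen U) (he : SmoothFieldOn e U) (j : Fin 3) :
    SmoothFieldOn (B.frame δ e j) (B.proj ⁻¹' U) := by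
  fin_cases j
  · exact ContMDiffOn.const_smul_section (a := δ) (B.smoothFieldOn_generator.mono (subset_univ _))
  · exact B.smoothFieldOn_hlift hU he
  · exact B.smoothFieldOn_hlift hU (he.J h hU)

end Bundle

theorem SmoothFieldOn.mlieBracket {n : ℕ} {M : Type*} [TopologicalSpace M]
    [ChartedSpace (EuclideanSpace ℝ (Fin n)) M] [IsManifold (𝓡 n) ∞ M]
    {X Y : ∀ p : M, TangentSpace (𝓡 n) p} {U : Set M} (hU : IsOpen U)
    (hX : SmoothFieldOn X U) (hY : SmoothFieldOn Y U) :
    SmoothFieldOn (VectorField.mlieBracket (𝓡 n) X Y) U := by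
  intro p hp
  have i : IsManifold (𝓡 n) (((⊤ : ℕ∞) : ℕ∞ω) + 1) M := by simpa using ‹IsManifold (𝓡 n) _ M›
  have i2 : IsManifold (𝓡 n) (minSmoothness ℝ 2) M := by
    rw [minSmoothness_of_isRCLikeNormedField]
    exact IsManifold.of_le (n := ((⊤ : ℕ∞) : ℕ∞ω)) (WithTop.coe_le_coe.2 le_top)
  exact (ContMDiffAt.mlieBracket_vectorField (m := ⊤) (n := ⊤) ((hX p hp).contMDiffAt (hU.mem_nhds hp))
    ((hY p hp).contMDiffAt (hU.mem_nhds hp)) (by simp)).contMDiffWithinAt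

section Bundle
variable {S : Type*} [TopologicalSpace S] [ChartedSpace (EuclideanSpace ℝ (Fin 2)) S]
  [IsManifold (𝓡 2) ∞ S] {h : OrientedMetric S}
  {N : Type*} [TopologicalSpace N] [ChartedSpace (EuclideanSpace ℝ (Fin 3)) N]
  [IsManifold (𝓡 3) ∞ N] [MulAction Circle N] (B : CircleBundle h N)

theorem CircleBundle.dirDeriv_comp_proj {E : Type*} [NormedAddCommGroup E] [NormedSpace ℝ E]
    {g : S → E} {p : N} (hg : MDifferentiableAt (𝓡 2) 𝓘(ℝ, E) g (B.proj p)) (v : TangentSpace (𝓡 3) p) :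
    dirDeriv (fun q => g (B.proj q)) p v = dirDeriv g (B.proj p) (B.dproj p v) :=
  DFunLike.congr_fun (mfderiv_comp p hg (B.mdifferentiableAt_proj p)) v

/-- The projection maps the bracket of two projectable fields to the bracket of the projections. -/
theorem CircleBundle.dproj_mlieBracket {U : Set S} (hU : IsOpen U)
    {X Y : ∀ p : N, TangentSpace (𝓡 3) p} {X' Y' : ∀ x : S, TangentSpace (𝓡 2) x}
    (hX : SmoothFieldOn X (B.proj ⁻¹' U)) (hY : SmoothFieldOn Y (B.proj ⁻¹' U))
    (hX' : SmoothFieldOn X' U) (hY' : SmoothFieldOn Y' U)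
    (hXX' : ∀ p ∈ B.proj ⁻¹' U, B.dproj p (X p) = X' (B.proj p))
    (hYY' : ∀ p ∈ B.proj ⁻¹' U, B.dproj p (Y p) = Y' (B.proj p)) {p : N} (hp : B.proj p ∈ U) :
    B.dproj p (VectorField.mlieBracket (𝓡 3) X Y p)
      = VectorField.mlieBracket (𝓡 2) X' Y' (B.proj p) := by
  have i1 : IsManifold (𝓡 2) 1 S := IsManifold.of_le (n := ∞) (by simp)
  set χ := extChartAt (𝓡 2) (B.proj p) with hχ
  have hVo : IsOpen (U ∩ χ.source) := hU.inter (isOpen_extChartAt_source _)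
  have hpV : B.proj p ∈ U ∩ χ.source := ⟨hp, mem_extChartAt_source _⟩
  set W := B.proj ⁻¹' (U ∩ χ.source) with hW
  have hWo : IsOpen W := hVo.preimage B.proj_smooth.continuous
  have hχs : ContMDiffOn (𝓡 2) 𝓘(ℝ, EuclideanSpace ℝ (Fin 2)) ∞ χ (U ∩ χ.source) :=
    (contMDiffOn_extChartAt (I := 𝓡 2)).mono fun y hy => by simpa [hχ] using hy.2
  have md {g : S → EuclideanSpace ℝ (Fin 2)}
      (hg : ContMDiffOn (𝓡 2) 𝓘(ℝ, EuclideanSpace ℝ (Fin 2)) ∞ g (U ∩ χ.source)) {q : N} (hq : q ∈ W) :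
      MDifferentiableAt (𝓡 2) 𝓘(ℝ, EuclideanSpace ℝ (Fin 2)) g (B.proj q) :=
    ((hg _ hq).contMDiffAt (hVo.mem_nhds hq)).mdifferentiableAt (by simp)
  have rel {Z : ∀ p : N, TangentSpace (𝓡 3) p} {Z' : ∀ x : S, TangentSpace (𝓡 2) x}
      (hZZ' : ∀ p ∈ B.proj ⁻¹' U, B.dproj p (Z p) = Z' (B.proj p)) {g : S → EuclideanSpace ℝ (Fin 2)}
      (hg : ContMDiffOn (𝓡 2) 𝓘(ℝ, EuclideanSpace ℝ (Fin 2)) ∞ g (U ∩ χ.source)) {q : N} (hq : q ∈ W) :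
      dirDeriv (fun q => g (B.proj q)) q (Z q) = (fun y => dirDeriv g y (Z' y)) (B.proj q) := by
    rw [B.dirDeriv_comp_proj (md hg hq), hZZ' q hq.1]
  have rel2 {Z₁ Z₂ : ∀ p : N, TangentSpace (𝓡 3) p} {Z₁' Z₂' : ∀ x : S, TangentSpace (𝓡 2) x}
      (h1 : ∀ p ∈ B.proj ⁻¹' U, B.dproj p (Z₁ p) = Z₁' (B.proj p))
      (h2 : ∀ p ∈ B.proj ⁻¹' U, B.dproj p (Z₂ p) = Z₂' (B.proj p)) (hs : SmoothFieldOn Z₂' U) :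
      dirDeriv (fun q => dirDeriv (fun q => χ (B.proj q)) q (Z₂ q)) p (Z₁ p)
        = dirDeriv (fun y => dirDeriv χ y (Z₂' y)) (B.proj p) (Z₁' (B.proj p)) := by
    have e1 : (fun q => dirDeriv (fun q => χ (B.proj q)) q (Z₂ q)) =ᶠ[𝓝 p]
        fun q => (fun y => dirDeriv χ y (Z₂' y)) (B.proj q) := by
      filter_upwards [hWo.mem_nhds hpV] with q hq using rel h2 hχs hq
    have e2 := DFunLike.congr_fun (e1.mfderiv_eq (I := 𝓡 3) (I' := 𝓘(ℝ, EuclideanSpace ℝ (Fin 2)))) (Z₁ p)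
    exact e2.trans (rel h1 (contMDiffOn_mfderiv_apply hVo hχs (hs.mono inter_subset_left)) hpV)
  have hχN : ContMDiffOn (𝓡 3) 𝓘(ℝ, EuclideanSpace ℝ (Fin 2)) ∞ (fun q => χ (B.proj q)) W :=
    hχs.comp B.proj_smooth.contMDiffOn fun q hq => hq
  have hWU : W ⊆ B.proj ⁻¹' U := fun q hq => hq.1
  -- Both brackets are tested as commutators, on χ ∘ π upstairs and on the chart χ downstairs. Since
  -- dχ is injective, equality of the results suffices.
  have c1 := dirDeriv_mlieBracket hWo hχN (hX.mono hWU) (hY.mono hWU) hpV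
  have c2 := dirDeriv_mlieBracket hVo hχs (hX'.mono inter_subset_left) (hY'.mono inter_subset_left) hpV
  rw [rel2 hXX' hYY' hY', rel2 hYY' hXX' hX', ← c2, B.dirDeriv_comp_proj (md hχs hpV)] at c1
  exact (isInvertible_mfderiv_extChartAt (I := 𝓡 2) (mem_extChartAt_source (B.proj p))).injective c1

end Bundle

/-! ### Orthonormal frames, dual norms and structure functions -/

section Frame
variable {S : Type*} [TopologicalSpace S] [ChartedSpace (EuclideanSpace ℝ (Fin 2)) S]
  [IsManifold (𝓡 2) ∞ S] (h : OrientedMetric S)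

/-- J is an isometry with J² = -1, so ⟨Jv, v⟩ = ⟨JJv, Jv⟩ = -⟨v, Jv⟩. -/
theorem OrientedMetric.inner_J_self (x : S) (v : TangentSpace (𝓡 2) x) :
    h.metric.inner x (h.J x v) v = 0 := by
  have h1 := h.J_isometry x (h.J x v) v
  rw [h.J_sq, map_neg, neg_apply, h.metric.symm x v] at h1
  linarith

theorem OrientedMetric.inner_self_J (x : S) (v : TangentSpace (𝓡 2) x) :
    h.metric.inner x v (h.J x v) = 0 := by
  rw [h.metric.symm, h.inner_J_self]

/-- The map w ↦ (⟨w, e⟩, ⟨w, Je⟩) is onto ℝ² because e, Je are orthonormal; in dimension two it is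
therefore injective. -/
theorem OrientedMetric.eq_combination {x : S} {e : TangentSpace (𝓡 2) x}
    (he : h.metric.inner x e e = 1) (w : TangentSpace (𝓡 2) x) :
    w = h.metric.inner x w e • e + h.metric.inner x w (h.J x e) • h.J x e := by
  have hJ : h.metric.inner x (h.J x e) (h.J x e) = 1 := by rw [h.J_isometry, he]
  let A : EuclideanSpace ℝ (Fin 2) →ₗ[ℝ] ℝ × ℝ :=
    { toFun := fun w => (h.metric.inner x w e, h.metric.inner x w (h.J x e))
      map_add' := fun a b => by
        refine Prod.ext ?_ ?_ <;> exact DFunLike.congr_fun (map_add (h.metric.inner x) a b) _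
      map_smul' := fun c a => by
        refine Prod.ext ?_ ?_ <;> exact DFunLike.congr_fun (map_smul (h.metric.inner x) c a) _ }
  have hA (a b : ℝ) : A (a • e + b • h.J x e) = (a, b) := by
    refine Prod.ext ?_ ?_
    · change h.metric.inner x (a • e + b • h.J x e) e = a
      rw [map_add, map_smul, map_smul]
      simp [he, h.inner_J_self]
    · change h.metric.inner x (a • e + b • h.J x e) (h.J x e) = b
      rw [map_add, map_smul, map_smul]
      simp [hJ, h.inner_self_J]
  have hsurj : Function.Surjective A := fun ab => ⟨_, hA ab.1 ab.2⟩
  have hinj : Function.Injective A :=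
    (LinearMap.injective_iff_surjective_of_finrank_eq_finrank (f := A) (by simp)).2 hsurj
  exact hinj (hA _ _).symm

end Frame

/-- The dual norm of a linear form is the Euclidean norm of its components in an orthonormal
basis. -/
theorem dualNormSq_eq_sum {V : Type*} [AddCommGroup V] [Module ℝ V] {g : V → V → ℝ} {n : ℕ}
    {X : Fin n → V} (hg : ∀ a : Fin n → ℝ, g (∑ j, a j • X j) (∑ j, a j • X j) = ∑ j, a j ^ 2)
    (hX : ∀ v : V, ∃ a : Fin n → ℝ, v = ∑ j, a j • X j) (ξ : V →ₗ[ℝ] ℝ) :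
    dualNormSq g ξ = ∑ j, ξ (X j) ^ 2 := by
  have hξ (a : Fin n → ℝ) : ξ (∑ j, a j • X j) = ∑ j, a j * ξ (X j) := by simp
  refine IsGreatest.csSup_eq ⟨?_, ?_⟩
  · set Q := ∑ j, ξ (X j) ^ 2 with hQ
    have hQ0 : 0 ≤ Q := Finset.sum_nonneg fun j _ => sq_nonneg _
    rcases hQ0.eq_or_lt with h0 | h0
    · refine ⟨∑ j, (0 : Fin n → ℝ) j • X j, ?_, ?_⟩
      · rw [hg]; simp
      · rw [hξ, ← h0]; simp
    · have hs : Real.sqrt Q ≠ 0 := (Real.sqrt_pos.2 h0).ne'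
      have hs2 : Real.sqrt Q ^ 2 = Q := Real.sq_sqrt hQ0
      -- The supremum is attained at the normalized gradient of ξ; the other bound is the
      -- Cauchy-Schwarz inequality.
      refine ⟨∑ j, (ξ (X j) / Real.sqrt Q) • X j, ?_, ?_⟩
      · rw [hg]
        simp_rw [div_pow, ← Finset.sum_div, hs2, ← hQ]
        exact (div_self h0.ne').le
      · rw [hξ]
        have : ∑ j, ξ (X j) / Real.sqrt Q * ξ (X j) = Q / Real.sqrt Q := by
          rw [hQ, Finset.sum_div]
          exact Finset.sum_congr rfl fun j _ => by ring
        rw [this, div_pow, hs2, sq, mul_div_assoc, div_self h0.ne', mul_one]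
  · rintro r ⟨w, hw, rfl⟩
    obtain ⟨a, rfl⟩ := hX w
    rw [hg] at hw
    rw [hξ]
    calc (∑ j, a j * ξ (X j)) ^ 2 ≤ (∑ j, a j ^ 2) * ∑ j, ξ (X j) ^ 2 :=
          Finset.sum_mul_sq_le_sq_mul_sq _ _ _
      _ ≤ 1 * ∑ j, ξ (X j) ^ 2 := by gcongr
      _ = _ := one_mul _

section StructureFunctions
variable {S : Type*} [TopologicalSpace S] [ChartedSpace (EuclideanSpace ℝ (Fin 2)) S]
  [IsManifold (𝓡 2) ∞ S] {h : OrientedMetric S}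
  {N : Type*} [TopologicalSpace N] [ChartedSpace (EuclideanSpace ℝ (Fin 3)) N]
  [IsManifold (𝓡 3) ∞ N] [MulAction Circle N] (B : CircleBundle h N)

/-- The projections of the frame fields to the base. -/
def baseFrame (h : OrientedMetric S) (e : ∀ x : S, TangentSpace (𝓡 2) x) :
    Fin 3 → ∀ x : S, TangentSpace (𝓡 2) x :=
  ![fun _ => 0, e, fun x => h.J x (e x)]

theorem baseFrame_zero (e : ∀ x : S, TangentSpace (𝓡 2) x) (x : S) : baseFrame h e 0 x = 0 := rfl

theorem baseFrame_one (e : ∀ x : S, TangentSpace (𝓡 2) x) (x : S) : baseFrame h e 1 x = e x := rfl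

theorem baseFrame_two (e : ∀ x : S, TangentSpace (𝓡 2) x) (x : S) :
    baseFrame h e 2 x = h.J x (e x) := rfl

theorem CircleBundle.dproj_frame (δ : ℝ) (e : ∀ x : S, TangentSpace (𝓡 2) x) (j : Fin 3) (p : N) :
    B.dproj p (B.frame δ e j p) = baseFrame h e j (B.proj p) := by
  fin_cases j
  · change B.dproj p (δ • generator N p) = 0
    rw [map_smul, B.dproj_generator, smul_zero]
  · exact B.dproj_hlift p _
  · exact B.dproj_hlift p _

theorem CircleBundle.η_frame (δ : ℝ) (e : ∀ x : S, TangentSpace (𝓡 2) x) (j : Fin 3) (p : N) :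
    B.η p (B.frame δ e j p) = if j = 0 then δ else 0 := by
  fin_cases j
  · change B.η p (δ • generator N p) = δ
    rw [map_smul, B.η_vertical]
    simp
  · exact B.η_hlift p _
  · exact B.η_hlift p _

theorem CircleBundle.metric_frame_right {δ : ℝ} (hδ : δ ≠ 0) (e : ∀ x : S, TangentSpace (𝓡 2) x)
    (p : N) (v : TangentSpace (𝓡 3) p) (l : Fin 3) :
    B.metric δ p v (B.frame δ e l p) = if l = 0 then δ⁻¹ * B.η p v
      else h.metric.inner (B.proj p) (B.dproj p v) (baseFrame h e l (B.proj p)) := by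
  unfold CircleBundle.metric
  rw [B.η_frame, B.dproj_frame]
  by_cases hl : l = 0
  · subst hl
    rw [baseFrame_zero, map_zero, if_pos rfl, if_pos rfl]
    field_simp
    ring
  · simp [hl]

theorem CircleBundle.eq_sum_frame {δ : ℝ} (hδ : δ ≠ 0) {e : ∀ x : S, TangentSpace (𝓡 2) x} {p : N}
    (he : h.metric.inner (B.proj p) (e (B.proj p)) (e (B.proj p)) = 1) (v : TangentSpace (𝓡 3) p) :
    v = ∑ l, B.metric δ p v (B.frame δ e l p) • B.frame δ e l p := by
  apply (B.isInvertible_dproj_prod p).injective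
  refine Prod.ext ?_ ?_
  · change B.dproj p v = B.dproj p _
    rw [map_sum]
    rw [Fin.sum_univ_three, map_smul, map_smul, map_smul, B.dproj_frame, B.dproj_frame,
      B.dproj_frame, baseFrame_zero, baseFrame_one, baseFrame_two, smul_zero, zero_add,
      B.metric_frame_right hδ, B.metric_frame_right hδ, if_neg (by decide), if_neg (by decide),
      baseFrame_one, baseFrame_two]
    exact h.eq_combination he (B.dproj p v)
  · change B.η p v = B.η p _
    rw [map_sum]
    rw [Fin.sum_univ_three, map_smul, map_smul, map_smul, B.η_frame, B.η_frame, B.η_frame,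
      if_pos rfl, if_neg (by decide), if_neg (by decide), B.metric_frame_right hδ, if_pos rfl,
      smul_zero, smul_zero, smul_eq_mul]
    field_simp
    ring

theorem CircleBundle.metric_sum_frame {δ : ℝ} (hδ : δ ≠ 0) {e : ∀ x : S, TangentSpace (𝓡 2) x} {p : N}
    (he : h.metric.inner (B.proj p) (e (B.proj p)) (e (B.proj p)) = 1) (a b : Fin 3 → ℝ) :
    B.metric δ p (∑ j, a j • B.frame δ e j p) (∑ j, b j • B.frame δ e j p) = ∑ j, a j * b j := by
  have hJ : h.metric.inner (B.proj p) (h.J _ (e (B.proj p))) (h.J _ (e (B.proj p))) = 1 := by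
    rw [h.J_isometry, he]
  unfold CircleBundle.metric
  have hη (c : Fin 3 → ℝ) : B.η p (∑ j, c j • B.frame δ e j p) = c 0 * δ := by
    rw [Fin.sum_univ_three, map_add, map_add, map_smul, map_smul, map_smul, B.η_frame, B.η_frame,
      B.η_frame, if_pos rfl, if_neg (by decide), if_neg (by decide), smul_zero, smul_zero, smul_eq_mul]
    ring
  have hπ (c : Fin 3 → ℝ) : B.dproj p (∑ j, c j • B.frame δ e j p)
      = c 1 • e (B.proj p) + c 2 • h.J _ (e (B.proj p)) := by
    rw [Fin.sum_univ_three, map_add, map_add, map_smul, map_smul, map_smul, B.dproj_frame,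
      B.dproj_frame, B.dproj_frame, baseFrame_zero, baseFrame_one, baseFrame_two, smul_zero, zero_add]
  rw [hη, hη, hπ, hπ, map_add, map_smul, map_smul, map_add, map_smul, map_smul, add_apply,
    smul_apply, smul_apply, add_apply, smul_apply, smul_apply, he, hJ, h.inner_J_self,
    h.inner_self_J, Fin.sum_univ_three]
  simp only [smul_eq_mul]
  field_simp
  ring

theorem CircleBundle.dualNormSq_metric {δ : ℝ} (hδ : δ ≠ 0) {e : ∀ x : S, TangentSpace (𝓡 2) x} {p : N}
    (he : h.metric.inner (B.proj p) (e (B.proj p)) (e (B.proj p)) = 1)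
    (ξ : TangentSpace (𝓡 3) p →L[ℝ] ℝ) :
    dualNormSq (B.metric δ p) ξ = ∑ j, ξ (B.frame δ e j p) ^ 2 :=
  dualNormSq_eq_sum (X := fun j => B.frame δ e j p)
    (fun a => by rw [B.metric_sum_frame hδ he]; simp [sq])
    (fun v => ⟨_, B.eq_sum_frame hδ he v⟩) (ξ : TangentSpace (𝓡 3) p →ₗ[ℝ] ℝ)

/-- The structure functions `[Xⱼ, Xₖ] = ∑ Cⱼₖˡ Xₗ` of the frame. -/
def structCoeff (δ : ℝ) (e : ∀ x : S, TangentSpace (𝓡 2) x) (j k l : Fin 3) (p : N) : ℝ :=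
  B.metric δ p (VectorField.mlieBracket (𝓡 3) (B.frame δ e j) (B.frame δ e k) p) (B.frame δ e l p)

theorem CircleBundle.mlieBracket_frame {δ : ℝ} (hδ : δ ≠ 0) {e : ∀ x : S, TangentSpace (𝓡 2) x} {p : N}
    (he : h.metric.inner (B.proj p) (e (B.proj p)) (e (B.proj p)) = 1) (j k : Fin 3) :
    VectorField.mlieBracket (𝓡 3) (B.frame δ e j) (B.frame δ e k) p
      = ∑ l, structCoeff B δ e j k l p • B.frame δ e l p :=
  B.eq_sum_frame hδ he _

end StructureFunctions

section StructureFunctions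
variable {S : Type*} [TopologicalSpace S] [ChartedSpace (EuclideanSpace ℝ (Fin 2)) S]
  [IsManifold (𝓡 2) ∞ S] {h : OrientedMetric S}
  {N : Type*} [TopologicalSpace N] [ChartedSpace (EuclideanSpace ℝ (Fin 3)) N]
  [IsManifold (𝓡 3) ∞ N] [MulAction Circle N] (B : CircleBundle h N)

theorem smoothFieldOn_baseFrame [T2Space S] {e : ∀ x : S, TangentSpace (𝓡 2) x} {U : Set S}
    (hU : IsOpen U) (he : SmoothFieldOn e U) (j : Fin 3) : SmoothFieldOn (baseFrame h e j) U := by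
  fin_cases j
  · exact (Bundle.contMDiff_zeroSection ℝ _).contMDiffOn
  · exact he
  · exact he.J h hU

theorem CircleBundle.frame_eq_smul (δ : ℝ) (e : ∀ x : S, TangentSpace (𝓡 2) x) (j : Fin 3) :
    B.frame δ e j = (if j = 0 then δ else 1) • B.frame 1 e j := by
  funext p
  fin_cases j
  · change δ • generator N p = δ • ((1 : ℝ) • generator N p)
    rw [one_smul]
  · change B.frame δ e 1 p = (1 : ℝ) • B.frame 1 e 1 p
    rw [one_smul]
    rfl
  · change B.frame δ e 2 p = (1 : ℝ) • B.frame 1 e 2 p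
    rw [one_smul]
    rfl

/-- The bracket is bilinear over constants, so each vertical argument contributes a factor δ. The
h_δ-component along X_0 is δ⁻¹η, which contributes δ⁻¹ for l = 0. -/
theorem structCoeff_eq [T2Space S] {δ : ℝ} (hδ : δ ≠ 0) {e : ∀ x : S, TangentSpace (𝓡 2) x} {U : Set S}
    (hU : IsOpen U) (he : SmoothFieldOn e U) (j k l : Fin 3) {p : N} (hp : B.proj p ∈ U) :
    structCoeff B δ e j k l p = (if j = 0 then δ else 1) * (if k = 0 then δ else 1)
      * (if l = 0 then δ⁻¹ else 1) * structCoeff B 1 e j k l p := by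
  have i2 : IsManifold (𝓡 3) 2 N := IsManifold.of_le (n := ((⊤ : ℕ∞) : ℕ∞ω)) (WithTop.coe_le_coe.2 le_top)
  have hW : IsOpen (B.proj ⁻¹' U) := hU.preimage B.proj_smooth.continuous
  have md (j : Fin 3) : MDifferentiableAt (𝓡 3) (𝓡 3).tangent
      (fun q => (⟨q, B.frame 1 e j q⟩ : TangentBundle (𝓡 3) N)) p :=
    ((B.smoothFieldOn_frame 1 hU he j p hp).contMDiffAt (hW.mem_nhds hp)).mdifferentiableAt (by simp)
  have md' (j : Fin 3) : MDifferentiableAt (𝓡 3) (𝓡 3).tangent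
      (fun q => (⟨q, B.frame δ e j q⟩ : TangentBundle (𝓡 3) N)) p :=
    ((B.smoothFieldOn_frame δ hU he j p hp).contMDiffAt (hW.mem_nhds hp)).mdifferentiableAt (by simp)
  have hbr : VectorField.mlieBracket (𝓡 3) (B.frame δ e j) (B.frame δ e k) p
      = ((if j = 0 then δ else 1) * (if k = 0 then δ else 1)) •
        VectorField.mlieBracket (𝓡 3) (B.frame 1 e j) (B.frame 1 e k) p := by
    conv_lhs => rw [B.frame_eq_smul δ e j]
    rw [VectorField.mlieBracket_const_smul_left (md j)]
    conv_lhs => rw [B.frame_eq_smul δ e k]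
    rw [VectorField.mlieBracket_const_smul_right (md k), smul_smul]
  unfold structCoeff
  rw [B.metric_frame_right hδ, B.metric_frame_right one_ne_zero, hbr, map_smul, map_smul, map_smul]
  by_cases hl : l = 0
  · simp only [hl, if_true, smul_eq_mul]
    ring
  · simp only [hl, if_false, smul_apply, smul_eq_mul]
    ring

/-- The frame fields project to the fields `baseFrame`, and brackets of projectable fields project
to brackets. -/
theorem structCoeff_horizontal [T2Space S] {e : ∀ x : S, TangentSpace (𝓡 2) x} {U : Set S}
    (hU : IsOpen U) (he : SmoothFieldOn e U) (j k l : Fin 3) (hl : l ≠ 0) {p : N} (hp : B.proj p ∈ U) :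
    structCoeff B 1 e j k l p = h.metric.inner (B.proj p)
      (VectorField.mlieBracket (𝓡 2) (baseFrame h e j) (baseFrame h e k) (B.proj p))
      (baseFrame h e l (B.proj p)) := by
  unfold structCoeff
  rw [B.metric_frame_right one_ne_zero, if_neg hl,
    B.dproj_mlieBracket hU (B.smoothFieldOn_frame 1 hU he j) (B.smoothFieldOn_frame 1 hU he k)
      (smoothFieldOn_baseFrame hU he j) (smoothFieldOn_baseFrame hU he k)
      (fun p _ => B.dproj_frame 1 e j p) (fun p _ => B.dproj_frame 1 e k p) hp]

theorem contMDiffOn_structCoeff [T2Space S] {e : ∀ x : S, TangentSpace (𝓡 2) x} {U : Set S}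
    (hU : IsOpen U) (he : SmoothFieldOn e U) (j k l : Fin 3) :
    ContMDiffOn (𝓡 3) 𝓘(ℝ, ℝ) ∞ (structCoeff B 1 e j k l) (B.proj ⁻¹' U) := by
  have hW : IsOpen (B.proj ⁻¹' U) := hU.preimage B.proj_smooth.continuous
  by_cases hl : l = 0
  · have h1 := SmoothFormOn.apply (B.η_smooth.mono (subset_univ (B.proj ⁻¹' U)))
      ((B.smoothFieldOn_frame 1 hU he j).mlieBracket hW (B.smoothFieldOn_frame 1 hU he k))
    refine h1.congr fun p hp => ?_
    unfold structCoeff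
    rw [B.metric_frame_right one_ne_zero, if_pos hl, inv_one, one_mul]
  · have h1 := SmoothFieldOn.inner h ((smoothFieldOn_baseFrame (h := h) hU he j).mlieBracket hU
      (smoothFieldOn_baseFrame (h := h) hU he k)) (smoothFieldOn_baseFrame (h := h) hU he l)
    exact (h1.comp B.proj_smooth.contMDiffOn fun p hp => hp).congr fun p hp =>
      structCoeff_horizontal B hU he j k l hl hp

/-- The vertical field projects to the zero field. This vanishing prevents [δζ, X_k] from producing
a term of order δ. -/
theorem structCoeff_vertical [T2Space S] {e : ∀ x : S, TangentSpace (𝓡 2) x} {U : Set S}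
    (hU : IsOpen U) (he : SmoothFieldOn e U) (j k l : Fin 3) (hl : l ≠ 0) (hjk : j = 0 ∨ k = 0)
    {p : N} (hp : B.proj p ∈ U) : structCoeff B 1 e j k l p = 0 := by
  rw [structCoeff_horizontal B hU he j k l hl hp]
  have : VectorField.mlieBracket (𝓡 2) (baseFrame h e j) (baseFrame h e k) (B.proj p) = 0 := by
    rcases hjk with rfl | rfl
    · exact congrFun (VectorField.mlieBracket_zero_left (I := 𝓡 2) (W := baseFrame h e k)) _
    · exact congrFun (VectorField.mlieBracket_zero_right (I := 𝓡 2) (W := baseFrame h e j)) _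
  rw [this, map_zero]
  rfl

/-- The structure functions are bounded uniformly in `δ ≥ 1`. -/
theorem abs_structCoeff_le [T2Space S] {δ : ℝ} (hδ : 1 ≤ δ) {e : ∀ x : S, TangentSpace (𝓡 2) x}
    {U : Set S} (hU : IsOpen U) (he : SmoothFieldOn e U) (j k l : Fin 3) {p : N} (hp : B.proj p ∈ U) :
    |structCoeff B δ e j k l p| ≤ |structCoeff B 1 e j k l p| := by
  have hδ0 : 0 < δ := by linarith
  rw [structCoeff_eq B hδ0.ne' hU he j k l hp]
  -- A single factor δ is either cancelled by δ⁻¹ (l = 0) or multiplies a vanishing coefficient (l ≠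
  -- 0); the product δ² occurs only for the zero bracket of X_0 with itself. What remains for l = 0
  -- and two horizontal fields is δ⁻¹ ≤ 1.
  by_cases hl : l = 0
  · by_cases hj : j = 0
    · by_cases hk : k = 0
      · have : structCoeff B 1 e j k l p = 0 := by
          rw [hj, hk]
          unfold structCoeff
          rw [VectorField.mlieBracket_self]
          unfold CircleBundle.metric
          simp
        simp [this]
      · simp [hl, hj, hk, hδ0.ne']
    · by_cases hk : k = 0
      · simp [hl, hj, hk, hδ0.ne']
      · simp only [hl, hj, hk, if_false, if_true, one_mul, abs_mul]
        rw [abs_of_pos (inv_pos.2 hδ0)]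
        exact mul_le_of_le_one_left (abs_nonneg _) (inv_le_one_of_one_le₀ hδ)
  · by_cases hjk : j = 0 ∨ k = 0
    · rw [structCoeff_vertical B hU he j k l hl hjk hp]
      simp
    · push Not at hjk
      simp [hl, hjk.1, hjk.2]

end StructureFunctions

/-! ### The Riemannian volume in charts, and the derivative of a determinant -/

theorem bilin_sum_smul {n : ℕ} {V : Type*} [AddCommGroup V] [Module ℝ V] (b : V →ₗ[ℝ] V →ₗ[ℝ] ℝ)
    (v : Fin n → V) (a c : Fin n → ℝ) :
    b (∑ k, a k • v k) (∑ k, c k • v k) = ∑ l, (∑ k, a k * b (v k) (v l)) * c l := by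
  simp only [map_sum, map_smul, LinearMap.sum_apply, LinearMap.smul_apply, smul_eq_mul,
    Finset.sum_mul, Finset.mul_sum]
  exact Finset.sum_congr rfl fun k _ => Finset.sum_congr rfl fun l _ => by ring

section Volume
variable {n : ℕ} {M : Type*} [TopologicalSpace M] [ChartedSpace (EuclideanSpace ℝ (Fin n)) M]
  [IsManifold (𝓡 n) ∞ M]

/-- The density of the Riemannian volume in the chart at `x`. -/
def chartDensity (g : ∀ p : M, TangentSpace (𝓡 n) p → TangentSpace (𝓡 n) p → ℝ) (x : M)
    (y : EuclideanSpace ℝ (Fin n)) : ℝ :=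
  Real.sqrt (Matrix.det (Matrix.of fun i j : Fin n => g _ (coordField x i y) (coordField x j y)))

/-- The Riemannian volume on the domain of the chart at `x`. -/
def chartVolume [MeasurableSpace M]
    (g : ∀ p : M, TangentSpace (𝓡 n) p → TangentSpace (𝓡 n) p → ℝ) (x : M) : Measure M :=
  Measure.map (chartAt (EuclideanSpace ℝ (Fin n)) x).symm
    ((volume.restrict (chartAt (EuclideanSpace ℝ (Fin n)) x).target).withDensity fun y =>
      ENNReal.ofReal (chartDensity g x y))

theorem aemeasurable_chart_symm [MeasurableSpace M] [BorelSpace M] (x : M)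
    (f : EuclideanSpace ℝ (Fin n) → ℝ≥0∞) :
    AEMeasurable (chartAt (EuclideanSpace ℝ (Fin n)) x).symm
      ((volume.restrict (chartAt (EuclideanSpace ℝ (Fin n)) x).target).withDensity f) := by
  refine AEMeasurable.mono_ac ?_ (withDensity_absolutelyContinuous _ _)
  exact (chartAt (EuclideanSpace ℝ (Fin n)) x).continuousOn_symm.aemeasurable
    (chartAt (EuclideanSpace ℝ (Fin n)) x).open_target.measurableSet

theorem measurableSet_chart_preimage [MeasurableSpace M] [BorelSpace M] (x : M) {A : Set M}
    (hA : MeasurableSet A) :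
    MeasurableSet ((chartAt (EuclideanSpace ℝ (Fin n)) x).target ∩
      (chartAt (EuclideanSpace ℝ (Fin n)) x).symm ⁻¹' A) := by
  set φ := chartAt (EuclideanSpace ℝ (Fin n)) x
  have h1 : Measurable (fun y : φ.target => φ.symm y) :=
    (continuousOn_iff_continuous_domRestrict.1 φ.continuousOn_symm).measurable
  have h2 := φ.open_target.measurableSet.subtype_image (h1 hA)
  convert h2 using 1
  ext y
  simp [and_comm]

theorem chartVolume_apply [MeasurableSpace M] [BorelSpace M]
    (g : ∀ p : M, TangentSpace (𝓡 n) p → TangentSpace (𝓡 n) p → ℝ) (x : M) {A : Set M}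
    (hA : MeasurableSet A) :
    chartVolume g x A = ∫⁻ y in (chartAt (EuclideanSpace ℝ (Fin n)) x).target ∩
      (chartAt (EuclideanSpace ℝ (Fin n)) x).symm ⁻¹' A, ENNReal.ofReal (chartDensity g x y) := by
  unfold chartVolume
  rw [Measure.map_apply_of_aemeasurable (aemeasurable_chart_symm x _) hA, withDensity_apply',
    Measure.restrict_restrict' (chartAt (EuclideanSpace ℝ (Fin n)) x).open_target.measurableSet, inter_comm]

/-- The transition map between two charts. -/
def transition (x x' : M) (y : EuclideanSpace ℝ (Fin n)) : EuclideanSpace ℝ (Fin n) :=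
  chartAt (EuclideanSpace ℝ (Fin n)) x' ((chartAt (EuclideanSpace ℝ (Fin n)) x).symm y)

theorem mdifferentiableAt_chart_symm (x : M) {y : EuclideanSpace ℝ (Fin n)}
    (hy : y ∈ (chartAt (EuclideanSpace ℝ (Fin n)) x).target) :
    MDifferentiableAt 𝓘(ℝ, EuclideanSpace ℝ (Fin n)) (𝓡 n)
      (chartAt (EuclideanSpace ℝ (Fin n)) x).symm y :=
  ((contMDiffOn_chart_symm (I := 𝓡 n) (n := ∞) y hy).contMDiffAt
    ((chartAt (EuclideanSpace ℝ (Fin n)) x).open_target.mem_nhds hy)).mdifferentiableAt (by simp)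

theorem mdifferentiableAt_chart (x : M) {q : M}
    (hq : q ∈ (chartAt (EuclideanSpace ℝ (Fin n)) x).source) :
    MDifferentiableAt (𝓡 n) 𝓘(ℝ, EuclideanSpace ℝ (Fin n)) (chartAt (EuclideanSpace ℝ (Fin n)) x) q :=
  ((contMDiffOn_chart (I := 𝓡 n) (n := ∞) q hq).contMDiffAt
    ((chartAt (EuclideanSpace ℝ (Fin n)) x).open_source.mem_nhds hq)).mdifferentiableAt (by simp)

theorem differentiableAt_transition (x x' : M) {y : EuclideanSpace ℝ (Fin n)}
    (hy : y ∈ (chartAt (EuclideanSpace ℝ (Fin n)) x).target)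
    (hy' : (chartAt (EuclideanSpace ℝ (Fin n)) x).symm y ∈ (chartAt (EuclideanSpace ℝ (Fin n)) x').source) :
    DifferentiableAt ℝ (transition x x') y :=
  ((mdifferentiableAt_chart x' hy').comp y (mdifferentiableAt_chart_symm x hy)).differentiableAt

theorem coordField_transition (x x' : M) {y : EuclideanSpace ℝ (Fin n)}
    (hy : y ∈ (chartAt (EuclideanSpace ℝ (Fin n)) x).target)
    (hy' : (chartAt (EuclideanSpace ℝ (Fin n)) x).symm y ∈ (chartAt (EuclideanSpace ℝ (Fin n)) x').source)
    (i : Fin n) :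
    (coordField x i y : EuclideanSpace ℝ (Fin n)) =
      ∑ k, (fderiv ℝ (transition x x') y (EuclideanSpace.single i 1)) k •
        (coordField x' k (transition x x' y) : EuclideanSpace ℝ (Fin n)) := by
  set φ := chartAt (EuclideanSpace ℝ (Fin n)) x
  set φ' := chartAt (EuclideanSpace ℝ (Fin n)) x'
  have hT : transition x x' y ∈ φ'.target := φ'.map_source hy'
  have h1 : φ'.symm ∘ transition x x' =ᶠ[𝓝 y] φ.symm := by
    have hc : ContinuousAt φ.symm y := φ.continuousAt_symm hy
    filter_upwards [hc.eventually_mem (φ'.open_source.mem_nhds hy')] with w hw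
    exact φ'.left_inv hw
  have h2 := h1.mfderiv_eq (I := 𝓘(ℝ, EuclideanSpace ℝ (Fin n))) (I' := 𝓡 n)
  have h3 := mfderiv_comp y (mdifferentiableAt_chart_symm x' hT)
    (differentiableAt_transition x x' hy hy').mdifferentiableAt
  have h4 := DFunLike.congr_fun (h2.symm.trans h3) (EuclideanSpace.single i (1 : ℝ))
  refine Eq.trans h4 ?_
  rw [mfderiv_eq_fderiv]
  set v : EuclideanSpace ℝ (Fin n) := fderiv ℝ (transition x x') y (EuclideanSpace.single i 1) with hv
  set A : EuclideanSpace ℝ (Fin n) →L[ℝ] EuclideanSpace ℝ (Fin n) :=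
    mfderiv 𝓘(ℝ, EuclideanSpace ℝ (Fin n)) (𝓡 n) φ'.symm (transition x x' y) with hA
  have hv2 : v = ∑ k, v k • EuclideanSpace.single k (1 : ℝ) := by
    simpa using ((EuclideanSpace.basisFun (Fin n) ℝ).sum_repr v).symm
  change A v = ∑ k, v k • A (EuclideanSpace.single k 1)
  conv_lhs => rw [hv2, map_sum]
  simp

/-- A pointwise inner product on the tangent spaces is bilinear. -/
def IsBilinearMetric (g : ∀ p : M, TangentSpace (𝓡 n) p → TangentSpace (𝓡 n) p → ℝ) : Prop :=
  ∀ p : M, ∃ b : EuclideanSpace ℝ (Fin n) →ₗ[ℝ] EuclideanSpace ℝ (Fin n) →ₗ[ℝ] ℝ,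
    ∀ v w, g p v w = b v w

/-- The Gram matrices of the two coordinate frames are related by G = PᵀG'P, with P the Jacobian
matrix of the transition map, so √det G picks up the factor |det P|. -/
theorem chartDensity_transition {g : ∀ p : M, TangentSpace (𝓡 n) p → TangentSpace (𝓡 n) p → ℝ}
    (hg : IsBilinearMetric g) (x x' : M) {y : EuclideanSpace ℝ (Fin n)}
    (hy : y ∈ (chartAt (EuclideanSpace ℝ (Fin n)) x).target)
    (hy' : (chartAt (EuclideanSpace ℝ (Fin n)) x).symm y ∈ (chartAt (EuclideanSpace ℝ (Fin n)) x').source) :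
    chartDensity g x y = |(fderiv ℝ (transition x x') y).det| * chartDensity g x' (transition x x' y) := by
  set φ := chartAt (EuclideanSpace ℝ (Fin n)) x with hφ
  set φ' := chartAt (EuclideanSpace ℝ (Fin n)) x' with hφ'
  have hpt : φ'.symm (transition x x' y) = φ.symm y := φ'.left_inv hy'
  obtain ⟨b, hb⟩ := hg (φ.symm y)
  obtain ⟨b', hb'⟩ := hg (φ'.symm (transition x x' y))
  have hbb' : b' = b := by
    -- The two expressions for the base point agree only propositionally; the point is generalized
    -- so that the bilinear forms can be compared.
    have key : ∀ q : M, q = φ.symm y → ∀ v w : EuclideanSpace ℝ (Fin n), g q v w = b v w := by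
      rintro q rfl v w
      exact hb v w
    ext v w
    exact (hb' _ _).symm.trans (key _ hpt _ _)
  let P : Matrix (Fin n) (Fin n) ℝ := Matrix.of fun k i =>
    (fderiv ℝ (transition x x') y (EuclideanSpace.single i 1)) k
  have hdet : (fderiv ℝ (transition x x') y).det = P.det := by
    have h1 : LinearMap.toMatrix (EuclideanSpace.basisFun (Fin n) ℝ).toBasis
        (EuclideanSpace.basisFun (Fin n) ℝ).toBasis
        (fderiv ℝ (transition x x') y : EuclideanSpace ℝ (Fin n) →ₗ[ℝ] EuclideanSpace ℝ (Fin n)) = P := by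
      ext k i
      simp [LinearMap.toMatrix_apply, P]
    rw [← h1, LinearMap.det_toMatrix]
  have hG : (Matrix.of fun i j : Fin n => g _ (coordField x i y) (coordField x j y))
      = P.transpose * (Matrix.of fun i j : Fin n => g _ (coordField x' i (transition x x' y))
        (coordField x' j (transition x x' y))) * P := by
    ext i j
    simp only [Matrix.of_apply, Matrix.mul_apply, Matrix.transpose_apply]
    have h1 : g _ (coordField x i y) (coordField x j y) = b (coordField x i y) (coordField x j y) := hb _ _
    have h2 (k l : Fin n) : g _ (coordField x' k (transition x x' y)) (coordField x' l (transition x x' y))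
        = b (coordField x' k (transition x x' y)) (coordField x' l (transition x x' y)) := by
      rw [← hbb']; exact hb' _ _
    rw [h1]
    simp_rw [h2]
    have e1 : b (coordField x i y) (coordField x j y) = b (∑ k, P k i •
        (coordField x' k (transition x x' y) : EuclideanSpace ℝ (Fin n))) (∑ k, P k j •
        (coordField x' k (transition x x' y) : EuclideanSpace ℝ (Fin n))) :=
      congrArg₂ (fun v w => b v w) (coordField_transition x x' hy hy' i) (coordField_transition x x' hy hy' j)
    exact e1.trans (bilin_sum_smul b (fun k => coordField x' k (transition x x' y)) (P · i) (P · j))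
  unfold chartDensity
  rw [hG, Matrix.det_mul, Matrix.det_mul, Matrix.det_transpose, hdet]
  rw [show P.det * (Matrix.of fun i j : Fin n => g _ (coordField x' i (transition x x' y))
        (coordField x' j (transition x x' y))).det * P.det = P.det ^ 2 * (Matrix.of fun i j : Fin n => g _ (coordField x' i (transition x x' y))
        (coordField x' j (transition x x' y))).det by ring, Real.sqrt_mul (sq_nonneg _), Real.sqrt_sq_eq_abs]

variable [MeasurableSpace M] [BorelSpace M]

/-- Change of variables along the transition map, whose Jacobian is exactly the ratio of the two
densities. -/
theorem chartVolume_eq_of_subset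
    {g : ∀ p : M, TangentSpace (𝓡 n) p → TangentSpace (𝓡 n) p → ℝ} (hg : IsBilinearMetric g)
    (x x' : M) {A : Set M} (hA : MeasurableSet A)
    (hx : A ⊆ (chartAt (EuclideanSpace ℝ (Fin n)) x).source)
    (hx' : A ⊆ (chartAt (EuclideanSpace ℝ (Fin n)) x').source) :
    chartVolume g x A = chartVolume g x' A := by
  set φ := chartAt (EuclideanSpace ℝ (Fin n)) x with hφ
  set φ' := chartAt (EuclideanSpace ℝ (Fin n)) x' with hφ'
  rw [chartVolume_apply g x hA, chartVolume_apply g x' hA]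
  set s := φ.target ∩ φ.symm ⁻¹' A with hs
  have hsm : MeasurableSet s := measurableSet_chart_preimage x hA
  have himg : φ'.target ∩ φ'.symm ⁻¹' A = transition x x' '' s := by
    ext y
    constructor
    · rintro ⟨hy, hyA⟩
      refine ⟨φ (φ'.symm y), ⟨φ.map_source (hx hyA), ?_⟩, ?_⟩
      · change φ.symm (φ (φ'.symm y)) ∈ A
        rwa [φ.left_inv (hx hyA)]
      · change φ' (φ.symm (φ (φ'.symm y))) = y
        rw [φ.left_inv (hx hyA), φ'.right_inv hy]
    · rintro ⟨w, ⟨hw, hwA⟩, rfl⟩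
      refine ⟨φ'.map_source (hx' hwA), ?_⟩
      change φ'.symm (φ' (φ.symm w)) ∈ A
      rwa [φ'.left_inv (hx' hwA)]
  have hinj : InjOn (transition x x') s := by
    rintro w ⟨hw, hwA⟩ v ⟨hv, hvA⟩ hwv
    have h1 : φ.symm w = φ.symm v := φ'.injOn (hx' hwA) (hx' hvA) hwv
    exact φ.symm.injOn hw hv h1
  rw [himg, lintegral_image_eq_lintegral_abs_det_fderiv_mul volume hsm
    (fun y hy => (differentiableAt_transition x x' hy.1 (hx' hy.2)).hasFDerivAt.hasFDerivWithinAt) hinj]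
  refine setLIntegral_congr_fun hsm fun y hy => ?_
  rw [chartDensity_transition hg x x' hy.1 (hx' hy.2), ENNReal.ofReal_mul (abs_nonneg _)]

theorem chartVolume_compl_source (g : ∀ p : M, TangentSpace (𝓡 n) p → TangentSpace (𝓡 n) p → ℝ)
    (x : M) {A : Set M} (hA : MeasurableSet A)
    (hx : Disjoint A (chartAt (EuclideanSpace ℝ (Fin n)) x).source) : chartVolume g x A = 0 := by
  rw [chartVolume_apply g x hA]
  have : (chartAt (EuclideanSpace ℝ (Fin n)) x).target ∩
      (chartAt (EuclideanSpace ℝ (Fin n)) x).symm ⁻¹' A = ∅ := by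
    ext y
    simp only [mem_inter_iff, mem_preimage, mem_empty_iff_false, iff_false, not_and]
    exact fun hy hyA => hx.le_bot ⟨hyA, (chartAt (EuclideanSpace ℝ (Fin n)) x).map_target hy⟩
  rw [this]
  simp

/-- On a chart domain the Riemannian volume is given by the density in that chart. -/
theorem riemannianVolume_restrict_source
    {g : ∀ p : M, TangentSpace (𝓡 n) p → TangentSpace (𝓡 n) p → ℝ} (hg : IsBilinearMetric g) (x : M) :
    (riemannianVolume g).restrict (chartAt (EuclideanSpace ℝ (Fin n)) x).source = chartVolume g x := by
  set U := (chartAt (EuclideanSpace ℝ (Fin n)) x).source with hU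
  have hUm : MeasurableSet U := (chartAt (EuclideanSpace ℝ (Fin n)) x).open_source.measurableSet
  have hvol : riemannianVolume g = ⨆ x, chartVolume g x := rfl
  apply le_antisymm
  · have h1 : riemannianVolume g ≤ chartVolume g x + (⊤ : Measure M).restrict Uᶜ := by
      rw [hvol]
      refine iSup_le fun x' => Measure.le_iff.2 fun A hA => ?_
      rw [Measure.add_apply, Measure.restrict_apply hA]
      set U' := (chartAt (EuclideanSpace ℝ (Fin n)) x').source with hU'
      have hUm' : MeasurableSet U' := (chartAt (EuclideanSpace ℝ (Fin n)) x').open_source.measurableSet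
      rw [← measure_inter_add_sdiff A hUm]
      refine add_le_add ?_ ?_
      · rw [← measure_inter_add_sdiff (A ∩ U) hUm', chartVolume_compl_source g x'
          ((hA.inter hUm).diff hUm') disjoint_sdiff_left, add_zero,
          chartVolume_eq_of_subset hg x' x ((hA.inter hUm).inter hUm') inter_subset_right
            (fun a ha => ha.1.2)]
        exact measure_mono fun a ha => ha.1.1
      · exact (Measure.le_iff'.1 le_top) _
    refine (Measure.restrict_mono_measure h1 U).trans ?_
    rw [Measure.restrict_add, Measure.restrict_restrict hUm, inter_compl_self, Measure.restrict_empty,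
      add_zero]
    exact Measure.restrict_le_self
  · refine Measure.le_iff.2 fun A hA => ?_
    rw [Measure.restrict_apply hA, ← measure_inter_add_sdiff A hUm, chartVolume_compl_source g x
      (hA.diff hUm) disjoint_sdiff_left, add_zero, hvol]
    exact (Measure.le_iff'.1 (le_iSup (chartVolume g) x)) _

end Volume

/-- Jacobi's formula for a matrix whose derivative along v is mC + Am. The two-sided form is the one
that the bracket relations of a frame produce. -/
theorem hasFDerivAt_det_three {E : Type*} [NormedAddCommGroup E] [NormedSpace ℝ E]
    {m : Fin 3 → Fin 3 → E → ℝ} {m' : Fin 3 → Fin 3 → E →L[ℝ] ℝ} {y : E}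
    (hm : ∀ i k, HasFDerivAt (m i k) (m' i k) y) (v : E) (A C : Matrix (Fin 3) (Fin 3) ℝ)
    (hv : ∀ i k, m' i k v = ∑ l, m i l y * C l k + ∑ l, A i l * m l k y) :
    ∃ D : E →L[ℝ] ℝ, HasFDerivAt (fun y => (Matrix.of fun i k => m i k y).det) D y ∧
      D v = (Matrix.of fun i k => m i k y).det * (C.trace + A.trace) := by
  simp only [Matrix.det_fin_three, Matrix.of_apply]
  refine ⟨_, ((((((((hm 0 0).mul (hm 1 1)).mul (hm 2 2)).sub (((hm 0 0).mul (hm 1 2)).mul (hm 2 1))).sub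
    (((hm 0 1).mul (hm 1 0)).mul (hm 2 2))).add (((hm 0 1).mul (hm 1 2)).mul (hm 2 0))).add
    (((hm 0 2).mul (hm 1 0)).mul (hm 2 1))).sub (((hm 0 2).mul (hm 1 1)).mul (hm 2 0))), ?_⟩
  simp only [add_apply, sub_apply, smul_apply, smul_eq_mul, Pi.mul_apply, hv, Fin.sum_univ_three, Matrix.trace,
    Matrix.diag]
  ring

/-! ### The density of an orthonormal frame and the divergence theorem -/

section Frame
variable {N : Type*} [TopologicalSpace N] [ChartedSpace (EuclideanSpace ℝ (Fin 3)) N]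
  [IsManifold (𝓡 3) ∞ N]

/-- The components in the chart at `x` of a family of vector fields. -/
def frameEntry (X : Fin 3 → ∀ p : N, TangentSpace (𝓡 3) p) (x : N) (i k : Fin 3) (q : N) : ℝ :=
  (dirDeriv (extChartAt (𝓡 3) x) q (X k q) : EuclideanSpace ℝ (Fin 3)) i

/-- The determinant of the components in the chart at `x` of a frame. -/
def frameDet (X : Fin 3 → ∀ p : N, TangentSpace (𝓡 3) p) (x : N) (q : N) : ℝ :=
  (Matrix.of fun i k => frameEntry X x i k q).det

variable {X : Fin 3 → ∀ p : N, TangentSpace (𝓡 3) p} {x : N} {W : Set N}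

theorem frameEntry_eq_dirDeriv {q : N} (hq : q ∈ (extChartAt (𝓡 3) x).source) (i k : Fin 3) :
    frameEntry X x i k q = dirDeriv (fun q => (extChartAt (𝓡 3) x q : EuclideanSpace ℝ (Fin 3)) i) q (X k q) := by
  have hd2 : MDifferentiableAt (𝓡 3) 𝓘(ℝ, EuclideanSpace ℝ (Fin 3)) (extChartAt (𝓡 3) x) q :=
    mdifferentiableAt_extChartAt (by simpa using hq)
  have h1 := DFunLike.congr_fun (mfderiv_comp q
    (EuclideanSpace.proj i : EuclideanSpace ℝ (Fin 3) →L[ℝ] ℝ).differentiableAt.mdifferentiableAt hd2) (X k q)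
  rw [mfderiv_eq_fderiv, ContinuousLinearMap.fderiv] at h1
  exact h1.symm

theorem contMDiffOn_chart_coord (hx : W ⊆ (extChartAt (𝓡 3) x).source) (i : Fin 3) :
    ContMDiffOn (𝓡 3) 𝓘(ℝ, ℝ) ∞ (fun q => (extChartAt (𝓡 3) x q : EuclideanSpace ℝ (Fin 3)) i) W := by
  have h1 : ContMDiffOn (𝓡 3) 𝓘(ℝ, EuclideanSpace ℝ (Fin 3)) ∞ (extChartAt (𝓡 3) x) W :=
    (contMDiffOn_extChartAt (n := ∞)).mono (by simpa using hx)
  exact (EuclideanSpace.proj i : EuclideanSpace ℝ (Fin 3) →L[ℝ] ℝ).contDiff.contMDiff.comp_contMDiffOn h1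

theorem contMDiffOn_frameEntry (hW : IsOpen W) (hX : ∀ k, SmoothFieldOn (X k) W)
    (hx : W ⊆ (extChartAt (𝓡 3) x).source) (i k : Fin 3) :
    ContMDiffOn (𝓡 3) 𝓘(ℝ, ℝ) ∞ (frameEntry X x i k) W :=
  (contMDiffOn_mfderiv_apply hW (contMDiffOn_chart_coord hx i) (hX k)).congr
    fun _ hq => frameEntry_eq_dirDeriv (hx hq) i k

/-- The bracket relation is applied to the i-th coordinate function, whose derivative along X_k is
the entry (i, k). -/
theorem dirDeriv_frameEntry_comm (hW : IsOpen W) (hX : ∀ k, SmoothFieldOn (X k) W)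
    (hx : W ⊆ (extChartAt (𝓡 3) x).source) {C : Fin 3 → Fin 3 → Fin 3 → N → ℝ}
    (hC : ∀ j k, ∀ q ∈ W, VectorField.mlieBracket (𝓡 3) (X j) (X k) q = ∑ l, C j k l q • X l q)
    {q : N} (hq : q ∈ W) (i j k : Fin 3) :
    dirDeriv (frameEntry X x i k) q (X j q) = ∑ l, frameEntry X x i l q * C j k l q
      + dirDeriv (frameEntry X x i j) q (X k q) := by
  have h1 := dirDeriv_mlieBracket hW (contMDiffOn_chart_coord hx i) (hX j) (hX k) hq
  have h2 (a b : Fin 3) : dirDeriv (fun q => dirDeriv (fun q => (extChartAt (𝓡 3) x q : EuclideanSpace ℝ (Fin 3)) i) q (X a q)) q (X b q)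
      = dirDeriv (frameEntry X x i a) q (X b q) := by
    have : (fun q => dirDeriv (fun q => (extChartAt (𝓡 3) x q : EuclideanSpace ℝ (Fin 3)) i) q (X a q)) =ᶠ[𝓝 q]
        frameEntry X x i a := by
      filter_upwards [hW.mem_nhds hq] with r hr
      exact (frameEntry_eq_dirDeriv (hx hr) i a).symm
    exact DFunLike.congr_fun (this.mfderiv_eq (I := 𝓡 3) (I' := 𝓘(ℝ, ℝ))) _
  have h3 : dirDeriv (fun q => (extChartAt (𝓡 3) x q : EuclideanSpace ℝ (Fin 3)) i) q
      (VectorField.mlieBracket (𝓡 3) (X j) (X k) q) = ∑ l, frameEntry X x i l q * C j k l q := by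
    refine (congrArg _ (hC j k q hq)).trans ?_
    refine (map_sum (mfderiv (𝓡 3) 𝓘(ℝ, ℝ) (fun q => (extChartAt (𝓡 3) x q : EuclideanSpace ℝ (Fin 3)) i) q) _ _).trans ?_
    refine Finset.sum_congr rfl fun l _ => ?_
    refine (map_smul (mfderiv (𝓡 3) 𝓘(ℝ, ℝ) (fun q => (extChartAt (𝓡 3) x q : EuclideanSpace ℝ (Fin 3)) i) q) _ _).trans ?_
    rw [frameEntry_eq_dirDeriv (hx hq), mul_comm]
    rfl
  rw [h2, h2, h3] at h1
  linarith

/-- The Riemannian density in a chart, in terms of an orthonormal frame. -/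
theorem chartDensity_eq_frameDet {g : ∀ p : N, TangentSpace (𝓡 3) p → TangentSpace (𝓡 3) p → ℝ}
    (hg : IsBilinearMetric g) {y : EuclideanSpace ℝ (Fin 3)}
    (hy : y ∈ (chartAt (EuclideanSpace ℝ (Fin 3)) x).target)
    (hX : ∀ j k, g _ (X j ((chartAt (EuclideanSpace ℝ (Fin 3)) x).symm y))
      (X k ((chartAt (EuclideanSpace ℝ (Fin 3)) x).symm y)) = if j = k then 1 else 0) :
    frameDet X x ((chartAt (EuclideanSpace ℝ (Fin 3)) x).symm y) ≠ 0 ∧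
      chartDensity g x y = |frameDet X x ((chartAt (EuclideanSpace ℝ (Fin 3)) x).symm y)|⁻¹ := by
  set φ := chartAt (EuclideanSpace ℝ (Fin 3)) x
  set q := φ.symm y with hq
  have hqs : q ∈ φ.source := φ.map_target hy
  obtain ⟨b, hb⟩ := hg q
  let P : Matrix (Fin 3) (Fin 3) ℝ := Matrix.of fun i k => frameEntry X x i k q
  let A : EuclideanSpace ℝ (Fin 3) →L[ℝ] EuclideanSpace ℝ (Fin 3) :=
    mfderiv 𝓘(ℝ, EuclideanSpace ℝ (Fin 3)) (𝓡 3) φ.symm y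
  have hXe (k : Fin 3) : (X k q : EuclideanSpace ℝ (Fin 3)) = ∑ i, P i k • (coordField x i y : EuclideanSpace ℝ (Fin 3)) := by
    set v : EuclideanSpace ℝ (Fin 3) := dirDeriv (extChartAt (𝓡 3) x) q (X k q) with hv
    have h1 : (X k q : EuclideanSpace ℝ (Fin 3)) = A v := by
      have e1 : φ.symm ∘ φ =ᶠ[𝓝 q] id := by
        filter_upwards [φ.open_source.mem_nhds hqs] with r hr
        exact φ.left_inv hr
      have hyq : φ q = y := φ.right_inv hy
      have hd : MDifferentiableAt 𝓘(ℝ, EuclideanSpace ℝ (Fin 3)) (𝓡 3) φ.symm (φ q) := by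
        rw [hyq]; exact mdifferentiableAt_chart_symm x hy
      have h2 := DFunLike.congr_fun ((mfderiv_comp q hd (mdifferentiableAt_chart x hqs)).symm.trans
        ((e1.mfderiv_eq (I := 𝓡 3) (I' := 𝓡 3)).trans (mfderiv_id))) (X k q)
      refine h2.symm.trans ?_
      have key : ∀ y' : EuclideanSpace ℝ (Fin 3), y' = y →
        (mfderiv 𝓘(ℝ, EuclideanSpace ℝ (Fin 3)) (𝓡 3) φ.symm y' : EuclideanSpace ℝ (Fin 3) →L[ℝ] EuclideanSpace ℝ (Fin 3)) v = A v := by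
        rintro _ rfl
        rfl
      exact key _ hyq
    have hv2 : v = ∑ i, v i • EuclideanSpace.single i (1 : ℝ) := by
      simpa using ((EuclideanSpace.basisFun (Fin 3) ℝ).sum_repr v).symm
    rw [h1]
    change A v = ∑ i, v i • A (EuclideanSpace.single i 1)
    conv_lhs => rw [hv2, map_sum]
    simp
  -- Orthonormality of the frame reads 1 = PᵀGP in coordinates, so det G = (det P)⁻².
  have hG : (1 : Matrix (Fin 3) (Fin 3) ℝ) = P.transpose * (Matrix.of fun i j : Fin 3 => g _ (coordField x i y)
        (coordField x j y)) * P := by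
    ext i j
    simp only [Matrix.of_apply, Matrix.mul_apply, Matrix.transpose_apply, Matrix.one_apply]
    have h2 (k l : Fin 3) : g _ (coordField x k y) (coordField x l y) = b (coordField x k y) (coordField x l y) := hb _ _
    simp_rw [h2]
    have e1 : b (X i q) (X j q) = b (∑ k, P k i • (coordField x k y : EuclideanSpace ℝ (Fin 3)))
        (∑ k, P k j • (coordField x k y : EuclideanSpace ℝ (Fin 3))) :=
      congrArg₂ (fun v w => b v w) (hXe i) (hXe j)
    exact ((hX i j).symm.trans (hb _ _)).trans
      (e1.trans (bilin_sum_smul b (fun k => coordField x k y) (P · i) (P · j)))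
  have hdet := congrArg Matrix.det hG
  rw [Matrix.det_mul, Matrix.det_mul, Matrix.det_transpose, Matrix.det_one] at hdet
  have hP : frameDet X x q = P.det := rfl
  have hne : P.det ≠ 0 := fun h0 => by simp [h0] at hdet
  refine ⟨hP ▸ hne, ?_⟩
  unfold chartDensity
  rw [hP]
  have : (Matrix.of fun i j : Fin 3 => g _ (coordField x i y) (coordField x j y)).det = (P.det⁻¹) ^ 2 := by
    field_simp
    linarith
  rw [this, Real.sqrt_sq_eq_abs, abs_inv]

theorem contMDiffOn_frameDet (hW : IsOpen W) (hX : ∀ k, SmoothFieldOn (X k) W)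
    (hx : W ⊆ (extChartAt (𝓡 3) x).source) :
    ContMDiffOn (𝓡 3) 𝓘(ℝ, ℝ) ∞ (frameDet X x) W := by
  have h := contMDiffOn_frameEntry hW hX hx
  have : frameDet X x = fun q => _ := funext fun q => Matrix.det_fin_three _
  rw [this]
  simp only [Matrix.of_apply]
  exact (((((((h 0 0).mul (h 1 1)).mul (h 2 2)).sub (((h 0 0).mul (h 1 2)).mul (h 2 1))).sub
    (((h 0 1).mul (h 1 0)).mul (h 2 2))).add (((h 0 1).mul (h 1 2)).mul (h 2 0))).add
    (((h 0 2).mul (h 1 0)).mul (h 2 1))).sub (((h 0 2).mul (h 1 1)).mul (h 2 0))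

theorem contMDiffOn_abs_inv {f : N → ℝ} (hf : ContMDiffOn (𝓡 3) 𝓘(ℝ, ℝ) ∞ f W) (h0 : ∀ q ∈ W, f q ≠ 0) :
    ContMDiffOn (𝓡 3) 𝓘(ℝ, ℝ) ∞ (fun q => |f q|⁻¹) W := by
  intro q hq
  have h1 : ContDiffAt ℝ ∞ (fun s : ℝ => |s|⁻¹) (f q) :=
    (contDiffAt_abs (h0 q hq)).inv (abs_ne_zero.2 (h0 q hq))
  exact h1.contMDiffAt.comp_contMDiffWithinAt q (hf q hq)

/-- The part of the chart at `x` that corresponds to `W`. -/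
def chartImage (x : N) (W : Set N) : Set (EuclideanSpace ℝ (Fin 3)) :=
  (chartAt (EuclideanSpace ℝ (Fin 3)) x).target ∩ (chartAt (EuclideanSpace ℝ (Fin 3)) x).symm ⁻¹' W

theorem isOpen_chartImage (x : N) (hW : IsOpen W) : IsOpen (chartImage x W) :=
  (chartAt (EuclideanSpace ℝ (Fin 3)) x).continuousOn_symm.isOpen_inter_preimage
    (chartAt (EuclideanSpace ℝ (Fin 3)) x).open_target hW

variable [MeasurableSpace N] [BorelSpace N]
  {g : ∀ p : N, TangentSpace (𝓡 3) p → TangentSpace (𝓡 3) p → ℝ}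

theorem riemannianVolume_restrict_frame (hg : IsBilinearMetric g) (hW : IsOpen W)
    (hx : W ⊆ (extChartAt (𝓡 3) x).source)
    (hX : ∀ q ∈ W, ∀ j k, g q (X j q) (X k q) = if j = k then 1 else 0) :
    (riemannianVolume g).restrict W = Measure.map (chartAt (EuclideanSpace ℝ (Fin 3)) x).symm
      ((volume.restrict (chartImage x W)).withDensity fun y =>
        ENNReal.ofReal |frameDet X x ((chartAt (EuclideanSpace ℝ (Fin 3)) x).symm y)|⁻¹) := by
  have hx' : W ⊆ (chartAt (EuclideanSpace ℝ (Fin 3)) x).source := by simpa using hx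
  have hV := (isOpen_chartImage x hW).measurableSet
  have hae : AEMeasurable (chartAt (EuclideanSpace ℝ (Fin 3)) x).symm
      ((volume.restrict (chartImage x W)).withDensity fun y =>
        ENNReal.ofReal |frameDet X x ((chartAt (EuclideanSpace ℝ (Fin 3)) x).symm y)|⁻¹) := by
    refine AEMeasurable.mono_ac ?_ (withDensity_absolutelyContinuous _ _)
    exact ((chartAt (EuclideanSpace ℝ (Fin 3)) x).continuousOn_symm.mono inter_subset_left).aemeasurable hV
  ext A hA
  rw [Measure.restrict_apply hA, Measure.map_apply_of_aemeasurable hae hA, withDensity_apply',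
    Measure.restrict_restrict' hV]
  have h1 : riemannianVolume g (A ∩ W) = chartVolume g x (A ∩ W) := by
    rw [← riemannianVolume_restrict_source hg x, Measure.restrict_apply (hA.inter hW.measurableSet),
      inter_eq_self_of_subset_left (inter_subset_right.trans hx')]
  rw [h1, chartVolume_apply g x (hA.inter hW.measurableSet)]
  have h2 : (chartAt (EuclideanSpace ℝ (Fin 3)) x).symm ⁻¹' A ∩ chartImage x W
      = (chartAt (EuclideanSpace ℝ (Fin 3)) x).target ∩
        (chartAt (EuclideanSpace ℝ (Fin 3)) x).symm ⁻¹' (A ∩ W) := by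
    ext y
    simp only [chartImage, mem_inter_iff, mem_preimage]
    tauto
  rw [h2]
  refine setLIntegral_congr_fun (measurableSet_chart_preimage x (hA.inter hW.measurableSet)) fun y hy => ?_
  rw [(chartDensity_eq_frameDet hg hy.1 (hX _ hy.2.2)).2]

theorem frameDet_ne_zero (hg : IsBilinearMetric g)
    (hx : W ⊆ (extChartAt (𝓡 3) x).source)
    (hX : ∀ q ∈ W, ∀ j k, g q (X j q) (X k q) = if j = k then 1 else 0) {q : N} (hq : q ∈ W) :
    frameDet X x q ≠ 0 := by
  have hx' : W ⊆ (chartAt (EuclideanSpace ℝ (Fin 3)) x).source := by simpa using hx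
  have hqs : (chartAt (EuclideanSpace ℝ (Fin 3)) x).symm (chartAt (EuclideanSpace ℝ (Fin 3)) x q) = q :=
    (chartAt (EuclideanSpace ℝ (Fin 3)) x).left_inv (hx' hq)
  have h1 : ∀ q', q' = q → ∀ j k, g q' (X j q') (X k q') = if j = k then 1 else 0 := by
    rintro _ rfl
    exact hX _ hq
  have h := (chartDensity_eq_frameDet (X := X) hg ((chartAt (EuclideanSpace ℝ (Fin 3)) x).map_source (hx' hq)) (h1 _ hqs)).1
  rwa [hqs] at h

theorem continuousOn_frameDet_symm (hg : IsBilinearMetric g) (hW : IsOpen W) (hX : ∀ k, SmoothFieldOn (X k) W)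
    (hx : W ⊆ (extChartAt (𝓡 3) x).source)
    (hgX : ∀ q ∈ W, ∀ j k, g q (X j q) (X k q) = if j = k then 1 else 0) :
    ContinuousOn (fun y => |frameDet X x ((chartAt (EuclideanSpace ℝ (Fin 3)) x).symm y)|⁻¹) (chartImage x W) :=
  (contMDiffOn_abs_inv (contMDiffOn_frameDet hW hX hx)
    (fun _ hq => frameDet_ne_zero hg hx hgX hq)).continuousOn.comp
    ((chartAt (EuclideanSpace ℝ (Fin 3)) x).continuousOn_symm.mono inter_subset_left) fun _ hy => hy.2

theorem integral_riemannianVolume_frame (hg : IsBilinearMetric g) (hW : IsOpen W) (hX : ∀ k, SmoothFieldOn (X k) W)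
    (hx : W ⊆ (extChartAt (𝓡 3) x).source)
    (hgX : ∀ q ∈ W, ∀ j k, g q (X j q) (X k q) = if j = k then 1 else 0)
    {f : N → ℝ} (hf : ContinuousOn f W) (hf0 : ∀ q ∉ W, f q = 0) :
    ∫ q, f q ∂(riemannianVolume g) = ∫ y in chartImage x W,
      |frameDet X x ((chartAt (EuclideanSpace ℝ (Fin 3)) x).symm y)|⁻¹ *
        f ((chartAt (EuclideanSpace ℝ (Fin 3)) x).symm y) := by
  have hV := (isOpen_chartImage x hW).measurableSet
  have hae : AEMeasurable (chartAt (EuclideanSpace ℝ (Fin 3)) x).symm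
      ((volume.restrict (chartImage x W)).withDensity fun y =>
        ENNReal.ofReal |frameDet X x ((chartAt (EuclideanSpace ℝ (Fin 3)) x).symm y)|⁻¹) := by
    refine AEMeasurable.mono_ac ?_ (withDensity_absolutelyContinuous _ _)
    exact ((chartAt (EuclideanSpace ℝ (Fin 3)) x).continuousOn_symm.mono inter_subset_left).aemeasurable hV
  have h1 : ∫ q, f q ∂(riemannianVolume g) = ∫ q in W, f q ∂(riemannianVolume g) :=
    (setIntegral_eq_integral_of_forall_compl_eq_zero hf0).symm
  have hfm : AEStronglyMeasurable f ((riemannianVolume g).restrict W) :=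
    hf.aestronglyMeasurable hW.measurableSet
  rw [h1]
  rw [riemannianVolume_restrict_frame hg hW hx hgX] at hfm ⊢
  rw [integral_map hae hfm, integral_withDensity_eq_integral_toReal_smul₀
    ((continuousOn_frameDet_symm hg hW hX hx hgX).aemeasurable hV).ennreal_ofReal (by simp)]
  refine integral_congr_ae (Eventually.of_forall fun y => ?_)
  simp only [smul_eq_mul]
  rw [ENNReal.toReal_ofReal (by positivity)]

end Frame

section IndicatorSmooth
variable {E F : Type*} [NormedAddCommGroup E] [NormedSpace ℝ E] [NormedAddCommGroup F] [NormedSpace ℝ F]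

theorem indicator_eventuallyEq_zero {V K : Set E} (hK : IsClosed K) (hKV : K ⊆ V) {f : E → F}
    (hf0 : ∀ y ∈ V, y ∉ K → f y = 0) {y : E} (hy : y ∉ V) : V.indicator f =ᶠ[𝓝 y] 0 := by
  filter_upwards [hK.isOpen_compl.mem_nhds fun h => hy (hKV h)] with w hw
  by_cases hwV : w ∈ V
  · rw [indicator_of_mem hwV]; exact hf0 w hwV hw
  · exact indicator_of_notMem hwV _

theorem indicator_eventuallyEq_self {V : Set E} (hV : IsOpen V) (f : E → F) {y : E} (hy : y ∈ V) :
    V.indicator f =ᶠ[𝓝 y] f := by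
  filter_upwards [hV.mem_nhds hy] with w hw using indicator_of_mem hw _

/-- Near a point outside V the extension by zero vanishes identically, because f is zero on V off K
and K is closed and contained in V. -/
theorem contDiff_indicator {V K : Set E} (hV : IsOpen V) (hK : IsClosed K) (hKV : K ⊆ V) {f : E → F}
    (hf : ContDiffOn ℝ ∞ f V) (hf0 : ∀ y ∈ V, y ∉ K → f y = 0) : ContDiff ℝ ∞ (V.indicator f) := by
  rw [contDiff_iff_contDiffAt]
  intro y
  by_cases hy : y ∈ V
  · exact (hf.contDiffAt (hV.mem_nhds hy)).congr_of_eventuallyEq (indicator_eventuallyEq_self hV f hy)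
  · exact contDiffAt_const.congr_of_eventuallyEq (indicator_eventuallyEq_zero hK hKV hf0 hy)

/-- Integration by parts against the constant function 1. -/
theorem integral_fderiv_eq_zero {E : Type*} [NormedAddCommGroup E] [NormedSpace ℝ E]
    [FiniteDimensional ℝ E] [MeasurableSpace E] [BorelSpace E] (μ : Measure E) [μ.IsAddHaarMeasure]
    {f : E → ℝ} (hf : ContDiff ℝ ∞ f)
    (hs : HasCompactSupport f) (v : E) :
    Integrable (fun y => fderiv ℝ f y v) μ ∧ ∫ y, fderiv ℝ f y v ∂μ = 0 := by
  have hc : Continuous (fun y => fderiv ℝ f y v) := (hf.continuous_fderiv (by simp)).clm_apply continuous_const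
  have hcs : HasCompactSupport (fun y => fderiv ℝ f y v) := hs.fderiv_apply (𝕜 := ℝ) v
  have hi : Integrable (fun y => fderiv ℝ f y v) μ := hc.integrable_of_hasCompactSupport hcs
  refine ⟨hi, ?_⟩
  have := integral_mul_fderiv_eq_neg_fderiv_mul_of_integrable (μ := μ) (f := fun _ : E => (1 : ℝ)) (g := f)
    (v := v) (by simp) (by simpa using hi) (by simpa using hf.continuous.integrable_of_hasCompactSupport hs)
    (fun _ _ => differentiableAt_const _) (fun _ _ => hf.differentiable (by simp) _)
  simpa using this

end IndicatorSmooth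

section Divergence
variable {N : Type*} [TopologicalSpace N] [ChartedSpace (EuclideanSpace ℝ (Fin 3)) N]
  [IsManifold (𝓡 3) ∞ N] {X : Fin 3 → ∀ p : N, TangentSpace (𝓡 3) p} {x : N} {W : Set N}

theorem contDiffOn_comp_chart_symm {E : Type*} [NormedAddCommGroup E] [NormedSpace ℝ E]
    {f : N → E} (hf : ContMDiffOn (𝓡 3) 𝓘(ℝ, E) ∞ f W) :
    ContDiffOn ℝ ∞ (fun y => f ((chartAt (EuclideanSpace ℝ (Fin 3)) x).symm y)) (chartImage x W) := by
  rw [← contMDiffOn_iff_contDiffOn]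
  exact hf.comp ((contMDiffOn_chart_symm (I := 𝓡 3) (n := ∞)).mono inter_subset_left) fun _ hy => hy.2

theorem hasFDerivAt_comp_chart_symm {E : Type*} [NormedAddCommGroup E] [NormedSpace ℝ E]
    (hW : IsOpen W) {f : N → E} (hf : ContMDiffOn (𝓡 3) 𝓘(ℝ, E) ∞ f W) {y : EuclideanSpace ℝ (Fin 3)}
    (hy : y ∈ chartImage x W) :
    HasFDerivAt (fun y => f ((chartAt (EuclideanSpace ℝ (Fin 3)) x).symm y))
      (fderiv ℝ (fun y => f ((chartAt (EuclideanSpace ℝ (Fin 3)) x).symm y)) y) y :=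
  (((contDiffOn_comp_chart_symm hf).contDiffAt ((isOpen_chartImage x hW).mem_nhds hy)).differentiableAt
    (by simp)).hasFDerivAt

theorem fderiv_comp_chart_symm {E : Type*} [NormedAddCommGroup E] [NormedSpace ℝ E]
    (hW : IsOpen W) {f : N → E} (hf : ContMDiffOn (𝓡 3) 𝓘(ℝ, E) ∞ f W) {y : EuclideanSpace ℝ (Fin 3)}
    (hy : y ∈ chartImage x W) (j : Fin 3) :
    dirDeriv f ((chartAt (EuclideanSpace ℝ (Fin 3)) x).symm y)
      (X j ((chartAt (EuclideanSpace ℝ (Fin 3)) x).symm y))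
    = ∑ i, frameEntry X x i j ((chartAt (EuclideanSpace ℝ (Fin 3)) x).symm y) •
      fderiv ℝ (fun y => f ((chartAt (EuclideanSpace ℝ (Fin 3)) x).symm y)) y (EuclideanSpace.single i 1) := by
  set q := (chartAt (EuclideanSpace ℝ (Fin 3)) x).symm y with hq
  have hqs : q ∈ (extChartAt (𝓡 3) x).source := by
    simpa using (chartAt (EuclideanSpace ℝ (Fin 3)) x).map_target hy.1
  have hyq : extChartAt (𝓡 3) x q = y := (chartAt (EuclideanSpace ℝ (Fin 3)) x).right_inv hy.1
  have hd : MDifferentiableAt (𝓡 3) 𝓘(ℝ, E) f q :=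
    ((hf q hy.2).contMDiffAt (hW.mem_nhds hy.2)).mdifferentiableAt (by simp)
  rw [dirDeriv_eq_fderiv_chart hqs hd, hyq]
  set v : EuclideanSpace ℝ (Fin 3) := dirDeriv (extChartAt (𝓡 3) x) q (X j q) with hv
  have hv2 : v = ∑ i, v i • EuclideanSpace.single i (1 : ℝ) := by
    simpa using ((EuclideanSpace.basisFun (Fin 3) ℝ).sum_repr v).symm
  conv_lhs => rw [hv2, map_sum]
  simp only [map_smul]
  rfl

variable [T2Space N] [MeasurableSpace N] [BorelSpace N]
  {g : ∀ p : N, TangentSpace (𝓡 3) p → TangentSpace (𝓡 3) p → ℝ}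

/-- The divergence theorem for the fields of an orthonormal frame. -/
theorem integral_divergence (hg : IsBilinearMetric g) (hW : IsOpen W) (hX : ∀ k, SmoothFieldOn (X k) W)
    (hx : W ⊆ (extChartAt (𝓡 3) x).source)
    (hgX : ∀ q ∈ W, ∀ j k, g q (X j q) (X k q) = if j = k then 1 else 0)
    {C : Fin 3 → Fin 3 → Fin 3 → N → ℝ} (hCc : ∀ j k l, ContinuousOn (C j k l) W)
    (hC : ∀ j k, ∀ q ∈ W, VectorField.mlieBracket (𝓡 3) (X j) (X k) q = ∑ l, C j k l q • X l q)
    {u : N → ℝ} (hu : ContMDiffOn (𝓡 3) 𝓘(ℝ, ℝ) ∞ u W) (hus : HasCompactSupport u) (huW : tsupport u ⊆ W)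
    (j : Fin 3) :
    ∫ q, (dirDeriv u q (X j q) - (∑ k, C j k k q) * u q) ∂(riemannianVolume g) = 0 := by
  set φ := chartAt (EuclideanSpace ℝ (Fin 3)) x with hφ
  have hx' : W ⊆ φ.source := by simpa [hφ] using hx
  set V := chartImage x W with hVdef
  have hV : IsOpen V := isOpen_chartImage x hW
  set K : Set (EuclideanSpace ℝ (Fin 3)) := φ '' tsupport u with hK
  have hKc : IsCompact K := hus.isCompact.image_of_continuousOn
    (φ.continuousOn.mono (huW.trans hx'))
  have hKV : K ⊆ V := by
    rintro _ ⟨q, hq, rfl⟩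
    refine ⟨φ.map_source (hx' (huW hq)), ?_⟩
    change φ.symm (φ q) ∈ W
    rw [φ.left_inv (hx' (huW hq))]
    exact huW hq
  have huK : ∀ y ∈ V, y ∉ K → u (φ.symm y) = 0 := by
    intro y hy hyK
    by_contra h
    exact hyK ⟨φ.symm y, subset_tsupport u h, φ.right_inv hy.1⟩
  have hdet : ∀ q ∈ W, frameDet X x q ≠ 0 := fun q hq => frameDet_ne_zero hg hx hgX hq
  have hr : ContMDiffOn (𝓡 3) 𝓘(ℝ, ℝ) ∞ (fun q => |frameDet X x q|⁻¹) W :=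
    contMDiffOn_abs_inv (contMDiffOn_frameDet hW hX hx) hdet
  have hm := contMDiffOn_frameEntry hW hX hx
  -- These are the coordinate components of the field u X_j multiplied by the density r = |det P|⁻¹.
  -- The sum of the ∂_i G_i is r times the divergence of u X_j, and its integral over ℝ³ vanishes.
  let G : Fin 3 → EuclideanSpace ℝ (Fin 3) → ℝ := fun i y =>
    u (φ.symm y) * (|frameDet X x (φ.symm y)|⁻¹ * frameEntry X x i j (φ.symm y))
  let H : Fin 3 → EuclideanSpace ℝ (Fin 3) → ℝ := fun i => V.indicator (G i)
  have hGs (i) : ContDiffOn ℝ ∞ (G i) V := contDiffOn_comp_chart_symm (hu.mul (hr.mul (hm i j)))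
  have hG0 (i) : ∀ y ∈ V, y ∉ K → G i y = 0 := fun y hy hyK => by simp [G, huK y hy hyK]
  have hHs (i) : ContDiff ℝ ∞ (H i) := contDiff_indicator hV hKc.isClosed hKV (hGs i) (hG0 i)
  have hHc (i) : HasCompactSupport (H i) := by
    refine HasCompactSupport.intro hKc fun y hy => ?_
    by_cases hyV : y ∈ V
    · simp only [H]; rw [indicator_of_mem hyV]; exact hG0 i y hyV hy
    · exact indicator_of_notMem hyV _
  let D : N → ℝ := fun q => dirDeriv u q (X j q) - (∑ k, C j k k q) * u q
  have hDc : ContinuousOn D W :=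
    (contMDiffOn_mfderiv_apply hW hu (hX j)).continuousOn.sub
      ((continuousOn_finsetSum _ fun k _ => hCc j k k).mul hu.continuousOn)
  have hD0 : ∀ q ∉ W, D q = 0 := by
    intro q hq
    have h1 : u =ᶠ[𝓝 q] fun _ => 0 := by
      filter_upwards [(isClosed_tsupport u).isOpen_compl.mem_nhds fun h => hq (huW h)] with w hw
      exact image_eq_zero_of_notMem_tsupport hw
    have h2 : dirDeriv u q (X j q) = 0 := by
      refine (DFunLike.congr_fun (h1.mfderiv_eq (I := 𝓡 3) (I' := 𝓘(ℝ, ℝ))) (X j q)).trans ?_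
      rw [mfderiv_const]
      rfl
    simp only [D]
    rw [h2, h1.self_of_nhds]
    simp
  have key : ∀ y, ∑ i, fderiv ℝ (H i) y (EuclideanSpace.single i 1)
      = V.indicator (fun y => |frameDet X x (φ.symm y)|⁻¹ * D (φ.symm y)) y := by
    intro y
    by_cases hy : y ∈ V
    swap
    · rw [indicator_of_notMem hy]
      refine Finset.sum_eq_zero fun i _ => ?_
      have h1 : H i =ᶠ[𝓝 y] 0 := indicator_eventuallyEq_zero hKc.isClosed hKV (hG0 i) hy
      rw [h1.fderiv_eq]
      simp
    rw [indicator_of_mem hy]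
    have hq : φ.symm y ∈ W := hy.2
    have e1 := hasFDerivAt_comp_chart_symm (x := x) hW hu hy
    have e2 (i k) := hasFDerivAt_comp_chart_symm (x := x) hW (hm i k) hy
    set u' := fderiv ℝ (fun y => u (φ.symm y)) y with hu'
    set m' : Fin 3 → Fin 3 → _ := fun i k => fderiv ℝ (fun y => frameEntry X x i k (φ.symm y)) y with hm'
    set v : EuclideanSpace ℝ (Fin 3) := ∑ i, frameEntry X x i j (φ.symm y) • EuclideanSpace.single i (1 : ℝ) with hv
    have hdu : dirDeriv u (φ.symm y) (X j (φ.symm y)) = u' v := by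
      rw [hv, map_sum]
      simp only [map_smul]
      exact fderiv_comp_chart_symm hW hu hy j
    have hdm (i k l) : dirDeriv (frameEntry X x i k) (φ.symm y) (X l (φ.symm y)) =
        ∑ n, m' i k (EuclideanSpace.single n 1) * frameEntry X x n l (φ.symm y) := by
      rw [fderiv_comp_chart_symm hW (hm i k) hy l]
      exact Finset.sum_congr rfl fun n _ => mul_comm _ _
    have hmv (i k) : m' i k v = dirDeriv (frameEntry X x i k) (φ.symm y) (X j (φ.symm y)) := by
      rw [hdm, hv, map_sum]
      simp only [map_smul, smul_eq_mul]
      exact Finset.sum_congr rfl fun n _ => mul_comm _ _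
    -- Along X_j the frame matrix satisfies X_j P = P C_j + A P with A = (∂_n P_ij). Hence X_j
    -- log|det P| = Σ_k C_jk^k + Σ_i ∂_i P_ij; the second sum cancels the coordinate divergence of
    -- X_j, and div X_j = -Σ_k C_jk^k remains.
    obtain ⟨Dd, hDd, hDv⟩ := hasFDerivAt_det_three e2 v
      (Matrix.of fun i n => m' i j (EuclideanSpace.single n 1)) (Matrix.of fun l k => C j k l (φ.symm y))
      (fun i k => by
        refine (hmv i k).trans ?_
        rw [dirDeriv_frameEntry_comm hW hX hx hC hq i j k, hdm]
        rfl)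
    have hd0 : frameDet X x (φ.symm y) ≠ 0 := hdet _ hq
    have hDd' : HasFDerivAt (fun y => frameDet X x (φ.symm y)) Dd y := hDd
    have hDv' : Dd v = frameDet X x (φ.symm y) * (∑ k, C j k k (φ.symm y)
      + ∑ i, m' i j (EuclideanSpace.single i 1)) := hDv
    have hrd : HasFDerivAt (fun y => |frameDet X x (φ.symm y)|⁻¹) _ y :=
      HasDerivAt.comp_hasFDerivAt (h₂ := fun s : ℝ => |s|⁻¹) y ((hasDerivAt_abs hd0).inv (abs_ne_zero.2 hd0)) hDd'
    set r := |frameDet X x (φ.symm y)|⁻¹ with hrr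
    set s := (-(SignType.sign (frameDet X x (φ.symm y)) : ℝ) / |frameDet X x (φ.symm y)| ^ 2) with hs
    have hGd (i) : fderiv ℝ (H i) y (EuclideanSpace.single i 1) = u (φ.symm y) *
        (r * m' i j (EuclideanSpace.single i 1) + frameEntry X x i j (φ.symm y) *
          (s * Dd (EuclideanSpace.single i 1)))
        + (r * frameEntry X x i j (φ.symm y)) * u' (EuclideanSpace.single i 1) := by
      rw [(indicator_eventuallyEq_self hV (G i) hy).fderiv_eq]
      exact DFunLike.congr_fun (e1.mul (hrd.mul (e2 i j))).fderiv (EuclideanSpace.single i 1)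
    simp only [hGd, D]
    rw [hdu]
    -- The factor s is the derivative of t ↦ |t|⁻¹ at the determinant; this relation treats both
    -- signs of the determinant at once.
    have hsr : s * frameDet X x (φ.symm y) = - r := by
      rw [hs, hrr]
      have : (SignType.sign (frameDet X x (φ.symm y)) : ℝ) * frameDet X x (φ.symm y)
        = |frameDet X x (φ.symm y)| := sign_mul_self _
      have h0 := abs_ne_zero.2 hd0
      field_simp
      linarith
    have hu1 : u' v = ∑ i, frameEntry X x i j (φ.symm y) * u' (EuclideanSpace.single i 1) := by
      rw [hv, map_sum]; simp
    have hD1 : Dd v = ∑ i, frameEntry X x i j (φ.symm y) * Dd (EuclideanSpace.single i 1) := by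
      rw [hv, map_sum]; simp
    rw [hD1] at hDv'
    rw [hu1]
    simp only [Fin.sum_univ_three] at hDv' ⊢
    linear_combination (u (φ.symm y) * s) * hDv' + u (φ.symm y) * (C j 0 0 (φ.symm y) + C j 1 1 (φ.symm y) + C j 2 2 (φ.symm y)
      + (m' 0 j (EuclideanSpace.single 0 1) + m' 1 j (EuclideanSpace.single 1 1) + m' 2 j (EuclideanSpace.single 2 1))) * hsr
  change ∫ q, D q ∂(riemannianVolume g) = 0
  rw [integral_riemannianVolume_frame hg hW hX hx hgX hDc hD0, ← integral_indicator hV.measurableSet]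
  refine (integral_congr_ae (Eventually.of_forall fun y => (key y).symm)).trans ?_
  rw [integral_finsetSum _ fun i _ => (integral_fderiv_eq_zero volume (hHs i) (hHc i) _).1]
  exact Finset.sum_eq_zero fun i _ => (integral_fderiv_eq_zero volume (hHs i) (hHc i) _).2

end Divergence

/-! ### Derivatives on ℝ × N: index 0 is time, index j + 1 is the field X_j -/

section TubeDeriv
variable {N : Type*} [TopologicalSpace N] [ChartedSpace (EuclideanSpace ℝ (Fin 3)) N]
  {E : Type*} [NormedAddCommGroup E] [NormedSpace ℝ E]
  {F : Type*} [NormedAddCommGroup F] [NormedSpace ℝ F]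
  {G : Type*} [NormedAddCommGroup G] [NormedSpace ℝ G]

/-- The derivatives in the direction of `ℝ` and along the vector fields `X j`. -/
def tubeDeriv (X : Fin 3 → ∀ p : N, TangentSpace (𝓡 3) p) (a : Fin 4) (f : ℝ × N → E) : ℝ × N → E :=
  Fin.cases (timeDeriv f) (fun j => fieldDeriv (X j) f) a

variable (X : Fin 3 → ∀ p : N, TangentSpace (𝓡 3) p)

theorem tubeDeriv_zero (f : ℝ × N → E) : tubeDeriv X 0 f = timeDeriv f := rfl

theorem tubeDeriv_succ (j : Fin 3) (f : ℝ × N → E) : tubeDeriv X j.succ f = fieldDeriv (X j) f := rfl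

/-- The vector fields on `ℝ × N` given by the direction of `ℝ` and a frame of `N`. -/
def tubeField (a : Fin 4) (z : ℝ × N) : ℝ × EuclideanSpace ℝ (Fin 3) :=
  Fin.cases ((1 : ℝ), (0 : EuclideanSpace ℝ (Fin 3))) (fun j => ((0 : ℝ), X j z.2)) a

theorem tubeDeriv_eq_mfderiv {f : ℝ × N → E} {z : ℝ × N}
    (hf : MDifferentiableAt (𝓘(ℝ, ℝ).prod (𝓡 3)) 𝓘(ℝ, E) f z) (a : Fin 4) :
    tubeDeriv X a f z = (mfderiv (𝓘(ℝ, ℝ).prod (𝓡 3)) 𝓘(ℝ, E) f z) (tubeField X a z) := by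
  refine Fin.cases ?_ (fun j => ?_) a
  · exact timeDeriv_eq_mfderiv hf
  · exact fieldDeriv_eq_mfderiv (X j) hf

theorem tubeDeriv_comp {f : ℝ × N → E} {z : ℝ × N}
    (hf : MDifferentiableAt (𝓘(ℝ, ℝ).prod (𝓡 3)) 𝓘(ℝ, E) f z) {g : E → F}
    (hg : DifferentiableAt ℝ g (f z)) (a : Fin 4) :
    tubeDeriv X a (fun z => g (f z)) z = fderiv ℝ g (f z) (tubeDeriv X a f z) := by
  have hgf : MDifferentiableAt (𝓘(ℝ, ℝ).prod (𝓡 3)) 𝓘(ℝ, F) (fun z => g (f z)) z :=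
    hg.mdifferentiableAt.comp z hf
  rw [tubeDeriv_eq_mfderiv X hgf, tubeDeriv_eq_mfderiv X hf]
  have h1 := DFunLike.congr_fun (mfderiv_comp z hg.mdifferentiableAt hf) (tubeField X a z)
  rw [mfderiv_eq_fderiv] at h1
  exact h1

theorem tubeDeriv_prodMk {f : ℝ × N → E} {g : ℝ × N → F} {z : ℝ × N}
    (hf : MDifferentiableAt (𝓘(ℝ, ℝ).prod (𝓡 3)) 𝓘(ℝ, E) f z)
    (hg : MDifferentiableAt (𝓘(ℝ, ℝ).prod (𝓡 3)) 𝓘(ℝ, F) g z) (a : Fin 4) :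
    MDifferentiableAt (𝓘(ℝ, ℝ).prod (𝓡 3)) 𝓘(ℝ, E × F) (fun z => (f z, g z)) z ∧
    tubeDeriv X a (fun z => (f z, g z)) z = (tubeDeriv X a f z, tubeDeriv X a g z) := by
  have h0 : MDifferentiableAt (𝓘(ℝ, ℝ).prod (𝓡 3)) 𝓘(ℝ, E × F) (fun z => (f z, g z)) z :=
    hf.prodMk_space hg
  refine ⟨h0, ?_⟩
  have h1 := tubeDeriv_comp X h0 (g := Prod.fst) differentiableAt_fst a
  have h2 := tubeDeriv_comp X h0 (g := Prod.snd) differentiableAt_snd a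
  rw [fderiv_fst] at h1
  rw [fderiv_snd] at h2
  exact Prod.ext h1.symm h2.symm

theorem tubeDeriv_bilin (L : E →L[ℝ] F →L[ℝ] G) {f : ℝ × N → E} {g : ℝ × N → F} {z : ℝ × N}
    (hf : MDifferentiableAt (𝓘(ℝ, ℝ).prod (𝓡 3)) 𝓘(ℝ, E) f z)
    (hg : MDifferentiableAt (𝓘(ℝ, ℝ).prod (𝓡 3)) 𝓘(ℝ, F) g z) (a : Fin 4) :
    tubeDeriv X a (fun z => L (f z) (g z)) z
      = L (tubeDeriv X a f z) (g z) + L (f z) (tubeDeriv X a g z) := by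
  obtain ⟨h0, h1⟩ := tubeDeriv_prodMk X hf hg a
  have hL := L.isBoundedBilinearMap.hasFDerivAt (f z, g z)
  have h2 := tubeDeriv_comp X h0 (g := fun p : E × F => L p.1 p.2) hL.differentiableAt a
  rw [hL.fderiv, h1] at h2
  refine h2.trans ?_
  simp [IsBoundedBilinearMap.deriv, add_comm]

theorem tubeDeriv_mul {f g : ℝ × N → ℝ} {z : ℝ × N}
    (hf : MDifferentiableAt (𝓘(ℝ, ℝ).prod (𝓡 3)) 𝓘(ℝ, ℝ) f z)
    (hg : MDifferentiableAt (𝓘(ℝ, ℝ).prod (𝓡 3)) 𝓘(ℝ, ℝ) g z) (a : Fin 4) :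
    tubeDeriv X a (fun z => f z * g z) z = tubeDeriv X a f z * g z + f z * tubeDeriv X a g z :=
  tubeDeriv_bilin X (ContinuousLinearMap.mul ℝ ℝ) hf hg a

theorem tubeDeriv_add {f g : ℝ × N → E} {z : ℝ × N}
    (hf : MDifferentiableAt (𝓘(ℝ, ℝ).prod (𝓡 3)) 𝓘(ℝ, E) f z)
    (hg : MDifferentiableAt (𝓘(ℝ, ℝ).prod (𝓡 3)) 𝓘(ℝ, E) g z) (a : Fin 4) :
    tubeDeriv X a (fun z => f z + g z) z = tubeDeriv X a f z + tubeDeriv X a g z := by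
  have h0 : MDifferentiableAt (𝓘(ℝ, ℝ).prod (𝓡 3)) 𝓘(ℝ, E) (fun z => f z + g z) z := hf.add hg
  rw [tubeDeriv_eq_mfderiv X hf, tubeDeriv_eq_mfderiv X hg, tubeDeriv_eq_mfderiv X h0]
  exact DFunLike.congr_fun (hf.hasMFDerivAt.add hg.hasMFDerivAt).mfderiv (tubeField X a z)

theorem tubeDeriv_congr {f g : ℝ × N → E} {z : ℝ × N}
    (hf : MDifferentiableAt (𝓘(ℝ, ℝ).prod (𝓡 3)) 𝓘(ℝ, E) f z) (hfg : f =ᶠ[𝓝 z] g) (a : Fin 4) :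
    tubeDeriv X a f z = tubeDeriv X a g z := by
  rw [tubeDeriv_eq_mfderiv X hf, tubeDeriv_eq_mfderiv X (hf.congr_of_eventuallyEq hfg.symm), hfg.mfderiv_eq]
  rfl

theorem tubeDeriv_const (c : E) (z : ℝ × N) (a : Fin 4) : tubeDeriv X a (fun _ => c) z = 0 := by
  rw [tubeDeriv_eq_mfderiv X mdifferentiableAt_const, mfderiv_const]
  rfl

theorem tubeDeriv_eq_zero_of_notMem_tsupport {f : ℝ × N → E} {z : ℝ × N} (hz : z ∉ tsupport f) (a : Fin 4) :
    tubeDeriv X a f z = 0 := by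
  have h1 : (fun _ => (0 : E)) =ᶠ[𝓝 z] f := by
    filter_upwards [(isClosed_tsupport f).isOpen_compl.mem_nhds hz] with w hw
    exact (image_eq_zero_of_notMem_tsupport hw).symm
  rw [← tubeDeriv_congr X mdifferentiableAt_const h1, tubeDeriv_const]

theorem tubeDeriv_sub {f g : ℝ × N → E} {z : ℝ × N}
    (hf : MDifferentiableAt (𝓘(ℝ, ℝ).prod (𝓡 3)) 𝓘(ℝ, E) f z)
    (hg : MDifferentiableAt (𝓘(ℝ, ℝ).prod (𝓡 3)) 𝓘(ℝ, E) g z) (a : Fin 4) :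
    tubeDeriv X a (fun z => f z - g z) z = tubeDeriv X a f z - tubeDeriv X a g z := by
  have h0 : MDifferentiableAt (𝓘(ℝ, ℝ).prod (𝓡 3)) 𝓘(ℝ, E) (fun z => f z - g z) z := hf.sub hg
  rw [tubeDeriv_eq_mfderiv X hf, tubeDeriv_eq_mfderiv X hg, tubeDeriv_eq_mfderiv X h0]
  exact DFunLike.congr_fun (hf.hasMFDerivAt.sub hg.hasMFDerivAt).mfderiv (tubeField X a z)

theorem tubeDeriv_sum {ι : Type*} (s : Finset ι) {f : ι → ℝ × N → E} {z : ℝ × N}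
    (hf : ∀ i ∈ s, MDifferentiableAt (𝓘(ℝ, ℝ).prod (𝓡 3)) 𝓘(ℝ, E) (f i) z) (a : Fin 4) :
    MDifferentiableAt (𝓘(ℝ, ℝ).prod (𝓡 3)) 𝓘(ℝ, E) (fun z => ∑ i ∈ s, f i z) z ∧
    tubeDeriv X a (fun z => ∑ i ∈ s, f i z) z = ∑ i ∈ s, tubeDeriv X a (f i) z := by
  classical
  induction s using Finset.induction_on with
  | empty => exact ⟨by simpa using mdifferentiableAt_const, by simpa using tubeDeriv_const X 0 z a⟩
  | insert i s hi ih =>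
    obtain ⟨h1, h2⟩ := ih fun j hj => hf j (Finset.mem_insert_of_mem hj)
    simp only [Finset.sum_insert hi]
    have h0 := hf i (Finset.mem_insert_self i s)
    exact ⟨h0.add h1, by rw [tubeDeriv_add X h0 h1, h2]⟩

variable {X}
variable [IsManifold (𝓡 3) ∞ N] {W : Set N}

theorem SmoothTubeOn.tubeDeriv (hW : IsOpen W) (hX : ∀ k, SmoothFieldOn (X k) W) {f : ℝ × N → E}
    (hf : SmoothTubeOn f W) (a : Fin 4) : SmoothTubeOn (tubeDeriv X a f) W := by
  refine Fin.cases ?_ (fun j => ?_) a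
  · exact SmoothTubeOn.timeDeriv hW hf
  · exact SmoothTubeOn.fieldDeriv hW hf (hX j)

theorem SmoothTubeOn.bilin (L : E →L[ℝ] F →L[ℝ] G) {f : ℝ × N → E} {g : ℝ × N → F}
    (hf : SmoothTubeOn f W) (hg : SmoothTubeOn g W) : SmoothTubeOn (fun z => L (f z) (g z)) W :=
  (L.contDiff.contMDiff.comp_contMDiffOn hf).clm_apply hg

theorem SmoothTubeOn.mul {f g : ℝ × N → ℝ}
    (hf : SmoothTubeOn f W) (hg : SmoothTubeOn g W) : SmoothTubeOn (fun z => f z * g z) W :=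
  hf.bilin (ContinuousLinearMap.mul ℝ ℝ) hg

theorem SmoothTubeOn.comp_snd {f : N → E} (hf : ContMDiffOn (𝓡 3) 𝓘(ℝ, E) ∞ f W) :
    SmoothTubeOn (fun z => f z.2) W :=
  hf.comp contMDiffOn_snd fun _ hz => hz.2

/-- The structure functions of the frame of `ℝ × N` given by a frame of `N`. -/
def tubeCoeff (C : Fin 3 → Fin 3 → Fin 3 → N → ℝ) (a b c : Fin 4) (p : N) : ℝ :=
  Fin.cases 0 (fun j => Fin.cases 0 (fun k => Fin.cases 0 (fun l => C j k l p) c) b) a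

/-- The frame does not depend on t, so only pairs of fields on N have a nonzero commutator, and that
one is their Lie bracket. -/
theorem tubeDeriv_comm (hW : IsOpen W) (hX : ∀ k, SmoothFieldOn (X k) W)
    {C : Fin 3 → Fin 3 → Fin 3 → N → ℝ}
    (hC : ∀ j k, ∀ q ∈ W, VectorField.mlieBracket (𝓡 3) (X j) (X k) q = ∑ l, C j k l q • X l q)
    {f : ℝ × N → E} (hf : SmoothTubeOn f W) (a b : Fin 4) {z : ℝ × N} (hz : z.2 ∈ W) :
    tubeDeriv X a (tubeDeriv X b f) z - tubeDeriv X b (tubeDeriv X a f) z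
      = ∑ c, tubeCoeff C a b c z.2 • tubeDeriv X c f z := by
  refine Fin.cases ?_ (fun j => ?_) a <;> refine Fin.cases ?_ (fun k => ?_) b
  · simp [tubeCoeff]
  · have := timeDeriv_fieldDeriv_comm hW hf (X k) hz
    simp only [tubeDeriv_zero, tubeDeriv_succ, this, sub_self]
    simp [tubeCoeff]
  · have := timeDeriv_fieldDeriv_comm hW hf (X j) hz
    simp only [tubeDeriv_zero, tubeDeriv_succ, this, sub_self]
    refine (Finset.sum_eq_zero fun c _ => ?_).symm
    rw [show tubeCoeff C j.succ 0 c z.2 = 0 from rfl, zero_smul]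
  · simp only [tubeDeriv_succ]
    rw [fieldDeriv_fieldDeriv_comm hW hf (hX j) (hX k) hz, Fin.sum_univ_succ]
    rw [show tubeCoeff C j.succ k.succ 0 z.2 = 0 from rfl, zero_smul, zero_add]
    unfold fieldDeriv dirDeriv
    refine (congrArg _ (hC j k z.2 hz)).trans ?_
    refine (map_sum (mfderiv (𝓡 3) 𝓘(ℝ, E) (fun q => f (z.1, q)) z.2) _ _).trans ?_
    refine Finset.sum_congr rfl fun l _ => ?_
    exact map_smul (mfderiv (𝓡 3) 𝓘(ℝ, E) (fun q => f (z.1, q)) z.2) _ _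

end TubeDeriv

section TubeIntegral
variable {N : Type*} [TopologicalSpace N] [ChartedSpace (EuclideanSpace ℝ (Fin 3)) N]
  [IsManifold (𝓡 3) ∞ N] [T2Space N] [SecondCountableTopology N] [MeasurableSpace N] [BorelSpace N]
  {X : Fin 3 → ∀ p : N, TangentSpace (𝓡 3) p} {W : Set N}

theorem integrable_of_continuousOn_tube {ν : Measure N} [IsFiniteMeasureOnCompacts ν] [SFinite ν] {f : ℝ × N → ℝ}
    {K : Set (ℝ × N)} (hK : IsCompact K) (hf : ContinuousOn f K) (hf0 : ∀ z ∉ K, f z = 0) :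
    Integrable f ((volume : Measure ℝ).prod ν) := by
  rw [← integrableOn_iff_integrable_of_support_subset (s := K)]
  · exact hf.integrableOn_compact hK
  · intro z hz
    by_contra h
    exact hz (hf0 z h)

/-- The divergence theorem on `ℝ × N`. -/
theorem integral_tubeDeriv {ν : Measure N} [IsFiniteMeasureOnCompacts ν] [SFinite ν] (hW : IsOpen W)
    (hX : ∀ k, SmoothFieldOn (X k) W) {C : Fin 3 → Fin 3 → Fin 3 → N → ℝ} (hCc : ∀ j k l, ContinuousOn (C j k l) W)
    (hdiv : ∀ u : N → ℝ, ContMDiffOn (𝓡 3) 𝓘(ℝ, ℝ) ∞ u W → HasCompactSupport u → tsupport u ⊆ W → ∀ j,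
      ∫ q, (dirDeriv u q (X j q) - (∑ k, C j k k q) * u q) ∂ν = 0)
    {u : ℝ × N → ℝ} (hu : SmoothTubeOn u W) (hus : HasCompactSupport u) (huW : tsupport u ⊆ univ ×ˢ W)
    (a : Fin 4) :
    ∫ z, (tubeDeriv X a u z - (∑ b, tubeCoeff C a b b z.2) * u z) ∂((volume : Measure ℝ).prod ν) = 0 := by
  have hcD : ContinuousOn (tubeDeriv X a u) (tsupport u) :=
    (SmoothTubeOn.tubeDeriv hW hX hu a).continuousOn.mono huW
  have hiD : Integrable (tubeDeriv X a u) ((volume : Measure ℝ).prod ν) :=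
    integrable_of_continuousOn_tube hus.isCompact hcD fun z hz => tubeDeriv_eq_zero_of_notMem_tsupport X hz a
  have hu0 : ∀ z : ℝ × N, z.2 ∉ W → u z = 0 := fun z hz =>
    image_eq_zero_of_notMem_tsupport fun h => hz (huW h).2
  revert hcD hiD
  refine Fin.cases ?_ (fun j => ?_) a
  · intro hcD hiD
    have : ∀ z : ℝ × N, (∑ b, tubeCoeff C 0 b b z.2) * u z = 0 := fun z => by simp [tubeCoeff]
    simp only [this, sub_zero]
    -- In the time direction the inner integral is over t, by the fundamental theorem of calculus;
    -- in the directions of N, treated below, the inner integral is over N and vanishes by the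
    -- divergence theorem.
    rw [integral_prod_symm _ hiD]
    refine integral_eq_zero_of_ae (Eventually.of_forall fun q => ?_)
    change ∫ t, deriv (fun s => u (s, q)) t = 0
    by_cases hq : q ∈ W
    · have hc : ContDiff ℝ ∞ (fun s => u (s, q)) := by
        rw [← contMDiff_iff_contDiff, ← contMDiffOn_univ]
        exact hu.comp (contMDiffOn_id.prodMk contMDiffOn_const) fun s _ => ⟨trivial, hq⟩
      have hs : HasCompactSupport (fun s => u (s, q)) := by
        refine HasCompactSupport.intro (hus.isCompact.image continuous_fst) fun t ht => ?_
        exact image_eq_zero_of_notMem_tsupport fun h => ht ⟨_, h, rfl⟩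
      have := (integral_fderiv_eq_zero volume hc hs (1 : ℝ)).2
      simpa using this
    · have : ∀ t : ℝ, deriv (fun s => u (s, q)) t = 0 := fun t => by
        rw [show (fun s => u (s, q)) = fun _ => 0 from funext fun s => hu0 _ hq]
        simp
      simp [this]
  · intro hcD hiD
    have hsum : ∀ p, ∑ b, tubeCoeff C j.succ b b p = ∑ k, C j k k p := fun p => by
      rw [Fin.sum_univ_succ]; simp [tubeCoeff]
    simp only [hsum]
    have hi2 : Integrable (fun z : ℝ × N => (∑ k, C j k k z.2) * u z) ((volume : Measure ℝ).prod ν) := by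
      refine integrable_of_continuousOn_tube hus.isCompact ?_ fun z hz => ?_
      · refine ContinuousOn.mul ?_ (hu.continuousOn.mono huW)
        have hc : ContinuousOn (fun p => ∑ k, C j k k p) W := continuousOn_finsetSum _ fun k _ => hCc j k k
        exact hc.comp continuousOn_snd fun z hz => (huW hz).2
      · rw [image_eq_zero_of_notMem_tsupport hz, mul_zero]
    refine (integral_prod _ (hiD.sub hi2)).trans ?_
    refine integral_eq_zero_of_ae (Eventually.of_forall fun t => ?_)
    have hs : tsupport (fun q => u (t, q)) ⊆ (fun q => (t, q)) ⁻¹' tsupport u := by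
      refine closure_minimal (fun q hq => subset_tsupport u hq) ?_
      exact (isClosed_tsupport u).preimage (by fun_prop)
    refine hdiv (fun q => u (t, q)) (hu.slice t) ?_ (fun q hq => (huW (hs hq)).2) j
    refine HasCompactSupport.intro (hus.isCompact.image continuous_snd) fun q hq => ?_
    exact image_eq_zero_of_notMem_tsupport fun h => hq ⟨_, h, rfl⟩

end TubeIntegral

/-! ### Limits in L², test functions and weak derivatives -/

section BilinearLimit
variable {Ω : Type*} [MeasurableSpace Ω] {μ : Measure Ω}
  {E : Type*} [NormedAddCommGroup E] [NormedSpace ℝ E]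
  {F : Type*} [NormedAddCommGroup F] [NormedSpace ℝ F]

theorem integrable_mul_bilin (L : E →L[ℝ] F →L[ℝ] ℝ) {κ : Ω → ℝ} (hκ : AEStronglyMeasurable κ μ) {M : ℝ}
    (hM : ∀ᵐ z ∂μ, |κ z| ≤ M) {f : Ω → E} {g : Ω → F} (hf : MemLp f 2 μ) (hg : MemLp g 2 μ) :
    Integrable (fun z => κ z * L (f z) (g z)) μ := by
  have h1 : Integrable (fun z => L (f z) (g z)) μ := memLp_one_iff_integrable.1 (L.memLp_of_bilin 1 hf hg)
  exact h1.bdd_mul hκ hM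

/-- Expanding L(f_m, g_m) around (f, g) leaves three error terms. By Hölder's inequality each is
bounded in L¹ by a product of two L² norms, of which at least one tends to zero and the other stays
bounded. -/
theorem tendsto_integral_bilin (L : E →L[ℝ] F →L[ℝ] ℝ) {κ : Ω → ℝ} (hκ : AEStronglyMeasurable κ μ) {M : ℝ}
    (hM : ∀ᵐ z ∂μ, |κ z| ≤ M) {f : Ω → E} {g : Ω → F} {f' : ℕ → Ω → E} {g' : ℕ → Ω → F}
    (hf : MemLp f 2 μ) (hg : MemLp g 2 μ) (hf' : ∀ m, AEStronglyMeasurable (f' m) μ)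
    (hg' : ∀ m, AEStronglyMeasurable (g' m) μ)
    (hft : Tendsto (fun m => eLpNorm (f' m - f) 2 μ) atTop (𝓝 0))
    (hgt : Tendsto (fun m => eLpNorm (g' m - g) 2 μ) atTop (𝓝 0)) :
    Tendsto (fun m => ∫ z, κ z * L (f' m z) (g' m z) ∂μ) atTop (𝓝 (∫ z, κ z * L (f z) (g z) ∂μ)) := by
  have hi := integrable_mul_bilin L hκ hM hf hg
  have hMemf : ∀ᶠ m in atTop, MemLp (f' m - f) 2 μ := by
    filter_upwards [hft.eventually_lt_const ENNReal.zero_lt_top] with m hm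
    exact ⟨(hf' m).sub hf.1, hm⟩
  have hMemg : ∀ᶠ m in atTop, MemLp (g' m - g) 2 μ := by
    filter_upwards [hgt.eventually_lt_const ENNReal.zero_lt_top] with m hm
    exact ⟨(hg' m).sub hg.1, hm⟩
  have hdec : ∀ m, (fun z => κ z * L (f' m z) (g' m z)) = fun z => κ z * L ((f' m - f) z) ((g' m - g) z)
      + κ z * L ((f' m - f) z) (g z) + κ z * L (f z) ((g' m - g) z) + κ z * L (f z) (g z) := by
    intro m
    funext z
    simp only [Pi.sub_apply, map_sub, sub_apply]
    ring
  have hM0 : ∀ᵐ z ∂μ, ‖κ z‖ ≤ max M 0 := by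
    filter_upwards [hM] with z hz using hz.trans (le_max_left _ _)
  have bound (p : Ω → E) (q : Ω → F) (hp : AEStronglyMeasurable p μ) (hq : AEStronglyMeasurable q μ) :
      eLpNorm (fun z => κ z * L (p z) (q z)) 1 μ
        ≤ ENNReal.ofReal (max M 0) * ((‖L‖₊ : ℝ≥0∞) * eLpNorm p 2 μ * eLpNorm q 2 μ) := by
    have h1 : eLpNorm (fun z => L (p z) (q z)) 1 μ ≤ (‖L‖₊ : ℝ≥0∞) * eLpNorm p 2 μ * eLpNorm q 2 μ :=
      eLpNorm_le_eLpNorm_mul_eLpNorm_of_nnnorm hp hq (fun u v => L u v) ‖L‖₊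
        (Eventually.of_forall fun z => L.le_opNorm₂ _ _)
    refine le_trans ?_ (mul_le_mul_right h1 _)
    refine eLpNorm_le_mul_eLpNorm_of_ae_le_mul ?_ 1
    filter_upwards [hM0] with z hz
    rw [norm_mul]
    exact mul_le_mul_of_nonneg_right hz (norm_nonneg _)
  have small (p : ℕ → Ω → E) (q : ℕ → Ω → F) (hp : ∀ m, AEStronglyMeasurable (p m) μ)
      (hq : ∀ m, AEStronglyMeasurable (q m) μ)
      (h0 : Tendsto (fun m => eLpNorm (p m) 2 μ * eLpNorm (q m) 2 μ) atTop (𝓝 0)) :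
      Tendsto (fun m => eLpNorm (fun z => κ z * L (p m z) (q m z)) 1 μ) atTop (𝓝 0) := by
    have h2 : Tendsto (fun m => ENNReal.ofReal (max M 0) *
        ((‖L‖₊ : ℝ≥0∞) * eLpNorm (p m) 2 μ * eLpNorm (q m) 2 μ)) atTop (𝓝 0) := by
      have := ENNReal.Tendsto.const_mul (a := ENNReal.ofReal (max M 0) * (‖L‖₊ : ℝ≥0∞)) h0
        (Or.inr (ENNReal.mul_ne_top ENNReal.ofReal_ne_top ENNReal.coe_ne_top))
      simpa [mul_assoc] using this
    exact tendsto_of_tendsto_of_tendsto_of_le_of_le tendsto_const_nhds h2 (fun _ => zero_le)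
      fun m => bound _ _ (hp m) (hq m)
  refine tendsto_integral_of_L1' _ hi.1 ?_ ?_
  · filter_upwards [hMemf, hMemg] with m h1 h2
    rw [hdec]
    exact (((integrable_mul_bilin L hκ hM h1 h2).add (integrable_mul_bilin L hκ hM h1 hg)).add
      (integrable_mul_bilin L hκ hM hf h2)).add hi
  · have t1 := small (fun m => f' m - f) (fun m => g' m - g) (fun m => (hf' m).sub hf.1)
      (fun m => (hg' m).sub hg.1) (by
        have := ENNReal.Tendsto.mul hft (Or.inr (by simp)) hgt (Or.inr (by simp)); simpa using this)
    have t2 := small (fun m => f' m - f) (fun _ => g) (fun m => (hf' m).sub hf.1)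
      (fun m => hg.1) (by
        have := ENNReal.Tendsto.mul_const (b := eLpNorm g 2 μ) hft (Or.inr hg.2.ne); simpa using this)
    have t3 := small (fun m => f) (fun m => g' m - g) (fun m => hf.1)
      (fun m => (hg' m).sub hg.1) (by
        have := ENNReal.Tendsto.const_mul (a := eLpNorm f 2 μ) hgt (Or.inr hf.2.ne); simpa using this)
    have t4 := (t1.add t2).add t3
    rw [add_zero, add_zero] at t4
    have meas (p : Ω → E) (q : Ω → F) (hp : AEStronglyMeasurable p μ) (hq : AEStronglyMeasurable q μ) :
        AEStronglyMeasurable (fun z => κ z * L (p z) (q z)) μ :=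
      hκ.mul (L.aestronglyMeasurable_comp₂ hp hq)
    refine tendsto_of_tendsto_of_tendsto_of_le_of_le tendsto_const_nhds t4 (fun _ => zero_le) fun m => ?_
    have e : ((fun z => κ z * L (f' m z) (g' m z)) - fun z => κ z * L (f z) (g z))
        = ((fun z => κ z * L ((f' m - f) z) ((g' m - g) z)) + fun z => κ z * L ((f' m - f) z) (g z))
          + fun z => κ z * L (f z) ((g' m - g) z) := by
      rw [hdec m]
      funext z
      simp only [Pi.sub_apply, Pi.add_apply]
      ring
    rw [e]
    refine (eLpNorm_add_le ((meas _ _ ((hf' m).sub hf.1) ((hg' m).sub hg.1)).add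
      (meas _ _ ((hf' m).sub hf.1) hg.1)) (meas _ _ hf.1 ((hg' m).sub hg.1)) le_rfl).trans ?_
    exact add_le_add_left (eLpNorm_add_le (meas _ _ ((hf' m).sub hf.1) ((hg' m).sub hg.1))
      (meas _ _ ((hf' m).sub hf.1) hg.1) le_rfl) _

end BilinearLimit

section WeakDeriv
variable {N : Type*} [TopologicalSpace N] [ChartedSpace (EuclideanSpace ℝ (Fin 3)) N]
  [IsManifold (𝓡 3) ∞ N] [T2Space N] [SecondCountableTopology N] [MeasurableSpace N] [BorelSpace N]
  {E : Type*} [NormedAddCommGroup E] [NormedSpace ℝ E]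
  {F : Type*} [NormedAddCommGroup F] [NormedSpace ℝ F]

/-- A smooth frame over the open set `W` with structure functions `C` for which the divergence
theorem holds. -/
structure DivFrame (ν : Measure N) (X : Fin 3 → ∀ p : N, TangentSpace (𝓡 3) p) (W : Set N)
    (C : Fin 3 → Fin 3 → Fin 3 → N → ℝ) : Prop where
  isOpen : IsOpen W
  smooth : ∀ k, SmoothFieldOn (X k) W
  continuousOn : ∀ j k l, ContinuousOn (C j k l) W
  bracket : ∀ j k, ∀ q ∈ W, VectorField.mlieBracket (𝓡 3) (X j) (X k) q = ∑ l, C j k l q • X l q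
  divergence : ∀ u : N → ℝ, ContMDiffOn (𝓡 3) 𝓘(ℝ, ℝ) ∞ u W → HasCompactSupport u → tsupport u ⊆ W →
    ∀ j, ∫ q, (dirDeriv u q (X j q) - (∑ k, C j k k q) * u q) ∂ν = 0

/-- Smooth functions with compact support in `K`. -/
structure IsTest (W : Set N) (K : Set (ℝ × N)) (φ : ℝ × N → ℝ) : Prop where
  smooth : SmoothTubeOn φ W
  compact : HasCompactSupport φ
  subset : tsupport φ ⊆ K

/-- Minus the formal adjoint of the `a`-th derivative. -/
def adjDeriv (X : Fin 3 → ∀ p : N, TangentSpace (𝓡 3) p) (C : Fin 3 → Fin 3 → Fin 3 → N → ℝ) (a : Fin 4)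
    (φ : ℝ × N → ℝ) (z : ℝ × N) : ℝ :=
  tubeDeriv X a φ z - (∑ b, tubeCoeff C a b b z.2) * φ z

/-- Over `K` the function `f` is an `L²` limit of smooth functions whose derivatives
converge in `L²` to `f' a`. -/
structure SobolevOn (μ : Measure (ℝ × N)) (X : Fin 3 → ∀ p : N, TangentSpace (𝓡 3) p) (W : Set N)
    (K : Set (ℝ × N)) (f : ℝ × N → E) (f' : Fin 4 → ℝ × N → E) : Prop where
  memLp : MemLp f 2 (μ.restrict K)
  memLp_deriv : ∀ a, MemLp (f' a) 2 (μ.restrict K)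
  approx : ∃ F : ℕ → ℝ × N → E, (∀ m, SmoothTubeOn (F m) W) ∧
    Tendsto (fun m => eLpNorm (F m - f) 2 (μ.restrict K)) atTop (𝓝 0) ∧
    ∀ a, Tendsto (fun m => eLpNorm (tubeDeriv X a (F m) - f' a) 2 (μ.restrict K)) atTop (𝓝 0)

theorem HasSobolevDeriv.sobolevOn {μ : Measure (ℝ × N)} {X : Fin 3 → ∀ p : N, TangentSpace (𝓡 3) p}
    {W : Set N} {f ft : ℝ × N → E} {fX : Fin 3 → ℝ × N → E} (h : HasSobolevDeriv μ X W f ft fX)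
    {K : Set (ℝ × N)} (hK : IsCompact K) (hKW : K ⊆ univ ×ˢ W) :
    SobolevOn μ X W K f (Fin.cases ft fX) := by
  obtain ⟨h1, h2, h3, F, h4, h5, h6, h7⟩ := h K hK hKW
  refine ⟨h1, Fin.cases h2 h3, F, h4, h5, Fin.cases h6 h7⟩

variable {ν : Measure N} [IsFiniteMeasureOnCompacts ν] [SFinite ν]
  {X : Fin 3 → ∀ p : N, TangentSpace (𝓡 3) p} {W : Set N}
  {C : Fin 3 → Fin 3 → Fin 3 → N → ℝ} {K : Set (ℝ × N)} {φ : ℝ × N → ℝ}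

theorem continuousOn_tubeCoeff (H : DivFrame ν X W C) (a b c : Fin 4) :
    ContinuousOn (fun z : ℝ × N => tubeCoeff C a b c z.2) (univ ×ˢ W) := by
  have h0 : ContinuousOn (fun _ : ℝ × N => (0 : ℝ)) (univ ×ˢ W) := continuousOn_const
  refine Fin.cases h0 (fun j => Fin.cases h0 (fun k => Fin.cases h0 (fun l => ?_) c) b) a
  exact (H.continuousOn j k l).comp continuousOn_snd fun z hz => hz.2

theorem continuousOn_adjDeriv (H : DivFrame ν X W C) (hφ : SmoothTubeOn φ W) (a : Fin 4) :
    ContinuousOn (adjDeriv X C a φ) (univ ×ˢ W) :=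
  (SmoothTubeOn.tubeDeriv H.isOpen H.smooth hφ a).continuousOn.sub
    ((continuousOn_finsetSum _ fun b _ => continuousOn_tubeCoeff H a b b).mul hφ.continuousOn)

theorem aesm_of_continuousOn {f : ℝ × N → E} (hK : IsCompact K) (hKW : K ⊆ univ ×ˢ W)
    (hf : ContinuousOn f (univ ×ˢ W)) :
    AEStronglyMeasurable f (((volume : Measure ℝ).prod ν).restrict K) :=
  (hf.mono hKW).aestronglyMeasurable hK.isClosed.measurableSet

theorem exists_bound_of_continuousOn {f : ℝ × N → ℝ} (hK : IsCompact K) (hKW : K ⊆ univ ×ˢ W)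
    (hf : ContinuousOn f (univ ×ˢ W)) :
    ∃ M : ℝ, ∀ᵐ z ∂(((volume : Measure ℝ).prod ν).restrict K), |f z| ≤ M := by
  obtain ⟨M, hM⟩ := hK.exists_bound_of_continuousOn (hf.mono hKW)
  exact ⟨M, ae_restrict_of_forall_mem hK.isClosed.measurableSet hM⟩

theorem IsTest.eq_zero (hφ : IsTest W K φ) {z : ℝ × N} (hz : z ∉ K) : φ z = 0 :=
  image_eq_zero_of_notMem_tsupport fun h => hz (hφ.subset h)

theorem IsTest.tubeDeriv_eq_zero (hφ : IsTest W K φ) {z : ℝ × N} (hz : z ∉ K) (a : Fin 4) :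
    tubeDeriv X a φ z = 0 :=
  tubeDeriv_eq_zero_of_notMem_tsupport X (fun h => hz (hφ.subset h)) a

theorem IsTest.mul (hφ : IsTest W K φ) {g : ℝ × N → ℝ} (hg : SmoothTubeOn g W) :
    IsTest W K (fun z => φ z * g z) :=
  ⟨hφ.smooth.mul hg, hφ.compact.mul_right, (tsupport_mul_subset_left).trans hφ.subset⟩

theorem IsTest.tubeDeriv (H : DivFrame ν X W C) (hφ : IsTest W K φ) (a : Fin 4) :
    IsTest W K (tubeDeriv X a φ) := by
  have hs : Function.support (AdiabaticSW.tubeDeriv X a φ) ⊆ tsupport φ := fun z hz => by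
    by_contra h
    exact hz (tubeDeriv_eq_zero_of_notMem_tsupport X h a)
  have ht := closure_minimal hs (isClosed_tsupport φ)
  exact ⟨SmoothTubeOn.tubeDeriv H.isOpen H.smooth hφ.smooth a, hφ.compact.of_isClosed_subset
    (isClosed_tsupport _) ht, ht.trans hφ.subset⟩

theorem integral_adjDeriv (H : DivFrame ν X W C) (hKW : K ⊆ univ ×ˢ W) (hφ : IsTest W K φ) (a : Fin 4) :
    ∫ z in K, adjDeriv X C a φ z ∂((volume : Measure ℝ).prod ν) = 0 := by
  rw [setIntegral_eq_integral_of_forall_compl_eq_zero]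
  · exact integral_tubeDeriv H.isOpen H.smooth H.continuousOn H.divergence hφ.smooth hφ.compact
      (hφ.subset.trans hKW) a
  · intro z hz
    simp only [adjDeriv]
    rw [hφ.tubeDeriv_eq_zero hz, hφ.eq_zero hz]
    simp

theorem adjDeriv_mul (H : DivFrame ν X W C) (hφ : SmoothTubeOn φ W) {g : ℝ × N → ℝ} (hg : SmoothTubeOn g W)
    (a : Fin 4) {z : ℝ × N} (hz : z.2 ∈ W) :
    adjDeriv X C a (fun z => φ z * g z) z = adjDeriv X C a φ z * g z + φ z * tubeDeriv X a g z := by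
  simp only [adjDeriv]
  rw [tubeDeriv_mul X (hφ.mdifferentiableAt H.isOpen hz) (hg.mdifferentiableAt H.isOpen hz)]
  ring

theorem integrableOn_mul_bilin (L : E →L[ℝ] F →L[ℝ] ℝ) {κ : ℝ × N → ℝ} (hK : IsCompact K)
    (hKW : K ⊆ univ ×ˢ W) (hκ : ContinuousOn κ (univ ×ˢ W)) {f : ℝ × N → E} {g : ℝ × N → F}
    (hf : MemLp f 2 (((volume : Measure ℝ).prod ν).restrict K))
    (hg : MemLp g 2 (((volume : Measure ℝ).prod ν).restrict K)) :
    IntegrableOn (fun z => κ z * L (f z) (g z)) K ((volume : Measure ℝ).prod ν) := by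
  obtain ⟨M, hM⟩ := exists_bound_of_continuousOn (ν := ν) hK hKW hκ
  exact integrable_mul_bilin L (aesm_of_continuousOn hK hKW hκ) hM hf hg

theorem memLp_of_continuousOn {f : ℝ × N → E} (hK : IsCompact K)
    (hKW : K ⊆ univ ×ˢ W) (hf : ContinuousOn f (univ ×ˢ W)) (p : ℝ≥0∞) :
    MemLp f p (((volume : Measure ℝ).prod ν).restrict K) := by
  obtain ⟨M, hM⟩ := hK.exists_bound_of_continuousOn (hf.mono hKW)
  have : IsFiniteMeasure (((volume : Measure ℝ).prod ν).restrict K) :=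
    ⟨by rw [Measure.restrict_apply_univ]; exact hK.measure_lt_top⟩
  exact MemLp.of_bound (aesm_of_continuousOn hK hKW hf) M
    (ae_restrict_of_forall_mem hK.isClosed.measurableSet hM)

theorem tendsto_integralOn_bilin (L : E →L[ℝ] F →L[ℝ] ℝ) {κ : ℝ × N → ℝ} (hK : IsCompact K)
    (hKW : K ⊆ univ ×ˢ W) (hκ : ContinuousOn κ (univ ×ˢ W)) {f : ℝ × N → E} {g : ℝ × N → F}
    {f' : ℕ → ℝ × N → E} {g' : ℕ → ℝ × N → F}
    (hf : MemLp f 2 (((volume : Measure ℝ).prod ν).restrict K))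
    (hg : MemLp g 2 (((volume : Measure ℝ).prod ν).restrict K))
    (hf' : ∀ m, SmoothTubeOn (f' m) W) (hg' : ∀ m, SmoothTubeOn (g' m) W)
    (hft : Tendsto (fun m => eLpNorm (f' m - f) 2 (((volume : Measure ℝ).prod ν).restrict K)) atTop (𝓝 0))
    (hgt : Tendsto (fun m => eLpNorm (g' m - g) 2 (((volume : Measure ℝ).prod ν).restrict K)) atTop (𝓝 0)) :
    Tendsto (fun m => ∫ z in K, κ z * L (f' m z) (g' m z) ∂((volume : Measure ℝ).prod ν)) atTop
      (𝓝 (∫ z in K, κ z * L (f z) (g z) ∂((volume : Measure ℝ).prod ν))) := by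
  obtain ⟨M, hM⟩ := exists_bound_of_continuousOn (ν := ν) hK hKW hκ
  exact tendsto_integral_bilin L (aesm_of_continuousOn hK hKW hκ) hM hf hg
    (fun m => aesm_of_continuousOn hK hKW (hf' m).continuousOn)
    (fun m => aesm_of_continuousOn hK hKW (hg' m).continuousOn) hft hgt

/-- The integrable function `s` has the weak derivative `s'` in the `a`-th direction over `K`. -/
structure IsWeakDeriv (ν : Measure N) (X : Fin 3 → ∀ p : N, TangentSpace (𝓡 3) p) (W : Set N)
    (C : Fin 3 → Fin 3 → Fin 3 → N → ℝ) (K : Set (ℝ × N)) (a : Fin 4) (s s' : ℝ × N → ℝ) : Prop where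
  integrable : IntegrableOn s K ((volume : Measure ℝ).prod ν)
  integrable_deriv : IntegrableOn s' K ((volume : Measure ℝ).prod ν)
  integral_eq : ∀ φ, IsTest W K φ → ∫ z in K, adjDeriv X C a φ z * s z ∂((volume : Measure ℝ).prod ν)
    + ∫ z in K, φ z * s' z ∂((volume : Measure ℝ).prod ν) = 0

theorem integrableOn_mul_of_continuousOn {κ s : ℝ × N → ℝ} (hK : IsCompact K)
    (hKW : K ⊆ univ ×ˢ W) (hκ : ContinuousOn κ (univ ×ˢ W))
    (hs : IntegrableOn s K ((volume : Measure ℝ).prod ν)) :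
    IntegrableOn (fun z => κ z * s z) K ((volume : Measure ℝ).prod ν) := by
  obtain ⟨M, hM⟩ := exists_bound_of_continuousOn (ν := ν) hK hKW hκ
  exact Integrable.bdd_mul hs (aesm_of_continuousOn hK hKW hκ) hM

/-- The divergence theorem applied to φ s, split by the product rule. -/
theorem isWeakDeriv_of_smooth (H : DivFrame ν X W C) (hK : IsCompact K) (hKW : K ⊆ univ ×ˢ W)
    {s : ℝ × N → ℝ} (hs : SmoothTubeOn s W) (a : Fin 4) :
    IsWeakDeriv ν X W C K a s (tubeDeriv X a s) := by
  have hs' := (SmoothTubeOn.tubeDeriv H.isOpen H.smooth hs a).continuousOn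
  refine ⟨memLp_one_iff_integrable.1 (memLp_of_continuousOn hK hKW hs.continuousOn 1),
    memLp_one_iff_integrable.1 (memLp_of_continuousOn hK hKW hs' 1), fun φ hφ => ?_⟩
  have i1 : IntegrableOn (fun z => adjDeriv X C a φ z * s z) K ((volume : Measure ℝ).prod ν) :=
    memLp_one_iff_integrable.1 (memLp_of_continuousOn hK hKW
      ((continuousOn_adjDeriv H hφ.smooth a).mul hs.continuousOn) 1)
  have i2 : IntegrableOn (fun z => φ z * tubeDeriv X a s z) K ((volume : Measure ℝ).prod ν) :=
    memLp_one_iff_integrable.1 (memLp_of_continuousOn hK hKW (hφ.smooth.continuousOn.mul hs') 1)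
  rw [← integral_add i1 i2, ← integral_adjDeriv H hKW (hφ.mul hs) a]
  refine setIntegral_congr_fun hK.isClosed.measurableSet fun z hz => ?_
  exact (adjDeriv_mul H hφ.smooth hs a (hKW hz).2).symm

/-- The integrals are continuous under L² convergence of f, g and their derivatives, so the identity
passes from smooth approximations to the limit. -/
theorem isWeakDeriv_bilin (H : DivFrame ν X W C) (hK : IsCompact K) (hKW : K ⊆ univ ×ˢ W)
    (L : E →L[ℝ] F →L[ℝ] ℝ) {f : ℝ × N → E} {f' : Fin 4 → ℝ × N → E} {g : ℝ × N → F}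
    {g' : Fin 4 → ℝ × N → F} (hf : SobolevOn ((volume : Measure ℝ).prod ν) X W K f f')
    (hg : SobolevOn ((volume : Measure ℝ).prod ν) X W K g g') (a : Fin 4) :
    IsWeakDeriv ν X W C K a (fun z => L (f z) (g z)) (fun z => L (f' a z) (g z) + L (f z) (g' a z)) := by
  have j1 : IntegrableOn (fun z => L (f z) (g z)) K ((volume : Measure ℝ).prod ν) :=
    memLp_one_iff_integrable.1 (L.memLp_of_bilin 1 hf.memLp hg.memLp)
  have j2 : IntegrableOn (fun z => L (f' a z) (g z)) K ((volume : Measure ℝ).prod ν) :=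
    memLp_one_iff_integrable.1 (L.memLp_of_bilin 1 (hf.memLp_deriv a) hg.memLp)
  have j3 : IntegrableOn (fun z => L (f z) (g' a z)) K ((volume : Measure ℝ).prod ν) :=
    memLp_one_iff_integrable.1 (L.memLp_of_bilin 1 hf.memLp (hg.memLp_deriv a))
  refine ⟨j1, j2.add j3, fun φ hφ => ?_⟩
  obtain ⟨P, hP, hP0, hP1⟩ := hf.approx
  obtain ⟨Q, hQ, hQ0, hQ1⟩ := hg.approx
  have hP' (m) := SmoothTubeOn.tubeDeriv H.isOpen H.smooth (hP m) a
  have hQ' (m) := SmoothTubeOn.tubeDeriv H.isOpen H.smooth (hQ m) a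
  have t1 := tendsto_integralOn_bilin L hK hKW (continuousOn_adjDeriv H hφ.smooth a) hf.memLp hg.memLp hP hQ hP0 hQ0
  have t2 := tendsto_integralOn_bilin L hK hKW hφ.smooth.continuousOn (hf.memLp_deriv a) hg.memLp hP' hQ (hP1 a) hQ0
  have t3 := tendsto_integralOn_bilin L hK hKW hφ.smooth.continuousOn hf.memLp (hg.memLp_deriv a) hP hQ' hP0 (hQ1 a)
  have t4 := t1.add (t2.add t3)
  have e1 : ∀ m, ∫ z in K, adjDeriv X C a φ z * L (P m z) (Q m z) ∂((volume : Measure ℝ).prod ν)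
      + (∫ z in K, φ z * L (tubeDeriv X a (P m) z) (Q m z) ∂((volume : Measure ℝ).prod ν)
        + ∫ z in K, φ z * L (P m z) (tubeDeriv X a (Q m) z) ∂((volume : Measure ℝ).prod ν)) = 0 := by
    intro m
    have hs : SmoothTubeOn (fun z => L (P m z) (Q m z)) W := (hP m).bilin L (hQ m)
    rw [← (isWeakDeriv_of_smooth H hK hKW hs a).integral_eq φ hφ, ← integral_add]
    · congr 1
      refine setIntegral_congr_fun hK.isClosed.measurableSet fun z hz => ?_
      rw [tubeDeriv_bilin X L ((hP m).mdifferentiableAt H.isOpen (hKW hz).2)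
        ((hQ m).mdifferentiableAt H.isOpen (hKW hz).2), mul_add]
    · exact integrableOn_mul_bilin L hK hKW hφ.smooth.continuousOn
        (memLp_of_continuousOn hK hKW (hP' m).continuousOn 2) (memLp_of_continuousOn hK hKW (hQ m).continuousOn 2)
    · exact integrableOn_mul_bilin L hK hKW hφ.smooth.continuousOn
        (memLp_of_continuousOn hK hKW (hP m).continuousOn 2) (memLp_of_continuousOn hK hKW (hQ' m).continuousOn 2)
  simp only [e1] at t4
  have e2 := tendsto_nhds_unique t4 tendsto_const_nhds
  rw [← integral_add (integrableOn_mul_of_continuousOn hK hKW hφ.smooth.continuousOn j2)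
    (integrableOn_mul_of_continuousOn hK hKW hφ.smooth.continuousOn j3)] at e2
  rw [← e2]
  simp only [mul_add]

/-- Only f is approximated by smooth functions; of s just the weak derivative is used. This
asymmetry serves `integral_pair`, where s is quadratic in the spinor and f is a component of the
connection. -/
theorem IsWeakDeriv.mul (H : DivFrame ν X W C) (hK : IsCompact K) (hKW : K ⊆ univ ×ˢ W) {a : Fin 4}
    {s s' : ℝ × N → ℝ} (hs : IsWeakDeriv ν X W C K a s s')
    (hs2 : MemLp s 2 (((volume : Measure ℝ).prod ν).restrict K))
    (hs2' : MemLp s' 2 (((volume : Measure ℝ).prod ν).restrict K)) {f : ℝ × N → ℝ}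
    {f' : Fin 4 → ℝ × N → ℝ} (hf : SobolevOn ((volume : Measure ℝ).prod ν) X W K f f') :
    IsWeakDeriv ν X W C K a (fun z => s z * f z) (fun z => s' z * f z + s z * f' a z) := by
  have j1 : IntegrableOn (fun z => s z * f z) K ((volume : Measure ℝ).prod ν) := hs2.integrable_mul hf.memLp
  have j2 : IntegrableOn (fun z => s' z * f z) K ((volume : Measure ℝ).prod ν) := hs2'.integrable_mul hf.memLp
  have j3 : IntegrableOn (fun z => s z * f' a z) K ((volume : Measure ℝ).prod ν) :=
    hs2.integrable_mul (hf.memLp_deriv a)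
  refine ⟨j1, j2.add j3, fun φ hφ => ?_⟩
  obtain ⟨P, hP, hP0, hP1⟩ := hf.approx
  have hP' (m) := SmoothTubeOn.tubeDeriv H.isOpen H.smooth (hP m) a
  have lim (κ : ℝ × N → ℝ) (hκ : ContinuousOn κ (univ ×ˢ W)) (t : ℝ × N → ℝ)
      (ht : MemLp t 2 (((volume : Measure ℝ).prod ν).restrict K)) (q : ℝ × N → ℝ) (Q : ℕ → ℝ × N → ℝ)
      (hQ : ∀ m, SmoothTubeOn (Q m) W) (hq : MemLp q 2 (((volume : Measure ℝ).prod ν).restrict K))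
      (hQq : Tendsto (fun m => eLpNorm (Q m - q) 2 (((volume : Measure ℝ).prod ν).restrict K)) atTop (𝓝 0)) :
      Tendsto (fun m => ∫ z in K, κ z * (t z * Q m z) ∂((volume : Measure ℝ).prod ν)) atTop
        (𝓝 (∫ z in K, κ z * (t z * q z) ∂((volume : Measure ℝ).prod ν))) := by
    obtain ⟨M, hM⟩ := exists_bound_of_continuousOn (ν := ν) hK hKW hκ
    exact tendsto_integral_bilin (ContinuousLinearMap.mul ℝ ℝ) (aesm_of_continuousOn hK hKW hκ) hM ht hq
      (f' := fun _ => t) (fun m => ht.1) (fun m => aesm_of_continuousOn hK hKW (hQ m).continuousOn)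
      (by simp) hQq
  have hφc := hφ.smooth.continuousOn
  have t1 := lim _ (continuousOn_adjDeriv H hφ.smooth a) s hs2 f P hP hf.memLp hP0
  have t2 := lim _ hφc s hs2 (f' a) _ hP' (hf.memLp_deriv a) (hP1 a)
  have t3 := lim _ hφc s' hs2' f P hP hf.memLp hP0
  have t4 := (t1.add t2).add t3
  have e1 : ∀ m, ∫ z in K, adjDeriv X C a φ z * (s z * P m z) ∂((volume : Measure ℝ).prod ν)
      + ∫ z in K, φ z * (s z * tubeDeriv X a (P m) z) ∂((volume : Measure ℝ).prod ν)
        + ∫ z in K, φ z * (s' z * P m z) ∂((volume : Measure ℝ).prod ν) = 0 := by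
    intro m
    -- The product of φ with the smooth approximation P m is again a test function for s.
    rw [← hs.integral_eq _ (hφ.mul (hP m)), ← integral_add]
    · congr 1
      · refine setIntegral_congr_fun hK.isClosed.measurableSet fun z hz => ?_
        rw [adjDeriv_mul H hφ.smooth (hP m) a (hKW hz).2]
        ring
      · refine integral_congr_ae (Eventually.of_forall fun z => ?_)
        simp only
        ring
    · exact integrableOn_mul_of_continuousOn hK hKW (continuousOn_adjDeriv H hφ.smooth a)
        (hs2.integrable_mul (memLp_of_continuousOn hK hKW (hP m).continuousOn 2))
    · exact integrableOn_mul_of_continuousOn hK hKW hφc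
        (hs2.integrable_mul (memLp_of_continuousOn hK hKW (hP' m).continuousOn 2))
  simp only [e1] at t4
  have e2 := tendsto_nhds_unique t4 tendsto_const_nhds
  have i2 := integrableOn_mul_of_continuousOn hK hKW hφc j2
  have i3 := integrableOn_mul_of_continuousOn hK hKW hφc j3
  simp only [mul_add]
  rw [integral_add i2 i3]
  linarith

end WeakDeriv

/-! ### The curl identity for a pair of directions -/

section Pair
variable {N : Type*} [TopologicalSpace N] [ChartedSpace (EuclideanSpace ℝ (Fin 3)) N]
  [IsManifold (𝓡 3) ∞ N] [T2Space N] [SecondCountableTopology N] [MeasurableSpace N] [BorelSpace N]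
  {E : Type*} [NormedAddCommGroup E] [NormedSpace ℝ E]
  {ν : Measure N} [IsFiniteMeasureOnCompacts ν] [SFinite ν]
  {X : Fin 3 → ∀ p : N, TangentSpace (𝓡 3) p} {W : Set N}
  {C : Fin 3 → Fin 3 → Fin 3 → N → ℝ} {K : Set (ℝ × N)} {φ : ℝ × N → ℝ}

/-- For antisymmetric β one has X_b β(X_a f, f) - X_a β(X_b f, f) = 2β(X_a f, X_b f) - β([X_a, X_b]
f, f). Second derivatives enter only through the commutator, which is of first order; the left side
is integrated by parts onto φ. -/
theorem integral_curl_smooth (H : DivFrame ν X W C) (hK : IsCompact K) (hKW : K ⊆ univ ×ˢ W)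
    {β : E →L[ℝ] E →L[ℝ] ℝ} (hβ : ∀ u v, β v u = - β u v) {f : ℝ × N → E} (hf : SmoothTubeOn f W)
    (hφ : IsTest W K φ) (a b : Fin 4) :
    ∫ z in K, adjDeriv X C b φ z * β (tubeDeriv X a f z) (f z) ∂((volume : Measure ℝ).prod ν)
      - ∫ z in K, adjDeriv X C a φ z * β (tubeDeriv X b f z) (f z) ∂((volume : Measure ℝ).prod ν)
      + 2 * ∫ z in K, φ z * β (tubeDeriv X a f z) (tubeDeriv X b f z) ∂((volume : Measure ℝ).prod ν)
      - ∑ c, ∫ z in K, (φ z * tubeCoeff C a b c z.2) * β (tubeDeriv X c f z) (f z)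
        ∂((volume : Measure ℝ).prod ν) = 0 := by
  have hf' (a) := SmoothTubeOn.tubeDeriv H.isOpen H.smooth hf a
  have hf'' (a b) := SmoothTubeOn.tubeDeriv H.isOpen H.smooth (hf' a) b
  have w (a b) := (isWeakDeriv_of_smooth H hK hKW ((hf' a).bilin β hf) b).integral_eq φ hφ
  have hφc := hφ.smooth.continuousOn
  have int {κ : ℝ × N → ℝ} (hκ : ContinuousOn κ (univ ×ˢ W)) {p q : ℝ × N → E} (hp : SmoothTubeOn p W)
      (hq : SmoothTubeOn q W) :
      IntegrableOn (fun z => κ z * β (p z) (q z)) K ((volume : Measure ℝ).prod ν) :=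
    integrableOn_mul_bilin β hK hKW hκ (memLp_of_continuousOn hK hKW hp.continuousOn 2)
      (memLp_of_continuousOn hK hKW hq.continuousOn 2)
  have hCc (c) : ContinuousOn (fun z => φ z * tubeCoeff C a b c z.2) (univ ×ˢ W) :=
    hφc.mul (continuousOn_tubeCoeff H a b c)
  have e (a b : Fin 4) : ∫ z in K, φ z * tubeDeriv X b (fun z => β (tubeDeriv X a f z) (f z)) z
        ∂((volume : Measure ℝ).prod ν) = ∫ z in K, φ z * β (tubeDeriv X b (tubeDeriv X a f) z) (f z)
        ∂((volume : Measure ℝ).prod ν)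
        + ∫ z in K, φ z * β (tubeDeriv X a f z) (tubeDeriv X b f z) ∂((volume : Measure ℝ).prod ν) := by
    rw [← integral_add (int hφc (hf'' a b) hf) (int hφc (hf' a) (hf' b))]
    refine setIntegral_congr_fun hK.isClosed.measurableSet fun z hz => ?_
    rw [tubeDeriv_bilin X β ((hf' a).mdifferentiableAt H.isOpen (hKW hz).2)
        (hf.mdifferentiableAt H.isOpen (hKW hz).2), mul_add]
  have w1 := w a b
  have w2 := w b a
  rw [e] at w1 w2
  have e3 : ∫ z in K, φ z * β (tubeDeriv X b f z) (tubeDeriv X a f z) ∂((volume : Measure ℝ).prod ν)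
      = - ∫ z in K, φ z * β (tubeDeriv X a f z) (tubeDeriv X b f z) ∂((volume : Measure ℝ).prod ν) := by
    rw [← integral_neg]
    refine integral_congr_ae (Eventually.of_forall fun z => ?_)
    simp only
    rw [hβ (tubeDeriv X a f z)]
    ring
  have e4 : ∫ z in K, φ z * β (tubeDeriv X a (tubeDeriv X b f) z) (f z) ∂((volume : Measure ℝ).prod ν)
      - ∫ z in K, φ z * β (tubeDeriv X b (tubeDeriv X a f) z) (f z) ∂((volume : Measure ℝ).prod ν)
      = ∑ c, ∫ z in K, (φ z * tubeCoeff C a b c z.2) * β (tubeDeriv X c f z) (f z)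
        ∂((volume : Measure ℝ).prod ν) := by
    rw [← integral_sub (int hφc (hf'' b a) hf) (int hφc (hf'' a b) hf),
      ← integral_finsetSum _ fun c _ => int (hCc c) (hf' c) hf]
    refine setIntegral_congr_fun hK.isClosed.measurableSet fun z hz => ?_
    have h1 := tubeDeriv_comm H.isOpen H.smooth H.bracket hf a b (hKW hz).2
    have h2 : β (tubeDeriv X a (tubeDeriv X b f) z - tubeDeriv X b (tubeDeriv X a f) z) (f z)
      = ∑ c, tubeCoeff C a b c z.2 * β (tubeDeriv X c f z) (f z) := by
      rw [h1, map_sum]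
      simp
    rw [map_sub, sub_apply] at h2
    calc _ = φ z * (β (tubeDeriv X a (tubeDeriv X b f) z) (f z)
          - β (tubeDeriv X b (tubeDeriv X a f) z) (f z)) := by ring
      _ = _ := by rw [h2, Finset.mul_sum]; exact Finset.sum_congr rfl fun c _ => by ring
  linarith

/-- No second derivative of f is left in the identity, so it survives the passage to functions of
class L^{1,2}. This replaces the second derivatives of ψ in the Weitzenböck formula. -/
theorem integral_curl (H : DivFrame ν X W C) (hK : IsCompact K) (hKW : K ⊆ univ ×ˢ W)
    {β : E →L[ℝ] E →L[ℝ] ℝ} (hβ : ∀ u v, β v u = - β u v) {f : ℝ × N → E} {f' : Fin 4 → ℝ × N → E}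
    (hf : SobolevOn ((volume : Measure ℝ).prod ν) X W K f f')
    (hφ : IsTest W K φ) (a b : Fin 4) :
    ∫ z in K, adjDeriv X C b φ z * β (f' a z) (f z) ∂((volume : Measure ℝ).prod ν)
      - ∫ z in K, adjDeriv X C a φ z * β (f' b z) (f z) ∂((volume : Measure ℝ).prod ν)
      + 2 * ∫ z in K, φ z * β (f' a z) (f' b z) ∂((volume : Measure ℝ).prod ν)
      - ∑ c, ∫ z in K, (φ z * tubeCoeff C a b c z.2) * β (f' c z) (f z)
        ∂((volume : Measure ℝ).prod ν) = 0 := by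
  obtain ⟨P, hP, hP0, hP1⟩ := hf.approx
  have hP' (a m) := SmoothTubeOn.tubeDeriv H.isOpen H.smooth (hP m) a
  have hφc := hφ.smooth.continuousOn
  have hCc (c) : ContinuousOn (fun z => φ z * tubeCoeff C a b c z.2) (univ ×ˢ W) :=
    hφc.mul (continuousOn_tubeCoeff H a b c)
  have t1 (a b) := tendsto_integralOn_bilin β hK hKW (continuousOn_adjDeriv H hφ.smooth b)
    (hf.memLp_deriv a) hf.memLp (hP' a) hP (hP1 a) hP0
  have t2 := tendsto_integralOn_bilin β hK hKW hφc (hf.memLp_deriv a) (hf.memLp_deriv b) (hP' a) (hP' b)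
    (hP1 a) (hP1 b)
  have t3 (c) := tendsto_integralOn_bilin β hK hKW (hCc c) (hf.memLp_deriv c) hf.memLp (hP' c) hP (hP1 c) hP0
  have t4 := (((t1 a b).sub (t1 b a)).add (t2.const_mul 2)).sub (tendsto_finsetSum Finset.univ fun c _ => t3 c)
  simp only [integral_curl_smooth H hK hKW hβ (hP _) hφ a b] at t4
  exact tendsto_nhds_unique t4 tendsto_const_nhds

/-- The contribution of a pair of directions to the Weitzenböck formula. -/
theorem integral_pair (H : DivFrame ν X W C) (hK : IsCompact K) (hKW : K ⊆ univ ×ˢ W)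
    {β : E →L[ℝ] E →L[ℝ] ℝ} (hβ : ∀ u v, β v u = - β u v) (J : E →L[ℝ] E)
    (hJ : ∀ u v, β (J u) v = β (J v) u) {f : ℝ × N → E} {f' : Fin 4 → ℝ × N → E}
    (hf : SobolevOn ((volume : Measure ℝ).prod ν) X W K f f')
    (hfb : MemLp f ⊤ (((volume : Measure ℝ).prod ν).restrict K))
    {α : Fin 4 → ℝ × N → ℝ} {α' : Fin 4 → Fin 4 → ℝ × N → ℝ}
    (hα : ∀ a, SobolevOn ((volume : Measure ℝ).prod ν) X W K (α a) (α' a))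
    (hφ : IsTest W K φ) (a b : Fin 4) {Z : ℝ × N → ℝ}
    (hZ : ∀ z, Z z = adjDeriv X C b φ z * (β (f' a z) (f z) + β (J (f z)) (f z) * α a z)
      - adjDeriv X C a φ z * (β (f' b z) (f z) + β (J (f z)) (f z) * α b z)
      + φ z * (2 * β (f' a z) (f' b z) - ∑ c, tubeCoeff C a b c z.2 * β (f' c z) (f z)
        + (2 * β (J (f' b z)) (f z) * α a z + β (J (f z)) (f z) * α' a b z)
        - (2 * β (J (f' a z)) (f z) * α b z + β (J (f z)) (f z) * α' b a z))) :
    IntegrableOn Z K ((volume : Measure ℝ).prod ν) ∧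
      ∫ z in K, Z z ∂((volume : Measure ℝ).prod ν) = 0 := by
  -- By `hJ` this form is symmetric, so the derivative of L(f, f) is 2L(f', f).
  let L : E →L[ℝ] E →L[ℝ] ℝ := β.comp J
  have hφc := hφ.smooth.continuousOn
  have hA (a) := continuousOn_adjDeriv H hφ.smooth a
  -- The L^∞ bound on f is needed here, and again for the derivative of this function: it keeps the
  -- quadratic expressions in L², so that they may be multiplied by the L² components of the
  -- connection.
  have hs2 : MemLp (fun z => L (f z) (f z)) 2 (((volume : Measure ℝ).prod ν).restrict K) :=
    L.memLp_of_bilin 2 hf.memLp hfb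
  have hw (a b) : IsWeakDeriv ν X W C K b (fun z => L (f z) (f z) * α a z)
      (fun z => 2 * L (f' b z) (f z) * α a z + L (f z) (f z) * α' a b z) := by
    have e : (fun z => L (f' b z) (f z) + L (f z) (f' b z)) = fun z => 2 * L (f' b z) (f z) := by
      funext z
      have : L (f z) (f' b z) = L (f' b z) (f z) := hJ _ _
      rw [this]; ring
    have h1 := isWeakDeriv_bilin H hK hKW L hf hf b
    rw [e] at h1
    exact h1.mul H hK hKW hs2 ((L.memLp_of_bilin 2 (hf.memLp_deriv b) hfb).const_mul 2) (hα a)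
  have c1 := integral_curl H hK hKW hβ hf hφ a b
  have w1 := (hw a b).integral_eq φ hφ
  have w2 := (hw b a).integral_eq φ hφ
  have i1 (a b) := integrableOn_mul_bilin β hK hKW (hA b) (hf.memLp_deriv a) hf.memLp
  have i2 := integrableOn_mul_bilin β hK hKW hφc (hf.memLp_deriv a) (hf.memLp_deriv b)
  have i3 (c) : IntegrableOn (fun z => (φ z * tubeCoeff C a b c z.2) * β (f' c z) (f z)) K
      ((volume : Measure ℝ).prod ν) := integrableOn_mul_bilin β hK hKW (hφc.mul (continuousOn_tubeCoeff H a b c))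
    (hf.memLp_deriv c) hf.memLp
  have i4 (a b) := integrableOn_mul_of_continuousOn hK hKW (hA b) (hw a b).integrable
  have i5 (a b) := integrableOn_mul_of_continuousOn hK hKW hφc (hw a b).integrable_deriv
  have i3' := integrable_finsetSum Finset.univ fun c _ => i3 c
  have hInt := ((((i1 a b).sub (i1 b a)).add (i2.const_mul 2)).sub i3').add
    (((i4 a b).add (i5 a b)).sub ((i4 b a).add (i5 b a)))
  have hZe : Z = ((((fun z => adjDeriv X C b φ z * β (f' a z) (f z)) - fun z => adjDeriv X C a φ z * β (f' b z) (f z))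
      + fun z => 2 * (φ z * β (f' a z) (f' b z))) - fun z => ∑ c, (φ z * tubeCoeff C a b c z.2) * β (f' c z) (f z))
      + (((fun z => adjDeriv X C b φ z * (L (f z) (f z) * α a z)) + fun z => φ z * (2 * L (f' b z) (f z) * α a z + L (f z) (f z) * α' a b z))
        - ((fun z => adjDeriv X C a φ z * (L (f z) (f z) * α b z)) + fun z => φ z * (2 * L (f' a z) (f z) * α b z + L (f z) (f z) * α' b a z))) := by
    funext z
    rw [hZ]
    have : ∑ c, φ z * tubeCoeff C a b c z.2 * β (f' c z) (f z)
        = φ z * ∑ c, tubeCoeff C a b c z.2 * β (f' c z) (f z) := by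
      rw [Finset.mul_sum]; exact Finset.sum_congr rfl fun c _ => by ring
    simp only [Pi.add_apply, Pi.sub_apply, this, L, ContinuousLinearMap.comp_apply]
    ring
  rw [hZe]
  refine ⟨hInt, ?_⟩
  rw [integral_add' ((((i1 a b).sub (i1 b a)).add (i2.const_mul 2)).sub i3')
    (((i4 a b).add (i5 a b)).sub ((i4 b a).add (i5 b a))),
    integral_sub' (((i1 a b).sub (i1 b a)).add (i2.const_mul 2)) i3',
    integral_add' ((i1 a b).sub (i1 b a)) (i2.const_mul 2), integral_sub' (i1 a b) (i1 b a),
    integral_sub' ((i4 a b).add (i5 a b)) ((i4 b a).add (i5 b a)), integral_add' (i4 a b) (i5 a b),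
    integral_add' (i4 b a) (i5 b a), integral_finsetSum _ fun c _ => i3 c, integral_const_mul]
  linarith

end Pair

/-! ### Clifford algebra and the pointwise Weitzenböck inequality -/

section Spinors

/-- The real inner product of spinors. -/
def spinInner : (Fin 2 → ℂ) →L[ℝ] (Fin 2 → ℂ) →L[ℝ] ℝ :=
  LinearMap.toContinuousBilinearMap (LinearMap.mk₂ ℝ
    (fun u v : Fin 2 → ℂ => (u 0).re * (v 0).re + (u 0).im * (v 0).im + (u 1).re * (v 1).re
      + (u 1).im * (v 1).im)
    (fun _ _ _ => by simp only [Pi.add_apply, Complex.add_re, Complex.add_im]; ring)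
    (fun _ _ _ => by simp only [Pi.smul_apply, Complex.real_smul, Complex.re_ofReal_mul,
      Complex.im_ofReal_mul, smul_eq_mul]; ring)
    (fun _ _ _ => by simp only [Pi.add_apply, Complex.add_re, Complex.add_im]; ring)
    (fun _ _ _ => by simp only [Pi.smul_apply, Complex.real_smul, Complex.re_ofReal_mul,
      Complex.im_ofReal_mul, smul_eq_mul]; ring))

theorem spinInner_apply (u v : Fin 2 → ℂ) : spinInner u v = (u 0).re * (v 0).re + (u 0).im * (v 0).im
    + (u 1).re * (v 1).re + (u 1).im * (v 1).im := rfl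

/-- Clifford multiplication by the `j`-th covector. -/
def cliffMap (j : Fin 3) : (Fin 2 → ℂ) →L[ℝ] (Fin 2 → ℂ) :=
  LinearMap.toContinuousLinearMap ((Matrix.mulVecLin (cliff j)).restrictScalars ℝ)

/-- The forms `-⟨u, cⱼ v⟩` on spinors. -/
def spinForm (j : Fin 3) : (Fin 2 → ℂ) →L[ℝ] (Fin 2 → ℂ) →L[ℝ] ℝ :=
  -(spinInner.flip.comp (cliffMap j)).flip

theorem spinForm_apply (j : Fin 3) (u v : Fin 2 → ℂ) : spinForm j u v = -spinInner u ((cliff j).mulVec v) := rfl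

/-- Multiplication of spinors by the imaginary unit. -/
def spinI : (Fin 2 → ℂ) →L[ℝ] (Fin 2 → ℂ) :=
  LinearMap.toContinuousLinearMap ((LinearMap.lsmul ℂ (Fin 2 → ℂ) Complex.I).restrictScalars ℝ)

theorem spinI_apply (u : Fin 2 → ℂ) (k : Fin 2) : spinI u k = Complex.I * u k := rfl

theorem cliff_zero_mulVec (u : Fin 2 → ℂ) : (cliff 0).mulVec u = ![Complex.I * u 0, -(Complex.I * u 1)] := by
  ext k; fin_cases k <;> simp [cliff, Matrix.mulVec, dotProduct]

theorem cliff_one_mulVec (u : Fin 2 → ℂ) : (cliff 1).mulVec u = ![u 1, -u 0] := by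
  ext k; fin_cases k <;> simp [cliff, Matrix.mulVec, dotProduct]

theorem cliff_two_mulVec (u : Fin 2 → ℂ) : (cliff 2).mulVec u = ![Complex.I * u 1, Complex.I * u 0] := by
  ext k; fin_cases k <;> simp [cliff, Matrix.mulVec, dotProduct]

theorem spinForm_zero (u v : Fin 2 → ℂ) : spinForm 0 u v =
    (u 0).re * (v 0).im - (u 0).im * (v 0).re - (u 1).re * (v 1).im + (u 1).im * (v 1).re := by
  rw [spinForm_apply, cliff_zero_mulVec, spinInner_apply]
  simp
  ring

theorem spinForm_one (u v : Fin 2 → ℂ) : spinForm 1 u v =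
    (u 1).re * (v 0).re + (u 1).im * (v 0).im - (u 0).re * (v 1).re - (u 0).im * (v 1).im := by
  rw [spinForm_apply, cliff_one_mulVec, spinInner_apply]
  simp
  ring

theorem spinForm_two (u v : Fin 2 → ℂ) : spinForm 2 u v =
    (u 0).re * (v 1).im - (u 0).im * (v 1).re + (u 1).re * (v 0).im - (u 1).im * (v 0).re := by
  rw [spinForm_apply, cliff_two_mulVec, spinInner_apply]
  simp
  ring

/-- Each c_j is skew-adjoint for the real inner product. -/
theorem spinForm_antisymm (j : Fin 3) (u v : Fin 2 → ℂ) : spinForm j v u = - spinForm j u v := by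
  fin_cases j
  · change spinForm 0 v u = - spinForm 0 u v
    simp only [spinForm_zero]; ring
  · change spinForm 1 v u = - spinForm 1 u v
    simp only [spinForm_one]; ring
  · change spinForm 2 v u = - spinForm 2 u v
    simp only [spinForm_two]; ring

theorem spinI_re (u : Fin 2 → ℂ) (k : Fin 2) : (spinI u k).re = -(u k).im := by simp [spinI_apply]
theorem spinI_im (u : Fin 2 → ℂ) (k : Fin 2) : (spinI u k).im = (u k).re := by simp [spinI_apply]

/-- Since c_j is complex linear and skew-adjoint, i c_j is self-adjoint. Thus ψ ↦ `spinForm j (spinI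
ψ) ψ` is the quadratic form of i c_j, through which the curvature enters. -/
theorem spinForm_spinI (j : Fin 3) (u v : Fin 2 → ℂ) : spinForm j (spinI u) v = spinForm j (spinI v) u := by
  fin_cases j
  · change spinForm 0 (spinI u) v = spinForm 0 (spinI v) u
    simp only [spinForm_zero, spinI_re, spinI_im]; ring
  · change spinForm 1 (spinI u) v = spinForm 1 (spinI v) u
    simp only [spinForm_one, spinI_re, spinI_im]; ring
  · change spinForm 2 (spinI u) v = spinForm 2 (spinI v) u
    simp only [spinForm_two, spinI_re, spinI_im]; ring

theorem spinInner_spinI (u : Fin 2 → ℂ) : spinInner (spinI u) u = 0 := by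
  simp only [spinInner_apply, spinI_re, spinI_im]; ring

theorem spinInner_comm (u v : Fin 2 → ℂ) : spinInner u v = spinInner v u := by
  simp only [spinInner_apply]; ring

theorem spinInner_self_nonneg (u : Fin 2 → ℂ) : 0 ≤ spinInner u u := by
  rw [spinInner_apply]
  nlinarith [mul_self_nonneg (u 0).re, mul_self_nonneg (u 0).im, mul_self_nonneg (u 1).re, mul_self_nonneg (u 1).im]

theorem spinInner_self (u : Fin 2 → ℂ) : spinInner u u = ∑ a, ‖u a‖ ^ 2 := by
  rw [spinInner_apply, Fin.sum_univ_two, ← Complex.normSq_eq_norm_sq, ← Complex.normSq_eq_norm_sq,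
    Complex.normSq_apply, Complex.normSq_apply]
  ring

/-- This is 2|v/4 - xψ|² ≥ 0. The weight 1/8 is the share of |∇ψ|² allotted to each lower order term
in `weitzenbock_le`. -/
theorem mul_spinInner_le (x : ℝ) (v ψ : Fin 2 → ℂ) :
    x * spinInner v ψ ≤ spinInner v v / 8 + 2 * x ^ 2 * spinInner ψ ψ := by
  simp only [spinInner_apply]
  nlinarith [sq_nonneg ((v 0).re / 4 - x * (ψ 0).re), sq_nonneg ((v 0).im / 4 - x * (ψ 0).im),
    sq_nonneg ((v 1).re / 4 - x * (ψ 1).re), sq_nonneg ((v 1).im / 4 - x * (ψ 1).im)]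

theorem spinInner_cliff (j : Fin 3) (u : Fin 2 → ℂ) :
    spinInner ((cliff j).mulVec u) ((cliff j).mulVec u) = spinInner u u := by
  fin_cases j
  · change spinInner ((cliff 0).mulVec u) ((cliff 0).mulVec u) = _
    rw [cliff_zero_mulVec]; simp [spinInner_apply]; ring
  · change spinInner ((cliff 1).mulVec u) ((cliff 1).mulVec u) = _
    rw [cliff_one_mulVec]; simp [spinInner_apply]; ring
  · change spinInner ((cliff 2).mulVec u) ((cliff 2).mulVec u) = _
    rw [cliff_two_mulVec]; simp [spinInner_apply]; ring

theorem mul_spinForm_le (x : ℝ) (j : Fin 3) (v ψ : Fin 2 → ℂ) :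
    x * spinForm j v ψ ≤ spinInner v v / 8 + 2 * x ^ 2 * spinInner ψ ψ := by
  have := mul_spinInner_le (-x) v ((cliff j).mulVec ψ)
  rw [spinInner_cliff] at this
  rw [spinForm_apply]
  nlinarith

/-- The Dirac equation, solved for the derivative in the direction of `ℝ`, in components. -/
theorem dirac_components {v : Fin 4 → Fin 2 → ℂ} {ψ : Fin 2 → ℂ} {ω₁ ω₂ : ℝ}
    (hv : v 0 = ∑ j, (cliff j).mulVec (v (Fin.succ j)) + ((ω₂ / 2 : ℝ) : ℂ) • (cliff 1).mulVec ψ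
      - ((ω₁ / 2 : ℝ) : ℂ) • (cliff 2).mulVec ψ) :
    (v 0 0).re = -(v 1 0).im + (v 2 1).re - (v 3 1).im + ω₂ / 2 * (ψ 1).re + ω₁ / 2 * (ψ 1).im ∧
    (v 0 0).im = (v 1 0).re + (v 2 1).im + (v 3 1).re + ω₂ / 2 * (ψ 1).im - ω₁ / 2 * (ψ 1).re ∧
    (v 0 1).re = (v 1 1).im - (v 2 0).re - (v 3 0).im - ω₂ / 2 * (ψ 0).re + ω₁ / 2 * (ψ 0).im ∧
    (v 0 1).im = -(v 1 1).re - (v 2 0).im + (v 3 0).re - ω₂ / 2 * (ψ 0).im - ω₁ / 2 * (ψ 0).re := by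
  rw [Fin.sum_univ_three, cliff_zero_mulVec, cliff_one_mulVec, cliff_two_mulVec, cliff_one_mulVec,
    cliff_two_mulVec] at hv
  have h0 := congrFun hv 0
  have h1 := congrFun hv 1
  simp only [Fin.succ_zero_eq_one, Fin.succ_one_eq_two, show Fin.succ (2 : Fin 3) = (3 : Fin 4) from rfl] at h0 h1
  rw [h0, h1]
  simp only [Pi.add_apply, Pi.sub_apply, Pi.smul_apply, smul_eq_mul, Matrix.cons_val_zero, Matrix.cons_val_one,
    Complex.add_re, Complex.add_im, Complex.sub_re, Complex.sub_im, Complex.re_ofReal_mul, Complex.im_ofReal_mul,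
    Complex.I_mul_re, Complex.I_mul_im, Complex.neg_re, Complex.neg_im, Matrix.cons_val_fin_one]
  refine ⟨?_, ?_, ?_, ?_⟩ <;> first | trivial | ring

/-- The equation v_0 - Σ c_j v_{j+1} = (ω₂/2) c_1 ψ - (ω₁/2) c_2 ψ is paired with (p_0 - Σ p_{j+1}
c_j) ψ and expanded by c_1 c_2 = c_0 and its cyclic permutations. With p the adjoint derivatives of
a test function, it trades the gradient of |ψ|²/2 for the curl terms of `integral_pair`. -/
theorem dirac_test {v : Fin 4 → Fin 2 → ℂ} {ψ : Fin 2 → ℂ} {ω₁ ω₂ : ℝ}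
    (hv : v 0 = ∑ j, (cliff j).mulVec (v (Fin.succ j)) + ((ω₂ / 2 : ℝ) : ℂ) • (cliff 1).mulVec ψ
      - ((ω₁ / 2 : ℝ) : ℂ) • (cliff 2).mulVec ψ) (p : Fin 4 → ℝ) :
    ∑ a, p a * spinInner (v a) ψ
      + (p 1 * spinForm 0 (v 0) ψ - p 0 * spinForm 0 (v 1) ψ)
      + (p 2 * spinForm 1 (v 0) ψ - p 0 * spinForm 1 (v 2) ψ)
      + (p 3 * spinForm 2 (v 0) ψ - p 0 * spinForm 2 (v 3) ψ)
      + (p 3 * spinForm 0 (v 2) ψ - p 2 * spinForm 0 (v 3) ψ)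
      + (p 1 * spinForm 1 (v 3) ψ - p 3 * spinForm 1 (v 1) ψ)
      + (p 2 * spinForm 2 (v 1) ψ - p 1 * spinForm 2 (v 2) ψ)
      = spinInner ψ ψ * (ω₁ * p 3 - ω₂ * p 2) / 2 := by
  obtain ⟨h1, h2, h3, h4⟩ := dirac_components hv
  simp only [Fin.sum_univ_four, spinInner_apply, spinForm_zero, spinForm_one, spinForm_two, h1, h2, h3, h4]
  ring

/-- The squared norm of v_0 - Σ c_j v_{j+1}, expanded: the diagonal gives Σ|v_a|², the mixed terms
give the six forms, and the right side of the equation contributes (ω₁² + ω₂²)/4 · |ψ|² because c_1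
ψ and c_2 ψ are orthogonal. -/
theorem dirac_square {v : Fin 4 → Fin 2 → ℂ} {ψ : Fin 2 → ℂ} {ω₁ ω₂ : ℝ}
    (hv : v 0 = ∑ j, (cliff j).mulVec (v (Fin.succ j)) + ((ω₂ / 2 : ℝ) : ℂ) • (cliff 1).mulVec ψ
      - ((ω₁ / 2 : ℝ) : ℂ) • (cliff 2).mulVec ψ) :
    2 * (spinForm 0 (v 0) (v 1) + spinForm 1 (v 0) (v 2) + spinForm 2 (v 0) (v 3)
      + spinForm 0 (v 2) (v 3) + spinForm 1 (v 3) (v 1) + spinForm 2 (v 1) (v 2))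
      = (ω₁ ^ 2 + ω₂ ^ 2) / 4 * spinInner ψ ψ - ∑ a, spinInner (v a) (v a) := by
  obtain ⟨h1, h2, h3, h4⟩ := dirac_components hv
  simp only [Fin.sum_univ_four, spinInner_apply, spinForm_zero, spinForm_one, spinForm_two, h1, h2, h3, h4]
  ring

/-- The endomorphism τ(ψ) multiplies ψ by |ψ|²/2; pairing Σ g_j i c_j ψ = τ(ψ)ψ with ψ gives |ψ|⁴/2.
-/
theorem curvature_test {ψ : Fin 2 → ℂ} {g : Fin 3 → ℝ}
    (hg : ∑ j, (Complex.I * (g j : ℂ)) • cliff j = tau ψ) :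
    ∑ j, g j * spinForm j (spinI ψ) ψ = spinInner ψ ψ ^ 2 / 2 := by
  have e (a b : Fin 2) := congrFun (congrFun hg a) b
  simp only [Fin.sum_univ_three, cliff, tau, Matrix.add_apply, Matrix.smul_apply, Matrix.sub_apply,
    Matrix.vecMulVec_apply, ← spinInner_self] at e
  have e00 := congrArg Complex.re (e 0 0)
  have e01r := congrArg Complex.re (e 0 1)
  have e01i := congrArg Complex.im (e 0 1)
  simp [spinInner_apply] at e00 e01r e01i
  rw [Fin.sum_univ_three]
  simp only [spinForm_zero, spinForm_one, spinForm_two, spinI_re, spinI_im, spinInner_apply]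
  have g0 : g 0 = -((ψ 0).re * (ψ 0).re + (ψ 0).im * (ψ 0).im -
      ((ψ 0).re * (ψ 0).re + (ψ 0).im * (ψ 0).im + (ψ 1).re * (ψ 1).re + (ψ 1).im * (ψ 1).im) / 2) := by
    linarith
  have g2 : g 2 = -((ψ 0).re * (ψ 1).re + (ψ 0).im * (ψ 1).im) := by linarith
  rw [g0, g2, e01i]
  ring

/-- The contribution of a pair of directions, in terms of covariant derivatives. -/
theorem pair_eq (j : Fin 3) (ψ : Fin 2 → ℂ) (ψ' : Fin 4 → Fin 2 → ℂ) (α : Fin 4 → ℝ) (α' : Fin 4 → Fin 4 → ℝ)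
    (p : Fin 4 → ℝ) (r : ℝ) (c : Fin 4 → ℝ) (a b : Fin 4) :
    p b * (spinForm j (ψ' a) ψ + spinForm j (spinI ψ) ψ * α a)
      - p a * (spinForm j (ψ' b) ψ + spinForm j (spinI ψ) ψ * α b)
      + r * (2 * spinForm j (ψ' a) (ψ' b) - ∑ d, c d * spinForm j (ψ' d) ψ
        + (2 * spinForm j (spinI (ψ' b)) ψ * α a + spinForm j (spinI ψ) ψ * α' a b)
        - (2 * spinForm j (spinI (ψ' a)) ψ * α b + spinForm j (spinI ψ) ψ * α' b a))
    = p b * spinForm j (ψ' a + α a • spinI ψ) ψ - p a * spinForm j (ψ' b + α b • spinI ψ) ψ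
      + r * (2 * spinForm j (ψ' a + α a • spinI ψ) (ψ' b + α b • spinI ψ)
        - ∑ d, c d * spinForm j (ψ' d + α d • spinI ψ) ψ
        - (α' b a - α' a b - ∑ d, c d * α d) * spinForm j (spinI ψ) ψ) := by
  -- Antisymmetry removes the product α_a α_b, so that the terms in α and α' assemble into covariant
  -- derivatives and the curvature of α.
  have h1 : spinForm j (spinI ψ) (spinI ψ) = 0 := by
    have := spinForm_antisymm j (spinI ψ) (spinI ψ); linarith
  have h2 : spinForm j (spinI ψ) (ψ' b) = spinForm j (spinI (ψ' b)) ψ := spinForm_spinI j _ _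
  have h3 : spinForm j (ψ' a) (spinI ψ) = - spinForm j (spinI (ψ' a)) ψ := by
    rw [spinForm_antisymm, spinForm_spinI]
  simp only [map_add, map_smul, add_apply, smul_apply, smul_eq_mul, h1, h2, h3, mul_add,
    Finset.sum_add_distrib, mul_zero, add_zero]
  have h4 : ∑ d, c d * (α d * spinForm j (spinI ψ) ψ) = (∑ d, c d * α d) * spinForm j (spinI ψ) ψ := by
    rw [Finset.sum_mul]; exact Finset.sum_congr rfl fun _ _ => by ring
  rw [h4]
  ring

/-- A curl term is a sum over four directions; each direction uses its own |v_d|²/8 and adds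
2M²|ψ|², whence 8M². -/
theorem neg_sum_spinForm_le {M : ℝ} (j : Fin 3) (ψ : Fin 2 → ℂ) (v : Fin 4 → Fin 2 → ℂ) (c : Fin 4 → ℝ)
    (hc : ∀ d, |c d| ≤ M) :
    -∑ d, c d * spinForm j (v d) ψ ≤ (∑ d, spinInner (v d) (v d)) / 8 + 8 * M ^ 2 * spinInner ψ ψ := by
  have hw := spinInner_self_nonneg ψ
  have h1 (d) : - (c d * spinForm j (v d) ψ) ≤ spinInner (v d) (v d) / 8 + 2 * M ^ 2 * spinInner ψ ψ := by
    have := mul_spinForm_le (- c d) j (v d) ψ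
    have h2 : (- c d) ^ 2 ≤ M ^ 2 := sq_le_sq' (by linarith [(abs_le.1 (hc d)).2]) (by linarith [(abs_le.1 (hc d)).1])
    nlinarith
  have := Finset.sum_le_sum fun d (_ : d ∈ Finset.univ) => h1 d
  rw [Finset.sum_neg_distrib, Finset.sum_add_distrib, ← Finset.sum_div] at this
  simp only [Finset.sum_const, Finset.card_univ, Fintype.card_fin, nsmul_eq_mul] at this
  push_cast at this
  linarith

/-- The zeroth order terms of the Weitzenböck formula are bounded above. -/
theorem weitzenbock_le {v : Fin 4 → Fin 2 → ℂ} {ψ : Fin 2 → ℂ} {ω₁ ω₂ q M : ℝ}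
    (hv : v 0 = ∑ j, (cliff j).mulVec (v (Fin.succ j)) + ((ω₂ / 2 : ℝ) : ℂ) • (cliff 1).mulVec ψ
      - ((ω₁ / 2 : ℝ) : ℂ) • (cliff 2).mulVec ψ) {g : Fin 3 → ℝ}
    (hg : ∑ j, (Complex.I * (g j : ℂ)) • cliff j = tau ψ) {c : Fin 4 → Fin 4 → Fin 4 → ℝ}
    (hc : ∀ a b d, |c a b d| ≤ M) (h₁ : |ω₁| ≤ M) (h₂ : |ω₂| ≤ M) (hq : |q| ≤ M) :
    ∑ a, (∑ b, c a b b) * spinInner (v a) ψ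
      + 2 * (spinForm 0 (v 0) (v 1) + spinForm 1 (v 0) (v 2) + spinForm 2 (v 0) (v 3)
        + spinForm 0 (v 2) (v 3) + spinForm 1 (v 3) (v 1) + spinForm 2 (v 1) (v 2))
      - ∑ d, c 0 1 d * spinForm 0 (v d) ψ - ∑ d, c 0 2 d * spinForm 1 (v d) ψ
      - ∑ d, c 0 3 d * spinForm 2 (v d) ψ - ∑ d, c 2 3 d * spinForm 0 (v d) ψ
      - ∑ d, c 3 1 d * spinForm 1 (v d) ψ - ∑ d, c 1 2 d * spinForm 2 (v d) ψ
      - ∑ j, g j * spinForm j (spinI ψ) ψ - q * spinInner ψ ψ / 2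
      - ω₁ * spinInner (v 3) ψ + ω₂ * spinInner (v 2) ψ ≤ (181 * M ^ 2 + M) * spinInner ψ ψ := by
  rw [dirac_square hv, curvature_test hg]
  have hw := spinInner_self_nonneg ψ
  have hM : 0 ≤ M := (abs_nonneg _).trans hq
  have sqM {x : ℝ} (hx : |x| ≤ M) : x ^ 2 ≤ M ^ 2 := sq_le_sq' (by linarith [(abs_le.1 hx).1]) (abs_le.1 hx).2
  have k1 := neg_sum_spinForm_le 0 ψ v (c 0 1) (hc 0 1)
  have k2 := neg_sum_spinForm_le 1 ψ v (c 0 2) (hc 0 2)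
  have k3 := neg_sum_spinForm_le 2 ψ v (c 0 3) (hc 0 3)
  have k4 := neg_sum_spinForm_le 0 ψ v (c 2 3) (hc 2 3)
  have k5 := neg_sum_spinForm_le 1 ψ v (c 3 1) (hc 3 1)
  have k6 := neg_sum_spinForm_le 2 ψ v (c 1 2) (hc 1 2)
  have he (a) : |∑ b, c a b b| ≤ 4 * M := by
    refine (Finset.abs_sum_le_sum_abs _ _).trans ((Finset.sum_le_sum fun b _ => hc a b b).trans ?_)
    simp
  have k7 : ∑ a, (∑ b, c a b b) * spinInner (v a) ψ
      ≤ (∑ d, spinInner (v d) (v d)) / 8 + 128 * M ^ 2 * spinInner ψ ψ := by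
    have h1 (a) : (∑ b, c a b b) * spinInner (v a) ψ ≤ spinInner (v a) (v a) / 8 + 32 * M ^ 2 * spinInner ψ ψ := by
      have := mul_spinInner_le (∑ b, c a b b) (v a) ψ
      have h2 : (∑ b, c a b b) ^ 2 ≤ (4 * M) ^ 2 := sq_le_sq' (by linarith [(abs_le.1 (he a)).1]) (abs_le.1 (he a)).2
      nlinarith
    have := Finset.sum_le_sum fun d (_ : d ∈ Finset.univ) => h1 d
    rw [Finset.sum_add_distrib, ← Finset.sum_div] at this
    simp only [Finset.sum_const, Finset.card_univ, Fintype.card_fin, nsmul_eq_mul] at this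
    push_cast at this
    linarith
  have k8 := mul_spinInner_le (-ω₁) (v 3) ψ
  have k9 := mul_spinInner_le ω₂ (v 2) ψ
  have p1 : ω₁ ^ 2 * spinInner ψ ψ ≤ M ^ 2 * spinInner ψ ψ := mul_le_mul_of_nonneg_right (sqM h₁) hw
  have p2 : ω₂ ^ 2 * spinInner ψ ψ ≤ M ^ 2 * spinInner ψ ψ := mul_le_mul_of_nonneg_right (sqM h₂) hw
  have p3 : -q * spinInner ψ ψ ≤ M * spinInner ψ ψ := mul_le_mul_of_nonneg_right (by linarith [(abs_le.1 hq).1]) hw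
  have p4 : 0 ≤ M * spinInner ψ ψ := mul_nonneg hM hw
  have p5 : 0 ≤ M ^ 2 * spinInner ψ ψ := mul_nonneg (sq_nonneg M) hw
  have v0 := spinInner_self_nonneg (v 0)
  have v1 := spinInner_self_nonneg (v 1)
  have v2 := spinInner_self_nonneg (v 2)
  have v3 := spinInner_self_nonneg (v 3)
  have hs : ∑ d, spinInner (v d) (v d) = spinInner (v 0) (v 0) + spinInner (v 1) (v 1) + spinInner (v 2) (v 2)
    + spinInner (v 3) (v 3) := Fin.sum_univ_four _
  have p6 := sq_nonneg (spinInner ψ ψ)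
  rw [neg_mul, neg_sq] at k8
  -- The budget: `dirac_square` supplies -S. The six curl terms use 6S/8, the divergence terms S/8,
  -- and the two terms with ω₁, ω₂ together at most S/8. The multiples of M²|ψ|² are 48, 128, 4 and
  -- 1/2, so 181 suffices. The quartic term -|ψ|⁴/2 is dropped.
  set S := ∑ d, spinInner (v d) (v d)
  set w := spinInner ψ ψ
  linarith

end Spinors

/-! ### The integrated Weitzenböck inequality over a trivializing set -/

section Local
variable {N : Type*} [TopologicalSpace N] [ChartedSpace (EuclideanSpace ℝ (Fin 3)) N]
  [IsManifold (𝓡 3) ∞ N] [T2Space N] [SecondCountableTopology N] [MeasurableSpace N] [BorelSpace N]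
  {ν : Measure N} [IsFiniteMeasureOnCompacts ν] [SFinite ν]
  {X : Fin 3 → ∀ p : N, TangentSpace (𝓡 3) p} {W : Set N}
  {C : Fin 3 → Fin 3 → Fin 3 → N → ℝ} {K : Set (ℝ × N)} {φ : ℝ × N → ℝ}

/-- The curvature of the connection form `α` in the frame. -/
def frameCurv (C : Fin 3 → Fin 3 → Fin 3 → N → ℝ) (α : Fin 4 → ℝ × N → ℝ) (α' : Fin 4 → Fin 4 → ℝ × N → ℝ)
    (a b : Fin 4) (z : ℝ × N) : ℝ :=
  α' b a z - α' a b z - ∑ d, tubeCoeff C a b d z.2 * α d z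

/-- The differential inequality `Δ|ψ|² ≥ -2Λ|ψ|²` for the solutions of the Seiberg-Witten equations,
in integrated form. -/
theorem integral_grad_le (H : DivFrame ν X W C) (hK : IsCompact K) (hKW : K ⊆ univ ×ˢ W)
    {ψ : ℝ × N → Fin 2 → ℂ} {ψ' : Fin 4 → ℝ × N → Fin 2 → ℂ}
    (hψ : SobolevOn ((volume : Measure ℝ).prod ν) X W K ψ ψ')
    (hψb : MemLp ψ ⊤ (((volume : Measure ℝ).prod ν).restrict K))
    {α : Fin 4 → ℝ × N → ℝ} {α' : Fin 4 → Fin 4 → ℝ × N → ℝ}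
    (hα : ∀ a, SobolevOn ((volume : Measure ℝ).prod ν) X W K (α a) (α' a))
    {ω₁ ω₂ : N → ℝ} (hω₁ : ContMDiffOn (𝓡 3) 𝓘(ℝ, ℝ) ∞ ω₁ W) (hω₂ : ContMDiffOn (𝓡 3) 𝓘(ℝ, ℝ) ∞ ω₂ W)
    {M : ℝ} (hCM : ∀ z ∈ K, ∀ a b c, |tubeCoeff C a b c z.2| ≤ M) (hM₁ : ∀ z ∈ K, |ω₁ z.2| ≤ M)
    (hM₂ : ∀ z ∈ K, |ω₂ z.2| ≤ M)
    (hM₃ : ∀ z ∈ K, |tubeDeriv X 3 (fun z => ω₁ z.2) z - tubeDeriv X 2 (fun z => ω₂ z.2) z| ≤ M)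
    (hdirac : ∀ᵐ z ∂(((volume : Measure ℝ).prod ν).restrict K),
      ψ' 0 z + α 0 z • spinI (ψ z) = ∑ j, (cliff j).mulVec (ψ' (Fin.succ j) z + α (Fin.succ j) z • spinI (ψ z))
        + ((ω₂ z.2 / 2 : ℝ) : ℂ) • (cliff 1).mulVec (ψ z) - ((ω₁ z.2 / 2 : ℝ) : ℂ) • (cliff 2).mulVec (ψ z))
    (hcurv : ∀ᵐ z ∂(((volume : Measure ℝ).prod ν).restrict K),
      ∑ j, (Complex.I * ((![frameCurv C α α' 0 1 z + frameCurv C α α' 2 3 z,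
        frameCurv C α α' 0 2 z + frameCurv C α α' 3 1 z,
        frameCurv C α α' 0 3 z + frameCurv C α α' 1 2 z] : Fin 3 → ℝ) j : ℂ)) • cliff j = tau (ψ z))
    (hφ : IsTest W K φ) (hφ0 : ∀ z, 0 ≤ φ z) :
    ∫ z in K, ∑ a, tubeDeriv X a φ z * spinInner (ψ' a z) (ψ z) ∂((volume : Measure ℝ).prod ν)
      ≤ (181 * M ^ 2 + M) * ∫ z in K, φ z * spinInner (ψ z) (ψ z) ∂((volume : Measure ℝ).prod ν) := by
  -- The integral of each Z j a b is zero by `integral_pair`; these functions stand for the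
  -- commutators of second covariant derivatives.
  let Z : Fin 3 → Fin 4 → Fin 4 → ℝ × N → ℝ := fun j a b z =>
    adjDeriv X C b φ z * (spinForm j (ψ' a z) (ψ z) + spinForm j (spinI (ψ z)) (ψ z) * α a z)
      - adjDeriv X C a φ z * (spinForm j (ψ' b z) (ψ z) + spinForm j (spinI (ψ z)) (ψ z) * α b z)
      + φ z * (2 * spinForm j (ψ' a z) (ψ' b z) - ∑ c, tubeCoeff C a b c z.2 * spinForm j (ψ' c z) (ψ z)
        + (2 * spinForm j (spinI (ψ' b z)) (ψ z) * α a z + spinForm j (spinI (ψ z)) (ψ z) * α' a b z)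
        - (2 * spinForm j (spinI (ψ' a z)) (ψ z) * α b z + spinForm j (spinI (ψ z)) (ψ z) * α' b a z))
  have hZ (j a b) : IntegrableOn (Z j a b) K ((volume : Measure ℝ).prod ν) ∧
      ∫ z in K, Z j a b z ∂((volume : Measure ℝ).prod ν) = 0 :=
    integral_pair H hK hKW (spinForm_antisymm j) spinI (spinForm_spinI j) hψ hψb hα hφ a b fun _ => rfl
  have hφc := hφ.smooth.continuousOn
  have hwk (a) := isWeakDeriv_bilin H hK hKW spinInner hψ hψ a
  -- The weak derivative identity for |ψ|², tested with φ · om. It removes the derivative of φ from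
  -- the terms in ω₁ and ω₂ on the right of `dirac_test`.
  let Y : (N → ℝ) → Fin 4 → ℝ × N → ℝ := fun om a z =>
    adjDeriv X C a (fun z => φ z * om z.2) z * spinInner (ψ z) (ψ z)
      + (φ z * om z.2) * (spinInner (ψ' a z) (ψ z) + spinInner (ψ z) (ψ' a z))
  have hY (om : N → ℝ) (hom : ContMDiffOn (𝓡 3) 𝓘(ℝ, ℝ) ∞ om W) (a) :
      IntegrableOn (Y om a) K ((volume : Measure ℝ).prod ν) ∧
      ∫ z in K, Y om a z ∂((volume : Measure ℝ).prod ν) = 0 := by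
    have ht : IsTest W K (fun z => φ z * om z.2) := hφ.mul (SmoothTubeOn.comp_snd hom)
    have i1 := integrableOn_mul_of_continuousOn hK hKW (continuousOn_adjDeriv H ht.smooth a) (hwk a).integrable
    have i2 := integrableOn_mul_of_continuousOn hK hKW ht.smooth.continuousOn (hwk a).integrable_deriv
    exact ⟨i1.add i2, (integral_add i1 i2).trans ((hwk a).integral_eq _ ht)⟩
  have iG : IntegrableOn (fun z => ∑ a, tubeDeriv X a φ z * spinInner (ψ' a z) (ψ z)) K
      ((volume : Measure ℝ).prod ν) :=
    integrable_finsetSum _ fun a _ => integrableOn_mul_bilin spinInner hK hKW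
      (SmoothTubeOn.tubeDeriv H.isOpen H.smooth hφ.smooth a).continuousOn (hψ.memLp_deriv a) hψ.memLp
  have iw : IntegrableOn (fun z => φ z * spinInner (ψ z) (ψ z)) K ((volume : Measure ℝ).prod ν) :=
    integrableOn_mul_bilin spinInner hK hKW hφc hψ.memLp hψ.memLp
  have z1 := hZ 0 0 1
  have z2 := hZ 1 0 2
  have z3 := hZ 2 0 3
  have z4 := hZ 0 2 3
  have z5 := hZ 1 3 1
  have z6 := hZ 2 1 2
  have y1 := hY ω₁ hω₁ 3
  have y2 := hY ω₂ hω₂ 2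
  -- The pairs 01 + 23, 02 + 31, 03 + 12 are the self-dual ones, attached to c_0, c_1, c_2
  -- respectively. For this choice the curvature appears exactly in the combinations that the second
  -- equation prescribes.
  let R : ℝ × N → ℝ := fun z => Z 0 0 1 z + Z 1 0 2 z + Z 2 0 3 z + Z 0 2 3 z + Z 1 3 1 z + Z 2 1 2 z
    - (Y ω₁ 3 z - Y ω₂ 2 z) / 2
  have hadd {f g : ℝ × N → ℝ} (hf : IntegrableOn f K ((volume : Measure ℝ).prod ν) ∧
        ∫ z in K, f z ∂((volume : Measure ℝ).prod ν) = 0) (hg : IntegrableOn g K ((volume : Measure ℝ).prod ν) ∧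
        ∫ z in K, g z ∂((volume : Measure ℝ).prod ν) = 0) :
      IntegrableOn (fun z => f z + g z) K ((volume : Measure ℝ).prod ν) ∧
        ∫ z in K, (f z + g z) ∂((volume : Measure ℝ).prod ν) = 0 :=
    ⟨hf.1.add hg.1, by rw [integral_add hf.1 hg.1, hf.2, hg.2, add_zero]⟩
  have hy : IntegrableOn (fun z => (Y ω₁ 3 z - Y ω₂ 2 z) / 2) K ((volume : Measure ℝ).prod ν) ∧
      ∫ z in K, (Y ω₁ 3 z - Y ω₂ 2 z) / 2 ∂((volume : Measure ℝ).prod ν) = 0 :=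
    ⟨(y1.1.sub y2.1).div_const 2, by rw [integral_div, integral_sub y1.1 y2.1, y1.2, y2.2]; norm_num⟩
  have hz := hadd (hadd (hadd (hadd (hadd z1 z2) z3) z4) z5) z6
  have iR : IntegrableOn R K ((volume : Measure ℝ).prod ν) := hz.1.sub hy.1
  have R0 : ∫ z in K, R z ∂((volume : Measure ℝ).prod ν) = 0 :=
    (integral_sub hz.1 hy.1).trans (by rw [hz.2, hy.2, sub_zero])
  -- After adding R, which has integral zero, the inequality holds pointwise: the terms with
  -- derivatives of φ cancel by `dirac_test`, and the rest is φ ≥ 0 times the left side of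
  -- `weitzenbock_le`.
  have hpt : ∀ᵐ z ∂(((volume : Measure ℝ).prod ν).restrict K),
      (∑ a, tubeDeriv X a φ z * spinInner (ψ' a z) (ψ z)) + R z
        ≤ (181 * M ^ 2 + M) * (φ z * spinInner (ψ z) (ψ z)) := by
    filter_upwards [hdirac, hcurv, ae_restrict_mem hK.isClosed.measurableSet] with z h1 h2 hz
    set v : Fin 4 → Fin 2 → ℂ := fun a => ψ' a z + α a z • spinI (ψ z) with hv
    have key := weitzenbock_le (v := v) h1 h2 (c := fun a b d => tubeCoeff C a b d z.2) (hCM z hz)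
      (hM₁ z hz) (hM₂ z hz) (hM₃ z hz)
    have test := dirac_test (v := v) h1 (fun a => adjDeriv X C a φ z)
    have hvi (a) : spinInner (v a) (ψ z) = spinInner (ψ' a z) (ψ z) := by
      simp only [hv, map_add, map_smul, add_apply, smul_apply, spinInner_spinI, smul_zero, add_zero]
    have hZe (j a b) := pair_eq j (ψ z) (fun a => ψ' a z) (fun a => α a z) (fun a b => α' a b z)
      (fun a => adjDeriv X C a φ z) (φ z) (fun d => tubeCoeff C a b d z.2) a b
    have hYe (om : N → ℝ) (hom : ContMDiffOn (𝓡 3) 𝓘(ℝ, ℝ) ∞ om W) (a) : Y om a z =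
        (adjDeriv X C a φ z * om z.2 + φ z * tubeDeriv X a (fun z => om z.2) z) * spinInner (ψ z) (ψ z)
        + (φ z * om z.2) * (2 * spinInner (v a) (ψ z)) := by
      simp only [Y]
      rw [adjDeriv_mul H hφ.smooth (SmoothTubeOn.comp_snd hom) a (hKW hz).2, spinInner_comm (ψ z) (ψ' a z), hvi]
      ring
    have hD (a) : tubeDeriv X a φ z = adjDeriv X C a φ z + (∑ b, tubeCoeff C a b b z.2) * φ z := by
      simp only [adjDeriv]; ring
    have hsum : ∑ a, tubeDeriv X a φ z * spinInner (ψ' a z) (ψ z)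
        = ∑ a, adjDeriv X C a φ z * spinInner (v a) (ψ z)
          + φ z * ∑ a, (∑ b, tubeCoeff C a b b z.2) * spinInner (v a) (ψ z) := by
      rw [Finset.mul_sum, ← Finset.sum_add_distrib]
      refine Finset.sum_congr rfl fun a _ => ?_
      rw [hD, hvi]
      ring
    have key' := mul_le_mul_of_nonneg_left key (hφ0 z)
    rw [Fin.sum_univ_three (fun j => (![frameCurv C α α' 0 1 z + frameCurv C α α' 2 3 z,
        frameCurv C α α' 0 2 z + frameCurv C α α' 3 1 z,
        frameCurv C α α' 0 3 z + frameCurv C α α' 1 2 z] : Fin 3 → ℝ) j * spinForm j (spinI (ψ z)) (ψ z))] at key'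
    simp only [Matrix.cons_val_zero, Matrix.cons_val_one, Matrix.cons_val_two, Matrix.head_cons,
      Matrix.tail_cons] at key'
    simp only [R]
    rw [hsum, hYe ω₁ hω₁ 3, hYe ω₂ hω₂ 2]
    have e1 : Z 0 0 1 z = _ := hZe 0 0 1
    have e2 : Z 1 0 2 z = _ := hZe 1 0 2
    have e3 : Z 2 0 3 z = _ := hZe 2 0 3
    have e4 : Z 0 2 3 z = _ := hZe 0 2 3
    have e5 : Z 1 3 1 z = _ := hZe 1 3 1
    have e6 : Z 2 1 2 z = _ := hZe 2 1 2
    rw [e1, e2, e3, e4, e5, e6]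
    have hc (a b) : α' b a z - α' a b z - ∑ d, tubeCoeff C a b d z.2 * α d z = frameCurv C α α' a b z := rfl
    simp only [hc]
    have hva (a) : ψ' a z + α a z • spinI (ψ z) = v a := rfl
    simp only [hva]
    linarith
  calc ∫ z in K, ∑ a, tubeDeriv X a φ z * spinInner (ψ' a z) (ψ z) ∂((volume : Measure ℝ).prod ν)
      = ∫ z in K, ((∑ a, tubeDeriv X a φ z * spinInner (ψ' a z) (ψ z)) + R z) ∂((volume : Measure ℝ).prod ν) := by
        rw [integral_add iG iR, R0, add_zero]
    _ ≤ ∫ z in K, (181 * M ^ 2 + M) * (φ z * spinInner (ψ z) (ψ z)) ∂((volume : Measure ℝ).prod ν) :=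
        integral_mono_ae (iG.add iR) (iw.const_mul _) hpt
    _ = _ := integral_const_mul _ _

end Local

/-! ### The frames and volume of the circle bundle, and basic Sobolev functions -/

section BundleFrame
variable {S : Type*} [TopologicalSpace S] [ChartedSpace (EuclideanSpace ℝ (Fin 2)) S]
  [IsManifold (𝓡 2) ∞ S] {h : OrientedMetric S}
  {N : Type*} [TopologicalSpace N] [ChartedSpace (EuclideanSpace ℝ (Fin 3)) N]
  [IsManifold (𝓡 3) ∞ N] [MulAction Circle N] (B : CircleBundle h N)

theorem CircleBundle.isBilinearMetric (δ : ℝ) : IsBilinearMetric (B.metric δ) := by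
  intro p
  let ηp : EuclideanSpace ℝ (Fin 3) →ₗ[ℝ] ℝ := (B.η p : TangentSpace (𝓡 3) p →ₗ[ℝ] ℝ)
  let dp : EuclideanSpace ℝ (Fin 3) →ₗ[ℝ] EuclideanSpace ℝ (Fin 2) :=
    (B.dproj p : TangentSpace (𝓡 3) p →ₗ[ℝ] TangentSpace (𝓡 2) (B.proj p))
  let ip : EuclideanSpace ℝ (Fin 2) →L[ℝ] EuclideanSpace ℝ (Fin 2) →L[ℝ] ℝ := h.metric.inner (B.proj p)
  refine ⟨LinearMap.mk₂ ℝ (fun v w => δ⁻¹ ^ 2 * (ηp v * ηp w) + ip (dp v) (dp w)) ?_ ?_ ?_ ?_, fun v w => rfl⟩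
  · intro u v w; simp only [map_add, add_apply]; ring
  · intro c v w; simp only [map_smul, smul_apply, smul_eq_mul]; ring
  · intro u v w; simp only [map_add]; ring
  · intro c v w; simp only [map_smul, smul_eq_mul]; ring

theorem CircleBundle.metric_frame {δ : ℝ} (hδ : δ ≠ 0) {e : ∀ x : S, TangentSpace (𝓡 2) x} {p : N}
    (he : h.metric.inner (B.proj p) (e (B.proj p)) (e (B.proj p)) = 1) (j k : Fin 3) :
    B.metric δ p (B.frame δ e j p) (B.frame δ e k p) = if j = k then 1 else 0 := by
  have hs (j : Fin 3) : B.frame δ e j p = ∑ l, (Pi.single j (1 : ℝ) : Fin 3 → ℝ) l • B.frame δ e l p := by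
    rw [Finset.sum_eq_single j]
    · rw [Pi.single_eq_same, one_smul]
    · intro l _ hl
      rw [Pi.single_eq_of_ne hl, zero_smul]
    · simp
  have := B.metric_sum_frame hδ he (Pi.single j (1 : ℝ)) (Pi.single k (1 : ℝ))
  rw [← hs, ← hs] at this
  rw [this]
  simp [Pi.single_apply, eq_comm]

theorem contMDiffOn_structCoeff' [T2Space S] {δ : ℝ} (hδ : δ ≠ 0) {e : ∀ x : S, TangentSpace (𝓡 2) x} {U : Set S}
    (hU : IsOpen U) (he : SmoothFieldOn e U) (j k l : Fin 3) :
    ContMDiffOn (𝓡 3) 𝓘(ℝ, ℝ) ∞ (structCoeff B δ e j k l) (B.proj ⁻¹' U) :=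
  (contMDiffOn_const.mul (contMDiffOn_structCoeff B hU he j k l)).congr fun _ hp =>
    structCoeff_eq B hδ hU he j k l hp

variable [T2Space N] [MeasurableSpace N] [BorelSpace N]

theorem CircleBundle.divFrame [T2Space S] {δ : ℝ} (hδ : δ ≠ 0) {e : ∀ x : S, TangentSpace (𝓡 2) x} {U : Set S}
    (hU : IsOpen U) (he : SmoothFieldOn e U) (he1 : ∀ x ∈ U, h.metric.inner x (e x) (e x) = 1)
    {W : Set N} (hW : IsOpen W) (hWU : W ⊆ B.proj ⁻¹' U) {x : N} (hx : W ⊆ (extChartAt (𝓡 3) x).source) :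
    DivFrame (riemannianVolume (B.metric δ)) (B.frame δ e) W (structCoeff B δ e) where
  isOpen := hW
  smooth k := (B.smoothFieldOn_frame δ hU he k).mono hWU
  continuousOn j k l := ((contMDiffOn_structCoeff' B hδ hU he j k l).mono hWU).continuousOn
  bracket j k q hq := B.mlieBracket_frame hδ (he1 _ (hWU hq)) j k
  divergence u hu hus huW j := integral_divergence (B.isBilinearMetric δ) hW
    (fun k => (B.smoothFieldOn_frame δ hU he k).mono hWU) hx
    (fun q hq => B.metric_frame hδ (he1 _ (hWU hq)))
    (fun j k l => ((contMDiffOn_structCoeff' B hδ hU he j k l).mono hWU).continuousOn)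
    (fun j k q hq => B.mlieBracket_frame hδ (he1 _ (hWU hq)) j k) hu hus huW j

/-- In an orthonormal frame the density is the continuous function |det P|⁻¹, which is integrable
over a compact neighbourhood in the chart. -/
theorem CircleBundle.isLocallyFiniteMeasure [T2Space S] {δ : ℝ} (hδ : δ ≠ 0) (σ : SpinStructure h) :
    IsLocallyFiniteMeasure (riemannianVolume (B.metric δ)) := by
  refine ⟨fun p => ?_⟩
  set i := σ.indexAt (B.proj p)
  have hU := σ.isOpen_base i
  set φ := chartAt (EuclideanSpace ℝ (Fin 3)) p with hφ
  set W : Set N := (extChartAt (𝓡 3) p).source ∩ B.proj ⁻¹' (σ.base i) with hWdef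
  have hW : IsOpen W := (isOpen_extChartAt_source p).inter (hU.preimage B.proj_smooth.continuous)
  have hpW : p ∈ W := ⟨mem_extChartAt_source p, σ.mem_base_indexAt _⟩
  have hXs : ∀ k, SmoothFieldOn (B.frame δ (σ.e i) k) W :=
    fun k => (B.smoothFieldOn_frame δ hU (σ.e_smooth i) k).mono inter_subset_right
  have hgX : ∀ q ∈ W, ∀ j k, B.metric δ q (B.frame δ (σ.e i) j q) (B.frame δ (σ.e i) k q)
      = if j = k then 1 else 0 := fun q hq => B.metric_frame hδ (σ.e_unit i _ hq.2)
  have hV := isOpen_chartImage p hW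
  have hpV : φ p ∈ chartImage p W := by
    refine ⟨mem_chart_target _ p, ?_⟩
    change φ.symm (φ p) ∈ W
    rw [φ.left_inv (mem_chart_source _ p)]
    exact hpW
  have hc := continuousOn_frameDet_symm (B.isBilinearMetric δ) hW hXs inter_subset_left hgX
  obtain ⟨A, hA, hAc, hAV⟩ : ∃ A ∈ 𝓝 (φ p), IsCompact A ∧ A ⊆ chartImage p W := by
    obtain ⟨A, h1, h2, h3⟩ := exists_compact_subset hV hpV
    exact ⟨A, mem_interior_iff_mem_nhds.1 h2, h1, h3⟩
  refine ⟨W ∩ φ ⁻¹' A, inter_mem (hW.mem_nhds hpW) ((φ.continuousAt (mem_chart_source _ p)).preimage_mem_nhds hA), ?_⟩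
  have hWs : W ⊆ φ.source := fun q hq => by simpa [hφ] using hq.1
  have hm : MeasurableSet (W ∩ φ ⁻¹' A) := by
    have h1 : W ∩ φ ⁻¹' A = φ.symm '' A := by
      ext q
      constructor
      · rintro ⟨hq, hqA⟩
        exact ⟨φ q, hqA, φ.left_inv (hWs hq)⟩
      · rintro ⟨y, hy, rfl⟩
        refine ⟨(hAV hy).2, ?_⟩
        change φ (φ.symm y) ∈ A
        rwa [φ.right_inv (hAV hy).1]
    rw [h1]
    exact (hAc.image_of_continuousOn (φ.continuousOn_symm.mono fun y hy => (hAV hy).1)).isClosed.measurableSet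
  have hae : AEMeasurable φ.symm ((volume.restrict (chartImage p W)).withDensity fun y =>
        ENNReal.ofReal |frameDet (B.frame δ (σ.e i)) p (φ.symm y)|⁻¹) := by
    refine AEMeasurable.mono_ac ?_ (withDensity_absolutelyContinuous _ _)
    exact (φ.continuousOn_symm.mono inter_subset_left).aemeasurable hV.measurableSet
  have h1 : riemannianVolume (B.metric δ) (W ∩ φ ⁻¹' A)
      = (riemannianVolume (B.metric δ)).restrict W (W ∩ φ ⁻¹' A) := by
    rw [Measure.restrict_apply hm, inter_eq_self_of_subset_left inter_subset_left]
  rw [h1, riemannianVolume_restrict_frame (B.isBilinearMetric δ) hW inter_subset_left hgX,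
    Measure.map_apply_of_aemeasurable hae hm, withDensity_apply', Measure.restrict_restrict' hV.measurableSet]
  have hsub : φ.symm ⁻¹' (W ∩ φ ⁻¹' A) ∩ chartImage p W ⊆ A := by
    rintro y ⟨⟨_, hy⟩, hy2⟩
    have : φ (φ.symm y) ∈ A := hy
    rwa [φ.right_inv hy2.1] at this
  refine (lintegral_mono_set hsub).trans_lt ?_
  exact ((hc.mono hAV).integrableOn_compact hAc).lintegral_lt_top

theorem CircleBundle.isFiniteMeasure [T2Space S] [CompactSpace N] {δ : ℝ} (hδ : δ ≠ 0) (σ : SpinStructure h) :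
    IsFiniteMeasure (riemannianVolume (B.metric δ)) := by
  have := B.isLocallyFiniteMeasure hδ σ
  exact ⟨isCompact_univ.measure_lt_top⟩

/-- `|du|²` in an orthonormal frame. -/
theorem gradNorm_sq {δ : ℝ} (hδ : δ ≠ 0) {e : ∀ x : S, TangentSpace (𝓡 2) x} {z : ℝ × N}
    (he : h.metric.inner (B.proj z.2) (e (B.proj z.2)) (e (B.proj z.2)) = 1) (u : ℝ × N → ℝ) :
    gradNorm B δ u z ^ 2 = ∑ a, tubeDeriv (B.frame δ e) a u z ^ 2 := by
  have h1 : dualNormSq (B.metric δ z.2) (fun w => dirDeriv (fun q => u (z.1, q)) z.2 w)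
      = ∑ j, dirDeriv (fun q => u (z.1, q)) z.2 (B.frame δ e j z.2) ^ 2 :=
    B.dualNormSq_metric hδ he (mfderiv (𝓡 3) 𝓘(ℝ, ℝ) (fun q => u (z.1, q)) z.2)
  unfold gradNorm
  rw [h1, Real.sq_sqrt (add_nonneg (sq_nonneg _) (Finset.sum_nonneg fun _ _ => sq_nonneg _)), Fin.sum_univ_succ]
  rfl

/-- The components of the connection form in the frame. -/
theorem contMDiffOn_connForm [T2Space S] {e : ∀ x : S, TangentSpace (𝓡 2) x} {U : Set S}
    (hU : IsOpen U) (he : SmoothFieldOn e U) (j : Fin 3) :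
    ContMDiffOn (𝓡 3) 𝓘(ℝ, ℝ) ∞ (fun p => h.connForm e (B.proj p) (baseFrame h e j (B.proj p))) (B.proj ⁻¹' U) := by
  have h1 : ContMDiffOn (𝓡 2) 𝓘(ℝ, ℝ) ∞ (fun x => h.connForm e x (baseFrame h e j x)) U :=
    ((he.mlieBracket hU (he.J h hU)).inner h (smoothFieldOn_baseFrame (h := h) hU he j)).neg
  exact h1.comp B.proj_smooth.contMDiffOn fun _ hp => hp

end BundleFrame

section SobolevBasics
variable {N : Type*} [TopologicalSpace N] [ChartedSpace (EuclideanSpace ℝ (Fin 3)) N]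
  [IsManifold (𝓡 3) ∞ N] [T2Space N] [SecondCountableTopology N] [MeasurableSpace N] [BorelSpace N]
  {E : Type*} [NormedAddCommGroup E] [NormedSpace ℝ E]
  {ν : Measure N} [IsFiniteMeasureOnCompacts ν] [SFinite ν]
  {X : Fin 3 → ∀ p : N, TangentSpace (𝓡 3) p} {W W' : Set N} {K : Set (ℝ × N)}
  {f : ℝ × N → E} {f' : Fin 4 → ℝ × N → E}

theorem SobolevOn.mono {μ : Measure (ℝ × N)} (hf : SobolevOn μ X W K f f') (hW : W' ⊆ W) :
    SobolevOn μ X W' K f f' := by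
  obtain ⟨F, h1, h2⟩ := hf.approx
  exact ⟨hf.memLp, hf.memLp_deriv, F, fun m => (h1 m).mono (prod_mono_right hW), h2⟩

theorem sobolevOn_zero {μ : Measure (ℝ × N)} : SobolevOn μ X W K (fun _ => (0 : E)) (fun _ _ => 0) := by
  refine ⟨MemLp.zero', fun _ => MemLp.zero', fun _ _ => 0, fun _ => contMDiffOn_const, ?_, fun a => ?_⟩
  · simp
  · have : tubeDeriv X a (fun _ => (0 : E)) = fun _ => 0 := funext fun z => tubeDeriv_const X 0 z a
    simp [this]

/-- Serves for the connection A₀ + ib, whose components are smooth functions plus functions of class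
L^{1,2}. -/
theorem SobolevOn.smooth_add (hW : IsOpen W) (hX : ∀ k, SmoothFieldOn (X k) W) (hK : IsCompact K)
    (hKW : K ⊆ univ ×ˢ W)
    (hf : SobolevOn ((volume : Measure ℝ).prod ν) X W K f f') {g : ℝ × N → E} (hg : SmoothTubeOn g W) :
    SobolevOn ((volume : Measure ℝ).prod ν) X W K (fun z => g z + f z)
      (fun a z => tubeDeriv X a g z + f' a z) := by
  obtain ⟨F, h1, h2, h3⟩ := hf.approx
  refine ⟨(memLp_of_continuousOn hK hKW hg.continuousOn 2).add hf.memLp, fun a =>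
    (memLp_of_continuousOn hK hKW (SmoothTubeOn.tubeDeriv hW hX hg a).continuousOn 2).add (hf.memLp_deriv a),
    fun m z => g z + F m z, fun m => hg.add (h1 m), ?_, fun a => ?_⟩
  · have e (m) : (fun z => g z + F m z) - (fun z => g z + f z) = F m - f := by
      funext z; simp
    simpa only [e] using h2
  · refine (h3 a).congr fun m => ?_
    refine eLpNorm_congr_ae ?_
    filter_upwards [ae_restrict_mem hK.isClosed.measurableSet] with z hz
    simp only [Pi.sub_apply]
    rw [tubeDeriv_add X (hg.mdifferentiableAt hW (hKW hz).2) ((h1 m).mdifferentiableAt hW (hKW hz).2)]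
    abel

end SobolevBasics

/-! ### The equations of a tunneling in a local trivialization -/

section Tunneling
variable {S : Type*} [TopologicalSpace S] [ChartedSpace (EuclideanSpace ℝ (Fin 2)) S]
  [IsManifold (𝓡 2) ∞ S] [T2Space S] {h : OrientedMetric S}
  {N : Type*} [TopologicalSpace N] [ChartedSpace (EuclideanSpace ℝ (Fin 3)) N]
  [IsManifold (𝓡 3) ∞ N] [MulAction Circle N]
  {B : CircleBundle h N} {σ : SpinStructure.{u} h} {L : HermitianLineBundle.{v} 3 N}

/-- The transition functions have modulus one, so the preferred indices in the definition of the
norm may be replaced by any others. -/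
theorem SpinorPath.norm_sq (ψ : SpinorPath B σ L) {i : σ.ι} {k : L.ι} {z : ℝ × N} (hz : z.2 ∈ patch B σ L i k) :
    ψ.norm z ^ 2 = spinInner (ψ.rep i k z) (ψ.rep i k z) := by
  have hz' : z.2 ∈ patch B σ L (σ.indexAt (B.proj z.2)) (L.indexAt z.2) :=
    ⟨σ.mem_base_indexAt _, L.mem_base_indexAt _⟩
  obtain ⟨h0, h1⟩ := ψ.compat _ i _ k z ⟨hz', hz⟩
  unfold SpinorPath.norm
  rw [Real.sq_sqrt (Finset.sum_nonneg fun _ _ => sq_nonneg _), spinInner_self, Fin.sum_univ_two,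
    Fin.sum_univ_two, h0, h1]
  simp only [norm_mul, norm_inv, Circle.norm_coe, inv_one, one_mul]

/-- The norm of `Fin 2 → ℂ` is the maximum norm, not the Hermitian one. -/
theorem norm_sq_le_spinInner (u : Fin 2 → ℂ) : ‖u‖ ^ 2 ≤ spinInner u u := by
  have h1 : ‖u‖ ≤ Real.sqrt (spinInner u u) := by
    refine (pi_norm_le_iff_of_nonneg (Real.sqrt_nonneg _)).2 fun a => Real.le_sqrt_of_sq_le ?_
    rw [spinInner_self]
    exact Finset.single_le_sum (f := fun a => ‖u a‖ ^ 2) (fun _ _ => sq_nonneg _) (Finset.mem_univ a)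
  calc ‖u‖ ^ 2 ≤ Real.sqrt (spinInner u u) ^ 2 := pow_le_pow_left₀ (norm_nonneg _) h1 2
    _ = _ := Real.sq_sqrt (spinInner_self_nonneg u)

theorem SpinorPath.norm_rep_le (ψ : SpinorPath B σ L) {i : σ.ι} {k : L.ι} {z : ℝ × N}
    (hz : z.2 ∈ patch B σ L i k) : ‖ψ.rep i k z‖ ≤ ψ.norm z := by
  have h0 : 0 ≤ ψ.norm z := Real.sqrt_nonneg _
  refine abs_le_of_sq_le_sq' ?_ h0 |>.2
  rw [ψ.norm_sq hz]
  exact norm_sq_le_spinInner _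

/-- The component of the connection form of the base along a frame field. -/
def connComp (B : CircleBundle h N) (σ : SpinStructure.{u} h) (i : σ.ι) (j : Fin 3) (p : N) : ℝ :=
  h.connForm (σ.e i) (B.proj p) (baseFrame h (σ.e i) j (B.proj p))

theorem connComp_eq (i : σ.ι) (δ : ℝ) (j : Fin 3) (p : N) :
    h.connForm (σ.e i) (B.proj p) (B.dproj p (B.frame δ (σ.e i) j p)) = connComp B σ i j p := by
  rw [B.dproj_frame]
  rfl

theorem connComp_zero (i : σ.ι) (p : N) : connComp B σ i 0 p = 0 := by
  unfold connComp OrientedMetric.connForm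
  rw [baseFrame_zero, map_zero, neg_zero]

/-- The Levi-Civita term acts on spinors as (ω/2) c_0, with c_1 c_0 = -c_2 and c_2 c_0 = c_1, and ω
has no component along the fibre. It thus becomes a bounded zeroth order term of the Dirac equation
instead of a part of the connection form α. -/
theorem dirac_eq (A₀ : HermitianConnection L) (i : σ.ι) (k : L.ι) {p : N}
    (b : TangentSpace (𝓡 3) p →L[ℝ] ℝ) (δ : ℝ) (ψ : Fin 2 → ℂ) (ψX : Fin 3 → Fin 2 → ℂ) :
    ∑ j, (cliff j).mulVec (covDeriv B A₀ i k b (B.frame δ (σ.e i) j p) ψ (ψX j))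
      = ∑ j, (cliff j).mulVec (ψX j + (A₀.θ k p (B.frame δ (σ.e i) j p) + b (B.frame δ (σ.e i) j p)) • spinI ψ)
        + ((connComp B σ i 2 p / 2 : ℝ) : ℂ) • (cliff 1).mulVec ψ
        - ((connComp B σ i 1 p / 2 : ℝ) : ℂ) • (cliff 2).mulVec ψ := by
  unfold covDeriv
  simp only [connComp_eq]
  generalize hα : (fun j => A₀.θ k p (B.frame δ (σ.e i) j p) + b (B.frame δ (σ.e i) j p)) = α
  have hα' (j) : A₀.θ k p (B.frame δ (σ.e i) j p) + b (B.frame δ (σ.e i) j p) = α j := congrFun hα j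
  simp only [hα', Fin.sum_univ_three, connComp_zero, cliff_zero_mulVec, cliff_one_mulVec, cliff_two_mulVec]
  ext a
  have hI : Complex.I * Complex.I = -1 := Complex.I_mul_I
  fin_cases a
  · simp [spinI_apply]
    linear_combination (-(connComp B σ i 2 p : ℂ) / 2 * ψ 1) * hI
  · simp [spinI_apply]
    linear_combination ((connComp B σ i 2 p : ℂ) / 2 * ψ 0) * hI

end Tunneling

section TunnelingLocal
variable {S : Type*} [TopologicalSpace S] [ChartedSpace (EuclideanSpace ℝ (Fin 2)) S]
  [IsManifold (𝓡 2) ∞ S] [T2Space S] {h : OrientedMetric S}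
  {N : Type*} [TopologicalSpace N] [ChartedSpace (EuclideanSpace ℝ (Fin 3)) N]
  [IsManifold (𝓡 3) ∞ N] [MulAction Circle N] [T2Space N] [SecondCountableTopology N]
  [MeasurableSpace N] [BorelSpace N]
  {B : CircleBundle h N} {σ : SpinStructure.{u} h} {L : HermitianLineBundle.{v} 3 N}

/-- A bound on `Q` for the structure functions of the frame and for the connection form of the base. -/
structure IsFrameBound (B : CircleBundle h N) (σ : SpinStructure.{u} h) (i : σ.ι) (Q : Set N) (M : ℝ) : Prop where
  structCoeff_le : ∀ p ∈ Q, ∀ j k l, |structCoeff B 1 (σ.e i) j k l p| ≤ M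
  conn_le : ∀ p ∈ Q, ∀ j, |connComp B σ i j p| ≤ M
  curv_le : ∀ p ∈ Q, |dirDeriv (connComp B σ i 1) p (B.frame 1 (σ.e i) 2 p)
    - dirDeriv (connComp B σ i 2) p (B.frame 1 (σ.e i) 1 p)| ≤ M

theorem contMDiffOn_connComp (i : σ.ι) (j : Fin 3) :
    ContMDiffOn (𝓡 3) 𝓘(ℝ, ℝ) ∞ (connComp B σ i j) (B.proj ⁻¹' σ.base i) :=
  contMDiffOn_connForm B (σ.isOpen_base i) (σ.e_smooth i) j

theorem isOpen_preimage_base (B : CircleBundle h N) (σ : SpinStructure.{u} h) (i : σ.ι) :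
    IsOpen (B.proj ⁻¹' σ.base i) :=
  (σ.isOpen_base i).preimage B.proj_smooth.continuous

theorem isOpen_patch (i : σ.ι) (k : L.ι) : IsOpen (patch B σ L i k) :=
  (isOpen_preimage_base B σ i).inter (L.isOpen_base k)

/-- Continuity on a compact set. Only the frame for δ = 1 occurs, so that M does not depend on δ. -/
theorem exists_isFrameBound (i : σ.ι) {Q : Set N} (hQ : IsCompact Q) (hQi : Q ⊆ B.proj ⁻¹' σ.base i) :
    ∃ M, 0 ≤ M ∧ IsFrameBound B σ i Q M := by
  have hO := isOpen_preimage_base B σ i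
  have hD (j k) : ContinuousOn (fun p => dirDeriv (connComp B σ i j) p (B.frame 1 (σ.e i) k p)) (B.proj ⁻¹' σ.base i) :=
    (contMDiffOn_mfderiv_apply hO (contMDiffOn_connComp i j)
      (B.smoothFieldOn_frame 1 (σ.isOpen_base i) (σ.e_smooth i) k)).continuousOn
  have h1 (j k l) := hQ.exists_bound_of_continuousOn
    ((contMDiffOn_structCoeff B (σ.isOpen_base i) (σ.e_smooth i) j k l).continuousOn.mono hQi)
  have h2 (j) := hQ.exists_bound_of_continuousOn ((contMDiffOn_connComp (B := B) i j).continuousOn.mono hQi)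
  obtain ⟨c, hc⟩ := hQ.exists_bound_of_continuousOn (((hD 1 2).sub (hD 2 1)).mono hQi)
  choose a ha using h1
  choose b hb using h2
  refine ⟨(∑ j, ∑ k, ∑ l, |a j k l|) + ∑ j, |b j| + |c|, by positivity, ?_, ?_, ?_⟩
  · intro p hp j k l
    have e1 : |a j k l| ≤ ∑ l, |a j k l| := Finset.single_le_sum (f := fun l => |a j k l|) (fun _ _ => abs_nonneg _) (Finset.mem_univ l)
    have e2 : ∑ l, |a j k l| ≤ ∑ k, ∑ l, |a j k l| := Finset.single_le_sum (f := fun k => ∑ l, |a j k l|) (fun _ _ => by positivity) (Finset.mem_univ k)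
    have e3 : ∑ k, ∑ l, |a j k l| ≤ ∑ j, ∑ k, ∑ l, |a j k l| := Finset.single_le_sum (f := fun j => ∑ k, ∑ l, |a j k l|) (fun _ _ => by positivity) (Finset.mem_univ j)
    have e4 : 0 ≤ ∑ j, |b j| := by positivity
    have := (ha j k l p hp).trans (le_abs_self _)
    rw [Real.norm_eq_abs] at this
    linarith [abs_nonneg c]
  · intro p hp j
    have e1 : |b j| ≤ ∑ j, |b j| := Finset.single_le_sum (f := fun l => |b l|) (fun _ _ => abs_nonneg _) (Finset.mem_univ j)
    have e4 : 0 ≤ ∑ j, ∑ k, ∑ l, |a j k l| := by positivity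
    have := (hb j p hp).trans (le_abs_self _)
    rw [Real.norm_eq_abs] at this
    linarith [abs_nonneg c]
  · intro p hp
    have e4 : 0 ≤ ∑ j, ∑ k, ∑ l, |a j k l| := by positivity
    have e1 : 0 ≤ ∑ j, |b j| := by positivity
    have := (hc p hp).trans (le_abs_self _)
    rw [Real.norm_eq_abs] at this
    exact this.trans (by linarith)

variable {A₀ : HermitianConnection L}

theorem timeDeriv_comp_snd (X : Fin 3 → ∀ p : N, TangentSpace (𝓡 3) p) (f : N → ℝ) (z : ℝ × N) :
    tubeDeriv X 0 (fun z => f z.2) z = 0 := by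
  simp [tubeDeriv, timeDeriv]

/-- The local form of the differential inequality for a tunneling. -/
theorem IsTunneling.exists_local [CompactSpace N] {δ : ℝ} (hδ : 1 ≤ δ) {ψ : SpinorPath B σ L}
    {b : ∀ z : ℝ × N, TangentSpace (𝓡 3) z.2 →L[ℝ] ℝ} (hT : IsTunneling A₀ δ ψ b) :
    ∃ ψ' : σ.ι → L.ι → Fin 4 → ℝ × N → Fin 2 → ℂ, ∀ i k x, ∀ K : Set (ℝ × N), IsCompact K →
      K ⊆ univ ×ˢ (patch B σ L i k ∩ (extChartAt (𝓡 3) x).source) →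
      SobolevOn (B.tubeVolume δ) (B.frame δ (σ.e i)) (patch B σ L i k ∩ (extChartAt (𝓡 3) x).source) K
        (ψ.rep i k) (ψ' i k) ∧
      MemLp (ψ.rep i k) ⊤ ((B.tubeVolume δ).restrict K) ∧
      ∀ M, IsFrameBound B σ i (Prod.snd '' K) M → ∀ φ,
        IsTest (patch B σ L i k ∩ (extChartAt (𝓡 3) x).source) K φ → (∀ z, 0 ≤ φ z) →
        ∫ z in K, ∑ a, tubeDeriv (B.frame δ (σ.e i)) a φ z * spinInner (ψ' i k a z) (ψ.rep i k z) ∂(B.tubeVolume δ)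
          ≤ (181 * M ^ 2 + M) * ∫ z in K, φ z * spinInner (ψ.rep i k z) (ψ.rep i k z) ∂(B.tubeVolume δ) := by
  obtain ⟨ψt, ψX, bt, bX, h1, h2, h3, -, h5⟩ := hT
  have hδ0 : δ ≠ 0 := by positivity
  have hfin := B.isFiniteMeasure hδ0 σ
  refine ⟨fun i k => Fin.cases (ψt.rep i k) (ψX i k), fun i k x K hK hKW => ?_⟩
  set W := patch B σ L i k ∩ (extChartAt (𝓡 3) x).source with hWdef
  have hW : IsOpen W := (isOpen_patch i k).inter (isOpen_extChartAt_source x)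
  have hWi : W ⊆ B.proj ⁻¹' σ.base i := fun p hp => hp.1.1
  have hU := σ.isOpen_base i
  have H : DivFrame (riemannianVolume (B.metric δ)) (B.frame δ (σ.e i)) W (structCoeff B δ (σ.e i)) :=
    B.divFrame hδ0 hU (σ.e_smooth i) (σ.e_unit i) hW hWi (x := x) fun p hp => hp.2
  have hKm := hK.isClosed.measurableSet
  have hψ : SobolevOn (B.tubeVolume δ) (B.frame δ (σ.e i)) W K (ψ.rep i k) (Fin.cases (ψt.rep i k) (ψX i k)) :=
    ((h1 i k).sobolevOn hK fun z hz => ⟨trivial, (hKW hz).2.1⟩).mono inter_subset_left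
  have hb (l) : SobolevOn (B.tubeVolume δ) (B.frame δ (σ.e i)) W K (fun z => b z (B.frame δ (σ.e i) l z.2))
      (Fin.cases (fun z => bt z (B.frame δ (σ.e i) l z.2)) (bX i l)) :=
    ((h2 i l).sobolevOn hK fun z hz => ⟨trivial, hWi (hKW hz).2⟩).mono hWi
  have hψb : MemLp (ψ.rep i k) ⊤ ((B.tubeVolume δ).restrict K) := by
    refine ⟨hψ.memLp.1, lt_of_le_of_lt (eLpNorm_mono_ae ?_) (h3 K hK)⟩
    filter_upwards [ae_restrict_mem hKm] with z hz
    exact (ψ.norm_rep_le (hKW hz).2.1).trans (le_abs_self _)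
  refine ⟨hψ, hψb, fun M hM φ hφ hφ0 => ?_⟩
  let θ : Fin 3 → N → ℝ := fun l p => A₀.θ k p (B.frame δ (σ.e i) l p)
  have hθ (l) : SmoothTubeOn (fun z => θ l z.2) W :=
    SmoothTubeOn.comp_snd (SmoothFormOn.apply (ContMDiffOn.mono (A₀.θ_smooth k) fun p (hp : p ∈ W) => hp.1.2) (H.smooth l))
  -- Temporal gauge: the connection has no component along ℝ.
  let α : Fin 4 → ℝ × N → ℝ := Fin.cases (fun _ => 0)
    fun l z => θ l z.2 + b z (B.frame δ (σ.e i) l z.2)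
  let α' : Fin 4 → Fin 4 → ℝ × N → ℝ := Fin.cases (fun _ _ => 0)
    fun l a z => tubeDeriv (B.frame δ (σ.e i)) a (fun z => θ l z.2) z
      + (Fin.cases (fun z => bt z (B.frame δ (σ.e i) l z.2)) (bX i l) a : ℝ × N → ℝ) z
  have hα (a) : SobolevOn (B.tubeVolume δ) (B.frame δ (σ.e i)) W K (α a) (α' a) := by
    refine Fin.cases ?_ (fun l => ?_) a
    · exact sobolevOn_zero
    · exact SobolevOn.smooth_add hW H.smooth hK hKW (hb l) (hθ l)
  -- The mixed curvature components reduce to ∂_t b, because the component along ℝ and the brackets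
  -- with ∂_t vanish and A₀ does not depend on t.
  have hcurv0 (l : Fin 3) (z) : frameCurv (structCoeff B δ (σ.e i)) α α' 0 l.succ z
      = bt z (B.frame δ (σ.e i) l z.2) := by
    have e1 : α' l.succ 0 z = bt z (B.frame δ (σ.e i) l z.2) := by
      change tubeDeriv (B.frame δ (σ.e i)) 0 (fun z => θ l z.2) z + bt z (B.frame δ (σ.e i) l z.2) = _
      rw [timeDeriv_comp_snd, zero_add]
    have e2 : ∑ d, tubeCoeff (structCoeff B δ (σ.e i)) 0 l.succ d z.2 * α d z = 0 :=
      Finset.sum_eq_zero fun d _ => by simp [tubeCoeff]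
    unfold frameCurv
    rw [e1, e2, sub_zero]
    exact sub_zero _
  have hcurv1 (j l : Fin 3) {z : ℝ × N} (hz : z ∈ K) :
      frameCurv (structCoeff B δ (σ.e i)) α α' j.succ l.succ z
      = extDeriv₁ (A₀.θ k) (B.frame δ (σ.e i) j) (B.frame δ (σ.e i) l) z.2
          + (bX i l j z - bX i j l z - b z (VectorField.mlieBracket (𝓡 3) (B.frame δ (σ.e i) j) (B.frame δ (σ.e i) l) z.2)) := by
    have e1 (j l) : α' l.succ j.succ z = dirDeriv (θ l) z.2 (B.frame δ (σ.e i) j z.2) + bX i l j z := rfl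
    have hbr := H.bracket j l z.2 (hKW hz).2
    have e2 : ∑ d, tubeCoeff (structCoeff B δ (σ.e i)) j.succ l.succ d z.2 * α d z
        = A₀.θ k z.2 (VectorField.mlieBracket (𝓡 3) (B.frame δ (σ.e i) j) (B.frame δ (σ.e i) l) z.2)
          + b z (VectorField.mlieBracket (𝓡 3) (B.frame δ (σ.e i) j) (B.frame δ (σ.e i) l) z.2) := by
      have e3 (T : TangentSpace (𝓡 3) z.2 →L[ℝ] ℝ) :
          T (VectorField.mlieBracket (𝓡 3) (B.frame δ (σ.e i) j) (B.frame δ (σ.e i) l) z.2)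
            = ∑ d, structCoeff B δ (σ.e i) j l d z.2 * T (B.frame δ (σ.e i) d z.2) := by
        refine (congrArg T hbr).trans ((map_sum T _ _).trans (Finset.sum_congr rfl fun d _ => ?_))
        exact map_smul T _ _
      rw [e3, e3, Fin.sum_univ_succ, ← Finset.sum_add_distrib]
      have e4 : tubeCoeff (structCoeff B δ (σ.e i)) j.succ l.succ 0 z.2 * α 0 z = 0 := mul_zero _
      rw [e4, zero_add]
      exact Finset.sum_congr rfl fun d _ => mul_add _ _ _
    unfold frameCurv extDeriv₁
    rw [e1, e1, e2]
    change dirDeriv (θ l) z.2 (B.frame δ (σ.e i) j z.2) + bX i l j z - (dirDeriv (θ j) z.2 (B.frame δ (σ.e i) l z.2) + bX i j l z) - _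
      = dirDeriv (θ l) z.2 (B.frame δ (σ.e i) j z.2) - dirDeriv (θ j) z.2 (B.frame δ (σ.e i) l z.2) - _ + _
    ring
  have hdata := ae_restrict_of_ae (s := K) (h5 i k)
  refine integral_grad_le H hK hKW hψ hψb hα ((contMDiffOn_connComp i 1).mono hWi)
    ((contMDiffOn_connComp i 2).mono hWi) ?_ ?_ ?_ ?_ ?_ ?_ hφ hφ0
  · intro z hz a b c
    have hM0 : 0 ≤ M := (abs_nonneg _).trans (hM.conn_le z.2 ⟨z, hz, rfl⟩ 0)
    have h0 : |(0:ℝ)| ≤ M := by simpa using hM0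
    refine Fin.cases h0 (fun j => Fin.cases h0 (fun k => Fin.cases h0 (fun l => ?_) c) b) a
    -- Here δ ≥ 1 makes the bound uniform: the structure functions for δ are dominated by those for
    -- δ = 1.
    exact (abs_structCoeff_le B hδ hU (σ.e_smooth i) j k l (hWi (hKW hz).2)).trans
      (hM.structCoeff_le z.2 ⟨z, hz, rfl⟩ j k l)
  · exact fun z hz => hM.conn_le z.2 ⟨z, hz, rfl⟩ 1
  · exact fun z hz => hM.conn_le z.2 ⟨z, hz, rfl⟩ 2
  · exact fun z hz => hM.curv_le z.2 ⟨z, hz, rfl⟩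
  · filter_upwards [hdata, ae_restrict_mem hKm] with z hz hzK
    obtain ⟨e1, -⟩ := hz (hKW hzK).2.1
    have e2 := e1.trans (dirac_eq A₀ i k (b z) δ (ψ.rep i k z) fun j => ψX i k j z)
    refine Eq.trans ?_ e2
    change ψt.rep i k z + (0 : ℝ) • spinI (ψ.rep i k z) = _
    rw [zero_smul, add_zero]
  · filter_upwards [hdata, ae_restrict_mem hKm] with z hz hzK
    obtain ⟨-, e1⟩ := hz (hKW hzK).2.1
    -- With the Hodge dual moved to the left, the coefficients of the c_j are the self-dual
    -- curvature components F_{0,j+1} + (*F)_j.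
    rw [eq_sub_iff_add_eq, ← Finset.sum_add_distrib] at e1
    refine Eq.trans (Finset.sum_congr rfl fun j _ => ?_) e1
    rw [← add_smul, ← mul_add, ← Complex.ofReal_add]
    congr 3
    fin_cases j
    · exact congrArg₂ (· + ·) (hcurv0 0 z) (hcurv1 1 2 hzK)
    · exact congrArg₂ (· + ·) (hcurv0 1 z) (hcurv1 2 0 hzK)
    · exact congrArg₂ (· + ·) (hcurv0 2 z) (hcurv1 0 1 hzK)

end TunnelingLocal

/-! ### The chain rule in L² and the truncation of |v|² -/

theorem tendsto_eLpNorm_two_of_dominated {Ω : Type*} [MeasurableSpace Ω] {μ : Measure Ω}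
    {E : Type*} [NormedAddCommGroup E] {f : ℕ → Ω → E} (hf : ∀ m, AEStronglyMeasurable (f m) μ)
    {g : Ω → ℝ} (hg : MemLp g 2 μ) (hfg : ∀ m, ∀ᵐ z ∂μ, ‖f m z‖ ≤ g z)
    (hlim : ∀ᵐ z ∂μ, Tendsto (fun m => f m z) atTop (𝓝 0)) :
    Tendsto (fun m => eLpNorm (f m) 2 μ) atTop (𝓝 0) := by
  have e (m) : eLpNorm (f m) 2 μ = (∫⁻ z, ‖f m z‖ₑ ^ (2 : ℝ) ∂μ) ^ (1 / 2 : ℝ) := by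
    rw [eLpNorm_eq_lintegral_rpow_enorm_toReal (by norm_num) (by norm_num)]; simp
  have h1 : Tendsto (fun m => ∫⁻ z, ‖f m z‖ₑ ^ (2 : ℝ) ∂μ) atTop (𝓝 (∫⁻ _, 0 ∂μ)) := by
    refine tendsto_lintegral_of_dominated_convergence' (fun z => ‖g z‖ₑ ^ (2 : ℝ))
      (fun m => (hf m).enorm.pow_const _) (fun m => ?_) ?_ ?_
    · filter_upwards [hfg m] with z hz
      refine ENNReal.rpow_le_rpow ?_ (by norm_num)
      exact enorm_le_iff_norm_le.2 (hz.trans (le_abs_self _))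
    · have := lintegral_rpow_enorm_lt_top_of_eLpNorm_lt_top (by norm_num) (by norm_num) hg.2
      simpa using this.ne
    · filter_upwards [hlim] with z hz
      have h2 := (ENNReal.continuous_rpow_const (y := (2 : ℝ))).tendsto 0 |>.comp
        ((continuous_enorm.tendsto (0 : E)).comp hz |>.trans_eq (by simp))
      simpa [Function.comp_def] using h2
  simp only [e]
  have h2 := (ENNReal.continuous_rpow_const (y := (1 / 2 : ℝ))).tendsto 0
  rw [lintegral_zero] at h1
  simpa [Function.comp_def] using h2.comp h1

section Composition
variable {N : Type*} [TopologicalSpace N] [ChartedSpace (EuclideanSpace ℝ (Fin 3)) N]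
  [IsManifold (𝓡 3) ∞ N] [T2Space N] [SecondCountableTopology N] [MeasurableSpace N] [BorelSpace N]
  {E : Type*} [NormedAddCommGroup E] [NormedSpace ℝ E]
  {ν : Measure N} [IsFiniteMeasureOnCompacts ν] [SFinite ν]
  {X : Fin 3 → ∀ p : N, TangentSpace (𝓡 3) p} {W : Set N} {K : Set (ℝ × N)}
  {f : ℝ × N → E} {f' : Fin 4 → ℝ × N → E}

/-- The chain rule for a smooth function with bounded derivative. -/
theorem SobolevOn.exists_comp (hW : IsOpen W) (hX : ∀ k, SmoothFieldOn (X k) W) (hK : IsCompact K)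
    (hKW : K ⊆ univ ×ˢ W) (hf : SobolevOn ((volume : Measure ℝ).prod ν) X W K f f')
    {g : E → ℝ} (hg : ContDiff ℝ ∞ g) {c : ℝ} (hc : ∀ v, ‖fderiv ℝ g v‖ ≤ c) :
    ∃ F : ℕ → ℝ × N → E, (∀ m, SmoothTubeOn (F m) W) ∧
      (∀ᵐ z ∂(((volume : Measure ℝ).prod ν).restrict K), Tendsto (fun m => F m z) atTop (𝓝 (f z))) ∧
      Tendsto (fun m => eLpNorm (fun z => g (F m z) - g (f z)) 2 (((volume : Measure ℝ).prod ν).restrict K)) atTop (𝓝 0) ∧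
      ∀ a, Tendsto (fun m => eLpNorm (fun z => tubeDeriv X a (fun z => g (F m z)) z - fderiv ℝ g (f z) (f' a z)) 2
        (((volume : Measure ℝ).prod ν).restrict K)) atTop (𝓝 0) := by
  obtain ⟨F, h1, h2, h3⟩ := hf.approx
  have hKm := hK.isClosed.measurableSet
  have hFm (m) : AEStronglyMeasurable (F m) (((volume : Measure ℝ).prod ν).restrict K) :=
    aesm_of_continuousOn hK hKW (h1 m).continuousOn
  -- A subsequence converging almost everywhere is needed to make g'(F_m) converge pointwise.
  obtain ⟨ns, hns, hae⟩ := (tendstoInMeasure_of_tendsto_eLpNorm (by norm_num) hFm hf.memLp.1 h2).exists_seq_tendsto_ae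
  have hgd : Differentiable ℝ g := hg.differentiable (by simp)
  have hgc : Continuous (fderiv ℝ g) := hg.continuous_fderiv (by simp)
  have hc0 : 0 ≤ c := (norm_nonneg _).trans (hc 0)
  refine ⟨fun m => F (ns m), fun m => h1 _, hae, ?_, fun a => ?_⟩
  · have h4 : Tendsto (fun m => ENNReal.ofReal c * eLpNorm (F (ns m) - f) 2 (((volume : Measure ℝ).prod ν).restrict K))
        atTop (𝓝 0) := by
      have := ENNReal.Tendsto.const_mul (a := ENNReal.ofReal c) (h2.comp hns.tendsto_atTop) (Or.inr ENNReal.ofReal_ne_top)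
      simpa using this
    refine tendsto_of_tendsto_of_tendsto_of_le_of_le tendsto_const_nhds h4 (fun _ => zero_le) fun m => ?_
    refine eLpNorm_le_mul_eLpNorm_of_ae_le_mul (Eventually.of_forall fun z => ?_) 2
    exact Convex.norm_image_sub_le_of_norm_fderiv_le (fun v _ => hgd v) (fun v _ => hc v) convex_univ trivial trivial
  -- The error is g'(F)(dF - f') + (g'(F) - g'(f)) f'. The first part is small because g' is
  -- bounded, the second by dominated convergence.
  · set A : ℕ → ℝ × N → ℝ := fun m z => fderiv ℝ g (F (ns m) z) (tubeDeriv X a (F (ns m)) z - f' a z) with hA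
    set D : ℕ → ℝ × N → ℝ := fun m z => (fderiv ℝ g (F (ns m) z) - fderiv ℝ g (f z)) (f' a z) with hD
    have hev : Continuous fun q : (E →L[ℝ] ℝ) × E => q.1 q.2 := isBoundedBilinearMap_apply.continuous
    have hFd (m) : AEStronglyMeasurable (tubeDeriv X a (F m)) (((volume : Measure ℝ).prod ν).restrict K) :=
      aesm_of_continuousOn hK hKW (SmoothTubeOn.tubeDeriv hW hX (h1 m) a).continuousOn
    have hAm (m) : AEStronglyMeasurable (A m) (((volume : Measure ℝ).prod ν).restrict K) :=
      hev.comp_aestronglyMeasurable ((hgc.comp_aestronglyMeasurable (hFm _)).prodMk ((hFd _).sub (hf.memLp_deriv a).1))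
    have hDm (m) : AEStronglyMeasurable (D m) (((volume : Measure ℝ).prod ν).restrict K) :=
      hev.comp_aestronglyMeasurable (((hgc.comp_aestronglyMeasurable (hFm _)).sub
        (hgc.comp_aestronglyMeasurable hf.memLp.1)).prodMk (hf.memLp_deriv a).1)
    have tA : Tendsto (fun m => eLpNorm (A m) 2 (((volume : Measure ℝ).prod ν).restrict K)) atTop (𝓝 0) := by
      have h4 : Tendsto (fun m => ENNReal.ofReal c * eLpNorm (tubeDeriv X a (F (ns m)) - f' a) 2
          (((volume : Measure ℝ).prod ν).restrict K)) atTop (𝓝 0) := by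
        have := ENNReal.Tendsto.const_mul (a := ENNReal.ofReal c) ((h3 a).comp hns.tendsto_atTop) (Or.inr ENNReal.ofReal_ne_top)
        simpa using this
      refine tendsto_of_tendsto_of_tendsto_of_le_of_le tendsto_const_nhds h4 (fun _ => zero_le) fun m => ?_
      refine eLpNorm_le_mul_eLpNorm_of_ae_le_mul (Eventually.of_forall fun z => ?_) 2
      exact ContinuousLinearMap.le_of_opNorm_le _ (hc _) _
    have tD : Tendsto (fun m => eLpNorm (D m) 2 (((volume : Measure ℝ).prod ν).restrict K)) atTop (𝓝 0) := by
      refine tendsto_eLpNorm_two_of_dominated hDm ((hf.memLp_deriv a).norm.const_mul (c + c))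
        (fun m => Eventually.of_forall fun z => ?_) ?_
      · refine ContinuousLinearMap.le_of_opNorm_le _ ?_ _
        exact (norm_sub_le _ _).trans (add_le_add (hc _) (hc _))
      · filter_upwards [hae] with z hz
        have h5 : Tendsto (fun m => fderiv ℝ g (F (ns m) z)) atTop (𝓝 (fderiv ℝ g (f z))) :=
          (hgc.tendsto _).comp hz
        have h6 : Tendsto (fun m => (fderiv ℝ g (F (ns m) z) - fderiv ℝ g (f z), f' a z)) atTop
            (𝓝 (0, f' a z)) := by
          have := h5.sub_const (fderiv ℝ g (f z))
          rw [sub_self] at this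
          exact this.prodMk_nhds tendsto_const_nhds
        simpa [Function.comp_def, hD] using (hev.tendsto _).comp h6
    have tAD := tA.add tD
    rw [add_zero] at tAD
    refine tendsto_of_tendsto_of_tendsto_of_le_of_le tendsto_const_nhds tAD (fun _ => zero_le) fun m => ?_
    refine le_trans (le_of_eq ?_) (eLpNorm_add_le (hAm m) (hDm m) (by norm_num))
    refine eLpNorm_congr_ae ?_
    filter_upwards [ae_restrict_mem hKm] with z hz
    rw [tubeDeriv_comp X ((h1 _).mdifferentiableAt hW (hKW hz).2) (hgd _)]
    simp [hA, hD]

end Composition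

/-- A bounded smooth function that agrees with `|v|²` on a given ball. -/
theorem exists_truncation (R : ℝ) : ∃ g : (Fin 2 → ℂ) → ℝ, ContDiff ℝ ∞ g ∧ (∀ v, 0 ≤ g v) ∧
    (∃ c, ∀ v, g v ≤ c ∧ ‖fderiv ℝ g v‖ ≤ c) ∧
    ∀ v, ‖v‖ ≤ R → g v = spinInner v v ∧ ∀ u, fderiv ℝ g v u = 2 * spinInner u v := by
  have hR : (0 : ℝ) < |R| + 1 := by positivity
  -- The inner radius exceeds R strictly, so that the truncation agrees with |v|² near every v with
  -- ‖v‖ ≤ R and the derivatives agree as well.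
  let f : ContDiffBump (0 : Fin 2 → ℂ) := ⟨|R| + 1, |R| + 2, hR, by linarith⟩
  have hs : ContDiff ℝ ∞ fun v : Fin 2 → ℂ => spinInner v v :=
    spinInner.isBoundedBilinearMap.contDiff.comp (contDiff_id.prodMk contDiff_id)
  have hg : ContDiff ℝ ∞ fun v => f v * spinInner v v := f.contDiff.mul hs
  have hcs : HasCompactSupport fun v => f v * spinInner v v := f.hasCompactSupport.mul_right
  obtain ⟨c₁, hc₁⟩ := hcs.exists_bound_of_continuous hg.continuous
  obtain ⟨c₂, hc₂⟩ := (hcs.fderiv ℝ).exists_bound_of_continuous (hg.continuous_fderiv (by simp))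
  refine ⟨_, hg, fun v => mul_nonneg f.nonneg (spinInner_self_nonneg v), ⟨max c₁ c₂, fun v =>
    ⟨((le_abs_self _).trans (hc₁ v)).trans (le_max_left _ _), (hc₂ v).trans (le_max_right _ _)⟩⟩, fun v hv => ?_⟩
  have hin : v ∈ Metric.ball (0 : Fin 2 → ℂ) (|R| + 1) := by
    rw [mem_ball_zero_iff]; linarith [le_abs_self R]
  refine ⟨?_, fun u => ?_⟩
  · rw [f.one_of_mem_closedBall (Metric.ball_subset_closedBall hin), one_mul]
  · have he : (fun v => f v * spinInner v v) =ᶠ[𝓝 v] fun v => spinInner v v := by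
      filter_upwards [Metric.isOpen_ball.mem_nhds hin] with w hw
      rw [f.one_of_mem_closedBall (Metric.ball_subset_closedBall hw), one_mul]
    rw [he.fderiv_eq]
    have h2 := HasFDerivAt.comp (f := fun v : Fin 2 → ℂ => (v, v)) v (spinInner.isBoundedBilinearMap.hasFDerivAt (v, v))
      ((hasFDerivAt_id v).prodMk (hasFDerivAt_id v))
    change fderiv ℝ ((fun p : (Fin 2 → ℂ) × (Fin 2 → ℂ) => spinInner p.1 p.2) ∘ fun v => (v, v)) v u = _
    rw [h2.fderiv]
    simp [IsBoundedBilinearMap.deriv]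
    rw [spinInner_comm v u]; ring

/-! ### The pairing ⟨du, dv⟩ for dt² + h_δ -/

section GradInner
variable {S : Type*} [TopologicalSpace S] [ChartedSpace (EuclideanSpace ℝ (Fin 2)) S]
  [IsManifold (𝓡 2) ∞ S] [T2Space S] {h : OrientedMetric S}
  {N : Type*} [TopologicalSpace N] [ChartedSpace (EuclideanSpace ℝ (Fin 3)) N]
  [IsManifold (𝓡 3) ∞ N] [MulAction Circle N] [T2Space N] [SecondCountableTopology N]
  [MeasurableSpace N] [BorelSpace N]
  (B : CircleBundle h N) {δ : ℝ}

/-- The inner product `⟨du, dv⟩` for the metric `dt² + h_δ`. -/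
def gradInner (δ : ℝ) (u v : ℝ × N → ℝ) (z : ℝ × N) : ℝ :=
  (gradNorm B δ (fun z => u z + v z) z ^ 2 - gradNorm B δ (fun z => u z - v z) z ^ 2) / 4

theorem gradInner_eq (hδ : δ ≠ 0) {e : ∀ x : S, TangentSpace (𝓡 2) x} {z : ℝ × N}
    (he : h.metric.inner (B.proj z.2) (e (B.proj z.2)) (e (B.proj z.2)) = 1) {u v : ℝ × N → ℝ}
    (hu : MDifferentiableAt (𝓘(ℝ, ℝ).prod (𝓡 3)) 𝓘(ℝ, ℝ) u z)
    (hv : MDifferentiableAt (𝓘(ℝ, ℝ).prod (𝓡 3)) 𝓘(ℝ, ℝ) v z) :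
    gradInner B δ u v z = ∑ a, tubeDeriv (B.frame δ e) a u z * tubeDeriv (B.frame δ e) a v z := by
  unfold gradInner
  rw [gradNorm_sq B hδ he, gradNorm_sq B hδ he, ← Finset.sum_sub_distrib, Finset.sum_div]
  refine Finset.sum_congr rfl fun a _ => ?_
  rw [tubeDeriv_add _ hu hv, tubeDeriv_sub _ hu hv]
  ring

theorem gradNorm_sq_eq (hδ : δ ≠ 0) (σ : SpinStructure.{u} h) {z : ℝ × N} {u : ℝ × N → ℝ}
    (hu : MDifferentiableAt (𝓘(ℝ, ℝ).prod (𝓡 3)) 𝓘(ℝ, ℝ) u z) :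
    gradNorm B δ u z ^ 2 = gradInner B δ u u z := by
  have he := σ.e_unit _ _ (σ.mem_base_indexAt (B.proj z.2))
  rw [gradNorm_sq B hδ he, gradInner_eq B hδ he hu hu]
  exact Finset.sum_congr rfl fun a _ => sq _

theorem ContMDiff.mdiffAt {u : ℝ × N → ℝ} (hu : ContMDiff (𝓘(ℝ, ℝ).prod (𝓡 3)) 𝓘(ℝ, ℝ) ∞ u) (z : ℝ × N) :
    MDifferentiableAt (𝓘(ℝ, ℝ).prod (𝓡 3)) 𝓘(ℝ, ℝ) u z :=
  (hu z).mdifferentiableAt (by simp)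

/-- Near each point a smooth local orthonormal frame expresses the pairing, which itself is defined
without a frame. -/
theorem continuous_gradInner (hδ : δ ≠ 0) (σ : SpinStructure.{u} h) {u v : ℝ × N → ℝ}
    (hu : ContMDiff (𝓘(ℝ, ℝ).prod (𝓡 3)) 𝓘(ℝ, ℝ) ∞ u) (hv : ContMDiff (𝓘(ℝ, ℝ).prod (𝓡 3)) 𝓘(ℝ, ℝ) ∞ v) :
    Continuous (gradInner B δ u v) := by
  refine continuous_iff_continuousAt.2 fun z => ?_
  set i := σ.indexAt (B.proj z.2)
  have hO := isOpen_preimage_base B σ i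
  have hX (k) := B.smoothFieldOn_frame δ (σ.isOpen_base i) (σ.e_smooth i) k
  have hc (f : ℝ × N → ℝ) (hf : ContMDiff (𝓘(ℝ, ℝ).prod (𝓡 3)) 𝓘(ℝ, ℝ) ∞ f) (a) :=
    (SmoothTubeOn.tubeDeriv hO hX (hf.contMDiffOn (s := univ ×ˢ _)) a).continuousOn
  have h1 : ContinuousOn (fun z => ∑ a, tubeDeriv (B.frame δ (σ.e i)) a u z * tubeDeriv (B.frame δ (σ.e i)) a v z)
      (univ ×ˢ (B.proj ⁻¹' σ.base i)) :=
    continuousOn_finsetSum _ fun a _ => (hc u hu a).mul (hc v hv a)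
  have hn : (univ : Set ℝ) ×ˢ (B.proj ⁻¹' σ.base i) ∈ 𝓝 z :=
    (isOpen_tube hO).mem_nhds ⟨trivial, σ.mem_base_indexAt _⟩
  refine (h1.continuousAt hn).congr ?_
  filter_upwards [hn] with y hy
  exact (gradInner_eq B hδ (σ.e_unit i _ hy.2) (ContMDiff.mdiffAt hu y) (ContMDiff.mdiffAt hv y)).symm

theorem continuous_gradNorm_sq (hδ : δ ≠ 0) (σ : SpinStructure.{u} h) {u : ℝ × N → ℝ}
    (hu : ContMDiff (𝓘(ℝ, ℝ).prod (𝓡 3)) 𝓘(ℝ, ℝ) ∞ u) : Continuous fun z => gradNorm B δ u z ^ 2 :=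
  (continuous_gradInner B hδ σ hu hu).congr fun z => (gradNorm_sq_eq B hδ σ (ContMDiff.mdiffAt hu z)).symm

theorem isCompact_cylinder [CompactSpace N] (T r : ℝ) : IsCompact (cylinder N T r) :=
  isCompact_Icc.prod isCompact_univ

theorem Continuous.integrableOn_cylinder [CompactSpace N] (hδ : δ ≠ 0) (σ : SpinStructure.{u} h) {f : ℝ × N → ℝ}
    (hf : Continuous f) (T r : ℝ) : IntegrableOn f (cylinder N T r) (B.tubeVolume δ) := by
  have := B.isFiniteMeasure hδ σ
  unfold CircleBundle.tubeVolume
  exact hf.continuousOn.integrableOn_compact (isCompact_cylinder T r)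

end GradInner

/-! ### Partitions of unity and local subsolutions -/

section Partition
variable {N : Type*} [TopologicalSpace N] [ChartedSpace (EuclideanSpace ℝ (Fin 3)) N]
  [IsManifold (𝓡 3) ∞ N] [T2Space N] [CompactSpace N]

/-- A finite subcover is chosen first, which makes the partition a sum over a `Finset`; the
functions of the remaining indices are zero. -/
theorem exists_partition (W : N → Set N) (hW : ∀ x, IsOpen (W x)) (hxW : ∀ x, x ∈ W x) :
    ∃ (t : Finset N) (ρ : N → N → ℝ), (∀ x, ContMDiff (𝓡 3) 𝓘(ℝ, ℝ) ∞ (ρ x)) ∧ (∀ x p, 0 ≤ ρ x p) ∧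
      (∀ x, tsupport (ρ x) ⊆ W x) ∧ ∀ p, ∑ x ∈ t, ρ x p = 1 := by
  classical
  obtain ⟨t, ht⟩ := isCompact_univ.elim_finite_subcover W hW fun x _ => mem_iUnion.2 ⟨x, hxW x⟩
  obtain ⟨f, hf⟩ := SmoothPartitionOfUnity.exists_isSubordinate (𝓡 3) isClosed_univ (fun x : t => W x)
    (fun x => hW x) fun p hp => by
      obtain ⟨x, hx⟩ := mem_iUnion.1 (ht hp)
      obtain ⟨hxt, hpx⟩ := mem_iUnion.1 hx
      exact mem_iUnion.2 ⟨⟨x, hxt⟩, hpx⟩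
  refine ⟨t, fun x => if hx : x ∈ t then f ⟨x, hx⟩ else 0, fun x => ?_, fun x p => ?_, fun x => ?_, fun p => ?_⟩
  · by_cases hx : x ∈ t
    · simpa [hx] using (f ⟨x, hx⟩).contMDiff
    · simp only [hx, dif_neg, not_false_eq_true]
      exact contMDiff_const (c := (0 : ℝ))
  · by_cases hx : x ∈ t
    · simpa [hx] using f.nonneg ⟨x, hx⟩ p
    · simp [hx]
  · by_cases hx : x ∈ t
    · simpa [hx] using hf ⟨x, hx⟩
    · simp only [hx, dif_neg, not_false_eq_true]
      rw [tsupport_eq_empty_iff.2 rfl]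
      exact empty_subset _
  · have h1 := f.sum_eq_one (mem_univ p)
    rw [finsum_eq_sum_of_fintype] at h1
    rw [← h1, ← Finset.sum_coe_sort t]
    exact Finset.sum_congr rfl fun x _ => by simp

theorem contMDiff_mul_of_tsupport {ρ : N → ℝ} (hρ : ContMDiff (𝓡 3) 𝓘(ℝ, ℝ) ∞ ρ) {W : Set N} (hW : IsOpen W)
    (hs : tsupport ρ ⊆ W) {G : ℝ × N → ℝ} (hG : SmoothTubeOn G W) :
    ContMDiff (𝓘(ℝ, ℝ).prod (𝓡 3)) 𝓘(ℝ, ℝ) ∞ fun z : ℝ × N => ρ z.2 * G z := by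
  intro z
  by_cases hz : z.2 ∈ W
  · exact ((SmoothTubeOn.comp_snd (hρ.contMDiffOn (s := W))).mul hG).contMDiffAt ((isOpen_tube hW).mem_nhds ⟨trivial, hz⟩)
  · have hn : {y : ℝ × N | y.2 ∉ tsupport ρ} ∈ 𝓝 z :=
      ((isClosed_tsupport ρ).isOpen_compl.preimage continuous_snd).mem_nhds fun h => hz (hs h)
    refine contMDiffAt_const (c := (0 : ℝ)) |>.congr_of_eventuallyEq ?_
    filter_upwards [hn] with y hy
    rw [image_eq_zero_of_notMem_tsupport hy, zero_mul]

end Partition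

section LocalApprox
variable {S : Type*} [TopologicalSpace S] [ChartedSpace (EuclideanSpace ℝ (Fin 2)) S]
  [IsManifold (𝓡 2) ∞ S] [T2Space S] {h : OrientedMetric S}
  {N : Type*} [TopologicalSpace N] [ChartedSpace (EuclideanSpace ℝ (Fin 3)) N]
  [IsManifold (𝓡 3) ∞ N] [MulAction Circle N] [T2Space N] [SecondCountableTopology N]
  [MeasurableSpace N] [BorelSpace N]
  {B : CircleBundle h N} {σ : SpinStructure.{u} h} {L : HermitianLineBundle.{v} 3 N} {A₀ : HermitianConnection L}

/-- The function `w` is over `K` the limit of the bounded smooth functions `G m`, whose derivatives converge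
in `L²`, and `Δw ≥ -2Λw` weakly. -/
structure LocalSubsolution (μ : Measure (ℝ × N)) (X : Fin 3 → ∀ p : N, TangentSpace (𝓡 3) p) (W : Set N)
    (K : Set (ℝ × N)) (Λ : ℝ) (w : ℝ × N → ℝ) (G : ℕ → ℝ × N → ℝ) (c : ℝ) (G' : Fin 4 → ℝ × N → ℝ) : Prop where
  smooth : ∀ m, SmoothTubeOn (G m) W
  nonneg : ∀ m z, 0 ≤ G m z
  le : ∀ m z, G m z ≤ c
  tendsto_ae : ∀ᵐ z ∂(μ.restrict K), Tendsto (fun m => G m z) atTop (𝓝 (w z))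
  memLp : MemLp w 2 (μ.restrict K)
  memLp_deriv : ∀ a, MemLp (G' a) 2 (μ.restrict K)
  tendsto : Tendsto (fun m => eLpNorm (G m - w) 2 (μ.restrict K)) atTop (𝓝 0)
  tendsto_deriv : ∀ a, Tendsto (fun m => eLpNorm (tubeDeriv X a (G m) - G' a) 2 (μ.restrict K)) atTop (𝓝 0)
  weak : ∀ φ, IsTest W K φ → (∀ z, 0 ≤ φ z) →
    ∫ z in K, ∑ a, tubeDeriv X a φ z * G' a z ∂μ ≤ 2 * Λ * ∫ z in K, φ z * w z ∂μ

/-- The approximations are g(F_m), where F_m tends to ψ and g is a bounded truncation of |·|². The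
essential bound of ψ over K lies in the range where g is |·|², so the limit is |ψ|², with
derivatives 2⟨ψ', ψ⟩. Boundedness is what later allows powers of the approximations in test
functions. -/
theorem IsTunneling.exists_localSubsolution [CompactSpace N] {δ : ℝ} (hδ : 1 ≤ δ) {ψ : SpinorPath B σ L}
    {b : ∀ z : ℝ × N, TangentSpace (𝓡 3) z.2 →L[ℝ] ℝ} (hT : IsTunneling A₀ δ ψ b) (i : σ.ι) (k : L.ι) (x : N)
    {K : Set (ℝ × N)} (hK : IsCompact K) (hKW : K ⊆ univ ×ˢ (patch B σ L i k ∩ (extChartAt (𝓡 3) x).source))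
    {M : ℝ} (hM : IsFrameBound B σ i (Prod.snd '' K) M) :
    ∃ G c G', LocalSubsolution (B.tubeVolume δ) (B.frame δ (σ.e i)) (patch B σ L i k ∩ (extChartAt (𝓡 3) x).source)
      K (181 * M ^ 2 + M) (fun z => ψ.norm z ^ 2) G c G' := by
  obtain ⟨ψ', hψ'⟩ := hT.exists_local hδ
  obtain ⟨hS, hb, hin⟩ := hψ' i k x K hK hKW
  have hδ0 : δ ≠ 0 := by positivity
  have hfin := B.isFiniteMeasure hδ0 σ
  have hKm := hK.isClosed.measurableSet
  set W := patch B σ L i k ∩ (extChartAt (𝓡 3) x).source with hWdef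
  have hW : IsOpen W := (isOpen_patch i k).inter (isOpen_extChartAt_source x)
  have hX (l) : SmoothFieldOn (B.frame δ (σ.e i) l) W :=
    ContMDiffOn.mono (B.smoothFieldOn_frame δ (σ.isOpen_base i) (σ.e_smooth i) l) fun p (hp : p ∈ W) => hp.1.1
  set R := (eLpNorm (ψ.rep i k) ⊤ ((B.tubeVolume δ).restrict K)).toReal with hR
  have hRb : ∀ᵐ z ∂((B.tubeVolume δ).restrict K), ‖ψ.rep i k z‖ ≤ R := by
    have h1 := ae_le_eLpNormEssSup (f := ψ.rep i k) (μ := (B.tubeVolume δ).restrict K)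
    filter_upwards [h1] with z hz
    rw [← eLpNorm_exponent_top] at hz
    have := ENNReal.toReal_mono hb.2.ne hz
    simpa [hR] using this
  obtain ⟨g, hg, hg0, ⟨c, hc⟩, hgR⟩ := exists_truncation R
  obtain ⟨F, f1, f2, f3, f4⟩ := SobolevOn.exists_comp hW hX hK hKW hS hg fun v => (hc v).2
  have hw : ∀ᵐ z ∂((B.tubeVolume δ).restrict K), g (ψ.rep i k z) = ψ.norm z ^ 2 := by
    filter_upwards [hRb, ae_restrict_mem hKm] with z hz hzK
    rw [(hgR _ hz).1, ψ.norm_sq (hKW hzK).2.1]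
  have hw' (a) : ∀ᵐ z ∂((B.tubeVolume δ).restrict K), fderiv ℝ g (ψ.rep i k z) (ψ' i k a z)
      = 2 * spinInner (ψ' i k a z) (ψ.rep i k z) := by
    filter_upwards [hRb] with z hz
    exact (hgR _ hz).2 _
  have hKf : IsFiniteMeasure ((B.tubeVolume δ).restrict K) := ⟨by
    rw [Measure.restrict_apply_univ]
    unfold CircleBundle.tubeVolume
    exact hK.measure_lt_top⟩
  refine ⟨fun m z => g (F m z), c, fun a z => 2 * spinInner (ψ' i k a z) (ψ.rep i k z), ?_, fun m z => hg0 _,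
    fun m z => (hc _).1, ?_, ?_, ?_, ?_, ?_, ?_⟩
  · exact fun m => hg.contMDiff.comp_contMDiffOn (f1 m)
  · filter_upwards [f2, hw] with z hz hz2
    rw [← hz2]
    exact (hg.continuous.tendsto _).comp hz
  · refine MemLp.ae_eq hw (MemLp.of_bound (hg.continuous.comp_aestronglyMeasurable hS.memLp.1) c ?_)
    exact Eventually.of_forall fun z => by rw [Real.norm_of_nonneg (hg0 _)]; exact (hc _).1
  · intro a
    refine MemLp.const_mul ?_ 2
    exact spinInner.memLp_of_bilin 2 (hS.memLp_deriv a) hb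
  · refine f3.congr fun m => eLpNorm_congr_ae ?_
    filter_upwards [hw] with z hz
    simp [hz]
  · refine fun a => (f4 a).congr fun m => eLpNorm_congr_ae ?_
    filter_upwards [hw' a] with z hz
    simp [hz]
  · intro φ hφ hφ0
    have h1 := hin M hM φ hφ hφ0
    have e1 : ∫ z in K, ∑ a, tubeDeriv (B.frame δ (σ.e i)) a φ z * (2 * spinInner (ψ' i k a z) (ψ.rep i k z)) ∂(B.tubeVolume δ)
        = 2 * ∫ z in K, ∑ a, tubeDeriv (B.frame δ (σ.e i)) a φ z * spinInner (ψ' i k a z) (ψ.rep i k z) ∂(B.tubeVolume δ) := by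
      rw [← integral_const_mul]
      refine integral_congr_ae (Eventually.of_forall fun z => ?_)
      simp only [Finset.mul_sum]
      exact Finset.sum_congr rfl fun a _ => by ring
    have e2 : ∫ z in K, φ z * ψ.norm z ^ 2 ∂(B.tubeVolume δ)
        = ∫ z in K, φ z * spinInner (ψ.rep i k z) (ψ.rep i k z) ∂(B.tubeVolume δ) :=
      setIntegral_congr_fun hKm fun z hz => by rw [ψ.norm_sq (hKW hz).2.1]
    rw [e1, e2]
    linarith

end LocalApprox

/-! ### Passage to the limit in local subsolutions -/

section SquareLimit
variable {Ω : Type*} [MeasurableSpace Ω] {μ : Measure Ω}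

theorem exists_integral_sq_sub_le {H : ℕ → Ω → ℝ} {f : Ω → ℝ} (hH : ∀ m, MemLp (H m) 2 μ) (hf : MemLp f 2 μ)
    (hlim : Tendsto (fun m => eLpNorm (H m - f) 2 μ) atTop (𝓝 0)) {ε : ℝ} (hε : 0 < ε) :
    ∃ n₀, ∀ m ≥ n₀, ∀ q ≥ n₀, ∫ z, (H m z - H q z) ^ 2 ∂μ ≤ ε := by
  have hd (m) : MemLp (fun z => H m z - f z) 2 μ := (hH m).sub hf
  have h1 : Tendsto (fun m => ∫ z, (H m z - f z) ^ 2 ∂μ) atTop (𝓝 0) := by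
    have h2 := tendsto_integral_bilin (ContinuousLinearMap.mul ℝ ℝ) (μ := μ) (κ := fun _ => 1)
      aestronglyMeasurable_const (M := 1) (by simp) (f := fun _ => 0) (g := fun _ => 0)
      MemLp.zero' MemLp.zero' (f' := fun m z => H m z - f z) (g' := fun m z => H m z - f z)
      (fun m => (hd m).1) (fun m => (hd m).1)
      (hlim.congr fun m => eLpNorm_congr_ae (Eventually.of_forall fun z => by simp))
      (hlim.congr fun m => eLpNorm_congr_ae (Eventually.of_forall fun z => by simp))
    simpa only [sq, one_mul, ContinuousLinearMap.mul_apply', mul_zero, integral_zero] using h2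
  obtain ⟨n₀, hn⟩ := eventually_atTop.1 (h1.eventually (ge_mem_nhds (show (0 : ℝ) < ε / 4 by positivity)))
  refine ⟨n₀, fun m hm q hq => ?_⟩
  have i1 := (hd m).integrable_sq
  have i2 := (hd q).integrable_sq
  calc ∫ z, (H m z - H q z) ^ 2 ∂μ ≤ ∫ z, (2 * (H m z - f z) ^ 2 + 2 * (H q z - f z) ^ 2) ∂μ := by
        refine integral_mono ((hH m).sub (hH q)).integrable_sq ((i1.const_mul 2).add (i2.const_mul 2)) fun z => ?_
        simp only
        nlinarith [sq_nonneg (H m z - f z + (H q z - f z))]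
    _ = 2 * ∫ z, (H m z - f z) ^ 2 ∂μ + 2 * ∫ z, (H q z - f z) ^ 2 ∂μ := by
        rw [integral_add (i1.const_mul 2) (i2.const_mul 2), integral_const_mul, integral_const_mul]
    _ ≤ ε := by linarith [hn m hm, hn q hq]

end SquareLimit

section WeakLimit
variable {N : Type*} [TopologicalSpace N] [ChartedSpace (EuclideanSpace ℝ (Fin 3)) N]
  [IsManifold (𝓡 3) ∞ N] [T2Space N] [SecondCountableTopology N] [MeasurableSpace N] [BorelSpace N]
  {ν : Measure N} [IsFiniteMeasureOnCompacts ν] [SFinite ν]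
  {X : Fin 3 → ∀ p : N, TangentSpace (𝓡 3) p} {W : Set N}
  {C : Fin 3 → Fin 3 → Fin 3 → N → ℝ} {K : Set (ℝ × N)} {φ : ℝ × N → ℝ}

theorem tendsto_integral_mul (hK : IsCompact K) (hKW : K ⊆ univ ×ˢ W) {κ : ℝ × N → ℝ}
    (hκ : ContinuousOn κ (univ ×ˢ W)) {w : ℝ × N → ℝ} {s : ℕ → ℝ × N → ℝ} (hs : ∀ q, SmoothTubeOn (s q) W)
    (hw : MemLp w 2 (((volume : Measure ℝ).prod ν).restrict K))
    (hsw : Tendsto (fun q => eLpNorm (s q - w) 2 (((volume : Measure ℝ).prod ν).restrict K)) atTop (𝓝 0)) :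
    Tendsto (fun q => ∫ z in K, κ z * s q z ∂((volume : Measure ℝ).prod ν)) atTop
      (𝓝 (∫ z in K, κ z * w z ∂((volume : Measure ℝ).prod ν))) := by
  have := tendsto_integralOn_bilin (ContinuousLinearMap.mul ℝ ℝ) hK hKW hκ (f := fun _ => (1 : ℝ))
    (f' := fun _ _ => (1 : ℝ)) (memLp_of_continuousOn hK hKW continuousOn_const 2) hw
    (fun _ => contMDiffOn_const) hs (by simp) hsw
  simpa using this

/-- A second integration by parts moves the derivative from s_q to the test function; after that, L²
convergence of s_q itself is enough. -/
theorem tendsto_integral_tubeDeriv (H : DivFrame ν X W C) (hK : IsCompact K) (hKW : K ⊆ univ ×ˢ W)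
    (hφ : IsTest W K φ) {w : ℝ × N → ℝ} {s : ℕ → ℝ × N → ℝ} (hs : ∀ q, SmoothTubeOn (s q) W)
    (hw : MemLp w 2 (((volume : Measure ℝ).prod ν).restrict K))
    (hsw : Tendsto (fun q => eLpNorm (s q - w) 2 (((volume : Measure ℝ).prod ν).restrict K)) atTop (𝓝 0)) (a : Fin 4) :
    Tendsto (fun q => ∫ z in K, tubeDeriv X a φ z * tubeDeriv X a (s q) z ∂((volume : Measure ℝ).prod ν)) atTop
      (𝓝 (-∫ z in K, adjDeriv X C a (tubeDeriv X a φ) z * w z ∂((volume : Measure ℝ).prod ν))) := by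
  have ht := hφ.tubeDeriv H a
  refine (tendsto_integral_mul hK hKW (continuousOn_adjDeriv H ht.smooth a) hs hw hsw).neg.congr fun q => ?_
  have := (isWeakDeriv_of_smooth H hK hKW (hs q) a).integral_eq _ ht
  linarith

variable {Λ c : ℝ} {w : ℝ × N → ℝ} {G : ℕ → ℝ × N → ℝ} {G' : Fin 4 → ℝ × N → ℝ}

/-- The limit of the pairing depends only on the L² limit w, not on the approximating sequence. This
permits the exchange of the local approximations for the glued ones in `exists_isSubsolution`. -/
theorem LocalSubsolution.tendsto_integral (hL : LocalSubsolution ((volume : Measure ℝ).prod ν) X W K Λ w G c G')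
    (H : DivFrame ν X W C) (hK : IsCompact K) (hKW : K ⊆ univ ×ˢ W)
    (hφ : IsTest W K φ) {s : ℕ → ℝ × N → ℝ} (hs : ∀ q, SmoothTubeOn (s q) W)
    (hsw : Tendsto (fun q => eLpNorm (s q - w) 2 (((volume : Measure ℝ).prod ν).restrict K)) atTop (𝓝 0)) :
    Tendsto (fun q => ∫ z in K, ∑ a, tubeDeriv X a φ z * tubeDeriv X a (s q) z ∂((volume : Measure ℝ).prod ν)) atTop
      (𝓝 (∫ z in K, ∑ a, tubeDeriv X a φ z * G' a z ∂((volume : Measure ℝ).prod ν))) := by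
  have hφ' (a) := (SmoothTubeOn.tubeDeriv H.isOpen H.smooth hφ.smooth a).continuousOn
  have e (a) : ∫ z in K, tubeDeriv X a φ z * G' a z ∂((volume : Measure ℝ).prod ν)
      = -∫ z in K, adjDeriv X C a (tubeDeriv X a φ) z * w z ∂((volume : Measure ℝ).prod ν) := by
    refine tendsto_nhds_unique ?_ (tendsto_integral_tubeDeriv H hK hKW hφ hL.smooth hL.memLp hL.tendsto a)
    exact tendsto_integral_mul hK hKW (hφ' a) (fun q => SmoothTubeOn.tubeDeriv H.isOpen H.smooth (hL.smooth q) a)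
      (hL.memLp_deriv a) (hL.tendsto_deriv a)
  rw [integral_finsetSum]
  · refine (tendsto_finsetSum Finset.univ fun a _ => ?_).congr fun q => (integral_finsetSum _ fun a _ => ?_).symm
    · rw [e]
      exact tendsto_integral_tubeDeriv H hK hKW hφ hs hL.memLp hsw a
    · exact memLp_one_iff_integrable.1 (memLp_of_continuousOn hK hKW
        ((hφ' a).mul (SmoothTubeOn.tubeDeriv H.isOpen H.smooth (hs q) a).continuousOn) 1)
  · intro a _
    have hfi : IsFiniteMeasure (((volume : Measure ℝ).prod ν).restrict K) :=
      ⟨by rw [Measure.restrict_apply_univ]; exact hK.measure_lt_top⟩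
    exact integrableOn_mul_of_continuousOn hK hKW (hφ' a) ((hL.memLp_deriv a).integrable (by norm_num))

/-- By the product rule the derivatives of ρ G_m are controlled by G_m and its derivatives, all of
which converge in L². The factor ρ is the cutoff used for gluing. -/
theorem LocalSubsolution.exists_cauchy (hL : LocalSubsolution ((volume : Measure ℝ).prod ν) X W K Λ w G c G')
    (H : DivFrame ν X W C) (hK : IsCompact K) (hKW : K ⊆ univ ×ˢ W) {ρ : ℝ × N → ℝ} (hρ : SmoothTubeOn ρ W)
    {ε : ℝ} (hε : 0 < ε) :
    ∃ n₀, ∀ m ≥ n₀, ∀ q ≥ n₀, ∫ z in K, ∑ a, tubeDeriv X a (fun z => ρ z * G m z - ρ z * G q z) z ^ 2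
      ∂((volume : Measure ℝ).prod ν) ≤ ε := by
  have hGd (m a) := SmoothTubeOn.tubeDeriv H.isOpen H.smooth (hL.smooth m) a
  have hρd (a) := SmoothTubeOn.tubeDeriv H.isOpen H.smooth hρ a
  have hG2 (m) : MemLp (G m) 2 (((volume : Measure ℝ).prod ν).restrict K) :=
    memLp_of_continuousOn hK hKW (hL.smooth m).continuousOn 2
  have hGd2 (m a) : MemLp (tubeDeriv X a (G m)) 2 (((volume : Measure ℝ).prod ν).restrict K) :=
    memLp_of_continuousOn hK hKW (hGd m a).continuousOn 2
  obtain ⟨M₀, hM₀⟩ := hK.exists_bound_of_continuousOn (hρ.continuousOn.mono hKW)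
  have hM₁ (a) := hK.exists_bound_of_continuousOn ((hρd a).continuousOn.mono hKW)
  choose M₁ hM₁ using hM₁
  set M := M₀ ^ 2 + ∑ a, M₁ a ^ 2 + 1 with hMdef
  have hMpos : 0 < M := by positivity
  have b0 (z) (hz : z ∈ K) : ρ z ^ 2 ≤ M := by
    have h1 : ρ z ^ 2 ≤ M₀ ^ 2 := sq_le_sq' (by linarith [neg_abs_le (ρ z), hM₀ z hz, Real.norm_eq_abs (ρ z)]) ((le_abs_self _).trans (hM₀ z hz))
    have h2 : 0 ≤ ∑ a, M₁ a ^ 2 := by positivity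
    linarith
  have b1 (a z) (hz : z ∈ K) : tubeDeriv X a ρ z ^ 2 ≤ M := by
    have h1 : tubeDeriv X a ρ z ^ 2 ≤ M₁ a ^ 2 := sq_le_sq' (by linarith [neg_abs_le (tubeDeriv X a ρ z), hM₁ a z hz, Real.norm_eq_abs (tubeDeriv X a ρ z)]) ((le_abs_self _).trans (hM₁ a z hz))
    have h2 : M₁ a ^ 2 ≤ ∑ a, M₁ a ^ 2 := Finset.single_le_sum (f := fun a => M₁ a ^ 2) (fun _ _ => sq_nonneg _) (Finset.mem_univ a)
    nlinarith [sq_nonneg M₀]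
  -- Four directions, each with two terms of weight 2M.
  set ε' := ε / (16 * M) with hε'
  have hε'0 : 0 < ε' := by positivity
  obtain ⟨n, hn⟩ := exists_integral_sq_sub_le hG2 hL.memLp hL.tendsto hε'0
  have hk (a) := exists_integral_sq_sub_le (fun m => hGd2 m a) (hL.memLp_deriv a) (hL.tendsto_deriv a) hε'0
  choose k hk using hk
  refine ⟨n + ∑ a, k a, fun m hm q hq => ?_⟩
  have hka (a) : k a ≤ n + ∑ a, k a :=
    (Finset.single_le_sum (f := k) (fun _ _ => Nat.zero_le _) (Finset.mem_univ a)).trans (Nat.le_add_left _ _)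
  have hle (a) : ∀ z ∈ K, tubeDeriv X a (fun z => ρ z * G m z - ρ z * G q z) z ^ 2
      ≤ 2 * M * (G m z - G q z) ^ 2 + 2 * M * (tubeDeriv X a (G m) z - tubeDeriv X a (G q) z) ^ 2 := by
    intro z hz
    have dρ := hρ.mdifferentiableAt H.isOpen (hKW hz).2
    have dG (m) := (hL.smooth m).mdifferentiableAt H.isOpen (hKW hz).2
    have dP (m) := ((hρ.mul (hL.smooth m)).mdifferentiableAt H.isOpen (hKW hz).2)
    rw [tubeDeriv_sub X (dP m) (dP q), tubeDeriv_mul X dρ (dG m), tubeDeriv_mul X dρ (dG q)]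
    have h0 := mul_le_mul_of_nonneg_right (b0 z hz) (sq_nonneg (tubeDeriv X a (G m) z - tubeDeriv X a (G q) z))
    have h1 := mul_le_mul_of_nonneg_right (b1 a z hz) (sq_nonneg (G m z - G q z))
    have h2 := sq_nonneg (tubeDeriv X a ρ z * (G m z - G q z) - ρ z * (tubeDeriv X a (G m) z - tubeDeriv X a (G q) z))
    nlinarith
  have i0 : IntegrableOn (fun z => (G m z - G q z) ^ 2) K ((volume : Measure ℝ).prod ν) :=
    ((hG2 m).sub (hG2 q)).integrable_sq
  have i1 (a) : IntegrableOn (fun z => (tubeDeriv X a (G m) z - tubeDeriv X a (G q) z) ^ 2) K ((volume : Measure ℝ).prod ν) :=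
    ((hGd2 m a).sub (hGd2 q a)).integrable_sq
  have i2 (a) : IntegrableOn (fun z => tubeDeriv X a (fun z => ρ z * G m z - ρ z * G q z) z ^ 2) K
      ((volume : Measure ℝ).prod ν) :=
    memLp_one_iff_integrable.1 (memLp_of_continuousOn hK hKW ((SmoothTubeOn.tubeDeriv H.isOpen H.smooth
      (ContMDiffOn.sub (hρ.mul (hL.smooth m)) (hρ.mul (hL.smooth q))) a).continuousOn.pow 2) 1)
  have i3 (a) : IntegrableOn (fun z => 2 * M * (G m z - G q z) ^ 2
      + 2 * M * (tubeDeriv X a (G m) z - tubeDeriv X a (G q) z) ^ 2) K ((volume : Measure ℝ).prod ν) :=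
    (i0.const_mul (2 * M)).add ((i1 a).const_mul (2 * M))
  rw [integral_finsetSum _ fun a _ => i2 a]
  have hb (a) : ∫ z in K, tubeDeriv X a (fun z => ρ z * G m z - ρ z * G q z) z ^ 2 ∂((volume : Measure ℝ).prod ν)
      ≤ ε / 4 := by
    calc _ ≤ ∫ z in K, (2 * M * (G m z - G q z) ^ 2 + 2 * M * (tubeDeriv X a (G m) z - tubeDeriv X a (G q) z) ^ 2)
          ∂((volume : Measure ℝ).prod ν) :=
          setIntegral_mono_on (i2 a) (i3 a) hK.isClosed.measurableSet (hle a)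
      _ = 2 * M * (∫ z in K, (G m z - G q z) ^ 2 ∂((volume : Measure ℝ).prod ν))
          + 2 * M * ∫ z in K, (tubeDeriv X a (G m) z - tubeDeriv X a (G q) z) ^ 2 ∂((volume : Measure ℝ).prod ν) := by
          rw [integral_add (i0.const_mul _) ((i1 a).const_mul _), integral_const_mul, integral_const_mul]
      _ ≤ 2 * M * ε' + 2 * M * ε' := by
          gcongr
          · exact hn m (by omega) q (by omega)
          · exact hk a m (by have := hka a; omega) q (by have := hka a; omega)
      _ = ε / 4 := by rw [hε']; field_simp; norm_num
  calc _ ≤ ∑ _a : Fin 4, ε / 4 := Finset.sum_le_sum fun a _ => hb a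
    _ = ε := by simp; ring

end WeakLimit

/-! ### Gluing the local subsolutions -/

section Global
variable {S : Type*} [TopologicalSpace S] [ChartedSpace (EuclideanSpace ℝ (Fin 2)) S]
  [IsManifold (𝓡 2) ∞ S] [T2Space S] {h : OrientedMetric S}
  {N : Type*} [TopologicalSpace N] [ChartedSpace (EuclideanSpace ℝ (Fin 3)) N]
  [IsManifold (𝓡 3) ∞ N] [MulAction Circle N] [T2Space N] [SecondCountableTopology N]
  [MeasurableSpace N] [BorelSpace N] [CompactSpace N]
  {B : CircleBundle h N} {σ : SpinStructure.{u} h} {L : HermitianLineBundle.{v} 3 N} {A₀ : HermitianConnection L}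

/-- On `C(T, 2)` the function `w` is the limit of the bounded smooth functions `F m`, whose differentials form a
Cauchy sequence in `L²`, and `Δw ≥ -2Λw` weakly. -/
structure IsSubsolution (B : CircleBundle h N) (δ T Λ : ℝ) (w : ℝ × N → ℝ) (F : ℕ → ℝ × N → ℝ) (R : ℝ) : Prop where
  smooth : ∀ m, ContMDiff (𝓘(ℝ, ℝ).prod (𝓡 3)) 𝓘(ℝ, ℝ) ∞ (F m)
  nonneg : ∀ m z, 0 ≤ F m z
  le : ∀ m z, F m z ≤ R
  tendsto_ae : ∀ᵐ z ∂((B.tubeVolume δ).restrict (cylinder N T 2)), Tendsto (fun m => F m z) atTop (𝓝 (w z))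
  cauchy : ∀ ε > 0, ∃ n₀, ∀ m ≥ n₀, ∀ q ≥ n₀,
    ∫ z in cylinder N T 2, gradNorm B δ (fun z => F m z - F q z) z ^ 2 ∂(B.tubeVolume δ) ≤ ε
  weak : ∀ φ, ContMDiff (𝓘(ℝ, ℝ).prod (𝓡 3)) 𝓘(ℝ, ℝ) ∞ φ → tsupport φ ⊆ Ioo (T - 2) (T + 2) ×ˢ univ →
    (∀ z, 0 ≤ φ z) → ∀ ε > 0, ∀ᶠ q in atTop, ∫ z in cylinder N T 2, gradInner B δ φ (F q) z ∂(B.tubeVolume δ)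
      ≤ 2 * Λ * ∫ z in cylinder N T 2, φ z * w z ∂(B.tubeVolume δ) + ε

theorem gradNorm_eq_zero {δ : ℝ} (hδ : δ ≠ 0) (σ : SpinStructure.{u} h) {u : ℝ × N → ℝ} {z : ℝ × N}
    (hz : z ∉ tsupport u) : gradNorm B δ u z ^ 2 = 0 := by
  rw [gradNorm_sq B hδ (σ.e_unit _ _ (σ.mem_base_indexAt (B.proj z.2)))]
  exact Finset.sum_eq_zero fun a _ => by rw [tubeDeriv_eq_zero_of_notMem_tsupport _ hz]; ring

theorem gradInner_eq_zero {δ : ℝ} (hδ : δ ≠ 0) (σ : SpinStructure.{u} h) {u v : ℝ × N → ℝ} {z : ℝ × N}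
    (hu : ContMDiff (𝓘(ℝ, ℝ).prod (𝓡 3)) 𝓘(ℝ, ℝ) ∞ u) (hv : ContMDiff (𝓘(ℝ, ℝ).prod (𝓡 3)) 𝓘(ℝ, ℝ) ∞ v)
    (hz : z ∉ tsupport u) : gradInner B δ u v z = 0 := by
  rw [gradInner_eq B hδ (σ.e_unit _ _ (σ.mem_base_indexAt (B.proj z.2))) (ContMDiff.mdiffAt hu z) (ContMDiff.mdiffAt hv z)]
  exact Finset.sum_eq_zero fun a _ => by rw [tubeDeriv_eq_zero_of_notMem_tsupport _ hz]; ring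

theorem gradInner_sum_left {δ : ℝ} (hδ : δ ≠ 0) (σ : SpinStructure.{u} h) {ι : Type*} (t : Finset ι)
    {u : ι → ℝ × N → ℝ} {v : ℝ × N → ℝ} (z : ℝ × N)
    (hu : ∀ x ∈ t, ContMDiff (𝓘(ℝ, ℝ).prod (𝓡 3)) 𝓘(ℝ, ℝ) ∞ (u x))
    (hv : ContMDiff (𝓘(ℝ, ℝ).prod (𝓡 3)) 𝓘(ℝ, ℝ) ∞ v) :
    gradInner B δ (fun z => ∑ x ∈ t, u x z) v z = ∑ x ∈ t, gradInner B δ (u x) v z := by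
  have he := σ.e_unit _ _ (σ.mem_base_indexAt (B.proj z.2))
  have h1 (a) := tubeDeriv_sum (B.frame δ (σ.e (σ.indexAt (B.proj z.2)))) t
    (fun x hx => ContMDiff.mdiffAt (hu x hx) z) a
  rw [gradInner_eq B hδ he (h1 0).1 (ContMDiff.mdiffAt hv z), Finset.sum_congr rfl fun x hx =>
    gradInner_eq B hδ he (ContMDiff.mdiffAt (hu x hx) z) (ContMDiff.mdiffAt hv z), Finset.sum_comm]
  refine Finset.sum_congr rfl fun a _ => ?_
  rw [(h1 a).2, Finset.sum_mul]

theorem gradNorm_sum_sq_le {δ : ℝ} (hδ : δ ≠ 0) (σ : SpinStructure.{u} h) {ι : Type*} (t : Finset ι)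
    {u : ι → ℝ × N → ℝ} (z : ℝ × N) (hu : ∀ x ∈ t, ContMDiff (𝓘(ℝ, ℝ).prod (𝓡 3)) 𝓘(ℝ, ℝ) ∞ (u x)) :
    gradNorm B δ (fun z => ∑ x ∈ t, u x z) z ^ 2 ≤ t.card * ∑ x ∈ t, gradNorm B δ (u x) z ^ 2 := by
  have he := σ.e_unit _ _ (σ.mem_base_indexAt (B.proj z.2))
  have h1 (a) := tubeDeriv_sum (B.frame δ (σ.e (σ.indexAt (B.proj z.2)))) t
    (fun x hx => ContMDiff.mdiffAt (hu x hx) z) a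
  rw [gradNorm_sq B hδ he, Finset.sum_congr rfl fun x _ => gradNorm_sq B hδ he (u x), Finset.sum_comm, Finset.mul_sum]
  refine Finset.sum_le_sum fun a _ => ?_
  rw [(h1 a).2]
  exact sq_sum_le_card_mul_sum_sq

variable (B σ L) in
/-- The trivializing neighbourhood of a point. -/
def trivNhd (x : N) : Set N :=
  patch B σ L (σ.indexAt (B.proj x)) (L.indexAt x) ∩ (extChartAt (𝓡 3) x).source

theorem isOpen_trivNhd (x : N) : IsOpen (trivNhd B σ L x) :=
  (isOpen_patch _ _).inter (isOpen_extChartAt_source x)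

theorem mem_trivNhd (x : N) : x ∈ trivNhd B σ L x :=
  ⟨⟨σ.mem_base_indexAt _, L.mem_base_indexAt _⟩, mem_extChartAt_source x⟩

/-- The weak inequality is localized by splitting the test function as Σ ρ_x φ, while w stays whole.
On each piece the glued functions converge to w in L², hence the pairings with d(ρ_x φ) tend to
those of the local derivative, where the local inequality applies. -/
theorem exists_isSubsolution {t : Finset N} {ρ : N → N → ℝ} (hρ : ∀ x, ContMDiff (𝓡 3) 𝓘(ℝ, ℝ) ∞ (ρ x))
    (hρ0 : ∀ x p, 0 ≤ ρ x p) (hρs : ∀ x, tsupport (ρ x) ⊆ trivNhd B σ L x) (hρ1 : ∀ p, ∑ x ∈ t, ρ x p = 1)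
    {δ T : ℝ} (hδ : 1 ≤ δ) {Λ : N → ℝ} {w : ℝ × N → ℝ} (hw0 : ∀ z, 0 ≤ w z) {G : N → ℕ → ℝ × N → ℝ} {c : N → ℝ}
    {G' : N → Fin 4 → ℝ × N → ℝ} {Λ₀ : ℝ} (hΛ : ∀ x ∈ t, Λ x ≤ Λ₀)
    (hL : ∀ x, LocalSubsolution (B.tubeVolume δ) (B.frame δ (σ.e (σ.indexAt (B.proj x)))) (trivNhd B σ L x)
      (Icc (T - 2) (T + 2) ×ˢ tsupport (ρ x)) (Λ x) w (G x) (c x) (G' x)) :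
    IsSubsolution B δ T Λ₀ w (fun m z => ∑ x ∈ t, ρ x z.2 * G x m z) (∑ x ∈ t, c x) := by
  have hδ0 : δ ≠ 0 := by positivity
  have hfin := B.isFiniteMeasure hδ0 σ
  set K : N → Set (ℝ × N) := fun x => Icc (T - 2) (T + 2) ×ˢ tsupport (ρ x) with hKdef
  have hK (x) : IsCompact (K x) := isCompact_Icc.prod (isClosed_tsupport _).isCompact
  have hKW (x) : K x ⊆ univ ×ˢ trivNhd B σ L x := prod_mono (subset_univ _) (hρs x)
  have hKC (x) : K x ⊆ cylinder N T 2 := prod_mono le_rfl (subset_univ _)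
  have hC : MeasurableSet (cylinder N T 2) := (isCompact_cylinder T 2).isClosed.measurableSet
  have H (x) : DivFrame (riemannianVolume (B.metric δ)) (B.frame δ (σ.e (σ.indexAt (B.proj x)))) (trivNhd B σ L x)
      (structCoeff B δ (σ.e (σ.indexAt (B.proj x)))) :=
    B.divFrame hδ0 (σ.isOpen_base _) (σ.e_smooth _) (σ.e_unit _) (isOpen_trivNhd x) (fun p hp => hp.1.1) (x := x)
      fun p hp => hp.2
  have hunit (x) {z : ℝ × N} (hz : z ∈ K x) := σ.e_unit (σ.indexAt (B.proj x)) _ (hKW x hz).2.1.1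
  have hv (x m) : ContMDiff (𝓘(ℝ, ℝ).prod (𝓡 3)) 𝓘(ℝ, ℝ) ∞ fun z : ℝ × N => ρ x z.2 * G x m z :=
    contMDiff_mul_of_tsupport (hρ x) (isOpen_trivNhd x) (hρs x) ((hL x).smooth m)
  have hF (m) : ContMDiff (𝓘(ℝ, ℝ).prod (𝓡 3)) 𝓘(ℝ, ℝ) ∞ fun z : ℝ × N => ∑ x ∈ t, ρ x z.2 * G x m z :=
    contMDiff_finsetSum fun x _ => hv x m
  have hF0 (m z) : 0 ≤ ∑ x ∈ t, ρ x z.2 * G x m z :=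
    Finset.sum_nonneg fun x _ => mul_nonneg (hρ0 _ _) ((hL x).nonneg _ _)
  have hρle (x) (hx : x ∈ t) (p) : ρ x p ≤ 1 := by
    rw [← hρ1 p]
    exact Finset.single_le_sum (f := fun x => ρ x p) (fun x _ => hρ0 x p) hx
  have hFR (m z) : ∑ x ∈ t, ρ x z.2 * G x m z ≤ ∑ x ∈ t, c x :=
    Finset.sum_le_sum fun x hx => (mul_le_of_le_one_left ((hL x).nonneg _ _) (hρle x hx _)).trans ((hL x).le _ _)
  have hlim : ∀ᵐ z ∂((B.tubeVolume δ).restrict (cylinder N T 2)),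
      Tendsto (fun m => ∑ x ∈ t, ρ x z.2 * G x m z) atTop (𝓝 (w z)) := by
    have h1 : ∀ᵐ z ∂(B.tubeVolume δ), ∀ x ∈ t, z ∈ K x → Tendsto (fun m => G x m z) atTop (𝓝 (w z)) := by
      rw [eventually_all_finset]
      exact fun x _ => (ae_restrict_iff' (hK x).isClosed.measurableSet).1 (hL x).tendsto_ae
    rw [ae_restrict_iff' hC]
    filter_upwards [h1] with z hz hzC
    have h2 : w z = ∑ x ∈ t, ρ x z.2 * w z := by rw [← Finset.sum_mul, hρ1, one_mul]
    rw [h2]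
    refine tendsto_finsetSum t fun x hx => ?_
    by_cases hzx : z.2 ∈ tsupport (ρ x)
    · exact (hz x hx ⟨hzC.1, hzx⟩).const_mul _
    · simp [image_eq_zero_of_notMem_tsupport hzx]
  have hCf : IsFiniteMeasure ((B.tubeVolume δ).restrict (cylinder N T 2)) := ⟨by
    rw [Measure.restrict_apply_univ]
    unfold CircleBundle.tubeVolume
    exact (isCompact_cylinder T 2).measure_lt_top⟩
  refine ⟨hF, hF0, hFR, hlim, fun ε hε => ?_, fun φ hφ hφs hφ0 ε hε => ?_⟩
  -- One factor card comes from the Cauchy-Schwarz inequality for the sum over the partition, the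
  -- other from adding the local bounds; the 1 keeps the denominator positive.
  · set ε' := ε / ((t.card : ℝ) * t.card + 1) with hε'
    have hε'0 : 0 < ε' := by positivity
    have hn (x) := (hL x).exists_cauchy (H x) (hK x) (hKW x)
      (SmoothTubeOn.comp_snd ((hρ x).contMDiffOn (s := trivNhd B σ L x))) hε'0
    choose n hn using hn
    refine ⟨∑ x ∈ t, n x, fun m hm q hq => ?_⟩
    have hu (x) : ContMDiff (𝓘(ℝ, ℝ).prod (𝓡 3)) 𝓘(ℝ, ℝ) ∞ fun z : ℝ × N => ρ x z.2 * G x m z - ρ x z.2 * G x q z :=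
      (hv x m).sub (hv x q)
    have hi (x) := Continuous.integrableOn_cylinder B hδ0 σ (continuous_gradNorm_sq B hδ0 σ (hu x)) T 2
    have hx (x) (hx : x ∈ t) : ∫ z in cylinder N T 2, gradNorm B δ (fun z => ρ x z.2 * G x m z - ρ x z.2 * G x q z) z ^ 2
        ∂(B.tubeVolume δ) ≤ ε' := by
      have hnx : n x ≤ ∑ x ∈ t, n x := Finset.single_le_sum (f := n) (fun _ _ => Nat.zero_le _) hx
      refine le_trans (le_of_eq ?_) (hn x m (hnx.trans hm) q (hnx.trans hq))
      rw [setIntegral_eq_of_subset_of_forall_sdiff_eq_zero hC (hKC x)]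
      · exact setIntegral_congr_fun (hK x).isClosed.measurableSet fun z hz => gradNorm_sq B hδ0 (hunit x hz) _
      · intro z hz
        refine gradNorm_eq_zero hδ0 σ fun hzs => hz.2 ⟨hz.1.1, ?_⟩
        have hsub : tsupport (fun z : ℝ × N => ρ x z.2 * G x m z - ρ x z.2 * G x q z) ⊆ Prod.snd ⁻¹' tsupport (ρ x) := by
          refine closure_minimal (fun y hy => ?_) ((isClosed_tsupport _).preimage continuous_snd)
          by_contra hc
          exact hy (by simp [image_eq_zero_of_notMem_tsupport hc])
        exact hsub hzs
    calc ∫ z in cylinder N T 2, gradNorm B δ (fun z => ∑ x ∈ t, ρ x z.2 * G x m z - ∑ x ∈ t, ρ x z.2 * G x q z) z ^ 2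
          ∂(B.tubeVolume δ)
        ≤ ∫ z in cylinder N T 2, t.card * ∑ x ∈ t, gradNorm B δ (fun z => ρ x z.2 * G x m z - ρ x z.2 * G x q z) z ^ 2
          ∂(B.tubeVolume δ) := by
          simp only [← Finset.sum_sub_distrib]
          refine setIntegral_mono_on ?_ ((integrable_finsetSum t fun x _ => hi x).const_mul _) hC fun z _ =>
            gradNorm_sum_sq_le hδ0 σ t z fun x _ => hu x
          exact Continuous.integrableOn_cylinder B hδ0 σ (continuous_gradNorm_sq B hδ0 σ
            (contMDiff_finsetSum fun x _ => hu x)) T 2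
      _ = t.card * ∑ x ∈ t, ∫ z in cylinder N T 2, gradNorm B δ (fun z => ρ x z.2 * G x m z - ρ x z.2 * G x q z) z ^ 2
          ∂(B.tubeVolume δ) := by
          rw [integral_const_mul, integral_finsetSum _ fun x _ => hi x]
      _ ≤ t.card * ∑ x ∈ t, ε' := by
          gcongr with x hxt
          exact hx x hxt
      _ ≤ ε := by
          rw [Finset.sum_const, nsmul_eq_mul, ← mul_assoc, hε', mul_div_assoc', div_le_iff₀ (by positivity)]
          nlinarith
  · have hws (x) : MemLp w 2 ((B.tubeVolume δ).restrict (K x)) := (hL x).memLp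
    have hRw (x) : Tendsto (fun q => eLpNorm ((fun z => ∑ x ∈ t, ρ x z.2 * G x q z) - w) 2 ((B.tubeVolume δ).restrict (K x)))
        atTop (𝓝 0) := by
      have hlimK := ae_restrict_of_ae_restrict_of_subset (hKC x) hlim
      have hKf : IsFiniteMeasure ((B.tubeVolume δ).restrict (K x)) := ⟨by
        rw [Measure.restrict_apply_univ]
        unfold CircleBundle.tubeVolume
        exact (hK x).measure_lt_top⟩
      -- Both the glued functions and w lie between 0 and Σ c_x, and the measure of the piece is
      -- finite.
      refine tendsto_eLpNorm_two_of_dominated (g := fun _ => ∑ x ∈ t, c x) (fun q => ?_) (memLp_const _)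
        (fun q => ?_) ?_
      · exact (hF q).continuous.aestronglyMeasurable.sub (hws x).1
      · filter_upwards [hlimK] with z hz
        have hwR : w z ≤ ∑ x ∈ t, c x := le_of_tendsto' hz fun m => hFR m z
        rw [Pi.sub_apply, Real.norm_eq_abs, abs_le]
        constructor <;> linarith [hFR q z, hF0 q z, hw0 z]
      · filter_upwards [hlimK] with z hz
        simpa using hz.sub_const (w z)
    have hψ (x) : ContMDiff (𝓘(ℝ, ℝ).prod (𝓡 3)) 𝓘(ℝ, ℝ) ∞ fun z : ℝ × N => ρ x z.2 * φ z :=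
      contMDiff_mul_of_tsupport (hρ x) (isOpen_trivNhd x) (hρs x) hφ.contMDiffOn
    have hsup (x) : tsupport (fun z : ℝ × N => ρ x z.2 * φ z) ⊆ K x := by
      have h1 : tsupport (fun z : ℝ × N => ρ x z.2 * φ z) ⊆ tsupport φ := tsupport_mul_subset_right
      have h2 : tsupport (fun z : ℝ × N => ρ x z.2 * φ z) ⊆ Prod.snd ⁻¹' tsupport (ρ x) := by
        refine closure_minimal (fun y hy => ?_) ((isClosed_tsupport _).preimage continuous_snd)
        by_contra hc
        exact hy (by simp [image_eq_zero_of_notMem_tsupport hc])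
      exact fun z hz => ⟨Ioo_subset_Icc_self (hφs (h1 hz)).1, h2 hz⟩
    have htest (x) : IsTest (trivNhd B σ L x) (K x) fun z : ℝ × N => ρ x z.2 * φ z :=
      ⟨(hψ x).contMDiffOn, (hK x).of_isClosed_subset (isClosed_tsupport _) (hsup x), hsup x⟩
    have ht (x) := (hL x).tendsto_integral (H x) (hK x) (hKW x) (htest x) (fun q => (hF q).contMDiffOn) (hRw x)
    have hsum := tendsto_finsetSum t fun x _ => ht x
    have e1 (q) : ∫ z in cylinder N T 2, gradInner B δ φ (fun z => ∑ x ∈ t, ρ x z.2 * G x q z) z ∂(B.tubeVolume δ)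
        = ∑ x ∈ t, ∫ z in K x, ∑ a, tubeDeriv (B.frame δ (σ.e (σ.indexAt (B.proj x)))) a (fun z => ρ x z.2 * φ z) z
          * tubeDeriv (B.frame δ (σ.e (σ.indexAt (B.proj x)))) a (fun z => ∑ x ∈ t, ρ x z.2 * G x q z) z ∂(B.tubeVolume δ) := by
      have e2 : φ = fun z => ∑ x ∈ t, ρ x z.2 * φ z := by
        funext z
        rw [← Finset.sum_mul, hρ1, one_mul]
      conv_lhs => rw [e2]
      simp only [gradInner_sum_left hδ0 σ t _ (fun x _ => hψ x) (hF q)]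
      rw [integral_finsetSum _ fun x _ => Continuous.integrableOn_cylinder B hδ0 σ
        (continuous_gradInner B hδ0 σ (hψ x) (hF q)) T 2]
      refine Finset.sum_congr rfl fun x _ => ?_
      rw [setIntegral_eq_of_subset_of_forall_sdiff_eq_zero hC (hKC x)]
      · exact setIntegral_congr_fun (hK x).isClosed.measurableSet fun z hz =>
          gradInner_eq B hδ0 (hunit x hz) (ContMDiff.mdiffAt (hψ x) z) (ContMDiff.mdiffAt (hF q) z)
      · exact fun z hz => gradInner_eq_zero hδ0 σ (hψ x) (hF q) fun hzs => hz.2 (hsup x hzs)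
    have hwC : IntegrableOn (fun z => φ z * w z) (cylinder N T 2) (B.tubeVolume δ) := by
      have hwm : AEStronglyMeasurable w ((B.tubeVolume δ).restrict (cylinder N T 2)) :=
        aestronglyMeasurable_of_tendsto_ae atTop (fun m => (hF m).continuous.aestronglyMeasurable) hlim
      refine Integrable.mul_bdd (c := ∑ x ∈ t, c x) (Continuous.integrableOn_cylinder B hδ0 σ hφ.continuous T 2) hwm ?_
      filter_upwards [hlim] with z hz
      rw [Real.norm_of_nonneg (hw0 z)]
      exact le_of_tendsto' hz fun m => hFR m z
    have e3 : ∑ x ∈ t, ∫ z in K x, ∑ a, tubeDeriv (B.frame δ (σ.e (σ.indexAt (B.proj x)))) a (fun z => ρ x z.2 * φ z) z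
          * G' x a z ∂(B.tubeVolume δ) ≤ 2 * Λ₀ * ∫ z in cylinder N T 2, φ z * w z ∂(B.tubeVolume δ) := by
      have e4 : ∫ z in cylinder N T 2, φ z * w z ∂(B.tubeVolume δ)
          = ∑ x ∈ t, ∫ z in K x, ρ x z.2 * φ z * w z ∂(B.tubeVolume δ) := by
        have e5 (x) : ∫ z in K x, ρ x z.2 * φ z * w z ∂(B.tubeVolume δ)
            = ∫ z in cylinder N T 2, ρ x z.2 * φ z * w z ∂(B.tubeVolume δ) := by
          refine (setIntegral_eq_of_subset_of_forall_sdiff_eq_zero hC (hKC x) fun z hz => ?_).symm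
          rw [image_eq_zero_of_notMem_tsupport (f := fun z : ℝ × N => ρ x z.2 * φ z) fun hzs => hz.2 (hsup x hzs), zero_mul]
        simp only [e5]
        rw [← integral_finsetSum]
        · refine integral_congr_ae (Eventually.of_forall fun z => ?_)
          simp only [mul_assoc]
          rw [← Finset.sum_mul, hρ1, one_mul]
        · intro x hx
          simp only [mul_assoc]
          refine Integrable.bdd_mul (c := 1) hwC ((hρ x).continuous.comp continuous_snd).aestronglyMeasurable
            (Eventually.of_forall fun z => ?_)
          rw [Real.norm_of_nonneg (hρ0 _ _)]
          exact hρle x hx _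
      rw [e4, Finset.mul_sum]
      refine Finset.sum_le_sum fun x hx => ?_
      refine ((hL x).weak _ (htest x) fun z => mul_nonneg (hρ0 _ _) (hφ0 z)).trans ?_
      refine mul_le_mul_of_nonneg_right (by linarith [hΛ x hx]) (integral_nonneg fun z => ?_)
      exact mul_nonneg (mul_nonneg (hρ0 _ _) (hφ0 z)) (hw0 z)
    filter_upwards [hsum.eventually (gt_mem_nhds (lt_add_of_pos_right _ hε))] with q hq
    rw [e1 q]
    exact hq.le.trans (add_le_add e3 le_rfl)

end Global

/-! ### The subsolution |ψ|² and its energy bounds -/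

section Energy
variable {S : Type*} [TopologicalSpace S] [ChartedSpace (EuclideanSpace ℝ (Fin 2)) S]
  [IsManifold (𝓡 2) ∞ S] [T2Space S] {h : OrientedMetric S}
  {N : Type*} [TopologicalSpace N] [ChartedSpace (EuclideanSpace ℝ (Fin 3)) N]
  [IsManifold (𝓡 3) ∞ N] [MulAction Circle N] [T2Space N] [SecondCountableTopology N]
  [MeasurableSpace N] [BorelSpace N] [CompactSpace N]
  {B : CircleBundle h N} {σ : SpinStructure.{u} h} {L : HermitianLineBundle.{v} 3 N} {A₀ : HermitianConnection L}

variable (B σ A₀) in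
/-- The function `|ψ|²` of a tunneling satisfies `Δ|ψ|² ≥ -2Λ|ψ|²` weakly, with `Λ` independent of `δ`. -/
theorem exists_isSubsolution_of_isTunneling :
    ∃ Λ : ℝ, 0 ≤ Λ ∧ ∀ δ : ℝ, 1 ≤ δ → ∀ (ψ : SpinorPath B σ L) (b : ∀ z : ℝ × N, TangentSpace (𝓡 3) z.2 →L[ℝ] ℝ),
      IsTunneling A₀ δ ψ b → ∀ T : ℝ, ∃ F R, IsSubsolution B δ T Λ (fun z => ψ.norm z ^ 2) F R := by
  obtain ⟨t, ρ, hρ, hρ0, hρs, hρ1⟩ := exists_partition (trivNhd B σ L) isOpen_trivNhd mem_trivNhd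
  have hM (x) := exists_isFrameBound (B := B) (σ.indexAt (B.proj x)) (isClosed_tsupport (ρ x)).isCompact
    fun p hp => (hρs x hp).1.1
  choose M hM0 hM using hM
  -- The partition and the bounds M are fixed before δ, ψ and T appear; the sum dominates every
  -- local constant.
  refine ⟨∑ x ∈ t, (181 * M x ^ 2 + M x), Finset.sum_nonneg fun x _ => by have := hM0 x; positivity,
    fun δ hδ ψ b hT T => ?_⟩
  have hK (x) : IsCompact (Icc (T - 2) (T + 2) ×ˢ tsupport (ρ x)) := isCompact_Icc.prod (isClosed_tsupport _).isCompact
  have hG (x) := hT.exists_localSubsolution hδ (σ.indexAt (B.proj x)) (L.indexAt x) x (hK x)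
    (prod_mono (subset_univ _) (hρs x)) (M := M x) (by
      have h1 : Prod.snd '' (Icc (T - 2) (T + 2) ×ˢ tsupport (ρ x)) ⊆ tsupport (ρ x) := by
        rintro _ ⟨z, hz, rfl⟩
        exact hz.2
      exact ⟨fun p hp => (hM x).1 p (h1 hp), fun p hp => (hM x).2 p (h1 hp), fun p hp => (hM x).3 p (h1 hp)⟩)
  choose G c G' hG using hG
  refine ⟨_, _, exists_isSubsolution hρ hρ0 hρs hρ1 hδ (fun z => sq_nonneg _) (fun x hx => ?_) hG⟩
  exact Finset.single_le_sum (f := fun x => 181 * M x ^ 2 + M x) (fun x _ => by have := hM0 x; positivity) hx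

theorem isFiniteMeasure_cylinder (σ : SpinStructure.{u} h) {δ : ℝ} (hδ : δ ≠ 0) (T r : ℝ) :
    IsFiniteMeasure ((B.tubeVolume δ).restrict (cylinder N T r)) := by
  have := B.isFiniteMeasure hδ σ
  refine ⟨?_⟩
  rw [Measure.restrict_apply_univ]
  unfold CircleBundle.tubeVolume
  exact (isCompact_cylinder T r).measure_lt_top

variable {δ T Λ R : ℝ} {w : ℝ × N → ℝ} {F : ℕ → ℝ × N → ℝ}

theorem IsSubsolution.aestronglyMeasurable (hF : IsSubsolution B δ T Λ w F R) :
    AEStronglyMeasurable w ((B.tubeVolume δ).restrict (cylinder N T 2)) :=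
  aestronglyMeasurable_of_tendsto_ae atTop (fun m => (hF.smooth m).continuous.aestronglyMeasurable) hF.tendsto_ae

theorem IsSubsolution.ae_mem_Icc (hF : IsSubsolution B δ T Λ w F R) :
    ∀ᵐ z ∂((B.tubeVolume δ).restrict (cylinder N T 2)), w z ∈ Icc 0 R := by
  filter_upwards [hF.tendsto_ae] with z hz
  exact ⟨ge_of_tendsto' hz fun m => hF.nonneg m z, le_of_tendsto' hz fun m => hF.le m z⟩

/-- Dominated convergence with 0 ≤ F_m, w ≤ R. The two exponents allow mixed integrands such as
F_m^(2n+1) w. -/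
theorem IsSubsolution.tendsto_integral (hF : IsSubsolution B δ T Λ w F R) (σ : SpinStructure.{u} h) (hδ : δ ≠ 0)
    {κ : ℝ × N → ℝ} (hκ : Continuous κ) (a b : ℕ) :
    Tendsto (fun m => ∫ z in cylinder N T 2, κ z * F m z ^ a * w z ^ b ∂(B.tubeVolume δ)) atTop
      (𝓝 (∫ z in cylinder N T 2, κ z * w z ^ a * w z ^ b ∂(B.tubeVolume δ))) := by
  have := isFiniteMeasure_cylinder (B := B) σ hδ T 2
  have hC : MeasurableSet (cylinder N T 2) := (isCompact_cylinder T 2).isClosed.measurableSet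
  obtain ⟨M, hM⟩ := (isCompact_cylinder (N := N) T 2).exists_bound_of_continuousOn hκ.continuousOn
  refine tendsto_integral_of_dominated_convergence (fun _ => |M| * |R| ^ a * |R| ^ b) (fun m => ?_)
    (integrable_const _) (fun m => ?_) ?_
  · exact (hκ.aestronglyMeasurable.mul ((hF.smooth m).continuous.pow a).aestronglyMeasurable).mul
      (hF.aestronglyMeasurable.pow b)
  · filter_upwards [ae_restrict_mem hC, hF.ae_mem_Icc] with z hz hw
    rw [norm_mul, norm_mul, norm_pow, norm_pow]
    have h1 : ‖F m z‖ ≤ |R| := by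
      rw [Real.norm_of_nonneg (hF.nonneg m z)]
      exact (hF.le m z).trans (le_abs_self R)
    have h2 : ‖w z‖ ≤ |R| := by
      rw [Real.norm_of_nonneg hw.1]
      exact hw.2.trans (le_abs_self R)
    have h3 := (hM z hz).trans (le_abs_self M)
    gcongr
  · filter_upwards [hF.tendsto_ae] with z hz
    exact ((hz.pow a).const_mul _).mul_const _

theorem IsSubsolution.integrable (hF : IsSubsolution B δ T Λ w F R) (σ : SpinStructure.{u} h) (hδ : δ ≠ 0)
    {κ : ℝ × N → ℝ} (hκ : Continuous κ) (a : ℕ) :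
    IntegrableOn (fun z => κ z * w z ^ a) (cylinder N T 2) (B.tubeVolume δ) := by
  refine Integrable.mul_bdd (c := R ^ a) (Continuous.integrableOn_cylinder B hδ σ hκ T 2)
    (hF.aestronglyMeasurable.pow a) ?_
  filter_upwards [hF.ae_mem_Icc] with z hz
  rw [norm_pow, Real.norm_of_nonneg hz.1]
  exact pow_le_pow_left₀ hz.1 hz.2 a

theorem gradInner_le (hδ : δ ≠ 0) (σ : SpinStructure.{u} h) {u v : ℝ × N → ℝ} {z : ℝ × N}
    (hu : MDifferentiableAt (𝓘(ℝ, ℝ).prod (𝓡 3)) 𝓘(ℝ, ℝ) u z)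
    (hv : MDifferentiableAt (𝓘(ℝ, ℝ).prod (𝓡 3)) 𝓘(ℝ, ℝ) v z) {η : ℝ} (hη : 0 < η) :
    gradInner B δ u v z ≤ η * gradNorm B δ u z ^ 2 + η⁻¹ * gradNorm B δ v z ^ 2 := by
  have he := σ.e_unit _ _ (σ.mem_base_indexAt (B.proj z.2))
  rw [gradNorm_sq B hδ he, gradNorm_sq B hδ he, gradInner_eq B hδ he hu hv, Finset.mul_sum, Finset.mul_sum,
    ← Finset.sum_add_distrib]
  refine Finset.sum_le_sum fun a _ => ?_
  set x := tubeDeriv (B.frame δ (σ.e (σ.indexAt (B.proj z.2)))) a u z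
  set y := tubeDeriv (B.frame δ (σ.e (σ.indexAt (B.proj z.2)))) a v z
  have h1 : 0 ≤ η⁻¹ * ((η * x - y) ^ 2 + (η * x) ^ 2 + y ^ 2) := by positivity
  have h2 : η⁻¹ * ((η * x - y) ^ 2 + (η * x) ^ 2 + y ^ 2) = 2 * (η * x ^ 2 + η⁻¹ * y ^ 2 - x * y) := by
    field_simp; ring
  linarith

theorem gradInner_sub_right (hδ : δ ≠ 0) (σ : SpinStructure.{u} h) {u v v' : ℝ × N → ℝ} {z : ℝ × N}
    (hu : MDifferentiableAt (𝓘(ℝ, ℝ).prod (𝓡 3)) 𝓘(ℝ, ℝ) u z)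
    (hv : MDifferentiableAt (𝓘(ℝ, ℝ).prod (𝓡 3)) 𝓘(ℝ, ℝ) v z)
    (hv' : MDifferentiableAt (𝓘(ℝ, ℝ).prod (𝓡 3)) 𝓘(ℝ, ℝ) v' z) :
    gradInner B δ u (fun z => v z - v' z) z = gradInner B δ u v z - gradInner B δ u v' z := by
  have he := σ.e_unit _ _ (σ.mem_base_indexAt (B.proj z.2))
  have hs : MDifferentiableAt (𝓘(ℝ, ℝ).prod (𝓡 3)) 𝓘(ℝ, ℝ) (fun z => v z - v' z) z := hv.sub hv'
  rw [gradInner_eq B hδ he hu hv, gradInner_eq B hδ he hu hv', gradInner_eq B hδ he hu hs,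
    ← Finset.sum_sub_distrib]
  refine Finset.sum_congr rfl fun a _ => ?_
  rw [tubeDeriv_sub _ hv hv', mul_sub]

theorem gradNorm_sq_le_sub (hδ : δ ≠ 0) (σ : SpinStructure.{u} h) {u v : ℝ × N → ℝ} {z : ℝ × N}
    (hu : MDifferentiableAt (𝓘(ℝ, ℝ).prod (𝓡 3)) 𝓘(ℝ, ℝ) u z)
    (hv : MDifferentiableAt (𝓘(ℝ, ℝ).prod (𝓡 3)) 𝓘(ℝ, ℝ) v z) :
    gradNorm B δ u z ^ 2 ≤ 2 * gradNorm B δ (fun z => u z - v z) z ^ 2 + 2 * gradNorm B δ v z ^ 2 := by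
  have he := σ.e_unit _ _ (σ.mem_base_indexAt (B.proj z.2))
  rw [gradNorm_sq B hδ he, gradNorm_sq B hδ he, gradNorm_sq B hδ he, Finset.mul_sum, Finset.mul_sum,
    ← Finset.sum_add_distrib]
  refine Finset.sum_le_sum fun a _ => ?_
  rw [tubeDeriv_sub _ hu hv]
  set x := tubeDeriv (B.frame δ (σ.e (σ.indexAt (B.proj z.2)))) a u z
  set y := tubeDeriv (B.frame δ (σ.e (σ.indexAt (B.proj z.2)))) a v z
  nlinarith [sq_nonneg (x - 2 * y)]

/-- A Cauchy sequence is bounded: every gradient is compared with that of F at the index n₀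
belonging to tolerance 1. -/
theorem IsSubsolution.exists_gradNorm_le (hF : IsSubsolution B δ T Λ w F R) (hδ : δ ≠ 0) (σ : SpinStructure.{u} h) :
    ∃ E n₀, 0 ≤ E ∧ ∀ m ≥ n₀, ∫ z in cylinder N T 2, gradNorm B δ (F m) z ^ 2 ∂(B.tubeVolume δ) ≤ E := by
  obtain ⟨n₀, hn⟩ := hF.cauchy 1 one_pos
  have hi (u : ℝ × N → ℝ) (hu : ContMDiff (𝓘(ℝ, ℝ).prod (𝓡 3)) 𝓘(ℝ, ℝ) ∞ u) :=
    Continuous.integrableOn_cylinder B hδ σ (continuous_gradNorm_sq B hδ σ hu) T 2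
  refine ⟨2 * 1 + 2 * ∫ z in cylinder N T 2, gradNorm B δ (F n₀) z ^ 2 ∂(B.tubeVolume δ), n₀, ?_, fun m hm => ?_⟩
  · have : 0 ≤ ∫ z in cylinder N T 2, gradNorm B δ (F n₀) z ^ 2 ∂(B.tubeVolume δ) := integral_nonneg fun z => sq_nonneg _
    positivity
  · have i1 := hi _ ((hF.smooth m).sub (hF.smooth n₀))
    have i2 := hi _ (hF.smooth n₀)
    calc _ ≤ ∫ z in cylinder N T 2, (2 * gradNorm B δ (fun z => F m z - F n₀ z) z ^ 2 + 2 * gradNorm B δ (F n₀) z ^ 2)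
          ∂(B.tubeVolume δ) := by
          refine integral_mono (hi _ (hF.smooth m)) ((i1.const_mul 2).add (i2.const_mul 2)) fun z => ?_
          exact gradNorm_sq_le_sub hδ σ (ContMDiff.mdiffAt (hF.smooth m) z) (ContMDiff.mdiffAt (hF.smooth n₀) z)
      _ = 2 * (∫ z in cylinder N T 2, gradNorm B δ (fun z => F m z - F n₀ z) z ^ 2 ∂(B.tubeVolume δ))
          + 2 * ∫ z in cylinder N T 2, gradNorm B δ (F n₀) z ^ 2 ∂(B.tubeVolume δ) := by
          rw [integral_add (i1.const_mul 2) (i2.const_mul 2), integral_const_mul, integral_const_mul]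
      _ ≤ _ := by gcongr; exact hn m hm n₀ le_rfl

end Energy

/-! ### Testing with powers of the subsolution -/

section Moser
variable {S : Type*} [TopologicalSpace S] [ChartedSpace (EuclideanSpace ℝ (Fin 2)) S]
  [IsManifold (𝓡 2) ∞ S] [T2Space S] {h : OrientedMetric S}
  {N : Type*} [TopologicalSpace N] [ChartedSpace (EuclideanSpace ℝ (Fin 3)) N]
  [IsManifold (𝓡 3) ∞ N] [MulAction Circle N] [T2Space N] [SecondCountableTopology N]
  [MeasurableSpace N] [BorelSpace N] [CompactSpace N]
  {B : CircleBundle h N} {δ T Λ R : ℝ} {w : ℝ × N → ℝ} {F : ℕ → ℝ × N → ℝ}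

theorem tubeDeriv_pow (X : Fin 3 → ∀ p : N, TangentSpace (𝓡 3) p) {f : ℝ × N → ℝ} {z : ℝ × N}
    (hf : MDifferentiableAt (𝓘(ℝ, ℝ).prod (𝓡 3)) 𝓘(ℝ, ℝ) f z) (n : ℕ) (a : Fin 4) :
    tubeDeriv X a (fun z => f z ^ (n + 1)) z = (n + 1) * f z ^ n * tubeDeriv X a f z := by
  have h1 := tubeDeriv_comp X hf (g := fun x : ℝ => x ^ (n + 1)) (by fun_prop) a
  rw [h1, fderiv_eq_smul_deriv]
  simp
  ring

theorem contMDiff_comp_fst {χ : ℝ → ℝ} (hχ : ContDiff ℝ ∞ χ) :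
    ContMDiff (𝓘(ℝ, ℝ).prod (𝓡 3)) 𝓘(ℝ, ℝ) ∞ fun z : ℝ × N => χ z.1 :=
  hχ.contMDiff.comp contMDiff_fst

theorem contMDiff_pow {f : ℝ × N → ℝ} (hf : ContMDiff (𝓘(ℝ, ℝ).prod (𝓡 3)) 𝓘(ℝ, ℝ) ∞ f) (n : ℕ) :
    ContMDiff (𝓘(ℝ, ℝ).prod (𝓡 3)) 𝓘(ℝ, ℝ) ∞ fun z => f z ^ n :=
  (contDiff_id.pow n).contMDiff.comp hf

theorem sum_tubeDeriv_comp_fst (X : Fin 3 → ∀ p : N, TangentSpace (𝓡 3) p) (χ : ℝ → ℝ) (z : ℝ × N) :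
    ∑ a, tubeDeriv X a (fun z => χ z.1) z ^ 2 = deriv χ z.1 ^ 2 := by
  rw [Fin.sum_univ_succ]
  have h0 : tubeDeriv X 0 (fun z => χ z.1) z = deriv χ z.1 := rfl
  have h1 (j : Fin 3) : tubeDeriv X j.succ (fun z => χ z.1) z = 0 := by
    change mfderiv (𝓡 3) 𝓘(ℝ, ℝ) (fun _ : N => χ z.1) z.2 (X j z.2) = 0
    rw [mfderiv_const]
    rfl
  simp [h0, h1]

/-- In each direction put X = f^(n+1) ∂χ and Y = χ f^n ∂f. The left side is (X + (n+1)Y)² and the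
pairing is 2XY + (2n+1)Y², so a quadratic inequality remains. The prefactors grow only linearly in n
+ 1, as the iteration requires. -/
theorem gradNorm_cutoff_pow_sq_le (hδ : δ ≠ 0) (σ : SpinStructure.{u} h) {χ : ℝ → ℝ} (hχ : ContDiff ℝ ∞ χ)
    {f : ℝ × N → ℝ} (hf : ContMDiff (𝓘(ℝ, ℝ).prod (𝓡 3)) 𝓘(ℝ, ℝ) ∞ f) (n : ℕ) (z : ℝ × N) :
    gradNorm B δ (fun z => χ z.1 * f z ^ (n + 1)) z ^ 2
      ≤ 4 * (n + 1) * gradInner B δ (fun z => χ z.1 ^ 2 * f z ^ (2 * n + 1)) f z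
        + 10 * (n + 1) * (deriv χ z.1 ^ 2 * f z ^ (2 * n + 2)) := by
  have he := σ.e_unit _ _ (σ.mem_base_indexAt (B.proj z.2))
  have dχ := ContMDiff.mdiffAt (contMDiff_comp_fst (N := N) hχ) z
  have dχ2 := ContMDiff.mdiffAt (contMDiff_pow (contMDiff_comp_fst (N := N) hχ) 2) z
  have df := ContMDiff.mdiffAt hf z
  have dfp (k) := ContMDiff.mdiffAt (contMDiff_pow hf k) z
  have dφ : MDifferentiableAt (𝓘(ℝ, ℝ).prod (𝓡 3)) 𝓘(ℝ, ℝ) (fun z : ℝ × N => χ z.1 ^ 2 * f z ^ (2 * n + 1)) z :=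
    ContMDiff.mdiffAt ((contMDiff_pow (contMDiff_comp_fst (N := N) hχ) 2).mul (contMDiff_pow hf (2 * n + 1))) z
  rw [gradNorm_sq B hδ he, gradInner_eq B hδ he dφ df,
    ← sum_tubeDeriv_comp_fst (B.frame δ (σ.e (σ.indexAt (B.proj z.2)))), Finset.mul_sum, Finset.sum_mul, Finset.mul_sum,
    ← Finset.sum_add_distrib]
  refine Finset.sum_le_sum fun a _ => ?_
  have e1 := tubeDeriv_pow (B.frame δ (σ.e (σ.indexAt (B.proj z.2)))) dχ 1 a
  norm_num at e1
  rw [tubeDeriv_mul _ dχ (dfp _), tubeDeriv_mul _ dχ2 (dfp _), tubeDeriv_pow _ df, tubeDeriv_pow _ df, e1]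
  generalize tubeDeriv (B.frame δ (σ.e (σ.indexAt (B.proj z.2)))) a (fun z => χ z.1) z = d
  generalize tubeDeriv (B.frame δ (σ.e (σ.indexAt (B.proj z.2)))) a f z = g
  generalize χ z.1 = c
  generalize f z = y
  have key (k X Y : ℝ) (hk : 0 ≤ k) : (X + (k + 1) * Y) ^ 2
      ≤ 4 * (k + 1) * (2 * X * Y + (2 * k + 1) * Y ^ 2) + 10 * (k + 1) * X ^ 2 := by
    nlinarith [mul_nonneg hk (sq_nonneg (3 * X + Y)), sq_nonneg (3 * X + Y), mul_nonneg hk (sq_nonneg X),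
      mul_nonneg hk (sq_nonneg Y), mul_nonneg hk (mul_nonneg hk (sq_nonneg Y)), sq_nonneg Y]
  have h1 := key n (d * y ^ (n + 1)) (c * y ^ n * g) n.cast_nonneg
  refine le_trans (le_of_eq ?_) (h1.trans (le_of_eq ?_))
  · ring
  · push_cast; ring

/-- A crude bound whose only use is to keep the gradients of the test functions χ² F_m^(2n+1)
bounded in L² as m grows. -/
theorem gradNorm_test_sq_le (hδ : δ ≠ 0) (σ : SpinStructure.{u} h) {χ : ℝ → ℝ} (hχ : ContDiff ℝ ∞ χ)
    {f : ℝ × N → ℝ} (hf : ContMDiff (𝓘(ℝ, ℝ).prod (𝓡 3)) 𝓘(ℝ, ℝ) ∞ f) (n : ℕ) (z : ℝ × N) :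
    gradNorm B δ (fun z => χ z.1 ^ 2 * f z ^ (2 * n + 1)) z ^ 2
      ≤ 8 * (χ z.1 * deriv χ z.1 * f z ^ (2 * n + 1)) ^ 2
        + 2 * ((2 * n + 1) * (χ z.1 ^ 2 * f z ^ (2 * n))) ^ 2 * gradNorm B δ f z ^ 2 := by
  have he := σ.e_unit _ _ (σ.mem_base_indexAt (B.proj z.2))
  have dχ := ContMDiff.mdiffAt (contMDiff_comp_fst (N := N) hχ) z
  have dχ2 := ContMDiff.mdiffAt (contMDiff_pow (contMDiff_comp_fst (N := N) hχ) 2) z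
  have df := ContMDiff.mdiffAt hf z
  have dfp (k) := ContMDiff.mdiffAt (contMDiff_pow hf k) z
  have e0 : (χ z.1 * deriv χ z.1 * f z ^ (2 * n + 1)) ^ 2 = (χ z.1 * f z ^ (2 * n + 1)) ^ 2 * deriv χ z.1 ^ 2 := by ring
  rw [e0, gradNorm_sq B hδ he, gradNorm_sq B hδ he,
    ← sum_tubeDeriv_comp_fst (B.frame δ (σ.e (σ.indexAt (B.proj z.2)))), Finset.mul_sum, Finset.mul_sum, Finset.mul_sum,
    ← Finset.sum_add_distrib]
  refine Finset.sum_le_sum fun a _ => ?_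
  have e1 := tubeDeriv_pow (B.frame δ (σ.e (σ.indexAt (B.proj z.2)))) dχ 1 a
  norm_num at e1
  rw [tubeDeriv_mul _ dχ2 (dfp _), tubeDeriv_pow _ df, e1]
  generalize tubeDeriv (B.frame δ (σ.e (σ.indexAt (B.proj z.2)))) a (fun z => χ z.1) z = d
  generalize tubeDeriv (B.frame δ (σ.e (σ.indexAt (B.proj z.2)))) a f z = g
  generalize χ z.1 = c
  generalize f z = y
  have key (X Y : ℝ) : (X + Y) ^ 2 ≤ 2 * X ^ 2 + 2 * Y ^ 2 := by nlinarith [sq_nonneg (X - Y)]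
  refine (key _ _).trans (le_of_eq ?_)
  push_cast; ring

theorem tsupport_cutoff_mul_subset {χ : ℝ → ℝ} {I : Set ℝ} (hχ : tsupport χ ⊆ I) {k : ℕ} (hk : k ≠ 0) (f : ℝ × N → ℝ) :
    tsupport (fun z : ℝ × N => χ z.1 ^ k * f z) ⊆ I ×ˢ univ := by
  have h1 : tsupport (fun z : ℝ × N => χ z.1 ^ k * f z) ⊆ Prod.fst ⁻¹' tsupport χ := by
    refine closure_minimal (fun y hy => ?_) ((isClosed_tsupport _).preimage continuous_fst)
    by_contra hc
    exact hy (by simp [image_eq_zero_of_notMem_tsupport hc, hk])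
  exact fun z hz => ⟨hχ (h1 hz), trivial⟩

/-- The weak inequality holds for a fixed test function in the limit q → ∞, whereas here the test
function contains F_m. For m and q large dF_q may be replaced by dF_m, because the gradients form a
Cauchy sequence and those of the test functions stay bounded. -/
theorem IsSubsolution.eventually_integral_le (hF : IsSubsolution B δ T Λ w F R) (hδ : δ ≠ 0) (σ : SpinStructure.{u} h)
    {χ : ℝ → ℝ} (hχ : ContDiff ℝ ∞ χ) (hχs : tsupport χ ⊆ Ioo (T - 2) (T + 2)) {A : ℝ} (hA : ∀ t, |χ t| ≤ A)
    (hA' : ∀ t, |deriv χ t| ≤ A) (n : ℕ) {ε : ℝ} (hε : 0 < ε) :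
    ∀ᶠ m in atTop, ∫ z in cylinder N T 2, gradInner B δ (fun z => χ z.1 ^ 2 * F m z ^ (2 * n + 1)) (F m) z ∂(B.tubeVolume δ)
      ≤ 2 * Λ * ∫ z in cylinder N T 2, χ z.1 ^ 2 * F m z ^ (2 * n + 1) * w z ∂(B.tubeVolume δ) + ε := by
  have hfin := isFiniteMeasure_cylinder (B := B) σ hδ T 2
  have hφ (m) : ContMDiff (𝓘(ℝ, ℝ).prod (𝓡 3)) 𝓘(ℝ, ℝ) ∞ fun z : ℝ × N => χ z.1 ^ 2 * F m z ^ (2 * n + 1) :=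
    (contMDiff_pow (contMDiff_comp_fst (N := N) hχ) 2).mul (contMDiff_pow (hF.smooth m) (2 * n + 1))
  have hA0 : 0 ≤ A := (abs_nonneg _).trans (hA 0)
  obtain ⟨E, n₀, hE0, hE⟩ := hF.exists_gradNorm_le hδ σ
  have hi (u : ℝ × N → ℝ) (hu : ContMDiff (𝓘(ℝ, ℝ).prod (𝓡 3)) 𝓘(ℝ, ℝ) ∞ u) :=
    Continuous.integrableOn_cylinder B hδ σ (continuous_gradNorm_sq B hδ σ hu) T 2
  set c₁ := 8 * (A * A * |R| ^ (2 * n + 1)) ^ 2 with hc₁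
  set c₂ := 2 * ((2 * n + 1) * (A ^ 2 * |R| ^ (2 * n))) ^ 2 with hc₂
  set V := ((B.tubeVolume δ).restrict (cylinder N T 2)).real univ with hV
  set E' := V * c₁ + c₂ * E with hE'
  have hV0 : 0 ≤ V := measureReal_nonneg
  have hE'0 : 0 ≤ E' := by positivity
  have hbound (m) (hm : m ≥ n₀) :
      ∫ z in cylinder N T 2, gradNorm B δ (fun z => χ z.1 ^ 2 * F m z ^ (2 * n + 1)) z ^ 2 ∂(B.tubeVolume δ) ≤ E' := by
    have i2 := (hi _ (hF.smooth m)).const_mul c₂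
    calc _ ≤ ∫ z in cylinder N T 2, (c₁ + c₂ * gradNorm B δ (F m) z ^ 2) ∂(B.tubeVolume δ) := by
          refine integral_mono (hi _ (hφ m)) ((integrable_const c₁).add i2) fun z => ?_
          refine (gradNorm_test_sq_le hδ σ hχ (hF.smooth m) n z).trans ?_
          have hFz : |F m z| ≤ |R| := by
            rw [abs_of_nonneg (hF.nonneg m z)]
            exact (hF.le m z).trans (le_abs_self R)
          have b1 : (χ z.1 * deriv χ z.1 * F m z ^ (2 * n + 1)) ^ 2 ≤ (A * A * |R| ^ (2 * n + 1)) ^ 2 := by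
            rw [← sq_abs, abs_mul, abs_mul, abs_pow]
            have := hA z.1
            have := hA' z.1
            gcongr
          have b2 : ((2 * n + 1) * (χ z.1 ^ 2 * F m z ^ (2 * n))) ^ 2 ≤ ((2 * n + 1) * (A ^ 2 * |R| ^ (2 * n))) ^ 2 := by
            rw [← sq_abs, abs_mul, abs_mul, abs_pow, abs_pow, abs_of_nonneg (show (0 : ℝ) ≤ 2 * n + 1 by positivity)]
            have := hA z.1
            gcongr
          have b3 := mul_le_mul_of_nonneg_right b2 (sq_nonneg (gradNorm B δ (F m) z))
          simp only [hc₁, hc₂]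
          linarith
      _ = V * c₁ + c₂ * ∫ z in cylinder N T 2, gradNorm B δ (F m) z ^ 2 ∂(B.tubeVolume δ) := by
          rw [integral_add (integrable_const c₁) i2, integral_const, smul_eq_mul]
          exact congrArg _ (integral_const_mul c₂ _)
      _ ≤ E' := by
          rw [hE']
          gcongr
          exact hE m hm
  -- Young's inequality with weight η bounds the error by ηE' ≤ ε/3 plus η⁻¹ times a Cauchy
  -- difference, which is made at most ηε/3. The last third of ε is spent on the weak inequality.
  set η := ε / (3 * (E' + 1)) with hη
  have hη0 : 0 < η := by positivity
  obtain ⟨n₁, hn₁⟩ := hF.cauchy (η * (ε / 3)) (by positivity)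
  refine eventually_atTop.2 ⟨max n₀ n₁, fun m hm => ?_⟩
  have hm0 : n₀ ≤ m := (le_max_left _ _).trans hm
  have hm1 : n₁ ≤ m := (le_max_right _ _).trans hm
  obtain ⟨q, hq, hq1⟩ := ((hF.weak _ (hφ m) (tsupport_cutoff_mul_subset hχs two_ne_zero _)
    (fun z => mul_nonneg (sq_nonneg _) (pow_nonneg (hF.nonneg m z) _)) (ε / 3) (by positivity)).and
    (eventually_ge_atTop n₁)).exists
  have hs := (hF.smooth m).sub (hF.smooth q)
  have iI (u v : ℝ × N → ℝ) (hu : ContMDiff (𝓘(ℝ, ℝ).prod (𝓡 3)) 𝓘(ℝ, ℝ) ∞ u)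
      (hv : ContMDiff (𝓘(ℝ, ℝ).prod (𝓡 3)) 𝓘(ℝ, ℝ) ∞ v) :=
    Continuous.integrableOn_cylinder B hδ σ (continuous_gradInner B hδ σ hu hv) T 2
  have h1 : ∫ z in cylinder N T 2, gradInner B δ (fun z => χ z.1 ^ 2 * F m z ^ (2 * n + 1)) (F m) z ∂(B.tubeVolume δ)
      - ∫ z in cylinder N T 2, gradInner B δ (fun z => χ z.1 ^ 2 * F m z ^ (2 * n + 1)) (F q) z ∂(B.tubeVolume δ)
      ≤ η * E' + η⁻¹ * (η * (ε / 3)) := by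
    rw [← integral_sub (iI _ _ (hφ m) (hF.smooth m)) (iI _ _ (hφ m) (hF.smooth q))]
    have j1 := (hi _ (hφ m)).const_mul η
    have j2 := (hi _ hs).const_mul η⁻¹
    calc _ ≤ ∫ z in cylinder N T 2, (η * gradNorm B δ (fun z => χ z.1 ^ 2 * F m z ^ (2 * n + 1)) z ^ 2
            + η⁻¹ * gradNorm B δ (fun z => F m z - F q z) z ^ 2) ∂(B.tubeVolume δ) := by
          refine integral_mono ((iI _ _ (hφ m) (hF.smooth m)).sub (iI _ _ (hφ m) (hF.smooth q))) (j1.add j2) fun z => ?_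
          simp only
          rw [← gradInner_sub_right hδ σ (ContMDiff.mdiffAt (hφ m) z) (ContMDiff.mdiffAt (hF.smooth m) z)
            (ContMDiff.mdiffAt (hF.smooth q) z)]
          exact gradInner_le hδ σ (ContMDiff.mdiffAt (hφ m) z) (ContMDiff.mdiffAt hs z) hη0
      _ = η * (∫ z in cylinder N T 2, gradNorm B δ (fun z => χ z.1 ^ 2 * F m z ^ (2 * n + 1)) z ^ 2 ∂(B.tubeVolume δ))
            + η⁻¹ * ∫ z in cylinder N T 2, gradNorm B δ (fun z => F m z - F q z) z ^ 2 ∂(B.tubeVolume δ) := by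
          rw [← integral_const_mul, ← integral_const_mul]
          exact integral_add j1 j2
      _ ≤ _ := by
          gcongr
          · exact hbound m hm0
          · exact hn₁ m hm1 q hq1
  have h2 : η * E' ≤ ε / 3 := by
    rw [hη, div_mul_eq_mul_div, div_le_div_iff₀ (by positivity) (by positivity)]
    nlinarith
  have h3 : η⁻¹ * (η * (ε / 3)) = ε / 3 := by field_simp
  linarith

end Moser

/-! ### Norms, moments and cutoff functions -/

section Norms
variable {Ω : Type*} [MeasurableSpace Ω] {μ : Measure Ω} {f : Ω → ℝ}

theorem eLpNorm_two_sq (hf : Integrable (fun z => f z ^ 2) μ) :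
    eLpNorm f 2 μ ^ 2 = ENNReal.ofReal (∫ z, f z ^ 2 ∂μ) := by
  rw [eLpNorm_eq_lintegral_rpow_enorm_toReal (by norm_num) (by norm_num),
    ofReal_integral_eq_lintegral_ofReal hf (Eventually.of_forall fun z => sq_nonneg _),
    ← ENNReal.rpow_natCast, ← ENNReal.rpow_mul]
  norm_num
  refine lintegral_congr fun z => ?_
  rw [← enorm_pow, Real.enorm_of_nonneg (sq_nonneg _)]

theorem eLpNorm_four_sq (hf : Integrable (fun z => f z ^ 4) μ) :
    eLpNorm f 4 μ ^ 2 = ENNReal.ofReal (Real.sqrt (∫ z, f z ^ 4 ∂μ)) := by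
  have h0 (z) : 0 ≤ f z ^ 4 := by positivity
  have h1 : ∫⁻ z, ‖f z‖ₑ ^ 4 ∂μ = ENNReal.ofReal (∫ z, f z ^ 4 ∂μ) := by
    rw [ofReal_integral_eq_lintegral_ofReal hf (Eventually.of_forall h0)]
    refine lintegral_congr fun z => ?_
    rw [← enorm_pow, Real.enorm_of_nonneg (h0 z)]
  rw [eLpNorm_eq_lintegral_rpow_enorm_toReal (by norm_num) (by norm_num), ← ENNReal.rpow_natCast, ← ENNReal.rpow_mul,
    Real.sqrt_eq_rpow, ← ENNReal.ofReal_rpow_of_nonneg (integral_nonneg h0) (by norm_num), ← h1]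
  norm_num

/-- A function is bounded by `c₀` if its moments `∫ w^(2^(k+1))` are at most `β⁻¹ c₀^(2^(k+1))`. -/
theorem ae_le_of_moments [IsFiniteMeasure μ] {w : Ω → ℝ} (hw : 0 ≤ᵐ[μ] w)
    (hi : ∀ k : ℕ, Integrable (fun z => w z ^ (2 ^ (k + 1))) μ) {c₀ β : ℝ} (hc₀ : 0 ≤ c₀) (hβ : 0 < β)
    (hm : ∀ k : ℕ, β * ∫ z, w z ^ (2 ^ (k + 1)) ∂μ ≤ c₀ ^ (2 ^ (k + 1))) :
    ∀ᵐ z ∂μ, w z ≤ c₀ := by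
  have key (c : ℝ) (hc : c₀ < c) : μ.real {z | c ≤ w z} = 0 := by
    have hc0 : 0 < c := hc₀.trans_lt hc
    have hq : 0 ≤ c₀ / c := by positivity
    have hq1 : c₀ / c < 1 := (div_lt_one hc0).2 hc
    -- Chebyshev's inequality at a level c > c₀. The powers of c₀/c < 1 tend to zero while β⁻¹ is
    -- fixed.
    have h1 (k : ℕ) : μ.real {z | c ≤ w z} ≤ β⁻¹ * (c₀ / c) ^ (2 ^ (k + 1)) := by
      have h2 : c ^ (2 ^ (k + 1)) * μ.real {z | c ≤ w z} ≤ ∫ z, w z ^ (2 ^ (k + 1)) ∂μ := by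
        refine le_trans ?_ (mul_meas_ge_le_integral_of_nonneg (by
          filter_upwards [hw] with z hz
          exact pow_nonneg hz _) (hi k) (c ^ (2 ^ (k + 1))))
        refine mul_le_mul_of_nonneg_left (measureReal_mono fun z hz => ?_) (by positivity)
        exact pow_le_pow_left₀ hc0.le hz _
      have h3 := (mul_le_mul_of_nonneg_left h2 hβ.le).trans (hm k)
      rw [div_pow, inv_mul_eq_div, div_div, le_div_iff₀ (by positivity)]
      linarith
    have h2 : Tendsto (fun k : ℕ => β⁻¹ * (c₀ / c) ^ (2 ^ (k + 1))) atTop (𝓝 (β⁻¹ * 0)) := by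
      refine Tendsto.const_mul _ ((tendsto_pow_atTop_nhds_zero_of_lt_one hq hq1).comp ?_)
      exact (tendsto_pow_atTop_atTop_of_one_lt one_lt_two).comp (tendsto_add_atTop_nat 1)
    rw [mul_zero] at h2
    exact le_antisymm (ge_of_tendsto' h2 h1) measureReal_nonneg
  have h1 : ∀ᵐ z ∂μ, ∀ n : ℕ, w z < c₀ + 1 / ((n : ℝ) + 1) := by
    rw [ae_all_iff]
    intro n
    have h2 := key (c₀ + 1 / ((n : ℝ) + 1)) (lt_add_of_pos_right _ (by positivity))
    rw [measureReal_eq_zero_iff] at h2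
    rw [ae_iff]
    simpa using h2
  filter_upwards [h1] with z hz
  have h2 : Tendsto (fun n : ℕ => c₀ + 1 / ((n : ℝ) + 1)) atTop (𝓝 (c₀ + 0)) :=
    tendsto_const_nhds.add tendsto_one_div_add_atTop_nhds_zero_nat
  rw [add_zero] at h2
  exact ge_of_tendsto' h2 fun n => (hz n).le

/-- With β = (D/s)², squaring the hypothesis gives a_{k+1} ≤ β 64^k a_k². Hence b_k = β 64^(k+1) a_k
satisfies b_{k+1} ≤ b_k², so b_k ≤ b_0^(2^k), and b_0 is the square of 8(D/s)√a_0. -/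
theorem moment_iteration {a : ℕ → ℝ} (ha : ∀ k, 0 ≤ a k) {s D : ℝ} (hs : 0 < s) (hD : 0 < D)
    (hstep : ∀ k, s * Real.sqrt (a (k + 1)) ≤ D * 8 ^ k * a k) (k : ℕ) :
    (D / s) ^ 2 * a k ≤ (8 * (D / s) * Real.sqrt (a 0)) ^ (2 ^ (k + 1)) := by
  have hβ : 0 < (D / s) ^ 2 := by positivity
  have h1 (k) : a (k + 1) ≤ (D / s) ^ 2 * 64 ^ k * a k ^ 2 := by
    have h2 : Real.sqrt (a (k + 1)) ≤ D / s * 8 ^ k * a k := by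
      rw [div_mul_eq_mul_div, div_mul_eq_mul_div, le_div_iff₀ hs]
      linarith [hstep k]
    have h3 := pow_le_pow_left₀ (Real.sqrt_nonneg _) h2 2
    rw [Real.sq_sqrt (ha _)] at h3
    refine h3.trans (le_of_eq ?_)
    rw [show (64 : ℝ) = 8 ^ 2 by norm_num, ← pow_mul]
    ring
  have h2 : (D / s) ^ 2 * 64 ^ (k + 1) * a k ≤ ((D / s) ^ 2 * 64 * a 0) ^ (2 ^ k) := by
    induction k with
    | zero => simp
    | succ k ih =>
      calc (D / s) ^ 2 * 64 ^ (k + 1 + 1) * a (k + 1)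
          ≤ (D / s) ^ 2 * 64 ^ (k + 1 + 1) * ((D / s) ^ 2 * 64 ^ k * a k ^ 2) := by gcongr; exact h1 k
        _ = ((D / s) ^ 2 * 64 ^ (k + 1) * a k) ^ 2 := by ring
        _ ≤ (((D / s) ^ 2 * 64 * a 0) ^ (2 ^ k)) ^ 2 := by
            have := ha k
            gcongr
        _ = _ := by rw [← pow_mul, ← pow_succ]
  have h3 : (8 * (D / s) * Real.sqrt (a 0)) ^ (2 ^ (k + 1)) = ((D / s) ^ 2 * 64 * a 0) ^ (2 ^ k) := by
    rw [pow_succ, mul_comm (2 ^ k) 2, pow_mul]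
    congr 1
    rw [mul_pow, Real.sq_sqrt (ha 0)]
    ring
  rw [h3]
  refine le_trans ?_ h2
  have : (1 : ℝ) ≤ 64 ^ (k + 1) := one_le_pow₀ (by norm_num)
  nlinarith [mul_nonneg hβ.le (ha k)]

end Norms

/-- A fixed smooth step is composed with the quadratic polynomial (r² - (t - T)²)/d, which avoids
the corner of |t - T|. The layer where the cutoff descends has width of order 2^(-k), hence the
bound A 2^k for the derivative. -/
theorem exists_cutoff : ∃ A : ℝ, 0 ≤ A ∧ ∀ (T : ℝ) (k : ℕ), ∃ χ : ℝ → ℝ, ContDiff ℝ ∞ χ ∧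
    tsupport χ ⊆ Ioo (T - (1 + (1 / 2) ^ k)) (T + (1 + (1 / 2) ^ k)) ∧ (∀ t, 0 ≤ χ t) ∧ (∀ t, χ t ≤ 1) ∧
    (∀ t ∈ Icc (T - (1 + (1 / 2) ^ (k + 1))) (T + (1 + (1 / 2) ^ (k + 1))), χ t = 1) ∧
    ∀ t, |deriv χ t| ≤ A * 2 ^ k := by
  have hg : ContDiff ℝ ∞ Real.smoothTransition := Real.smoothTransition.contDiff
  obtain ⟨A, hA⟩ : ∃ A, ∀ x, |deriv Real.smoothTransition x| ≤ A := by
    obtain ⟨A, hA⟩ := (isCompact_Icc (a := (0 : ℝ)) (b := 1)).exists_bound_of_continuousOn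
      (hg.continuous_deriv (by simp)).continuousOn
    refine ⟨max A 0, fun x => ?_⟩
    by_cases hx : x ∈ Icc (0 : ℝ) 1
    · exact (hA x hx).trans (le_max_left _ _)
    · have : deriv Real.smoothTransition x = 0 := by
        rcases lt_or_ge x 0 with h0 | h0
        · have : Real.smoothTransition =ᶠ[𝓝 x] fun _ => 0 := by
            filter_upwards [Iio_mem_nhds h0] with y hy
            exact Real.smoothTransition.zero_of_nonpos (le_of_lt hy)
          rw [this.deriv_eq, deriv_const]
        · have h1 : 1 < x := by
            by_contra hc
            exact hx ⟨h0, not_lt.1 hc⟩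
          have : Real.smoothTransition =ᶠ[𝓝 x] fun _ => 1 := by
            filter_upwards [Ioi_mem_nhds h1] with y hy
            exact Real.smoothTransition.one_of_one_le (le_of_lt hy)
          rw [this.deriv_eq, deriv_const]
      rw [this, abs_zero]
      exact le_max_right _ _
  have hA0 : 0 ≤ A := (abs_nonneg _).trans (hA 0)
  refine ⟨8 * A, by positivity, fun T k => ?_⟩
  set x : ℝ := (1 / 2) ^ k with hx
  have hx0 : 0 < x := by positivity
  have hx1 : x ≤ 1 := pow_le_one₀ (by norm_num) (by norm_num)
  have hxs : (1 / 2 : ℝ) ^ (k + 1) = x / 2 := by rw [pow_succ, hx]; ring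
  -- The midpoint of the inner radius 1 + x/2 and the outer radius 1 + x: the support stays strictly
  -- inside the larger interval.
  set r := 1 + 3 / 4 * x with hr
  set d := r ^ 2 - (1 + x / 2) ^ 2 with hd
  -- One has d = (x/4)(2 + 5x/4). With |t - T| ≤ 2 on the support this gives the slope bound 4/d ≤ 8
  -- · 2^k.
  have hdx : x / 2 ≤ d := by rw [hd, hr]; nlinarith
  have hd0 : 0 < d := by linarith
  have hp : ContDiff ℝ ∞ fun t : ℝ => (r ^ 2 - (t - T) ^ 2) / d := by fun_prop
  have hχ : ContDiff ℝ ∞ fun t => Real.smoothTransition ((r ^ 2 - (t - T) ^ 2) / d) := hg.comp hp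
  have hs : tsupport (fun t => Real.smoothTransition ((r ^ 2 - (t - T) ^ 2) / d)) ⊆ Icc (T - r) (T + r) := by
    refine closure_minimal (fun t ht => ?_) isClosed_Icc
    by_contra hc
    refine ht (Real.smoothTransition.zero_of_nonpos (div_nonpos_of_nonpos_of_nonneg ?_ hd0.le))
    have : r ^ 2 ≤ (t - T) ^ 2 := by
      rw [sq_le_sq, abs_of_pos (show 0 < r by rw [hr]; linarith)]
      by_contra hlt
      rw [not_le, abs_lt] at hlt
      exact hc ⟨by linarith [hlt.1], by linarith [hlt.2]⟩
    linarith
  refine ⟨_, hχ, hs.trans fun t ht => ⟨?_, ?_⟩, fun t => Real.smoothTransition.nonneg _,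
    fun t => Real.smoothTransition.le_one _, fun t ht => ?_, fun t => ?_⟩
  · have := ht.1; rw [hr] at this; linarith
  · have := ht.2; rw [hr] at this; linarith
  · refine Real.smoothTransition.one_of_one_le ((one_le_div hd0).2 ?_)
    rw [hxs] at ht
    have : (t - T) ^ 2 ≤ (1 + x / 2) ^ 2 := sq_le_sq' (by linarith [ht.1]) (by linarith [ht.2])
    linarith
  · by_cases ht : t ∈ Icc (T - r) (T + r)
    · have h1 : HasDerivAt (fun t : ℝ => (r ^ 2 - (t - T) ^ 2) / d) (-(2 * (t - T)) / d) t := by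
        have := ((((hasDerivAt_id t).sub_const T).pow 2).const_sub (r ^ 2)).div_const d
        simpa using this
      have h2 := ((hg.differentiable (by simp)) ((r ^ 2 - (t - T) ^ 2) / d)).hasDerivAt.comp t h1
      have h3 : deriv (fun t => Real.smoothTransition ((r ^ 2 - (t - T) ^ 2) / d)) t = _ := h2.deriv
      rw [h3, abs_mul]
      have h4 : |-(2 * (t - T)) / d| ≤ 8 * 2 ^ k := by
        rw [abs_div, abs_of_pos hd0, abs_neg, abs_mul, abs_two, div_le_iff₀ hd0]
        have h5 : |t - T| ≤ 2 := by rw [abs_le]; constructor <;> linarith [ht.1, ht.2, hr]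
        have h6 : (2 : ℝ) ^ k * x = 1 := by rw [hx, ← mul_pow]; norm_num
        nlinarith [pow_pos (two_pos (α := ℝ)) k, mul_le_mul_of_nonneg_left hdx (pow_pos (two_pos (α := ℝ)) k).le]
      calc _ ≤ A * (8 * 2 ^ k) := mul_le_mul (hA _) h4 (abs_nonneg _) hA0
        _ = 8 * A * 2 ^ k := by ring
    · have h1 : deriv (fun t => Real.smoothTransition ((r ^ 2 - (t - T) ^ 2) / d)) t = 0 := by
        by_contra hc
        exact ht (hs (support_deriv_subset hc))
      rw [h1, abs_zero]
      positivity

/-! ### The reverse Hölder inequality and Moser iteration -/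

section Iteration
variable {S : Type*} [TopologicalSpace S] [ChartedSpace (EuclideanSpace ℝ (Fin 2)) S]
  [IsManifold (𝓡 2) ∞ S] [T2Space S] {h : OrientedMetric S}
  {N : Type*} [TopologicalSpace N] [ChartedSpace (EuclideanSpace ℝ (Fin 3)) N]
  [IsManifold (𝓡 3) ∞ N] [MulAction Circle N] [T2Space N] [SecondCountableTopology N]
  [MeasurableSpace N] [BorelSpace N] [CompactSpace N]
  {B : CircleBundle h N} {δ T Λ R : ℝ} {w : ℝ × N → ℝ} {F : ℕ → ℝ × N → ℝ}

/-- The supremum of the admissible constants is itself admissible, because multiplication commutes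
with suprema. A real s below it is used since the supremum may be infinite. -/
theorem sobolev_real_le (hδ : δ ≠ 0) (σ : SpinStructure.{u} h) {s : ℝ} (hs : 0 ≤ s)
    (hsS : ENNReal.ofReal s ≤ sobolevConst B δ T) {u : ℝ × N → ℝ}
    (hu : ContMDiff (𝓘(ℝ, ℝ).prod (𝓡 3)) 𝓘(ℝ, ℝ) ∞ u) (hus : tsupport u ⊆ Ioo (T - 2) (T + 2) ×ˢ univ) :
    s * Real.sqrt (∫ z in cylinder N T 2, u z ^ 4 ∂(B.tubeVolume δ))
      ≤ ∫ z in cylinder N T 2, gradNorm B δ u z ^ 2 ∂(B.tubeVolume δ) + ∫ z in cylinder N T 2, u z ^ 2 ∂(B.tubeVolume δ) := by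
  have hc : HasCompactSupport u := (isCompact_cylinder (N := N) T 2).of_isClosed_subset (isClosed_tsupport _)
    (hus.trans (prod_mono Ioo_subset_Icc_self le_rfl))
  have i1 := Continuous.integrableOn_cylinder B hδ σ (continuous_gradNorm_sq B hδ σ hu) T 2
  have i2 := Continuous.integrableOn_cylinder B hδ σ (hu.continuous.pow 2) T 2
  have i4 := Continuous.integrableOn_cylinder B hδ σ (hu.continuous.pow 4) T 2
  have h1 : sobolevConst B δ T * eLpNorm u 4 ((B.tubeVolume δ).restrict (cylinder N T 2)) ^ 2
      ≤ eLpNorm (gradNorm B δ u) 2 ((B.tubeVolume δ).restrict (cylinder N T 2)) ^ 2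
        + eLpNorm u 2 ((B.tubeVolume δ).restrict (cylinder N T 2)) ^ 2 := by
    unfold sobolevConst
    rw [ENNReal.sSup_mul]
    exact iSup₂_le fun s hs => hs u hu hc hus
  have h2 := (mul_le_mul_left hsS _).trans h1
  rw [eLpNorm_four_sq i4, eLpNorm_two_sq i1, eLpNorm_two_sq i2, ← ENNReal.ofReal_mul hs,
    ← ENNReal.ofReal_add (integral_nonneg fun _ => sq_nonneg _) (integral_nonneg fun _ => sq_nonneg _)] at h2
  refine (ENNReal.ofReal_le_ofReal_iff ?_).1 h2
  exact add_nonneg (integral_nonneg fun _ => sq_nonneg _) (integral_nonneg fun _ => sq_nonneg _)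

/-- The reverse Hölder inequality for a subsolution. -/
theorem IsSubsolution.sobolev_le (hF : IsSubsolution B δ T Λ w F R) (hδ : δ ≠ 0) (σ : SpinStructure.{u} h)
    {s : ℝ} (hs : 0 ≤ s) (hsS : ENNReal.ofReal s ≤ sobolevConst B δ T)
    {χ : ℝ → ℝ} (hχ : ContDiff ℝ ∞ χ) (hχs : tsupport χ ⊆ Ioo (T - 2) (T + 2)) (n : ℕ) :
    s * Real.sqrt (∫ z in cylinder N T 2, χ z.1 ^ 4 * w z ^ (4 * n + 4) ∂(B.tubeVolume δ))
      ≤ (8 * (n + 1) * Λ + 1) * ∫ z in cylinder N T 2, χ z.1 ^ 2 * w z ^ (2 * n + 2) ∂(B.tubeVolume δ)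
        + 10 * (n + 1) * ∫ z in cylinder N T 2, deriv χ z.1 ^ 2 * w z ^ (2 * n + 2) ∂(B.tubeVolume δ) := by
  have hcs : HasCompactSupport χ := isCompact_Icc.of_isClosed_subset (isClosed_tsupport _) (hχs.trans Ioo_subset_Icc_self)
  have hχ' : Continuous (deriv χ) := hχ.continuous_deriv (by simp)
  obtain ⟨A₁, hA₁⟩ := hcs.exists_bound_of_continuous hχ.continuous
  obtain ⟨A₂, hA₂⟩ := hcs.deriv.exists_bound_of_continuous hχ'
  have c1 : Continuous fun z : ℝ × N => χ z.1 := hχ.continuous.comp continuous_fst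
  have c2 : Continuous fun z : ℝ × N => deriv χ z.1 := hχ'.comp continuous_fst
  refine le_of_forall_pos_le_add fun ε hε => ?_
  -- The error of the weak inequality is multiplied by 4(n + 1) in `gradNorm_cutoff_pow_sq_le`.
  set ε' := ε / (4 * (n + 1)) with hε'
  have hε'0 : 0 < ε' := by positivity
  have hev := hF.eventually_integral_le hδ σ hχ hχs (A := max A₁ A₂) (fun t => (hA₁ t).trans (le_max_left _ _))
    (fun t => (hA₂ t).trans (le_max_right _ _)) n hε'0
  have t4 : Tendsto (fun m => ∫ z in cylinder N T 2, χ z.1 ^ 4 * F m z ^ (4 * n + 4) ∂(B.tubeVolume δ)) atTop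
      (𝓝 (∫ z in cylinder N T 2, χ z.1 ^ 4 * w z ^ (4 * n + 4) ∂(B.tubeVolume δ))) := by
    simpa using hF.tendsto_integral σ hδ (c1.pow 4) (4 * n + 4) 0
  have t2 : Tendsto (fun m => ∫ z in cylinder N T 2, χ z.1 ^ 2 * F m z ^ (2 * n + 2) ∂(B.tubeVolume δ)) atTop
      (𝓝 (∫ z in cylinder N T 2, χ z.1 ^ 2 * w z ^ (2 * n + 2) ∂(B.tubeVolume δ))) := by
    simpa using hF.tendsto_integral σ hδ (c1.pow 2) (2 * n + 2) 0
  have t3 : Tendsto (fun m => ∫ z in cylinder N T 2, deriv χ z.1 ^ 2 * F m z ^ (2 * n + 2) ∂(B.tubeVolume δ)) atTop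
      (𝓝 (∫ z in cylinder N T 2, deriv χ z.1 ^ 2 * w z ^ (2 * n + 2) ∂(B.tubeVolume δ))) := by
    simpa using hF.tendsto_integral σ hδ (c2.pow 2) (2 * n + 2) 0
  have t1 : Tendsto (fun m => ∫ z in cylinder N T 2, χ z.1 ^ 2 * F m z ^ (2 * n + 1) * w z ∂(B.tubeVolume δ)) atTop
      (𝓝 (∫ z in cylinder N T 2, χ z.1 ^ 2 * w z ^ (2 * n + 2) ∂(B.tubeVolume δ))) := by
    have := hF.tendsto_integral σ hδ (κ := fun z => χ z.1 ^ 2) (c1.pow 2) (2 * n + 1) 1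
    beta_reduce at this
    have e (z : ℝ × N) : χ z.1 ^ 2 * w z ^ (2 * n + 1) * w z ^ 1 = χ z.1 ^ 2 * w z ^ (2 * n + 2) := by ring
    simp only [e] at this
    simpa only [pow_one] using this
  have lim := ((((t1.const_mul (2 * Λ)).add_const ε').const_mul (4 * ((n : ℝ) + 1))).add
    (t3.const_mul (10 * ((n : ℝ) + 1)))).add t2
  -- The Sobolev inequality is applied to the smooth functions χ F_m^(n+1) only. Both sides then
  -- converge, and no gradient of w is needed in the limit.
  have lim4 := ((Real.continuous_sqrt.tendsto _).comp t4).const_mul s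
  have hle := le_of_tendsto_of_tendsto lim4 lim ?_
  · refine hle.trans (le_of_eq ?_)
    rw [hε']
    field_simp
    ring
  · filter_upwards [hev] with m hm
    have hsm : ContMDiff (𝓘(ℝ, ℝ).prod (𝓡 3)) 𝓘(ℝ, ℝ) ∞ fun z : ℝ × N => χ z.1 * F m z ^ (n + 1) :=
      (contMDiff_comp_fst (N := N) hχ).mul (contMDiff_pow (hF.smooth m) (n + 1))
    have hφ : ContMDiff (𝓘(ℝ, ℝ).prod (𝓡 3)) 𝓘(ℝ, ℝ) ∞ fun z : ℝ × N => χ z.1 ^ 2 * F m z ^ (2 * n + 1) :=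
      (contMDiff_pow (contMDiff_comp_fst (N := N) hχ) 2).mul (contMDiff_pow (hF.smooth m) (2 * n + 1))
    have hsupp := tsupport_cutoff_mul_subset (N := N) hχs one_ne_zero (fun z => F m z ^ (n + 1))
    simp only [pow_one] at hsupp
    have h1 := sobolev_real_le hδ σ hs hsS hsm hsupp
    have e4 (z : ℝ × N) : (χ z.1 * F m z ^ (n + 1)) ^ 4 = χ z.1 ^ 4 * F m z ^ (4 * n + 4) := by ring
    have e2 (z : ℝ × N) : (χ z.1 * F m z ^ (n + 1)) ^ 2 = χ z.1 ^ 2 * F m z ^ (2 * n + 2) := by ring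
    simp only [e4, e2] at h1
    have i1 := (Continuous.integrableOn_cylinder B hδ σ (continuous_gradInner B hδ σ hφ (hF.smooth m)) T 2).const_mul (4 * ((n : ℝ) + 1))
    have i2 := (Continuous.integrableOn_cylinder B hδ σ ((c2.pow 2).mul ((hF.smooth m).continuous.pow (2 * n + 2))) T 2).const_mul (10 * ((n : ℝ) + 1))
    have h2 : ∫ z in cylinder N T 2, gradNorm B δ (fun z => χ z.1 * F m z ^ (n + 1)) z ^ 2 ∂(B.tubeVolume δ)
        ≤ 4 * (n + 1) * (∫ z in cylinder N T 2, gradInner B δ (fun z => χ z.1 ^ 2 * F m z ^ (2 * n + 1)) (F m) z ∂(B.tubeVolume δ))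
          + 10 * (n + 1) * ∫ z in cylinder N T 2, deriv χ z.1 ^ 2 * F m z ^ (2 * n + 2) ∂(B.tubeVolume δ) := by
      rw [← integral_const_mul, ← integral_const_mul]
      refine le_trans ?_ (le_of_eq (integral_add i1 i2))
      exact integral_mono (Continuous.integrableOn_cylinder B hδ σ (continuous_gradNorm_sq B hδ σ hsm) T 2) (i1.add i2)
        fun z => gradNorm_cutoff_pow_sq_le hδ σ hχ (hF.smooth m) n z
    have h3 := mul_le_mul_of_nonneg_left hm (show (0 : ℝ) ≤ 4 * (n + 1) by positivity)
    simp only [Function.comp_apply]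
    linarith

theorem cylinder_subset {r r' : ℝ} (hr : r ≤ r') : cylinder N T r ⊆ cylinder N T r' :=
  prod_mono (Icc_subset_Icc (by linarith) (by linarith)) le_rfl

/-- The mean value inequality for subsolutions, by Moser iteration. -/
theorem exists_moser_bound (Λ : ℝ) (hΛ : 0 ≤ Λ) : ∃ D : ℝ, 0 < D ∧ ∀ {B : CircleBundle h N} {δ T R : ℝ} {w : ℝ × N → ℝ}
    {F : ℕ → ℝ × N → ℝ}, IsSubsolution B δ T Λ w F R → δ ≠ 0 → SpinStructure.{u} h → ∀ s : ℝ, 0 < s →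
    ENNReal.ofReal s ≤ sobolevConst B δ T → ∀ᵐ z ∂((B.tubeVolume δ).restrict (cylinder N T 1)),
      w z ≤ 8 * (D / s) * Real.sqrt (∫ z in cylinder N T 2, w z ^ 2 ∂(B.tubeVolume δ)) := by
  obtain ⟨A, hA, hcut⟩ := exists_cutoff
  -- The three summands majorize 8Λ 2^k, 1 and 10A² 8^k after division by 8^k.
  refine ⟨8 * Λ + 1 + 10 * A ^ 2, by positivity, fun {B δ T R w F} hF hδ σ s hs hsS => ?_⟩
  set D := 8 * Λ + 1 + 10 * A ^ 2 with hD
  have hD0 : 0 < D := by positivity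
  have hfin (r) := isFiniteMeasure_cylinder (B := B) σ hδ T r
  have hm (r) : MeasurableSet (cylinder N T r) := (isCompact_cylinder T r).isClosed.measurableSet
  have hr2 (k : ℕ) : 1 + (1 / 2 : ℝ) ^ k ≤ 2 := by
    have : (1 / 2 : ℝ) ^ k ≤ 1 := pow_le_one₀ (by norm_num) (by norm_num)
    linarith
  have hw0 : ∀ᵐ z ∂((B.tubeVolume δ).restrict (cylinder N T 2)), 0 ≤ w z := hF.ae_mem_Icc.mono fun z hz => hz.1
  have hInt (n) : IntegrableOn (fun z => w z ^ n) (cylinder N T 2) (B.tubeVolume δ) := by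
    simpa using hF.integrable σ hδ (κ := fun _ => 1) continuous_const n
  -- Exponents double while the radii shrink from 2 towards 1; a 0 is the integral of w² over C(T,
  -- 2).
  set a : ℕ → ℝ := fun k => ∫ z in cylinder N T (1 + (1 / 2) ^ k), w z ^ (2 ^ (k + 1)) ∂(B.tubeVolume δ) with ha
  have hpos (r) (hr : r ≤ 2) (n : ℕ) : 0 ≤ᵐ[(B.tubeVolume δ).restrict (cylinder N T r)] fun z => w z ^ n := by
    filter_upwards [ae_restrict_of_ae_restrict_of_subset (cylinder_subset hr) hw0] with z hz
    exact pow_nonneg hz n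
  have ha0 (k) : 0 ≤ a k := integral_nonneg_of_ae (hpos _ (hr2 k) _)
  have hstep (k) : s * Real.sqrt (a (k + 1)) ≤ D * 8 ^ k * a k := by
    obtain ⟨χ, hχ, hχs, hχ0, hχ1, hχe, hχd⟩ := hcut T k
    -- With n + 1 = 2^k the exponents 2n + 2 and 4n + 4 are those of a k and a (k + 1).
    obtain ⟨n, hn⟩ : ∃ n : ℕ, 2 ^ k = n + 1 := ⟨2 ^ k - 1, by have := Nat.one_le_two_pow (n := k); omega⟩
    have hn2 : 2 ^ (k + 1) = 2 * n + 2 := by rw [pow_succ, hn]; ring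
    have hn4 : 2 ^ (k + 1 + 1) = 4 * n + 4 := by rw [pow_succ, hn2]; ring
    have hnr : (n : ℝ) + 1 = 2 ^ k := by exact_mod_cast hn.symm
    have hχs2 : tsupport χ ⊆ Ioo (T - 2) (T + 2) :=
      hχs.trans (Ioo_subset_Ioo (by linarith [hr2 k]) (by linarith [hr2 k]))
    have key := hF.sobolev_le hδ σ hs.le hsS hχ hχs2 n
    have c1 : Continuous fun z : ℝ × N => χ z.1 := hχ.continuous.comp continuous_fst
    have c2 : Continuous fun z : ℝ × N => deriv χ z.1 := (hχ.continuous_deriv (by simp)).comp continuous_fst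
    have h1 : a (k + 1) ≤ ∫ z in cylinder N T 2, χ z.1 ^ 4 * w z ^ (4 * n + 4) ∂(B.tubeVolume δ) := by
      have i4 := hF.integrable σ hδ (c1.pow 4) (4 * n + 4)
      calc a (k + 1) = ∫ z in cylinder N T (1 + (1 / 2) ^ (k + 1)), χ z.1 ^ 4 * w z ^ (4 * n + 4) ∂(B.tubeVolume δ) := by
            refine setIntegral_congr_fun (hm _) fun z hz => ?_
            rw [hχe z.1 hz.1, hn4, one_pow, one_mul]
        _ ≤ _ := by
            refine setIntegral_mono_set i4 ?_ (cylinder_subset (hr2 _)).eventuallyLE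
            filter_upwards [hpos 2 le_rfl (4 * n + 4)] with z hz
            have hz' : 0 ≤ w z ^ (4 * n + 4) := hz
            have := hχ0 z.1
            change 0 ≤ χ z.1 ^ 4 * w z ^ (4 * n + 4)
            positivity
    -- Used for g = χ and g = χ': both vanish outside the cylinder of radius 1 + 2^(-k), which
    -- reduces the integrals to a k.
    have hle (g : ℝ → ℝ) (hg : Continuous g) (M : ℝ) (hM : ∀ t, g t ^ 2 ≤ M) (hgs : ∀ t ∉ tsupport χ, g t = 0) :
        ∫ z in cylinder N T 2, g z.1 ^ 2 * w z ^ (2 * n + 2) ∂(B.tubeVolume δ) ≤ M * a k := by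
      have cg : Continuous fun z : ℝ × N => g z.1 := hg.comp continuous_fst
      have ig := hF.integrable σ hδ (cg.pow 2) (2 * n + 2)
      have hsub := cylinder_subset (N := N) (T := T) (hr2 k)
      rw [setIntegral_eq_of_subset_of_forall_sdiff_eq_zero (hm 2) hsub, ha, ← integral_const_mul]
      · refine integral_mono_ae (ig.mono_set hsub) (((hInt _).mono_set hsub).const_mul M) ?_
        filter_upwards [hpos _ (hr2 k) (2 * n + 2)] with z hz
        rw [hn2]
        exact mul_le_mul_of_nonneg_right (hM z.1) hz
      · intro z hz
        rw [hgs z.1 fun hzs => hz.2 ⟨Ioo_subset_Icc_self (hχs hzs), trivial⟩]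
        ring
    have h2 := hle χ hχ.continuous 1 (fun t => pow_le_one₀ (hχ0 t) (hχ1 t)) fun t ht => image_eq_zero_of_notMem_tsupport ht
    have h3 := hle (deriv χ) (hχ.continuous_deriv (by simp)) ((A * 2 ^ k) ^ 2)
      (fun t => by rw [← sq_abs]; exact pow_le_pow_left₀ (abs_nonneg _) (hχd t) 2) fun t ht => by
        by_contra hc
        exact ht (support_deriv_subset hc)
    have h4 : s * Real.sqrt (a (k + 1)) ≤ (8 * 2 ^ k * Λ + 1) * (1 * a k) + 10 * 2 ^ k * ((A * 2 ^ k) ^ 2 * a k) := by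
      rw [hnr] at key
      refine (mul_le_mul_of_nonneg_left (Real.sqrt_le_sqrt h1) hs.le).trans (key.trans ?_)
      gcongr
    refine h4.trans ?_
    -- The factor n + 1 contributes 2^k and the square of χ' contributes 4^k.
    have e8 : (8 : ℝ) ^ k = 2 ^ k * (2 ^ k) ^ 2 := by
      rw [← pow_mul, ← pow_add, show (8 : ℝ) = 2 ^ 3 by norm_num, ← pow_mul]
      congr 1; ring
    have h1k : (1 : ℝ) ≤ 2 ^ k := one_le_pow₀ (by norm_num)
    have h1k2 : (1 : ℝ) ≤ (2 ^ k) ^ 2 := one_le_pow₀ h1k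
    have h8 : (2 : ℝ) ^ k ≤ 8 ^ k := pow_le_pow_left₀ (by norm_num) (by norm_num) k
    have h81 : (1 : ℝ) ≤ 8 ^ k := one_le_pow₀ (by norm_num)
    have e9 : (8 * 2 ^ k * Λ + 1) * (1 * a k) + 10 * 2 ^ k * ((A * 2 ^ k) ^ 2 * a k)
        = (8 * Λ * 2 ^ k + 1 + 10 * A ^ 2 * 8 ^ k) * a k := by rw [e8]; ring
    rw [e9]
    refine mul_le_mul_of_nonneg_right ?_ (ha0 k)
    rw [hD]
    have := mul_le_mul_of_nonneg_left h8 (show 0 ≤ 8 * Λ by positivity)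
    linarith
  have hit := moment_iteration ha0 hs hD0 hstep
  have e0 : a 0 = ∫ z in cylinder N T 2, w z ^ 2 ∂(B.tubeVolume δ) := by
    simp only [ha]
    norm_num
  rw [← e0]
  have h12 : cylinder N T 1 ⊆ cylinder N T 2 := cylinder_subset one_le_two
  refine ae_le_of_moments (β := (D / s) ^ 2) (ae_restrict_of_ae_restrict_of_subset h12 hw0)
    (fun k => (hInt _).mono_set h12) (by positivity) (by positivity) fun k => le_trans ?_ (hit k)
  refine mul_le_mul_of_nonneg_left ?_ (by positivity)
  refine setIntegral_mono_set ((hInt _).mono_set (cylinder_subset (hr2 k))) (hpos _ (hr2 k) _) ?_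
  exact (cylinder_subset (by have : (0 : ℝ) ≤ (1 / 2) ^ k := by positivity
                             linarith)).eventuallyLE

end Iteration

end AdiabaticSW

end

/-! ### The mean value estimate -/

theorem lemma2p6
    {S : Type*} [TopologicalSpace S] [ChartedSpace (EuclideanSpace ℝ (Fin 2)) S]
    [IsManifold (𝓡 2) ∞ S] [T2Space S] [CompactSpace S] [ConnectedSpace S]
    [MeasurableSpace S] [BorelSpace S]
    {N : Type*} [TopologicalSpace N] [ChartedSpace (EuclideanSpace ℝ (Fin 3)) N]
    [IsManifold (𝓡 3) ∞ N] [T2Space N] [CompactSpace N] [MulAction Circle N]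
    [MeasurableSpace N] [BorelSpace N]
    (h : AdiabaticSW.OrientedMetric S) (hvol : h.totalArea = ENNReal.ofReal Real.pi)
    (B : AdiabaticSW.CircleBundle h N) (σ : AdiabaticSW.SpinStructure h)
    (L : AdiabaticSW.HermitianLineBundle 3 N) (A₀ : AdiabaticSW.HermitianConnection L) :
    ∃ C : ℝ, 0 < C ∧
      ∀ δ : ℝ, 1 ≤ δ →
      ∀ (ψ : AdiabaticSW.SpinorPath B σ L)
        (b : ∀ z : ℝ × N, TangentSpace (𝓡 3) z.2 →L[ℝ] ℝ),
      AdiabaticSW.IsTunneling A₀ δ ψ b →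
      ∀ T : ℝ,
        essSup (fun z => ENNReal.ofReal (ψ.norm z ^ 2))
            ((B.tubeVolume δ).restrict (AdiabaticSW.cylinder N T 1))
          ≤ ENNReal.ofReal C / AdiabaticSW.sobolevConst B δ T
            * eLpNorm ψ.norm 4 ((B.tubeVolume δ).restrict (AdiabaticSW.cylinder N T 2)) ^ 2 := by
  have : SecondCountableTopology N :=
    ChartedSpace.secondCountable_of_sigmaCompact (EuclideanSpace ℝ (Fin 3)) N
  obtain ⟨Λ, hΛ, hsub⟩ := AdiabaticSW.exists_isSubsolution_of_isTunneling B σ A₀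
  obtain ⟨D, hD, hmoser⟩ := AdiabaticSW.exists_moser_bound (h := h) (N := N) Λ hΛ
  refine ⟨8 * D, by positivity, fun δ hδ ψ b hT T => ?_⟩
  obtain ⟨F, R, hF⟩ := hsub δ hδ ψ b hT T
  have hδ0 : δ ≠ 0 := by positivity
  have hInt : IntegrableOn (fun z => ψ.norm z ^ 4) (AdiabaticSW.cylinder N T 2) (B.tubeVolume δ) := by
    have := hF.integrable σ hδ0 (κ := fun _ => 1) continuous_const 2
    simpa [← pow_mul] using this
  set X := Real.sqrt (∫ z in AdiabaticSW.cylinder N T 2, ψ.norm z ^ 4 ∂(B.tubeVolume δ)) with hX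
  have hX0 : 0 ≤ X := Real.sqrt_nonneg _
  rw [AdiabaticSW.eLpNorm_four_sq hInt]
  -- The estimate for a positive real s ≤ S_δ. For 0 < S_δ < ∞ it is applied with s = S_δ; the two
  -- extreme values are treated separately.
  have hfinite (s : ℝ) (hs : 0 < s) (hsS : ENNReal.ofReal s ≤ AdiabaticSW.sobolevConst B δ T) :
      essSup (fun z => ENNReal.ofReal (ψ.norm z ^ 2)) ((B.tubeVolume δ).restrict (AdiabaticSW.cylinder N T 1))
        ≤ ENNReal.ofReal (8 * D / s * X) := by
    refine essSup_le_of_ae_le _ ?_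
    filter_upwards [hmoser hF hδ0 σ s hs hsS] with z hz
    refine ENNReal.ofReal_le_ofReal (hz.trans (le_of_eq ?_))
    simp only [← pow_mul, hX]
    ring
  -- In [0, ∞] the quotient C/0 is ∞ and ∞ · 0 is 0. For S_δ = 0 the claim is therefore empty unless
  -- ‖ψ‖₄ = 0, and then ψ vanishes almost everywhere.
  rcases eq_or_ne (AdiabaticSW.sobolevConst B δ T) 0 with h0 | h0
  · rw [h0, ENNReal.div_zero (by simpa using hD)]
    rcases hX0.eq_or_lt with hX1 | hX1
    · have hzero : ∫ z in AdiabaticSW.cylinder N T 2, ψ.norm z ^ 4 ∂(B.tubeVolume δ) = 0 := by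
        have hn : 0 ≤ ∫ z in AdiabaticSW.cylinder N T 2, ψ.norm z ^ 4 ∂(B.tubeVolume δ) :=
          integral_nonneg fun z => by positivity
        exact (Real.sqrt_eq_zero hn).1 hX1.symm
      rw [setIntegral_eq_zero_iff_of_nonneg_ae (Eventually.of_forall fun z => by positivity) hInt] at hzero
      refine (essSup_le_of_ae_le 0 ?_).trans bot_le
      filter_upwards [ae_restrict_of_ae_restrict_of_subset (AdiabaticSW.cylinder_subset one_le_two) hzero] with z hz
      have : ψ.norm z = 0 := by simpa using hz
      simp [this]
    · rw [ENNReal.top_mul (ENNReal.ofReal_pos.2 hX1).ne']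
      exact le_top
  rcases eq_or_ne (AdiabaticSW.sobolevConst B δ T) ⊤ with h1 | h1
  -- For S_δ = ∞ the right side is 0, and the bound is obtained by letting s = n + 1 tend to
  -- infinity.
  · have hlim : Tendsto (fun n : ℕ => ENNReal.ofReal (8 * D / ((n : ℝ) + 1) * X)) atTop (𝓝 (ENNReal.ofReal 0)) := by
      refine ENNReal.tendsto_ofReal ?_
      have := (tendsto_one_div_add_atTop_nhds_zero_nat (𝕜 := ℝ)).const_mul (8 * D * X)
      rw [mul_zero] at this
      exact this.congr fun n => by ring
    rw [ENNReal.ofReal_zero] at hlim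
    refine (ge_of_tendsto' hlim fun n => hfinite _ (by positivity) (by rw [h1]; exact le_top)).trans bot_le
  · have hs : 0 < (AdiabaticSW.sobolevConst B δ T).toReal := ENNReal.toReal_pos h0 h1
    refine (hfinite _ hs (ENNReal.ofReal_toReal h1).le).trans (le_of_eq ?_)
    rw [ENNReal.ofReal_mul (by positivity), ENNReal.ofReal_div_of_pos hs, ENNReal.ofReal_toReal h1]
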